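/- Let $M$ be a closed, connected, oriented smooth $3$-manifold which is a rational homology $3$-sphere, let $L=\bigsqcup_i K_i\subset M$ be an oriented null-homologous (smooth) link, and fix a Seifert surface $S$ for $L$, i.e. a compact, connected, oriented surface smoothly embedded in $M$ with oriented boundary $\partial S=L$. For $n\ge 1$ let $p:\Sigma_n(L)\to M$ be the $n$-fold cyclic cover branched over $L$ that is determined by $S$: over $M\setminus L$ it is the connected $n$-fold covering corresponding to the kernel of the epimorphism $$H_1(M\setminus L)\to\mathbb Z\to\mathbb Z/n,\qquad a\mapsto a\cdot[S] \pmod n ,$$ and each $K_i$ has a tubular neighbourhood with cylindrical coordinates $(r,\theta,z)$, and $p^{-1}$ of that neighbourhood has cylindrical coordinates $(\tilde r,\tilde\theta,\tilde z)$, in which $p$ is $(\tilde r,\tilde\theta,\tilde z)\mapsto(\tilde r,n\tilde\theta,\tilde z)$; $\Sigma_n(L)$ carries the corresponding smooth structure and orientation. Let $\xi=\ker\alpha$ be a positive contact structure on $M$, where $\alpha$ is a smooth $1$-form with $\alpha\wedge d\alpha>0$, and suppose that $L$ is positively transverse to $\xi$. Choose the above coordinates so that $\xi=\ker(dz+r^2d\theta)$,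 as co-oriented plane fields, near each $K_i$. Let $\widetilde\xi$ be the lift of $\xi$ to $\Sigma_n(L)$: the smooth co-oriented plane field that equals $\ker(p^*\alpha)$, with its co-orientation, away from $p^{-1}(L)$ (so that $\widetilde\xi=\ker(d\tilde z+n\tilde r^2d\tilde\theta)$ near $p^{-1}(L)$). Orient $\xi$ and $\widetilde\xi$ by their co-orientations and the orientations of the ambient $3$-manifolds. If the Euler class $e(\xi)\in H^2(M;\mathbb Z)$ is zero, then the Euler class $e(\widetilde\xi)\in H^2(\Sigma_n(L);\mathbb Z)$ is zero. -/

import Mathlib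

open scoped Manifold ContDiff Topology

noncomputable section

universe u

/-! ## Orientations of manifolds -/

/-- An orientation of a manifold modelled on a `d`-dimensional space: an orientation of every tangent
space, varying continuously in the sense that a frame of vector fields that is continuous at `x` and
positive at `x` is positive at all points near `x`. -/
structure ManifoldOrientation {E H : Type*} [NormedAddCommGroup E] [NormedSpace ℝ E]
    [TopologicalSpace H] (I : ModelWithCorners ℝ E H) (X : Type*) [TopologicalSpace X]
    [ChartedSpace H X] [IsManifold I ∞ X] (d : ℕ) where
  /-- The orientation of the tangent space at `x`. -/
  at_point : ∀ x : X, Orientation ℝ (TangentSpace I x) (Fin d)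
  continuous_at : ∀ (x : X) (V : Fin d → ∀ y : X, TangentSpace I y),
    (∀ i, ContinuousAt (fun y => (⟨y, V i y⟩ : TangentBundle I X)) x) →
    (∃ b : Module.Basis (Fin d) ℝ (TangentSpace I x),
      (∀ i, b i = V i x) ∧ b.orientation = at_point x) →
    ∀ᶠ y in 𝓝 x, ∃ b : Module.Basis (Fin d) ℝ (TangentSpace I y),
      (∀ i, b i = V i y) ∧ b.orientation = at_point y

/-- The family `v` of tangent vectors at `x` is a positively oriented basis. -/
def ManifoldOrientation.IsPos {E H : Type*} [NormedAddCommGroup E] [NormedSpace ℝ E]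
    [TopologicalSpace H] {I : ModelWithCorners ℝ E H} {X : Type*} [TopologicalSpace X]
    [ChartedSpace H X] [IsManifold I ∞ X] {d : ℕ} (o : ManifoldOrientation I X d)
    (x : X) (v : Fin d → TangentSpace I x) : Prop :=
  ∃ b : Module.Basis (Fin d) ℝ (TangentSpace I x), (∀ i, b i = v i) ∧ b.orientation = o.at_point x

/-! ## Rational homology spheres -/

/-- The rational singular homology of `X` is that of the 3-sphere, in every degree. -/
def IsRationalHomologySphere (X : Type u) [TopologicalSpace X] : Prop :=
  ∀ k : ℕ, Nonempty
    ((((AlgebraicTopology.singularHomologyFunctor (ModuleCat.{u} ℚ) k).obj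
        (ModuleCat.of ℚ (ULift.{u} ℚ))).obj (TopCat.of X)) ≃ₗ[ℚ]
      (((AlgebraicTopology.singularHomologyFunctor (ModuleCat.{0} ℚ) k).obj
        (ModuleCat.of ℚ ℚ)).obj
          (TopCat.of (Metric.sphere (0 : EuclideanSpace ℝ (Fin 4)) 1))))

/-! ## Second Čech cohomology with integer coefficients

The open covers used are indexed by the points of the space, `x ∈ U x`; these covers, ordered by
`U x ⊆ V x` for all `x`, are cofinal among all open covers, so that the direct limit over them is
Čech cohomology.  The constant sheaf `ℤ` has the locally constant, i.e. continuous, functions as its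
sections.  Values of a cochain outside the relevant intersections are irrelevant. -/

/-- `U` assigns to every point an open neighbourhood of it. -/
def IsPointCover {X : Type*} [TopologicalSpace X] (U : X → Set X) : Prop :=
  ∀ x, IsOpen (U x) ∧ x ∈ U x

lemma IsPointCover.inter {X : Type*} [TopologicalSpace X] {U V : X → Set X}
    (hU : IsPointCover U) (hV : IsPointCover V) : IsPointCover (fun x => U x ∩ V x) :=
  fun x => ⟨(hU x).1.inter (hV x).1, (hU x).2, (hV x).2⟩

/-- Functions that are Čech 2-cocycles with values in `ℤ` on some open cover. -/
def cechCocycles (X : Type*) [TopologicalSpace X] : AddSubgroup (X → X → X → X → ℤ) where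
  carrier := {c | ∃ U : X → Set X, IsPointCover U ∧
    (∀ i j k, ContinuousOn (c i j k) (U i ∩ U j ∩ U k)) ∧
    ∀ i j k l, ∀ y ∈ U i ∩ U j ∩ U k ∩ U l,
      c j k l y - c i k l y + c i j l y - c i j k y = 0}
  zero_mem' := ⟨fun _ => Set.univ, fun _ => ⟨isOpen_univ, trivial⟩,
    fun _ _ _ => continuousOn_const, fun _ _ _ _ _ _ => by simp⟩
  add_mem' := by
    rintro a b ⟨U, hU, hUc, hUd⟩ ⟨V, hV, hVc, hVd⟩
    refine ⟨fun x => U x ∩ V x, hU.inter hV, fun i j k => ?_, fun i j k l y hy => ?_⟩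
    · refine ContinuousOn.add ((hUc i j k).mono ?_) ((hVc i j k).mono ?_)
      · rintro y ⟨⟨h1, h2⟩, h3⟩; exact ⟨⟨h1.1, h2.1⟩, h3.1⟩
      · rintro y ⟨⟨h1, h2⟩, h3⟩; exact ⟨⟨h1.2, h2.2⟩, h3.2⟩
    · obtain ⟨⟨⟨h1, h2⟩, h3⟩, h4⟩ := hy
      have e1 := hUd i j k l y ⟨⟨⟨h1.1, h2.1⟩, h3.1⟩, h4.1⟩
      have e2 := hVd i j k l y ⟨⟨⟨h1.2, h2.2⟩, h3.2⟩, h4.2⟩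
      simp only [Pi.add_apply]
      linarith
  neg_mem' := by
    rintro a ⟨U, hU, hUc, hUd⟩
    refine ⟨U, hU, fun i j k => (hUc i j k).neg, fun i j k l y hy => ?_⟩
    have e1 := hUd i j k l y hy
    simp only [Pi.neg_apply]
    linarith

/-- Functions that are Čech 2-coboundaries with values in `ℤ` on some open cover. -/
def cechCoboundaries (X : Type*) [TopologicalSpace X] : AddSubgroup (X → X → X → X → ℤ) where
  carrier := {c | ∃ U : X → Set X, IsPointCover U ∧ ∃ b : X → X → X → ℤ,
    (∀ i j, ContinuousOn (b i j) (U i ∩ U j)) ∧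
    ∀ i j k, ∀ y ∈ U i ∩ U j ∩ U k, c i j k y = b j k y - b i k y + b i j y}
  zero_mem' := ⟨fun _ => Set.univ, fun _ => ⟨isOpen_univ, trivial⟩, 0,
    fun _ _ => continuousOn_const, fun _ _ _ _ _ => by simp⟩
  add_mem' := by
    rintro a a' ⟨U, hU, b, hUc, hUd⟩ ⟨V, hV, b', hVc, hVd⟩
    refine ⟨fun x => U x ∩ V x, hU.inter hV, b + b', fun i j => ?_, fun i j k y hy => ?_⟩
    · refine ContinuousOn.add ((hUc i j).mono ?_) ((hVc i j).mono ?_)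
      · rintro y ⟨h1, h2⟩; exact ⟨h1.1, h2.1⟩
      · rintro y ⟨h1, h2⟩; exact ⟨h1.2, h2.2⟩
    · obtain ⟨⟨h1, h2⟩, h3⟩ := hy
      have e1 := hUd i j k y ⟨⟨h1.1, h2.1⟩, h3.1⟩
      have e2 := hVd i j k y ⟨⟨h1.2, h2.2⟩, h3.2⟩
      simp only [Pi.add_apply]
      linarith
  neg_mem' := by
    rintro a ⟨U, hU, b, hUc, hUd⟩
    refine ⟨U, hU, -b, fun i j => (hUc i j).neg, fun i j k y hy => ?_⟩
    have e1 := hUd i j k y hy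
    simp only [Pi.neg_apply]
    linarith

/-- The second Čech cohomology group of `X` with integer coefficients. -/
abbrev CechH2 (X : Type*) [TopologicalSpace X] : Type _ :=
  cechCocycles X ⧸ (cechCoboundaries X).addSubgroupOf (cechCocycles X)

/-! ## One-forms, contact forms and Euler classes on 3-manifolds -/

section OneForms

variable {X : Type*} [TopologicalSpace X] [ChartedSpace (EuclideanSpace ℝ (Fin 3)) X]

/-- The expression of the 1-form `α` in the preferred chart at `x₀`. -/
def chartForm (α : ∀ x : X, TangentSpace (𝓡 3) x →L[ℝ] ℝ) (x₀ : X)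
    (w : EuclideanSpace ℝ (Fin 3)) : EuclideanSpace ℝ (Fin 3) →L[ℝ] ℝ :=
  (α ((extChartAt (𝓡 3) x₀).symm w)).comp
    (mfderiv 𝓘(ℝ, EuclideanSpace ℝ (Fin 3)) (𝓡 3) (extChartAt (𝓡 3) x₀).symm w)

/-- Smooth 1-forms. -/
def IsSmoothForm (α : ∀ x : X, TangentSpace (𝓡 3) x →L[ℝ] ℝ) : Prop :=
  ∀ x₀ : X, ContDiffOn ℝ ∞ (chartForm α x₀) (extChartAt (𝓡 3) x₀).target

/-- The exterior derivative `dα` at `x`, computed in the preferred chart at `x`. -/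
def dForm (α : ∀ x : X, TangentSpace (𝓡 3) x →L[ℝ] ℝ) (x : X)
    (v w : TangentSpace (𝓡 3) x) : ℝ :=
  let D := mfderiv (𝓡 3) 𝓘(ℝ, EuclideanSpace ℝ (Fin 3)) (extChartAt (𝓡 3) x) x
  let A := fderiv ℝ (chartForm α x) (extChartAt (𝓡 3) x x)
  A (D v) (D w) - A (D w) (D v)

variable [IsManifold (𝓡 3) ∞ X]

/-- `α` is a smooth 1-form with `α ∧ dα > 0`, so that its kernel is a (co-oriented) positive contact
structure. -/
def IsPositiveContactForm (o : ManifoldOrientation (𝓡 3) X 3)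
    (α : ∀ x : X, TangentSpace (𝓡 3) x →L[ℝ] ℝ) : Prop :=
  IsSmoothForm α ∧ ∀ (x : X) (v : Fin 3 → TangentSpace (𝓡 3) x), o.IsPos x v →
    0 < α x (v 0) * dForm α x (v 1) (v 2) + α x (v 1) * dForm α x (v 2) (v 0)
      + α x (v 2) * dForm α x (v 0) (v 1)

/-- `e` is the Euler class of the oriented plane field `ker α`, where `ker α` is oriented by
the orientation of the 3-manifold and the co-orientation `α`.

There are an open cover `U`, continuous positive frames `(a i, b i)` of `ker α` over `U i` that differ
by rotations on overlaps (a reduction of the structure group to `SO(2)`), and continuous choices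
`h i j` of the rotation angles on the overlaps; `e` is the class of the integral 2-cocycle by which
the angles fail to be additive, i.e. the image of the class of the circle bundle under the connecting
homomorphism of `0 → ℤ → C(-, ℝ) → C(-, S¹) → 0`. -/
def IsEulerClass (o : ManifoldOrientation (𝓡 3) X 3)
    (α : ∀ x : X, TangentSpace (𝓡 3) x →L[ℝ] ℝ) (e : CechH2 X) : Prop :=
  ∃ (U : X → Set X) (a b : X → ∀ y : X, TangentSpace (𝓡 3) y) (h : X → X → X → ℝ)
    (c : cechCocycles X),
    IsPointCover U ∧
    (∀ i, ContinuousOn (fun y => (⟨y, a i y⟩ : TangentBundle (𝓡 3) X)) (U i)) ∧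
    (∀ i, ContinuousOn (fun y => (⟨y, b i y⟩ : TangentBundle (𝓡 3) X)) (U i)) ∧
    (∀ i, ∀ y ∈ U i, α y (a i y) = 0 ∧ α y (b i y) = 0 ∧
      ∃ r : TangentSpace (𝓡 3) y, 0 < α y r ∧ o.IsPos y ![r, a i y, b i y]) ∧
    (∀ i j, ContinuousOn (h i j) (U i ∩ U j)) ∧
    (∀ i j, ∀ y ∈ U i ∩ U j,
      a j y = Real.cos (h i j y) • a i y + Real.sin (h i j y) • b i y ∧
      b j y = -Real.sin (h i j y) • a i y + Real.cos (h i j y) • b i y) ∧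
    (∀ i j k, ∀ y ∈ U i ∩ U j ∩ U k,
      h j k y - h i k y + h i j y = 2 * Real.pi * (c.1 i j k y : ℝ)) ∧
    e = QuotientAddGroup.mk c

end OneForms

/-! ## Links and Seifert surfaces -/

/-- An oriented link with `m` components: smoothly embedded, pairwise disjoint, oriented circles,
given by 1-periodic parametrisations. -/
structure OrientedLink (M : Type*) [TopologicalSpace M]
    [ChartedSpace (EuclideanSpace ℝ (Fin 3)) M] (m : ℕ) where
  knot : Fin m → ℝ → M
  smooth : ∀ i, ContMDiff 𝓘(ℝ, ℝ) (𝓡 3) ∞ (knot i)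
  periodic : ∀ i, Function.Periodic (knot i) 1
  immersed : ∀ i t, mfderiv 𝓘(ℝ, ℝ) (𝓡 3) (knot i) t (1 : ℝ) ≠ 0
  embedded : ∀ i j s t, knot i s = knot j t → i = j ∧ ∃ k : ℤ, s - t = k

namespace OrientedLink

variable {M : Type u} [TopologicalSpace M] [ChartedSpace (EuclideanSpace ℝ (Fin 3)) M] {m : ℕ}

/-- The underlying set of the link. -/
def carrier (L : OrientedLink M m) : Set M := ⋃ i, Set.range (L.knot i)

/-- The `i`-th component as a map from the circle `ℝ / ℤ`. -/
def circleMap (L : OrientedLink M m) (i : Fin m) : C(ULift.{u} (AddCircle (1 : ℝ)), M) where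
  toFun x := (L.periodic i).lift x.down
  continuous_toFun := by
    have h : Continuous (fun x : AddCircle (1 : ℝ) => (L.periodic i).lift x) :=
      continuous_quot_lift _ (L.smooth i).continuous
    exact h.comp continuous_uliftDown

/-- The link is null-homologous: the sum of the maps `H₁(S¹; ℤ) → H₁(M; ℤ)` induced by the components,
and hence the sum of the fundamental classes of the components, is zero. -/
def NullHomologous (L : OrientedLink M m) : Prop :=
  ∑ i, ((AlgebraicTopology.singularHomologyFunctor (ModuleCat.{u} ℤ) 1).obj
    (ModuleCat.of ℤ (ULift.{u} ℤ))).map (TopCat.ofHom (L.circleMap i)) = 0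

/-- The link is positively transverse to the co-oriented plane field `ker α`. -/
def PositivelyTransverse (L : OrientedLink M m)
    (α : ∀ x : M, TangentSpace (𝓡 3) x →L[ℝ] ℝ) : Prop :=
  ∀ i t, 0 < α (L.knot i t) (mfderiv 𝓘(ℝ, ℝ) (𝓡 3) (L.knot i) t (1 : ℝ))

end OrientedLink

section Seifert

variable {M : Type*} [TopologicalSpace M] [ChartedSpace (EuclideanSpace ℝ (Fin 3)) M]
  {F : Type*} [TopologicalSpace F] [ChartedSpace (EuclideanHalfSpace 2) F]

/-- `ν` is an outward pointing tangent vector at the boundary point `y` of the surface `F` (whose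
charts take values in the half plane `0 ≤ x 0`). -/
def IsOutward (y : F) (ν : TangentSpace (𝓡∂ 2) y) : Prop :=
  let w : EuclideanSpace ℝ (Fin 2) :=
    mfderiv (𝓡∂ 2) 𝓘(ℝ, EuclideanSpace ℝ (Fin 2)) (extChartAt (𝓡∂ 2) y) y ν
  w 0 < 0

/-- The map `ι` is a smooth embedding of the surface `F` (to be taken compact and connected), oriented
by `oF`, with oriented boundary the link `L`; the boundary is oriented by "outward normal first". -/
structure IsSeifertSurface [IsManifold (𝓡∂ 2) ∞ F] {m : ℕ} (L : OrientedLink M m)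
    (oF : ManifoldOrientation (𝓡∂ 2) F 2) (ι : F → M) : Prop where
  smooth : ContMDiff (𝓡∂ 2) (𝓡 3) ∞ ι
  injective : Function.Injective ι
  immersed : ∀ y, Function.Injective (mfderiv (𝓡∂ 2) (𝓡 3) ι y)
  boundary : ι '' (𝓡∂ 2).boundary F = L.carrier
  oriented : ∀ (y : F) (i : Fin m) (t : ℝ), ι y = L.knot i t →
    ∀ ν τ : TangentSpace (𝓡∂ 2) y, IsOutward y ν →
      (mfderiv (𝓡∂ 2) (𝓡 3) ι y τ : EuclideanSpace ℝ (Fin 3)) =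
        (mfderiv 𝓘(ℝ, ℝ) (𝓡 3) (L.knot i) t (1 : ℝ) : EuclideanSpace ℝ (Fin 3)) →
      oF.IsPos y ![ν, τ]

/-- The loop `γ` is transverse to the surface. -/
def LoopTransverse (ι : F → M) (γ : ℝ → M) : Prop :=
  ∀ (t : ℝ) (y : F), ι y = γ t →
    ∀ τ : TangentSpace (𝓡∂ 2) y,
      (mfderiv (𝓡∂ 2) (𝓡 3) ι y τ : EuclideanSpace ℝ (Fin 3)) ≠
        (mfderiv 𝓘(ℝ, ℝ) (𝓡 3) γ t (1 : ℝ) : EuclideanSpace ℝ (Fin 3))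

variable [IsManifold (𝓡 3) ∞ M] [IsManifold (𝓡∂ 2) ∞ F]

/-- At time `t` the curve `γ` crosses the surface, and the velocity of `γ` followed by `ε` times the
first and the second vector of a positive frame of the surface is a positive frame of `M`.  For `ε = 1`
this is a positive crossing, for `(ε : ℝ) = -1` a negative one. -/
def IsCrossing (oM : ManifoldOrientation (𝓡 3) M 3) (oF : ManifoldOrientation (𝓡∂ 2) F 2)
    (ι : F → M) (γ : ℝ → M) (ε : ℝ) (t : ℝ) : Prop :=
  ∃ y : F, ι y = γ t ∧ ∃ v : Fin 2 → TangentSpace (𝓡∂ 2) y, oF.IsPos y v ∧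
    oM.IsPos (ι y) ![(mfderiv 𝓘(ℝ, ℝ) (𝓡 3) γ t (1 : ℝ) : TangentSpace (𝓡 3) (ι y)),
      ε • mfderiv (𝓡∂ 2) (𝓡 3) ι y (v 0), mfderiv (𝓡∂ 2) (𝓡 3) ι y (v 1)]

/-- The algebraic intersection number of a 1-periodic loop with the surface (for smooth loops that
are transverse to the surface and miss its boundary, when the counts are finite). -/
def intersectionNumber (oM : ManifoldOrientation (𝓡 3) M 3) (oF : ManifoldOrientation (𝓡∂ 2) F 2)
    (ι : F → M) (γ : ℝ → M) : ℤ :=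
  ({t | t ∈ Set.Ico (0 : ℝ) 1 ∧ IsCrossing oM oF ι γ 1 t}.ncard : ℤ) -
    ({t | t ∈ Set.Ico (0 : ℝ) 1 ∧ IsCrossing oM oF ι γ (-1) t}.ncard : ℤ)

end Seifert

/-! ## Cyclic branched covers and lifts of contact structures -/

/-- Cylindrical coordinates on an open solid torus in a 3-manifold.  The point with cylindrical
coordinates `(r, θ, z)` is `map (r * exp (i * θ), z)`; here `r < radius`, and `z` has period 1. -/
structure CylindricalCoords (X : Type*) [TopologicalSpace X]
    [ChartedSpace (EuclideanSpace ℝ (Fin 3)) X] where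
  map : ℂ × ℝ → X
  radius : ℝ
  radius_pos : 0 < radius
  smooth : ContMDiffOn 𝓘(ℝ, ℂ × ℝ) (𝓡 3) ∞ map (Metric.ball 0 radius ×ˢ Set.univ)
  periodic : ∀ w ∈ Metric.ball (0 : ℂ) radius, ∀ z : ℝ, map (w, z + 1) = map (w, z)
  injective : ∀ w ∈ Metric.ball (0 : ℂ) radius, ∀ w' ∈ Metric.ball (0 : ℂ) radius, ∀ z z' : ℝ,
    map (w, z) = map (w', z') → w = w' ∧ ∃ k : ℤ, z - z' = k
  local_diffeo : ∀ w ∈ Metric.ball (0 : ℂ) radius, ∀ z : ℝ,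
    Function.Bijective (mfderiv 𝓘(ℝ, ℂ × ℝ) (𝓡 3) map (w, z))

/-- The open solid torus covered by the coordinates. -/
def CylindricalCoords.image {X : Type*} [TopologicalSpace X]
    [ChartedSpace (EuclideanSpace ℝ (Fin 3)) X] (Φ : CylindricalCoords X) : Set X :=
  Φ.map '' (Metric.ball 0 Φ.radius ×ˢ Set.univ)

/-- The model `(r, θ, z) ↦ (r, n * θ, z)` of an `n`-fold cyclic branched cover. -/
def branchMap (n : ℕ) (q : ℂ × ℝ) : ℂ × ℝ :=
  ((‖q.1‖ : ℂ) * (q.1 / (‖q.1‖ : ℂ)) ^ n, q.2)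

/-- Cylindrical coordinates on disjoint tubular neighbourhoods of the components of `L`, and on their
preimages under `p`, in which `p` is `(r, θ, z) ↦ (r, n * θ, z)`. -/
structure BranchedCoords {M N : Type*} [TopologicalSpace M]
    [ChartedSpace (EuclideanSpace ℝ (Fin 3)) M] [TopologicalSpace N]
    [ChartedSpace (EuclideanSpace ℝ (Fin 3)) N] {m : ℕ} (n : ℕ) (L : OrientedLink M m)
    (p : N → M) where
  base : Fin m → CylindricalCoords M
  cover : Fin m → CylindricalCoords N
  core : ∀ i, Set.range (fun z : ℝ => (base i).map (0, z)) = Set.range (L.knot i)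
  disjoint : ∀ i j, i ≠ j → Disjoint (base i).image (base j).image
  radius_eq : ∀ i, (cover i).radius = (base i).radius
  image_eq : ∀ i, (cover i).image = p ⁻¹' (base i).image
  proj : ∀ i, ∀ w ∈ Metric.ball (0 : ℂ) (base i).radius, ∀ z : ℝ,
    p ((cover i).map (w, z)) = (base i).map (branchMap n (w, z))

section Cover

variable {M N F : Type*}
  [TopologicalSpace M] [ChartedSpace (EuclideanSpace ℝ (Fin 3)) M] [IsManifold (𝓡 3) ∞ M]
  [TopologicalSpace N] [ChartedSpace (EuclideanSpace ℝ (Fin 3)) N] [IsManifold (𝓡 3) ∞ N]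
  [TopologicalSpace F] [ChartedSpace (EuclideanHalfSpace 2) F] [IsManifold (𝓡∂ 2) ∞ F]

/-- Off the link `L`, the map `p` is the connected, `n`-fold, smooth, orientation preserving covering
determined by "intersection number with the surface, modulo `n`": a loop in the complement of `L` that
is smooth and transverse to the surface has closed lifts exactly when its intersection number with
the surface is divisible by `n`. -/
structure IsCyclicBranchedCover {m : ℕ} (n : ℕ) (L : OrientedLink M m)
    (oM : ManifoldOrientation (𝓡 3) M 3) (oF : ManifoldOrientation (𝓡∂ 2) F 2) (ι : F → M)
    (oN : ManifoldOrientation (𝓡 3) N 3) (p : N → M) : Prop where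
  continuous : Continuous p
  covering : IsCoveringMapOn p L.carrierᶜ
  degree : ∀ x ∉ L.carrier, (p ⁻¹' {x}).ncard = n
  connected : IsConnected (p ⁻¹' L.carrierᶜ)
  local_diffeo : ∀ y, p y ∉ L.carrier → IsLocalDiffeomorphAt (𝓡 3) (𝓡 3) ∞ p y
  oriented : ∀ y, p y ∉ L.carrier → ∀ v : Fin 3 → TangentSpace (𝓡 3) y, oN.IsPos y v →
    oM.IsPos (p y) (fun i => mfderiv (𝓡 3) (𝓡 3) p y (v i))
  monodromy : ∀ γ : ℝ → M, ContMDiff 𝓘(ℝ, ℝ) (𝓡 3) ∞ γ → Function.Periodic γ 1 →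
    (∀ t, γ t ∉ L.carrier) → LoopTransverse ι γ →
    ∀ δ : ℝ → N, Continuous δ → (∀ t, p (δ t) = γ t) →
      (δ 1 = δ 0 ↔ (n : ℤ) ∣ intersectionNumber oM oF ι γ)

/-- The plane field `ker β` (co-oriented by `β`) is the lift of `ker α` to the branched cover.
In the cylindrical coordinates `ker α = ker (dz + r ^ 2 dθ)` near the link, as co-oriented plane fields;
`β` is a smooth nowhere zero 1-form that is a positive multiple of the pull-back of `α` off the
branch set.  (Thus `ker β = ker (dz + n * r ^ 2 dθ)` in the coordinates upstairs, and by continuity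
this also holds on the branch set `r = 0`.) -/
structure IsContactLift {m : ℕ} {n : ℕ} {L : OrientedLink M m} {p : N → M}
    (B : BranchedCoords n L p) (α : ∀ x : M, TangentSpace (𝓡 3) x →L[ℝ] ℝ)
    (β : ∀ y : N, TangentSpace (𝓡 3) y →L[ℝ] ℝ) : Prop where
  standard : ∀ i, ∀ w ∈ Metric.ball (0 : ℂ) (B.base i).radius, ∀ z : ℝ,
    ∃ f : ℝ, 0 < f ∧ ∀ (η : ℂ) (ζ : ℝ),
      α ((B.base i).map (w, z)) (mfderiv 𝓘(ℝ, ℂ × ℝ) (𝓡 3) (B.base i).map (w, z) (η, ζ)) =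
        f * (ζ + (starRingEnd ℂ w * η).im)
  smooth : IsSmoothForm β
  ne_zero : ∀ y, β y ≠ 0
  pullback : ∀ y, p y ∉ L.carrier → ∃ g : ℝ, 0 < g ∧ ∀ v : TangentSpace (𝓡 3) y,
    β y v = g * α (p y) (mfderiv (𝓡 3) (𝓡 3) p y v)

end Cover

end

/-! An oriented plane field on a compact 3-manifold has vanishing Euler class exactly when it has a
nowhere zero section: `exists_isPositiveFrame` produces a global frame from `e = 0`, and
`isEulerClass_zero_of_section` completes a section to a frame. So let `(a, b)` be a global positive
frame of `ker α`. Off the branch set `p` is a local diffeomorphism, and `a`, `b` lift to a frame of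
`ker β` there.

The lifted frame need not extend over the branch set. In cylindrical coordinates, with `u = w /
‖w‖`, the map `p` replaces `u` by `u ^ n`, so a vector whose image under `dp` is nearly constant
turns like `u ^ (1 - n)`: it makes `-(n - 1)` turns along a meridian upstairs. The remedy is to
rotate the lifted frame by `g ^ (n - 1)`, where `g` is a unit complex function on the complement of
the branch set that winds exactly once around every meridian.

The Seifert surface provides `g`. There is a real function `Φ` that jumps by `-1` along positive
crossings of the surface (`exists_jumpFunction`), so that `exp (2πiΦ)` extends to the map from the
complement of `L` to the circle dual to the surface, which winds once around each meridian of `L`.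
Its pull-back to the cover has an `n`-th root, because the monodromy of the cover is the
intersection number with the surface modulo `n` (`exists_sheetFunction`, `exists_root`). A meridian
upstairs covers one downstairs `n` times, so the root winds once.

The sign of this winding matters. It comes from three conventions: coordinates with `ξ = ker (dz +
r² dθ)` are positively oriented because `α ∧ dα > 0` (`isPos_core`), positive transversality makes
the link run in the direction of increasing `z`, and the boundary orientation of the surface then
makes increasing `θ` cross the surface positively (`exists_boundary_frame`). Straightening the
surface near one boundary point per component (`exists_isBoundaryParam`) turns this into a formula
for `exp (2πiΦ)` (`exists_arg`), and hence for `g` on a small meridian disc (`exists_cover_log`).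

Winding numbers are expressed by continuous logarithms throughout. By `exists_log_of_branchDeriv_eq`
the rotated section has a logarithm on a punctured meridian disc, so it does not wind;
`exists_tube_extension` changes it inside the tube to a nowhere zero section, and
`exists_glued_section` assembles the pieces. -/

set_option linter.unusedSectionVars false

noncomputable section

/-! ## Smooth parametrisations of open subsets of a 3-manifold -/

section Param

open Set Filter

variable {E' : Type*} [NormedAddCommGroup E'] [NormedSpace ℝ E'] [FiniteDimensional ℝ E']
  {X : Type*} [TopologicalSpace X] [ChartedSpace (EuclideanSpace ℝ (Fin 3)) X]

/-- `θ` is smooth on the open set `U`, with bijective derivatives. -/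
structure IsParam (θ : E' → X) (U : Set E') : Prop where
  isOpen : IsOpen U
  smooth : ContMDiffOn 𝓘(ℝ, E') (𝓡 3) ∞ θ U
  bijective : ∀ q ∈ U, Function.Bijective (mfderiv 𝓘(ℝ, E') (𝓡 3) θ q)

namespace IsParam

variable {θ : E' → X} {U : Set E'}

lemma mono (h : IsParam θ U) {V : Set E'} (hV : IsOpen V) (hVU : V ⊆ U) : IsParam θ V :=
  ⟨hV, h.smooth.mono hVU, fun q hq => h.bijective q (hVU hq)⟩

lemma contMDiffAt (h : IsParam θ U) {q : E'} (hq : q ∈ U) :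
    ContMDiffAt 𝓘(ℝ, E') (𝓡 3) ∞ θ q :=
  h.smooth.contMDiffAt (h.isOpen.mem_nhds hq)

lemma mdifferentiableAt (h : IsParam θ U) {q : E'} (hq : q ∈ U) :
    MDifferentiableAt 𝓘(ℝ, E') (𝓡 3) θ q :=
  (h.contMDiffAt hq).mdifferentiableAt (by simp)

variable [IsManifold (𝓡 3) ∞ X]

/-- This is the inverse function theorem for the chart expression of `θ`. Vector fields, curves and
forms are transported to `E'` through these local inverses. -/
lemma exists_homeo (h : IsParam θ U) {q : E'} (hq : q ∈ U) :
    ∃ e : OpenPartialHomeomorph E' X, q ∈ e.source ∧ e.source ⊆ U ∧ EqOn e θ e.source ∧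
      ContMDiffOn (𝓡 3) 𝓘(ℝ, E') ∞ e.symm e.target := by
  set x := θ q with hx
  have hI : IsManifold (𝓡 3) 1 X := IsManifold.of_le (n := ∞) (by simp)
  let Θ : E' → EuclideanSpace ℝ (Fin 3) := fun r => extChartAt (𝓡 3) x (θ r)
  let U' : Set E' := U ∩ θ ⁻¹' (extChartAt (𝓡 3) x).source
  have hU' : IsOpen U' :=
    h.smooth.continuousOn.isOpen_inter_preimage h.isOpen (isOpen_extChartAt_source x)
  have hqU' : q ∈ U' := ⟨hq, mem_extChartAt_source x⟩
  have hΘ : ContDiffOn ℝ ∞ Θ U' := by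
    rw [← contMDiffOn_iff_contDiffOn]
    exact (contMDiffOn_extChartAt (I := 𝓡 3) (x := x) (n := ∞)).comp (h.smooth.mono inter_subset_left)
      (fun r hr => by simpa using hr.2)
  have hbij : ∀ r ∈ U', Function.Bijective (fderiv ℝ Θ r) := by
    intro r hr
    have hr2 : θ r ∈ (chartAt (EuclideanSpace ℝ (Fin 3)) x).source := by simpa using hr.2
    have h1 := (mdifferentiableAt_extChartAt (I := 𝓡 3) hr2)
    have h2 : mfderiv 𝓘(ℝ, E') 𝓘(ℝ, EuclideanSpace ℝ (Fin 3)) Θ r =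
        (mfderiv (𝓡 3) 𝓘(ℝ, EuclideanSpace ℝ (Fin 3)) (extChartAt (𝓡 3) x) (θ r)).comp
          (mfderiv 𝓘(ℝ, E') (𝓡 3) θ r) :=
      mfderiv_comp r h1 (h.mdifferentiableAt hr.1)
    rw [← mfderiv_eq_fderiv, h2]
    obtain ⟨A, hA⟩ := isInvertible_mfderiv_extChartAt (I := 𝓡 3) hr.2
    rw [← hA]
    exact A.bijective.comp (h.bijective r hr.1)
  have hequiv : ∀ r ∈ U', ∃ A : E' ≃L[ℝ] EuclideanSpace ℝ (Fin 3), HasFDerivAt Θ (A : E' →L[ℝ] _) r := by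
    intro r hr
    let A := (LinearEquiv.ofBijective (fderiv ℝ Θ r).toLinearMap (hbij r hr)).toContinuousLinearEquiv
    refine ⟨A, ?_⟩
    have : (A : E' →L[ℝ] EuclideanSpace ℝ (Fin 3)) = fderiv ℝ Θ r := by ext v; rfl
    rw [this]
    exact ((hΘ.contDiffAt (hU'.mem_nhds hr)).differentiableAt (by simp)).hasFDerivAt
  obtain ⟨A, hA⟩ := hequiv q hqU'
  have hcd := hΘ.contDiffAt (hU'.mem_nhds hqU')
  -- On `U'` all derivatives are invertible. Shrinking the source to it makes the inverse smooth on
  -- the whole target, not only at the image of `q`.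
  let e0 := (hcd.toOpenPartialHomeomorph Θ hA (by simp)).restrOpen U' hU'
  have he0s : e0.source ⊆ U' := by
    intro r hr
    have : r ∈ (hcd.toOpenPartialHomeomorph Θ hA (by simp)).source ∩ U' := by
      simpa [e0] using hr
    exact this.2
  have he0 : ∀ r, e0 r = Θ r := fun r => rfl
  have hq0 : q ∈ e0.source := by
    have : q ∈ (hcd.toOpenPartialHomeomorph Θ hA (by simp)).source ∩ U' :=
      ⟨hcd.mem_toOpenPartialHomeomorph_source hA (by simp), hqU'⟩
    simpa [e0] using this
  let e := e0.trans (chartAt (EuclideanSpace ℝ (Fin 3)) x).symm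
  have hes : e.source ⊆ e0.source := by
    intro r hr; exact ((e0.trans_source _).subset hr).1
  refine ⟨e, ?_, ?_, ?_, ?_⟩
  · rw [OpenPartialHomeomorph.trans_source]
    refine ⟨hq0, ?_⟩
    change Θ q ∈ (chartAt (EuclideanSpace ℝ (Fin 3)) x).target
    simp [Θ, x]
  · exact fun r hr => (he0s (hes hr)).1
  · intro r hr
    change (chartAt (EuclideanSpace ℝ (Fin 3)) x).symm (Θ r) = θ r
    have := (he0s (hes hr)).2
    simpa [Θ] using (extChartAt (𝓡 3) x).left_inv this
  · have hesymm : ∀ z ∈ e.target, e0.symm (extChartAt (𝓡 3) x z) = e.symm z := by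
      intro z hz; rfl
    have htar : ∀ z ∈ e.target, extChartAt (𝓡 3) x z ∈ e0.target ∧ z ∈ (extChartAt (𝓡 3) x).source := by
      intro z hz
      rw [OpenPartialHomeomorph.trans_target] at hz
      exact ⟨by simpa using hz.2, by simpa using hz.1⟩
    have h0 : ContDiffOn ℝ ∞ e0.symm e0.target := by
      intro z hz
      have hm := he0s (e0.map_target hz)
      obtain ⟨B, hB⟩ := hequiv _ hm
      exact (e0.contDiffAt_symm hz hB (hΘ.contDiffAt (hU'.mem_nhds hm))).contDiffWithinAt
    refine ContMDiffOn.congr ?_ (fun z hz => (hesymm z hz).symm)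
    exact (contMDiffOn_iff_contDiffOn.2 h0).comp
      ((contMDiffOn_extChartAt (I := 𝓡 3) (x := x) (n := ∞)).mono (fun z hz => by
        simpa using (htar z hz).2)) (fun z hz => (htar z hz).1)

lemma isParam_extChartAt_symm (x : X) :
    IsParam (X := X) (extChartAt (𝓡 3) x).symm (extChartAt (𝓡 3) x).target := by
  have hI : IsManifold (𝓡 3) 1 X := IsManifold.of_le (n := ∞) (by simp)
  refine ⟨isOpen_extChartAt_target x, contMDiffOn_extChartAt_symm x, fun q hq => ?_⟩
  obtain ⟨A, hA⟩ := isInvertible_mfderivWithin_extChartAt_symm (I := 𝓡 3) hq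
  have : mfderiv 𝓘(ℝ, EuclideanSpace ℝ (Fin 3)) (𝓡 3) (extChartAt (𝓡 3) x).symm q = A := by
    rw [hA, ModelWithCorners.Boundaryless.range_eq_univ, mfderivWithin_univ]
  rw [this]
  exact A.bijective

/-- The derivative of the local inverse is inverse to the derivative. -/
lemma mfderiv_symm_apply (h : IsParam θ U) {e : OpenPartialHomeomorph E' X} (hU : e.source ⊆ U)
    (he : EqOn e θ e.source) (hs : ContMDiffOn (𝓡 3) 𝓘(ℝ, E') ∞ e.symm e.target) {q : E'}
    (hq : q ∈ e.source) (v : E') :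
    (mfderiv (𝓡 3) 𝓘(ℝ, E') e.symm (θ q) (mfderiv 𝓘(ℝ, E') (𝓡 3) θ q v) : E') = v := by
  have ht : θ q ∈ e.target := by rw [← he hq]; exact e.map_source hq
  have h1 : MDifferentiableAt (𝓡 3) 𝓘(ℝ, E') e.symm (θ q) :=
    (hs.contMDiffAt (e.open_target.mem_nhds ht)).mdifferentiableAt (by simp)
  have h2 := mfderiv_comp q h1 (h.mdifferentiableAt (hU hq))
  have h3 : (e.symm ∘ θ) =ᶠ[𝓝 q] id := by
    filter_upwards [e.open_source.mem_nhds hq] with r hr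
    simp only [Function.comp, id]
    rw [← he hr, e.left_inv hr]
  rw [h3.mfderiv_eq, mfderiv_id] at h2
  exact (congrArg (fun (L : E' →L[ℝ] E') => L v) h2).symm

lemma map_nhds_eq (h : IsParam θ U) {q : E'} (hq : q ∈ U) : map θ (𝓝 q) = 𝓝 (θ q) := by
  obtain ⟨e, h1, h2, h3, h4⟩ := h.exists_homeo hq
  rw [← h3 h1, ← e.map_nhds_eq h1]
  exact map_congr (by filter_upwards [e.open_source.mem_nhds h1] with r hr using (h3 hr).symm)

lemma continuousWithinAt_modelSection {Y : Type*} [TopologicalSpace Y] {s : Set Y} {y : Y}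
    {f v : Y → E'} :
    ContinuousWithinAt (fun y => (⟨f y, v y⟩ : TangentBundle 𝓘(ℝ, E') E')) s y ↔
      ContinuousWithinAt f s y ∧ ContinuousWithinAt v s y := by
  rw [FiberBundle.continuousWithinAt_totalSpace]
  simp

/-- Vector fields along maps that are continuous in coordinates are continuous. -/
lemma continuousWithinAt_push (h : IsParam θ U) {Y : Type*} [TopologicalSpace Y] {s : Set Y} {y : Y}
    {f v : Y → E'} (hf : ContinuousWithinAt f s y) (hv : ContinuousWithinAt v s y) (hy : f y ∈ U) :
    ContinuousWithinAt (fun y => (⟨θ (f y), mfderiv 𝓘(ℝ, E') (𝓡 3) θ (f y) (v y)⟩ :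
      TangentBundle (𝓡 3) X)) s y := by
  have hI : IsManifold (𝓡 3) 1 X := IsManifold.of_le (n := ∞) (by simp)
  have hc := h.smooth.continuousOn_tangentMapWithin (by simp) h.isOpen.uniqueMDiffOn
  have hfv := continuousWithinAt_modelSection.2 ⟨hf, hv⟩
  have hmem : Bundle.TotalSpace.proj ⁻¹' U ∈
      𝓝 ((⟨f y, v y⟩ : TangentBundle 𝓘(ℝ, E') E')) :=
    (h.isOpen.preimage (FiberBundle.continuous_proj _ _)).mem_nhds hy
  have hca := hc.continuousAt hmem
  refine (ContinuousAt.comp_continuousWithinAt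
    (f := fun y => (⟨f y, v y⟩ : TangentBundle 𝓘(ℝ, E') E')) (x := y) hca hfv).congr_of_eventuallyEq ?_ ?_
  · have := hf.eventually (h.isOpen.mem_nhds hy)
    filter_upwards [this] with z hz
    simp only [Function.comp, tangentMapWithin]
    rw [mfderivWithin_of_isOpen h.isOpen hz]
  · simp only [Function.comp, tangentMapWithin]
    rw [mfderivWithin_of_isOpen h.isOpen hy]

/-- The coordinates of a continuous vector field along a map are continuous. -/
lemma continuousWithinAt_pull (h : IsParam θ U) {Y : Type*} [TopologicalSpace Y] {s : Set Y} {y : Y}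
    {f v : Y → E'} (hf : ContinuousWithinAt f s y) (hy : f y ∈ U)
    (hV : ContinuousWithinAt (fun y => (⟨θ (f y), mfderiv 𝓘(ℝ, E') (𝓡 3) θ (f y) (v y)⟩ :
      TangentBundle (𝓡 3) X)) s y) : ContinuousWithinAt v s y := by
  have hI : IsManifold (𝓡 3) 1 X := IsManifold.of_le (n := ∞) (by simp)
  obtain ⟨e, h1, h2, h3, h4⟩ := h.exists_homeo hy
  have ht : θ (f y) ∈ e.target := by rw [← h3 h1]; exact e.map_source h1
  have hc := h4.continuousOn_tangentMapWithin (by simp) e.open_target.uniqueMDiffOn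
  have hmem : Bundle.TotalSpace.proj ⁻¹' e.target ∈
      𝓝 ((⟨θ (f y), mfderiv 𝓘(ℝ, E') (𝓡 3) θ (f y) (v y)⟩ : TangentBundle (𝓡 3) X)) :=
    (e.open_target.preimage (FiberBundle.continuous_proj _ _)).mem_nhds ht
  have hca := ContinuousAt.comp_continuousWithinAt
    (f := fun y => (⟨θ (f y), mfderiv 𝓘(ℝ, E') (𝓡 3) θ (f y) (v y)⟩ : TangentBundle (𝓡 3) X))
    (x := y) (hc.continuousAt hmem) hV
  have key : ∀ z, f z ∈ e.source → tangentMapWithin (𝓡 3) 𝓘(ℝ, E') e.symm e.target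
      (⟨θ (f z), mfderiv 𝓘(ℝ, E') (𝓡 3) θ (f z) (v z)⟩ : TangentBundle (𝓡 3) X) =
      (⟨f z, v z⟩ : TangentBundle 𝓘(ℝ, E') E') := by
    intro z hz
    have ht' : θ (f z) ∈ e.target := by rw [← h3 hz]; exact e.map_source hz
    simp only [tangentMapWithin]
    rw [mfderivWithin_of_isOpen e.open_target ht']
    have e1 : e.symm (θ (f z)) = f z := by rw [← h3 hz, e.left_inv hz]
    have e2 := h.mfderiv_symm_apply h2 h3 h4 hz (v z)
    exact Bundle.TotalSpace.ext e1 (heq_of_eq e2)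
  have hfin : ContinuousWithinAt (fun z => (⟨f z, v z⟩ : TangentBundle 𝓘(ℝ, E') E')) s y := by
    refine hca.congr_of_eventuallyEq ?_ ?_
    · filter_upwards [hf.eventually (e.open_source.mem_nhds h1)] with z hz using (key z hz).symm
    · exact (key y h1).symm
  exact (continuousWithinAt_modelSection.1 hfin).2

/-- A section of the tangent bundle is continuous iff its coordinates are. -/
lemma continuousAt_section_iff (h : IsParam θ U) {q : E'} (hq : q ∈ U)
    {V : ∀ x : X, TangentSpace (𝓡 3) x} {v : E' → E'}
    (hv : ∀ᶠ r in 𝓝 q, mfderiv 𝓘(ℝ, E') (𝓡 3) θ r (v r) = V (θ r)) :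
    ContinuousAt (fun x => (⟨x, V x⟩ : TangentBundle (𝓡 3) X)) (θ q) ↔ ContinuousAt v q := by
  have hθ : ContinuousAt θ q := (h.contMDiffAt hq).continuousAt
  have hev : (fun r => (⟨θ r, mfderiv 𝓘(ℝ, E') (𝓡 3) θ r (v r)⟩ : TangentBundle (𝓡 3) X)) =ᶠ[𝓝 q]
      (fun x => (⟨x, V x⟩ : TangentBundle (𝓡 3) X)) ∘ θ := by
    filter_upwards [hv] with r hr
    simp only [Function.comp, hr]
  constructor
  · intro hV
    have h1 : ContinuousAt ((fun x => (⟨x, V x⟩ : TangentBundle (𝓡 3) X)) ∘ θ) q :=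
      ContinuousAt.comp hV hθ
    have h2 := h1.congr hev.symm
    rw [← continuousWithinAt_univ] at h2 ⊢
    exact h.continuousWithinAt_pull (f := id) continuousWithinAt_id hq h2
  · intro hc
    rw [← continuousWithinAt_univ] at hc
    have h2 := h.continuousWithinAt_push (f := id) continuousWithinAt_id hc hq
    rw [continuousWithinAt_univ] at h2
    have h3 : Tendsto ((fun x => (⟨x, V x⟩ : TangentBundle (𝓡 3) X)) ∘ θ) (𝓝 q)
        (𝓝 (⟨θ q, V (θ q)⟩ : TangentBundle (𝓡 3) X)) := by
      have := Tendsto.congr' hev h2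
      simp only [id, hv.self_of_nhds] at this
      exact this
    have h4 : Tendsto (fun x => (⟨x, V x⟩ : TangentBundle (𝓡 3) X)) (map θ (𝓝 q))
        (𝓝 (⟨θ q, V (θ q)⟩ : TangentBundle (𝓡 3) X)) := h3
    rw [h.map_nhds_eq hq] at h4
    exact h4

end IsParam
end Param

/-! ## Positive frames -/

section Orientation

open Set Filter

lemma ManifoldOrientation.isPos_iff_det {E H : Type*} [NormedAddCommGroup E] [NormedSpace ℝ E]
    [TopologicalSpace H] {I : ModelWithCorners ℝ E H} {X : Type*} [TopologicalSpace X]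
    [ChartedSpace H X] [IsManifold I ∞ X] {d : ℕ} (o : ManifoldOrientation I X d) {x : X}
    (b : Module.Basis (Fin d) ℝ (TangentSpace I x)) (hb : b.orientation = o.at_point x)
    (v : Fin d → TangentSpace I x) : o.IsPos x v ↔ 0 < b.det v := by
  constructor
  · rintro ⟨b', h1, h2⟩
    have : v = b' := funext fun i => (h1 i).symm
    rw [this, ← b.orientation_eq_iff_det_pos, hb, h2]
  · intro h
    obtain ⟨h1, h2⟩ := (b.is_basis_iff_det (v := v)).2 (isUnit_iff_ne_zero.2 h.ne')
    refine ⟨Module.Basis.mk h1 h2.ge, fun i => by simp, ?_⟩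
    rw [← hb, eq_comm, b.orientation_eq_iff_det_pos]
    simpa using h

/-- Near a point, positivity of frames is decided by the sign of a determinant with respect to
any continuous frame. -/
lemma ManifoldOrientation.eventually_isPos_iff {E H : Type*} [NormedAddCommGroup E]
    [NormedSpace ℝ E] [TopologicalSpace H] {I : ModelWithCorners ℝ E H} {X : Type*}
    [TopologicalSpace X] [ChartedSpace H X] [IsManifold I ∞ X] {d : ℕ}
    (o : ManifoldOrientation I X (d + 1)) {x : X} (V : Fin (d + 1) → ∀ y : X, TangentSpace I y)
    (hV : ∀ i, ContinuousAt (fun y => (⟨y, V i y⟩ : TangentBundle I X)) x)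
    (hneg : ContinuousAt (fun y => (⟨y, -V 0 y⟩ : TangentBundle I X)) x)
    (hb : ∃ b : Module.Basis (Fin (d + 1)) ℝ (TangentSpace I x), ∀ i, b i = V i x) :
    ∃ ε : ℝ, (ε = 1 ∨ ε = -1) ∧ ∀ᶠ y in 𝓝 x,
      ∃ b : Module.Basis (Fin (d + 1)) ℝ (TangentSpace I y), (∀ i, b i = V i y) ∧
        ∀ v, o.IsPos y v ↔ 0 < ε * b.det v := by
  obtain ⟨b, hb⟩ := hb
  rcases b.orientation_eq_or_eq_neg (o.at_point x) with h | h
  · refine ⟨1, Or.inl rfl, ?_⟩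
    filter_upwards [o.continuous_at x V hV ⟨b, hb, h.symm⟩] with y hy
    obtain ⟨b', h1, h2⟩ := hy
    exact ⟨b', h1, fun v => by rw [o.isPos_iff_det b' h2, one_mul]⟩
  · refine ⟨-1, Or.inr rfl, ?_⟩
    -- Flipping the first vector of a negative frame makes it positive, so that `continuous_at`
    -- applies. Undoing the flip multiplies the determinant by `ε = -1`.
    let w : Fin (d + 1) → ℝˣ := Function.update 1 0 (-1)
    have hw0 : w 0 = -1 := by simp [w]
    have hw : ∀ i, i ≠ 0 → w i = 1 := fun i hi => by simp [w, hi]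
    let V' : Fin (d + 1) → ∀ y : X, TangentSpace I y := fun i y => w i • V i y
    have hV'0 : ∀ y, V' 0 y = - V 0 y := fun y => by simp [V', hw0]
    have hV'1 : ∀ i, i ≠ 0 → ∀ y, V' i y = V i y := fun i hi y => by simp [V', hw i hi]
    have hV' : ∀ i, ContinuousAt (fun y => (⟨y, V' i y⟩ : TangentBundle I X)) x := by
      intro i
      by_cases hi : i = 0
      · subst hi; simpa only [hV'0] using hneg
      · simpa only [hV'1 i hi] using hV i
    have key := o.continuous_at x V' hV' ⟨b.unitsSMul w, fun i => by
      simp [V', Module.Basis.unitsSMul_apply, hb], by rw [b.orientation_neg_single, h]⟩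
    filter_upwards [key] with y hy
    obtain ⟨b', h1, h2⟩ := hy
    refine ⟨b'.unitsSMul w, fun i => ?_, fun v => ?_⟩
    · rw [Module.Basis.unitsSMul_apply, h1]
      change w i • w i • V i y = V i y
      rw [smul_smul]
      by_cases hi : i = 0
      · subst hi; simp [hw0]
      · simp [hw i hi]
    · rw [o.isPos_iff_det b' h2, Module.Basis.det_unitsSMul]
      have : ∏ i, w i = -1 := by
        rw [Finset.prod_update_of_mem (Finset.mem_univ _)]; simp
      simp [this]

end Orientation

/-! ### Continuous vector fields, global frames and vanishing of the Euler class -/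

section Sections

open Set Filter

variable {X : Type*} [TopologicalSpace X] [ChartedSpace (EuclideanSpace ℝ (Fin 3)) X]
  [IsManifold (𝓡 3) ∞ X]

lemma continuousAt_section_lincomb {f g : X → ℝ} {V W : ∀ x : X, TangentSpace (𝓡 3) x} {x : X}
    (hf : ContinuousAt f x) (hg : ContinuousAt g x)
    (hV : ContinuousAt (fun y => (⟨y, V y⟩ : TangentBundle (𝓡 3) X)) x)
    (hW : ContinuousAt (fun y => (⟨y, W y⟩ : TangentBundle (𝓡 3) X)) x) :
    ContinuousAt (fun y => (⟨y, f y • V y + g y • W y⟩ : TangentBundle (𝓡 3) X)) x := by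
  have hI : IsManifold (𝓡 3) 1 X := IsManifold.of_le (n := ∞) (by simp)
  have key : ∀ S : (∀ x : X, TangentSpace (𝓡 3) x),
      ContinuousAt (fun y => (⟨y, S y⟩ : TangentBundle (𝓡 3) X)) x ↔
        ContinuousAt (fun y => (trivializationAt (EuclideanSpace ℝ (Fin 3))
          (TangentSpace (𝓡 3) (M := X)) x ⟨y, S y⟩).2) x := by
    intro S
    rw [FiberBundle.continuousAt_totalSpace]
    exact and_iff_right continuousAt_id
  rw [key] at *
  refine ((hf.smul hV).add (hg.smul hW)).congr ?_
  have hb : (trivializationAt (EuclideanSpace ℝ (Fin 3)) (TangentSpace (𝓡 3) (M := X)) x).baseSet ∈ 𝓝 x :=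
    (Bundle.Trivialization.open_baseSet _).mem_nhds (FiberBundle.mem_baseSet_trivializationAt' x)
  filter_upwards [hb] with y hy
  have hl := (Bundle.Trivialization.linear ℝ (trivializationAt (EuclideanSpace ℝ (Fin 3)) (TangentSpace (𝓡 3) (M := X)) x) hy)
  simp only [hl.map_add, hl.map_smul]
  rfl

/-- The extension has constant coordinates in the chart at `x`. -/
lemma exists_continuous_extension (x : X) (v : TangentSpace (𝓡 3) x) :
    ∃ V : ∀ y : X, TangentSpace (𝓡 3) y, V x = v ∧
      ∀ᶠ y in 𝓝 x, ContinuousAt (fun y => (⟨y, V y⟩ : TangentBundle (𝓡 3) X)) y := by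
  have hI : IsManifold (𝓡 3) 1 X := IsManifold.of_le (n := ∞) (by simp)
  set e := extChartAt (𝓡 3) x
  have hp := IsParam.isParam_extChartAt_symm x
  -- The point `e.symm (e x)` is only propositionally equal to `x`, but every tangent space is the
  -- model space by definition, so the cast does nothing to the vector.
  obtain ⟨w, hw⟩ := (hp.bijective (e x) (mem_extChartAt_target x)).2
    (cast (by rw [extChartAt_to_inv]) v)
  let V : ∀ y : X, TangentSpace (𝓡 3) y := fun y =>
    mfderiv 𝓘(ℝ, EuclideanSpace ℝ (Fin 3)) (𝓡 3) e.symm (e y) w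
  refine ⟨V, ?_, ?_⟩
  · change mfderiv 𝓘(ℝ, EuclideanSpace ℝ (Fin 3)) (𝓡 3) e.symm (e x) w = v
    rw [hw]
    rfl
  · filter_upwards [extChartAt_source_mem_nhds (I := 𝓡 3) x] with y hy
    have h1 : e y ∈ e.target := e.map_source hy
    have h2 := hp.continuousAt_section_iff (V := V) (v := fun _ => w) h1 (by
      filter_upwards [hp.isOpen.mem_nhds h1] with r hr
      change _ = mfderiv 𝓘(ℝ, EuclideanSpace ℝ (Fin 3)) (𝓡 3) e.symm (e (e.symm r)) w
      rw [e.right_inv hr])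
    have h3 : e.symm (e y) = y := e.left_inv hy
    change ContinuousAt _ (e.symm (e y)) ↔ _ at h2
    rw [h3] at h2
    exact h2.2 continuousAt_const

/-- A smooth 1-form evaluated on a continuous vector field is continuous. -/
lemma IsSmoothForm.continuousAt_apply {β : ∀ x : X, TangentSpace (𝓡 3) x →L[ℝ] ℝ}
    (hβ : IsSmoothForm β) {V : ∀ x : X, TangentSpace (𝓡 3) x} {x : X}
    (hV : ContinuousAt (fun y => (⟨y, V y⟩ : TangentBundle (𝓡 3) X)) x) :
    ContinuousAt (fun y => β y (V y)) x := by
  have hI : IsManifold (𝓡 3) 1 X := IsManifold.of_le (n := ∞) (by simp)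
  set e := extChartAt (𝓡 3) x with he
  have hp := IsParam.isParam_extChartAt_symm x
  have hx : e x ∈ e.target := mem_extChartAt_target x
  choose v hv using fun (r : e.target) => (hp.bijective r.1 r.2).2 (V (e.symm r.1))
  classical
  let v' : EuclideanSpace ℝ (Fin 3) → EuclideanSpace ℝ (Fin 3) := fun r =>
    if hr : r ∈ e.target then v ⟨r, hr⟩ else 0
  have hv' : ∀ r ∈ e.target, mfderiv 𝓘(ℝ, EuclideanSpace ℝ (Fin 3)) (𝓡 3) e.symm r (v' r) =
      V (e.symm r) := by
    intro r hr
    have h0 : v' r = v ⟨r, hr⟩ := dif_pos hr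
    rw [h0]
    exact hv ⟨r, hr⟩
  have h1 := (hp.continuousAt_section_iff (V := V) (v := v') hx (by
      filter_upwards [hp.isOpen.mem_nhds hx] with r hr using hv' r hr))
  have h3 : e.symm (e x) = x := extChartAt_to_inv x
  change ContinuousAt _ (e.symm (e x)) ↔ _ at h1
  rw [h3] at h1
  have h4 : ContinuousAt (fun r => chartForm β x r (v' r)) (e x) :=
    ((hβ x).continuousOn.continuousAt (hp.isOpen.mem_nhds hx)).clm_apply (h1.1 hV)
  have h5 : ContinuousAt (fun y => chartForm β x (e y) (v' (e y))) x :=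
    ContinuousAt.comp (g := fun r => chartForm β x r (v' r)) (f := e) h4 (continuousAt_extChartAt x)
  refine h5.congr ?_
  filter_upwards [extChartAt_source_mem_nhds (I := 𝓡 3) x] with y hy
  have hy' : e y ∈ e.target := e.map_source hy
  change β (e.symm (e y)) (mfderiv 𝓘(ℝ, EuclideanSpace ℝ (Fin 3)) (𝓡 3) e.symm (e y) (v' (e y))) = _
  rw [hv' _ hy', show e.symm (e y) = y from e.left_inv hy]

/-- A continuous positive frame of the oriented plane field `ker α`. -/
structure IsPositiveFrame (o : ManifoldOrientation (𝓡 3) X 3)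
    (α : ∀ x : X, TangentSpace (𝓡 3) x →L[ℝ] ℝ) (a b : ∀ x : X, TangentSpace (𝓡 3) x) : Prop where
  continuous_left : Continuous (fun y => (⟨y, a y⟩ : TangentBundle (𝓡 3) X))
  continuous_right : Continuous (fun y => (⟨y, b y⟩ : TangentBundle (𝓡 3) X))
  left_mem : ∀ y, α y (a y) = 0
  right_mem : ∀ y, α y (b y) = 0
  pos : ∀ y, ∃ r : TangentSpace (𝓡 3) y, 0 < α y r ∧ o.IsPos y ![r, a y, b y]

/-- With one and the same frame over every set of the cover all rotation angles, and with them the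
cocycle, can be taken to be zero. -/
lemma IsPositiveFrame.isEulerClass_zero {o : ManifoldOrientation (𝓡 3) X 3}
    {α : ∀ x : X, TangentSpace (𝓡 3) x →L[ℝ] ℝ} {a b : ∀ x : X, TangentSpace (𝓡 3) x}
    (h : IsPositiveFrame o α a b) : IsEulerClass o α 0 := by
  refine ⟨fun _ => univ, fun _ => a, fun _ => b, fun _ _ _ => 0, 0,
    fun _ => ⟨isOpen_univ, trivial⟩, fun _ => h.continuous_left.continuousOn,
    fun _ => h.continuous_right.continuousOn, fun _ y _ => ⟨h.left_mem y, h.right_mem y, h.pos y⟩,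
    fun _ _ => continuousOn_const, fun _ _ y _ => by simp, fun _ _ _ y _ => by simp, by simp⟩

lemma det_vec3 {V : Type*} [AddCommGroup V] [Module ℝ V] (b : Module.Basis (Fin 3) ℝ V)
    (v : Fin 3 → V) : b.det v =
      b.repr (v 0) 0 * (b.repr (v 1) 1 * b.repr (v 2) 2 - b.repr (v 2) 1 * b.repr (v 1) 2)
      - b.repr (v 1) 0 * (b.repr (v 0) 1 * b.repr (v 2) 2 - b.repr (v 2) 1 * b.repr (v 0) 2)
      + b.repr (v 2) 0 * (b.repr (v 0) 1 * b.repr (v 1) 2 - b.repr (v 1) 1 * b.repr (v 0) 2) := by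
  rw [Module.Basis.det_apply, Matrix.det_fin_three]
  simp only [Module.Basis.toMatrix_apply]
  ring

/-- The determinant is multiplied by `c ^ 2 + s ^ 2 = 1`. -/
lemma isPos_rotate {o : ManifoldOrientation (𝓡 3) X 3} {x : X} {r a b : TangentSpace (𝓡 3) x}
    (h : o.IsPos x ![r, a, b]) {c s : ℝ} (hcs : c ^ 2 + s ^ 2 = 1) :
    o.IsPos x ![r, c • a - s • b, s • a + c • b] := by
  obtain ⟨B, h1, h2⟩ := h
  rw [o.isPos_iff_det B h2]
  have e0 : r = B 0 := (h1 0).symm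
  have e1 : a = B 1 := (h1 1).symm
  have e2 : b = B 2 := (h1 2).symm
  rw [det_vec3, e0, e1, e2]
  simp
  nlinarith

lemma ManifoldOrientation.isPos_or_isPos_neg (o : ManifoldOrientation (𝓡 3) X 3) {x : X}
    {a b c : TangentSpace (𝓡 3) x} (h : LinearIndependent ℝ ![a, b, c]) :
    o.IsPos x ![a, b, c] ∨ o.IsPos x ![a, b, -c] := by
  have hdim : Fintype.card (Fin 3) = Module.finrank ℝ (TangentSpace (𝓡 3) x) := by
    change _ = Module.finrank ℝ (EuclideanSpace ℝ (Fin 3))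
    simp
  let B := basisOfLinearIndependentOfCardEqFinrank h hdim
  have hB : ∀ i, B i = ![a, b, c] i := fun i => by simp [B]
  rcases B.orientation_eq_or_eq_neg (o.at_point x) with h | h
  · exact Or.inl ⟨B, hB, h.symm⟩
  · refine Or.inr ⟨B.unitsSMul (Function.update 1 2 (-1)), fun i => ?_, ?_⟩
    · rw [Module.Basis.unitsSMul_apply, hB]
      fin_cases i <;> simp
    · rw [Module.Basis.orientation_neg_single, h]

/-- If the Euler class vanishes, the plane field has a global positive frame. -/
lemma exists_isPositiveFrame [T2Space X] [CompactSpace X] {o : ManifoldOrientation (𝓡 3) X 3}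
    {α : ∀ x : X, TangentSpace (𝓡 3) x →L[ℝ] ℝ} (he : IsEulerClass o α 0) :
    ∃ a b : ∀ x : X, TangentSpace (𝓡 3) x, IsPositiveFrame o α a b := by
  obtain ⟨U, a, b, h, c, hU, ha, hb, hab, hh, hrot, hcoc, hc⟩ := he
  have hc' : c.1 ∈ cechCoboundaries X := by
    have := (QuotientAddGroup.eq_zero_iff c).1 hc.symm
    exact AddSubgroup.mem_addSubgroupOf.1 this
  obtain ⟨U', hU', d, hd, hcd⟩ := hc'
  let W : X → Set X := fun x => U x ∩ U' x
  have hW : IsPointCover W := hU.inter hU'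
  -- Subtracting `2π` times the integral primitive `d` leaves the rotations unchanged and makes the
  -- angles additive: `H` is a genuine real Čech 1-cocycle.
  let H : X → X → X → ℝ := fun i j y => h i j y - 2 * Real.pi * (d i j y : ℝ)
  have hH : ∀ i j, ContinuousOn (H i j) (W i ∩ W j) := by
    intro i j
    refine ((hh i j).mono fun y hy => ⟨hy.1.1, hy.2.1⟩).sub (continuousOn_const.mul ?_)
    exact (continuous_of_discreteTopology (f := fun k : ℤ => (k : ℝ))).comp_continuousOn
      ((hd i j).mono fun y hy => ⟨hy.1.2, hy.2.2⟩)
  have hHc : ∀ i j k, ∀ y ∈ W i ∩ W j ∩ W k, H j k y - H i k y + H i j y = 0 := by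
    rintro i j k y ⟨⟨h1, h2⟩, h3⟩
    have e1 := hcoc i j k y ⟨⟨h1.1, h2.1⟩, h3.1⟩
    have e2 := hcd i j k y ⟨⟨h1.2, h2.2⟩, h3.2⟩
    rw [e2] at e1
    push_cast at e1
    simp only [H]
    linarith
  have hcos : ∀ i j y, Real.cos (H i j y) = Real.cos (h i j y) := by
    intro i j y
    have : H i j y = h i j y - (d i j y : ℝ) * (2 * Real.pi) := by simp only [H]; ring
    rw [this, Real.cos_sub_int_mul_two_pi]
  have hsin : ∀ i j y, Real.sin (H i j y) = Real.sin (h i j y) := by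
    intro i j y
    have : H i j y = h i j y - (d i j y : ℝ) * (2 * Real.pi) := by simp only [H]; ring
    rw [this, Real.sin_sub_int_mul_two_pi]
  obtain ⟨φ, hφ⟩ := PartitionOfUnity.exists_isSubordinate (isClosed_univ (X := X)) W
    (fun i => (hW i).1) (fun x _ => mem_iUnion.2 ⟨x, (hW x).2⟩)
  -- The sheaf of continuous real functions is fine: averaging `H k i` over `k` with a partition of
  -- unity gives functions with `S j - S i = H i j`.
  let S : X → X → ℝ := fun i y => ∑ᶠ k, φ k y * H k i y
  have hS : ∀ i, ∀ y ∈ W i, ContinuousAt (S i) y := by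
    intro i y hy
    obtain ⟨is, n, hn, hn1, hn2⟩ := φ.exists_finset_nhds_support_subset hφ (fun i => (hW i).1) y
    have h1 : ContinuousAt (fun z => ∑ k ∈ is, φ k z * H k i z) y := by
      refine tendsto_finsetSum _ fun k hk => ?_
      refine (φ k).continuous.continuousAt.mul ((hH k i).continuousAt ?_)
      have hyk : y ∈ W k := by
        have := hn1 (mem_of_mem_nhds hn)
        simp only [mem_iInter] at this
        exact this k hk
      exact ((hW k).1.inter (hW i).1).mem_nhds ⟨hyk, hy⟩
    refine h1.congr ?_
    filter_upwards [hn] with z hz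
    refine (finsum_eq_sum_of_support_subset _ fun k hk => hn2 z hz ?_).symm
    exact fun h0 => hk (by simp [h0])
  have hSdiff : ∀ i j, ∀ y ∈ W i ∩ W j, S j y = S i y + H i j y := by
    rintro i j y ⟨hi, hj⟩
    have hfin : (Function.support fun k => φ k y).Finite := φ.locallyFinite.point_finite y
    have e1 : S j y = ∑ k ∈ hfin.toFinset, φ k y * H k j y :=
      finsum_eq_sum_of_support_subset _ fun k hk => by
        simp only [Finite.coe_toFinset]; exact fun h0 => hk (by simp [h0])
    have e2 : S i y = ∑ k ∈ hfin.toFinset, φ k y * H k i y :=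
      finsum_eq_sum_of_support_subset _ fun k hk => by
        simp only [Finite.coe_toFinset]; exact fun h0 => hk (by simp [h0])
    have e3 : ∑ k ∈ hfin.toFinset, φ k y = 1 := by
      rw [← φ.sum_eq_one (mem_univ y)]
      exact (finsum_eq_sum_of_support_subset _ fun k hk => by simpa using hk).symm
    rw [e1, e2, ← one_mul (H i j y), ← e3, Finset.sum_mul, ← Finset.sum_add_distrib]
    refine Finset.sum_congr rfl fun k hk => ?_
    have hk' : y ∈ W k := hφ k (subset_tsupport _ (by simpa using hk))
    have := hHc k i j y ⟨⟨hk', hi⟩, hj⟩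
    rw [← mul_add]
    congr 1
    linarith
  -- The frame over `W i` is turned back by the angle `S i`. The turned frames agree on overlaps and
  -- hence are global.
  let A : X → ∀ y : X, TangentSpace (𝓡 3) y := fun i y =>
    Real.cos (S i y) • a i y + (-Real.sin (S i y)) • b i y
  let B : X → ∀ y : X, TangentSpace (𝓡 3) y := fun i y =>
    Real.sin (S i y) • a i y + Real.cos (S i y) • b i y
  have hAB : ∀ i j, ∀ y ∈ W i ∩ W j, A j y = A i y ∧ B j y = B i y := by
    rintro i j y ⟨hi, hj⟩
    obtain ⟨r1, r2⟩ := hrot i j y ⟨hi.1, hj.1⟩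
    have e := hSdiff i j y ⟨hi, hj⟩
    have hs2 := Real.sin_sq_add_cos_sq (h i j y)
    simp only [A, B, r1, r2, e, Real.cos_add, Real.sin_add, hcos, hsin]
    constructor
    · have h1 : Real.cos (S i y) = (Real.cos (S i y) * Real.cos (h i j y) - Real.sin (S i y) * Real.sin (h i j y)) * Real.cos (h i j y) + (Real.sin (S i y) * Real.cos (h i j y) + Real.cos (S i y) * Real.sin (h i j y)) * Real.sin (h i j y) := by linear_combination (-Real.cos (S i y)) * hs2
      have h2 : Real.sin (S i y) = -(Real.cos (S i y) * Real.cos (h i j y) - Real.sin (S i y) * Real.sin (h i j y)) * Real.sin (h i j y) + (Real.sin (S i y) * Real.cos (h i j y) + Real.cos (S i y) * Real.sin (h i j y)) * Real.cos (h i j y) := by linear_combination (-Real.sin (S i y)) * hs2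
      conv_rhs => rw [h1, h2]
      module
    · have h1 : Real.cos (S i y) = (Real.cos (S i y) * Real.cos (h i j y) - Real.sin (S i y) * Real.sin (h i j y)) * Real.cos (h i j y) + (Real.sin (S i y) * Real.cos (h i j y) + Real.cos (S i y) * Real.sin (h i j y)) * Real.sin (h i j y) := by linear_combination (-Real.cos (S i y)) * hs2
      have h2 : Real.sin (S i y) = -(Real.cos (S i y) * Real.cos (h i j y) - Real.sin (S i y) * Real.sin (h i j y)) * Real.sin (h i j y) + (Real.sin (S i y) * Real.cos (h i j y) + Real.cos (S i y) * Real.sin (h i j y)) * Real.cos (h i j y) := by linear_combination (-Real.sin (S i y)) * hs2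
      conv_rhs => rw [h1, h2]
      module
  have hAc : ∀ i, ∀ y ∈ W i, ContinuousAt (fun y => (⟨y, A i y⟩ : TangentBundle (𝓡 3) X)) y := by
    intro i y hy
    have hs := hS i y hy
    exact continuousAt_section_lincomb (Real.continuous_cos.continuousAt.comp hs)
      (Real.continuous_sin.continuousAt.comp hs).neg
      ((ha i).continuousAt ((hU i).1.mem_nhds hy.1)) ((hb i).continuousAt ((hU i).1.mem_nhds hy.1))
  have hBc : ∀ i, ∀ y ∈ W i, ContinuousAt (fun y => (⟨y, B i y⟩ : TangentBundle (𝓡 3) X)) y := by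
    intro i y hy
    have hs := hS i y hy
    exact continuousAt_section_lincomb (Real.continuous_sin.continuousAt.comp hs)
      (Real.continuous_cos.continuousAt.comp hs)
      ((ha i).continuousAt ((hU i).1.mem_nhds hy.1)) ((hb i).continuousAt ((hU i).1.mem_nhds hy.1))
  -- The cover is indexed by points, so the frame with index `y` may be used at `y` itself. Near `y`
  -- it agrees with the single continuous frame of index `y`.
  refine ⟨fun y => A y y, fun y => B y y, ?_, ?_, ?_, ?_, ?_⟩
  · refine continuous_iff_continuousAt.2 fun y => (hAc y y (hW y).2).congr ?_
    filter_upwards [(hW y).1.mem_nhds (hW y).2] with z hz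
    rw [(hAB y z z ⟨hz, (hW z).2⟩).1]
  · refine continuous_iff_continuousAt.2 fun y => (hBc y y (hW y).2).congr ?_
    filter_upwards [(hW y).1.mem_nhds (hW y).2] with z hz
    rw [(hAB y z z ⟨hz, (hW z).2⟩).2]
  · intro y
    obtain ⟨h1, h2, -⟩ := hab y y (hU y).2
    simp [A, h1, h2]
  · intro y
    obtain ⟨h1, h2, -⟩ := hab y y (hU y).2
    simp [B, h1, h2]
  · intro y
    obtain ⟨-, -, r, hr, hp⟩ := hab y y (hU y).2
    refine ⟨r, hr, ?_⟩
    have := isPos_rotate hp (c := Real.cos (S y y)) (s := Real.sin (S y y))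
      (by rw [add_comm]; exact Real.sin_sq_add_cos_sq _)
    simpa only [A, B, sub_eq_add_neg, neg_smul] using this

/-- A plane field with a nowhere vanishing continuous section has vanishing Euler class. -/
lemma isEulerClass_zero_of_section [T2Space X] [CompactSpace X] {o : ManifoldOrientation (𝓡 3) X 3}
    {β : ∀ x : X, TangentSpace (𝓡 3) x →L[ℝ] ℝ} (hβ : IsSmoothForm β) (hβ0 : ∀ y, β y ≠ 0)
    {V : ∀ x : X, TangentSpace (𝓡 3) x}
    (hV : Continuous (fun y => (⟨y, V y⟩ : TangentBundle (𝓡 3) X)))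
    (hVβ : ∀ y, β y (V y) = 0) (hV0 : ∀ y, V y ≠ 0) : IsEulerClass o β 0 := by
  have hI : IsManifold (𝓡 3) 1 X := IsManifold.of_le (n := ∞) (by simp)
  -- The admissible second vectors of a positive frame starting with `V y`. They form an open half
  -- plane in `ker β`, hence a convex set, and a partition of unity then yields a global choice from
  -- local ones.
  let t : ∀ y : X, Set (TangentSpace (𝓡 3) y) := fun y =>
    {Y | β y Y = 0 ∧ ∃ r, 0 < β y r ∧ o.IsPos y ![r, V y, Y]}
  have hconv : ∀ y, Convex ℝ (t y) := by
    rintro y Y₁ ⟨hY₁, r₁, hr₁, hp₁⟩ Y₂ ⟨hY₂, r₂, hr₂, hp₂⟩ p q hp hq hpq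
    refine ⟨by simp [hY₁, hY₂], r₁, hr₁, ?_⟩
    obtain ⟨B, h1, h2⟩ := hp₁
    have e0 : r₁ = B 0 := (h1 0).symm
    have e1 : V y = B 1 := (h1 1).symm
    have e2 : Y₁ = B 2 := (h1 2).symm
    rw [o.isPos_iff_det B h2] at hp₂ ⊢
    -- The form `β y` kills the second and the third vector of the basis `(r₁, V y, Y₁)`, so it is a
    -- multiple of the first coordinate.
    have hb : ∀ w, β y w = β y r₁ * B.repr w 0 := by
      intro w
      conv_lhs => rw [← B.sum_repr w]
      rw [Fin.sum_univ_three, ← e0, ← e1, ← e2]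
      simp [hVβ, hY₁, mul_comm]
    have hY₂0 : B.repr Y₂ 0 = 0 := by
      have := hb Y₂
      rw [hY₂] at this
      rcases mul_eq_zero.1 this.symm with h | h
      · exact absurd h hr₁.ne'
      · exact h
    have hr₂0 : 0 < B.repr r₂ 0 := by
      have := hb r₂
      rw [this] at hr₂
      exact (pos_iff_pos_of_mul_pos hr₂).1 hr₁
    rw [det_vec3, e1] at hp₂
    rw [det_vec3, e1, e2, e0]
    simp [hY₂0] at hp₂ ⊢
    have hk : 0 < B.repr Y₂ 2 := (pos_iff_pos_of_mul_pos hp₂).1 hr₂0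
    rcases hp.eq_or_lt with rfl | hp
    · have : q = 1 := by linarith
      subst this; simpa using hk
    · have := mul_nonneg hq hk.le
      linarith
  have hloc : ∀ y : X, ∃ U ∈ 𝓝 y, ∃ s : ∀ x : X, TangentSpace (𝓡 3) x,
      ContMDiffOn (𝓡 3) ((𝓡 3).prod 𝓘(ℝ, EuclideanSpace ℝ (Fin 3))) 0
        (fun x => (⟨x, s x⟩ : TangentBundle (𝓡 3) X)) U ∧ ∀ z ∈ U, s z ∈ t z := by
    intro y
    obtain ⟨r, hr⟩ : ∃ r, 0 < β y r := by
      obtain ⟨r, hr⟩ : ∃ r, β y r ≠ 0 := by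
        by_contra hcon
        push Not at hcon
        exact hβ0 y (ContinuousLinearMap.ext hcon)
      rcases lt_or_gt_of_ne hr with h | h
      · exact ⟨-r, by simpa using h⟩
      · exact ⟨r, h⟩
    -- a vector completing the frame at the point
    obtain ⟨Y, hY, hp⟩ : ∃ Y, β y Y = 0 ∧ o.IsPos y ![r, V y, Y] := by
      have hdim : Module.finrank ℝ (TangentSpace (𝓡 3) y) = 3 := by
        change Module.finrank ℝ (EuclideanSpace ℝ (Fin 3)) = 3
        simp
      have hli : LinearIndependent ℝ ![r, V y] := by
        rw [LinearIndependent.pair_iff]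
        intro c d hcd
        have h1 := congrArg (β y) hcd
        simp [hVβ, hr.ne'] at h1
        subst h1
        simp at hcd
        exact ⟨rfl, hcd.resolve_right (hV0 y)⟩
      obtain ⟨Y', hY'⟩ : ∃ Y', LinearIndependent ℝ ![r, V y, Y'] := by
        obtain ⟨Y', hY'⟩ := exists_linearIndependent_snoc_of_lt_finrank hli (by rw [hdim]; norm_num)
        have e : (Fin.snoc ![r, V y] Y' : Fin 3 → TangentSpace (𝓡 3) y) = ![r, V y, Y'] := by
          funext i; fin_cases i <;> rfl
        exact ⟨Y', e ▸ hY'⟩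
      set Y₀ := Y' - (β y Y' / β y r) • r
      have hY₀ : β y Y₀ = 0 := by simp [Y₀, hr.ne']
      have hli₀ : LinearIndependent ℝ ![r, V y, Y₀] := by
        rw [Fintype.linearIndependent_iff] at hY' ⊢
        intro g hg
        have := hY' ![g 0 - g 2 * (β y Y' / β y r), g 1, g 2] (by
          rw [Fin.sum_univ_three] at hg ⊢
          rw [← hg]
          simp [Y₀]
          module)
        have h0 := this 0
        have h1 := this 1
        have h2 := this 2
        simp at h0 h1 h2
        intro i
        fin_cases i
        · simpa [h2] using h0
        · exact h1
        · exact h2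
      rcases o.isPos_or_isPos_neg hli₀ with h | h
      · exact ⟨Y₀, hY₀, h⟩
      · exact ⟨-Y₀, by simp [hY₀], h⟩
    obtain ⟨R, hR, hRc⟩ := exists_continuous_extension y r
    obtain ⟨Z, hZ, hZc⟩ := exists_continuous_extension y Y
    have hβR : ∀ᶠ z in 𝓝 y, 0 < β z (R z) := by
      have := hβ.continuousAt_apply hRc.self_of_nhds
      exact this.eventually_const_lt (by beta_reduce; rw [hR]; exact hr)
    -- Projecting the extension `Z` to `ker β` along `R`, which stays transverse to `ker β` near
    -- `y`.
    let s : ∀ x : X, TangentSpace (𝓡 3) x := fun z =>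
      (1 : ℝ) • Z z + (-(β z (Z z) / β z (R z))) • R z
    have hsc : ∀ᶠ z in 𝓝 y, ContinuousAt (fun y => (⟨y, s y⟩ : TangentBundle (𝓡 3) X)) z := by
      filter_upwards [hRc, hZc, hβR] with z h1 h2 h3
      refine continuousAt_section_lincomb continuousAt_const ?_ h2 h1
      exact ((hβ.continuousAt_apply h2).div (hβ.continuousAt_apply h1) h3.ne').neg
    have hsy : s y = Y := by simp [s, hZ, hY]
    have hpos : ∀ᶠ z in 𝓝 y, o.IsPos z ![R z, V z, s z] := by
      have := o.continuous_at y ![R, V, s] (by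
        intro i
        fin_cases i
        · exact hRc.self_of_nhds
        · exact hV.continuousAt
        · exact hsc.self_of_nhds) (by
        obtain ⟨B, h1, h2⟩ := hp
        refine ⟨B, fun i => ?_, h2⟩
        rw [h1]
        fin_cases i
        · exact hR.symm
        · rfl
        · exact hsy.symm)
      filter_upwards [this] with z hz
      obtain ⟨B, h1, h2⟩ := hz
      refine ⟨B, fun i => ?_, h2⟩
      rw [h1]
      fin_cases i <;> rfl
    refine ⟨_, (hsc.and (hpos.and hβR)), s, ?_, ?_⟩
    · rw [contMDiffOn_zero_iff]
      exact fun z hz => hz.1.continuousWithinAt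
    · rintro z ⟨-, h2, h3⟩
      refine ⟨?_, R z, h3, h2⟩
      simp [s, h3.ne']
  obtain ⟨s, hs⟩ := exists_contMDiffSection_forall_mem_convex_of_local (𝓡 3) (n := 0)
    (TangentSpace (𝓡 3) (M := X)) t hconv hloc
  exact IsPositiveFrame.isEulerClass_zero (a := V) (b := s)
    ⟨hV, s.contMDiff.continuous, hVβ, fun y => (hs y).1, fun y => (hs y).2⟩

end Sections

/-! ## Extending functions without winding over a solid torus -/

section Tube

open Set Filter

/-- The function `f / (2πi)` is continuous and integer-valued on a connected set. This makes the
increments of a logarithm over a period constant. -/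
lemma eqOn_of_exp_eq_one {Y : Type*} [TopologicalSpace Y] {C : Set Y} (hC : IsPreconnected C)
    {f : Y → ℂ} (hf : ContinuousOn f C) (h1 : ∀ x ∈ C, Complex.exp (f x) = 1) {x y : Y}
    (hx : x ∈ C) (hy : y ∈ C) : f x = f y := by
  choose k hk using fun (z : C) => Complex.exp_eq_one_iff.1 (h1 z.1 z.2)
  have hk' : ∀ z : C, ((k z : ℤ) : ℝ) = (f z).im / (2 * Real.pi) := by
    intro z
    rw [hk z]
    have : Real.pi ≠ 0 := Real.pi_ne_zero
    simp
  have hcont : Continuous k := by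
    rw [Int.isClosedEmbedding_coe_real.isEmbedding.continuous_iff]
    have : ((fun n : ℤ => (n : ℝ)) ∘ k) = fun z : C => (f z).im / (2 * Real.pi) := funext hk'
    rw [this]
    exact (Complex.continuous_im.comp (continuousOn_iff_continuous_domRestrict.1 hf)).div_const _
  have := isPreconnected_iff_preconnectedSpace.1 hC
  have hkk := PreconnectedSpace.constant inferInstance hcont (x := ⟨x, hx⟩) (y := ⟨y, hy⟩)
  have e1 := hk ⟨x, hx⟩
  have e2 := hk ⟨y, hy⟩
  rw [hkk] at e1
  exact e1.trans e2.symm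

/-- Polar coordinates present the punctured disc as the image of a strip. -/
lemma isPreconnected_ball_diff_zero (ε : ℝ) :
    IsPreconnected (Metric.ball (0 : ℂ) ε \ {0}) := by
  have : Metric.ball (0 : ℂ) ε \ {0} =
      (fun q : ℝ × ℝ => (q.1 : ℂ) * Complex.exp (q.2 * Complex.I)) '' (Ioo 0 ε ×ˢ univ) := by
    ext w
    constructor
    · rintro ⟨h1, h2⟩
      refine ⟨(‖w‖, Complex.arg w), ⟨⟨norm_pos_iff.2 h2, by simpa using h1⟩, trivial⟩, ?_⟩
      simp
    · rintro ⟨⟨s, θ⟩, ⟨⟨h1, h2⟩, -⟩, rfl⟩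
      refine ⟨?_, ?_⟩
      · simp [Complex.norm_exp_ofReal_mul_I, abs_of_pos h1, h2]
      · simp [h1.ne']
  rw [this]
  refine IsPreconnected.image ?_ _ (by fun_prop)
  exact isPreconnected_Ioo.prod isPreconnected_univ

/-- In polar coordinates the punctured tube is covered by the convex set `O`, on which `χ` has a
logarithm `H`. The hypothesis `hexp` says that `χ` does not wind around one meridian; then `H` is
unchanged by a full turn, on all meridians. Hence `χ = χ(R/2, z) · exp h` with `h` single-valued and
1-periodic in `z`, and multiplying `h` by a cutoff that vanishes near the core gives the extension.
Winding in the longitudinal direction is harmless, as it is carried by the factor `χ(R/2, z)`. -/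
theorem exists_tube_extension {R : ℝ} {χ : ℂ × ℝ → ℂ}
    (hc : ContinuousOn χ ((Metric.ball 0 R \ {0}) ×ˢ univ))
    (h0 : ∀ w ∈ Metric.ball (0 : ℂ) R \ {0}, ∀ z, χ (w, z) ≠ 0)
    (hper : ∀ w ∈ Metric.ball (0 : ℂ) R \ {0}, ∀ z, χ (w, z + 1) = χ (w, z))
    {z₀ ε : ℝ} (hε : 0 < ε) (hεR : ε ≤ R) {ℓ : ℂ → ℂ}
    (hℓ : ContinuousOn ℓ (Metric.ball 0 ε \ {0}))
    (hexp : ∀ w ∈ Metric.ball (0 : ℂ) ε \ {0}, χ (w, z₀) = Complex.exp (ℓ w)) :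
    ∃ χ' : ℂ × ℝ → ℂ, ContinuousOn χ' (Metric.ball 0 R ×ˢ univ) ∧
      (∀ w ∈ Metric.ball (0 : ℂ) R, ∀ z, χ' (w, z) ≠ 0) ∧
      (∀ w ∈ Metric.ball (0 : ℂ) R, ∀ z, χ' (w, z + 1) = χ' (w, z)) ∧
      ∀ w ∈ Metric.ball (0 : ℂ) R, R / 2 ≤ ‖w‖ → ∀ z, χ' (w, z) = χ (w, z) := by
  have hR : 0 < R := hε.trans_le hεR
  let O : Set (ℝ × ℝ × ℝ) := Ioo 0 R ×ˢ univ
  have hOo : IsOpen O := isOpen_Ioo.prod isOpen_univ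
  have hOc : Convex ℝ O := (convex_Ioo 0 R).prod convex_univ
  have hOne : O.Nonempty := ⟨(R / 2, 0, 0), ⟨by simp [hR], trivial⟩⟩
  have hOsc : IsSimplyConnected O := by
    have := hOc.contractibleSpace hOne
    exact inferInstanceAs (SimplyConnectedSpace O)
  let P : ℝ × ℝ × ℝ → ℂ × ℝ := fun q => ((q.1 : ℂ) * Complex.exp (q.2.1 * Complex.I), q.2.2)
  have hP : Continuous P := by fun_prop
  have hnorm : ∀ s θ : ℝ, 0 < s → ‖(s : ℂ) * Complex.exp (θ * Complex.I)‖ = s := fun s θ hs => by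
    simp [Complex.norm_exp_ofReal_mul_I, abs_of_pos hs]
  have hPm : ∀ {s θ r : ℝ}, 0 < s → s < r →
      (s : ℂ) * Complex.exp (θ * Complex.I) ∈ Metric.ball (0 : ℂ) r \ {0} := by
    intro s θ r h1 h2
    refine ⟨by rw [mem_ball_zero_iff, hnorm s θ h1]; exact h2, ?_⟩
    simp [h1.ne']
  have hPO : MapsTo P O ((Metric.ball 0 R \ {0}) ×ˢ univ) := by
    rintro ⟨s, θ, z⟩ ⟨⟨h1, h2⟩, -⟩
    exact ⟨hPm h1 h2, trivial⟩
  obtain ⟨H, hHc, hH⟩ := Complex.exists_continuousOn_eqOn_exp_comp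
    (U := O) (g := χ ∘ P) hOsc hOo (hc.comp hP.continuousOn hPO) (by
      rintro ⟨q, hq, h⟩
      exact h0 _ (hPO hq).1 _ h)
  have hH' : ∀ s θ z, 0 < s → s < R → Complex.exp (H (s, θ, z)) =
      χ ((s : ℂ) * Complex.exp (θ * Complex.I), z) := fun s θ z h1 h2 =>
    hH (x := (s, θ, z)) ⟨⟨h1, h2⟩, trivial⟩
  have hexp2 : ∀ θ : ℝ, Complex.exp (((θ + 2 * Real.pi : ℝ) : ℂ) * Complex.I) = Complex.exp (θ * Complex.I) := by
    intro θ
    push_cast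
    rw [add_mul, Complex.exp_add, Complex.exp_two_pi_mul_I, mul_one]
  -- no winding
  have hwind : ∀ s θ z, 0 < s → s < R → H (s, θ + 2 * Real.pi, z) = H (s, θ, z) := by
    -- The increment of `H` over a full turn lies in `2πiℤ` and therefore does not depend on the
    -- point.
    have hD : ∀ q ∈ O, ∀ q' ∈ O, H (q.1, q.2.1 + 2 * Real.pi, q.2.2) - H q =
        H (q'.1, q'.2.1 + 2 * Real.pi, q'.2.2) - H q' := by
      intro q hq q' hq'
      refine eqOn_of_exp_eq_one (f := fun q : ℝ × ℝ × ℝ => H (q.1, q.2.1 + 2 * Real.pi, q.2.2) - H q)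
        hOc.isPreconnected ?_ ?_ hq hq'
      · refine (hHc.comp (by fun_prop) fun q hq => ?_).sub hHc
        exact ⟨hq.1, trivial⟩
      · rintro ⟨s, θ, z⟩ ⟨⟨h1, h2⟩, -⟩
        have hne : χ ((s : ℂ) * Complex.exp (θ * Complex.I), z) ≠ 0 := h0 _ (hPm h1 h2) _
        simp only [Complex.exp_sub]
        rw [hH' _ _ _ h1 h2, hH' _ _ _ h1 h2, hexp2]
        exact div_self hne
    -- On the circle of radius `ε / 2` at height `z₀` the logarithms `H` and `ℓ` differ by a
    -- constant. As `ℓ` is single-valued there, the increment of `H` is zero.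
    have hE : ∀ θ θ' : ℝ, H (ε / 2, θ, z₀) - ℓ (((ε / 2 : ℝ) : ℂ) * Complex.exp (θ * Complex.I)) =
        H (ε / 2, θ', z₀) - ℓ (((ε / 2 : ℝ) : ℂ) * Complex.exp (θ' * Complex.I)) := by
      intro θ θ'
      refine eqOn_of_exp_eq_one (C := univ) (f := fun θ : ℝ => H (ε / 2, θ, z₀) -
        ℓ (((ε / 2 : ℝ) : ℂ) * Complex.exp (θ * Complex.I))) isPreconnected_univ ?_ ?_ trivial trivial
      · refine (hHc.comp (by fun_prop) fun θ _ => ?_).sub (hℓ.comp (by fun_prop) fun θ _ => ?_)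
        · exact ⟨⟨by simp [hε], by simp; linarith⟩, trivial⟩
        · exact hPm (by linarith) (by linarith)
      · intro θ _
        have hm := hPm (s := ε / 2) (θ := θ) (r := ε) (by linarith) (by linarith)
        rw [Complex.exp_sub, hH' _ _ _ (by linarith) (by linarith), hexp _ hm]
        exact div_self (Complex.exp_ne_zero _)
    intro s θ z h1 h2
    have e1 := hD (s, θ, z) ⟨⟨h1, h2⟩, trivial⟩ (ε / 2, 0, z₀) ⟨⟨by simp [hε], by simp; linarith⟩, trivial⟩
    have e2 := hE (0 + 2 * Real.pi) 0
    rw [hexp2] at e2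
    have e3 : H (ε / 2, 0 + 2 * Real.pi, z₀) - H (ε / 2, 0, z₀) = 0 := by
      linear_combination e2
    simp only at e1
    rw [e3] at e1
    exact sub_eq_zero.1 e1
  have hper' : ∀ s θ z, 0 < s → s < R →
      H (s, θ, z + 1) - H (R / 2, 0, z + 1) = H (s, θ, z) - H (R / 2, 0, z) := by
    have hD : ∀ q ∈ O, ∀ q' ∈ O, H (q.1, q.2.1, q.2.2 + 1) - H q =
        H (q'.1, q'.2.1, q'.2.2 + 1) - H q' := by
      intro q hq q' hq'
      refine eqOn_of_exp_eq_one (f := fun q : ℝ × ℝ × ℝ => H (q.1, q.2.1, q.2.2 + 1) - H q)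
        hOc.isPreconnected ?_ ?_ hq hq'
      · refine (hHc.comp (by fun_prop) fun q hq => ?_).sub hHc
        exact ⟨hq.1, trivial⟩
      · rintro ⟨s, θ, z⟩ ⟨⟨h1, h2⟩, -⟩
        have hne : χ ((s : ℂ) * Complex.exp (θ * Complex.I), z) ≠ 0 := h0 _ (hPm h1 h2) _
        simp only [Complex.exp_sub]
        rw [hH' _ _ _ h1 h2, hH' _ _ _ h1 h2, hper _ (hPm h1 h2)]
        exact div_self hne
    intro s θ z h1 h2
    have e1 := hD (s, θ, z) ⟨⟨h1, h2⟩, trivial⟩ (R / 2, 0, z) ⟨⟨by simp [hR], by simp; linarith⟩, trivial⟩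
    simp only at e1
    linear_combination e1
  -- Translation by one in `z` may change `H` by a constant. Subtracting the value at the reference
  -- point of the same height removes it.
  let H₀ : ℝ × ℝ × ℝ → ℂ := fun q => H q - H (R / 2, 0, q.2.2)
  have hH₀c : ContinuousOn H₀ O := by
    refine hHc.sub (hHc.comp (by fun_prop) fun q hq => ?_)
    exact ⟨⟨by simp [hR], by simp; linarith⟩, trivial⟩
  have hH₀θ : ∀ {s θ θ' z : ℝ}, 0 < s → s < R →
      Complex.exp (θ * Complex.I) = Complex.exp (θ' * Complex.I) → H₀ (s, θ, z) = H₀ (s, θ', z) := by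
    intro s θ θ' z h1 h2 he
    obtain ⟨k, hk⟩ := Complex.exp_eq_exp_iff_exists_int.1 he
    have hk' : θ = θ' + k * (2 * Real.pi) := by
      have := congrArg Complex.im hk
      simpa using this
    have hp : Function.Periodic (fun θ => H (s, θ, z)) (2 * Real.pi) := fun θ => hwind s θ z h1 h2
    have := hp.int_mul k θ'
    simp only [H₀, hk']
    rw [this]
  let h : ℂ × ℝ → ℂ := fun q => H₀ (‖q.1‖, Complex.arg q.1, q.2)
  have harg : ∀ w : ℂ, w ≠ 0 → Complex.exp ((Complex.arg w : ℂ) * Complex.I) = w / ‖w‖ := by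
    intro w hw
    rw [eq_div_iff (by simpa using hw), mul_comm]
    exact Complex.norm_mul_exp_arg_mul_I w
  have hhc : ContinuousOn h ((Metric.ball 0 R \ {0}) ×ˢ univ) := by
    rintro ⟨w, z⟩ ⟨⟨hw1, hw2⟩, -⟩
    have hw2' : w ≠ 0 := hw2
    have hwn : 0 < ‖w‖ := norm_pos_iff.2 hw2'
    have hwR : ‖w‖ < R := by simpa using hw1
    refine ContinuousAt.continuousWithinAt ?_
    by_cases hs : w ∈ Complex.slitPlane
    · have hca : ContinuousAt (fun q : ℂ × ℝ => (‖q.1‖, Complex.arg q.1, q.2)) (w, z) :=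
        (continuous_norm.comp continuous_fst).continuousAt.prodMk
          ((ContinuousAt.comp (g := Complex.arg) (f := fun q : ℂ × ℝ => q.1)
            (Complex.continuousAt_arg hs) continuousAt_fst).prodMk continuousAt_snd)
      exact ContinuousAt.comp (g := H₀) (hH₀c.continuousAt (hOo.mem_nhds ⟨⟨hwn, hwR⟩, trivial⟩)) hca
    -- On the cut of `arg` the angle `arg (-w) + π` is continuous. It represents the same direction
    -- as `arg w`, and `H₀` depends on the direction only.
    · have hs' : -w ∈ Complex.slitPlane := by
        rw [Complex.mem_slitPlane_iff] at hs ⊢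
        push Not at hs
        left
        have : w.re ≠ 0 := fun h => hw2' (Complex.ext h hs.2)
        simp only [Complex.neg_re]
        have := lt_of_le_of_ne hs.1 this
        linarith
      have hca : ContinuousAt (fun q : ℂ × ℝ => (‖q.1‖, Complex.arg (-q.1) + Real.pi, q.2)) (w, z) := by
        refine (continuous_norm.comp continuous_fst).continuousAt.prodMk (ContinuousAt.prodMk ?_ continuousAt_snd)
        refine ContinuousAt.add ?_ continuousAt_const
        exact ContinuousAt.comp (g := Complex.arg) (f := fun q : ℂ × ℝ => -q.1)
          (Complex.continuousAt_arg hs') continuousAt_fst.neg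
      have hcomp : ContinuousAt (fun q : ℂ × ℝ => H₀ (‖q.1‖, Complex.arg (-q.1) + Real.pi, q.2)) (w, z) :=
        ContinuousAt.comp (g := H₀) (hH₀c.continuousAt (hOo.mem_nhds ⟨⟨hwn, hwR⟩, trivial⟩)) hca
      refine hcomp.congr ?_
      have hopen : ((Metric.ball (0 : ℂ) R \ {0}) ×ˢ (univ : Set ℝ)) ∈ 𝓝 (w, z) :=
        ((Metric.isOpen_ball.sdiff isClosed_singleton).prod isOpen_univ).mem_nhds ⟨⟨hw1, hw2⟩, trivial⟩
      filter_upwards [hopen] with q hq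
      have hq0 : q.1 ≠ 0 := hq.1.2
      refine hH₀θ (norm_pos_iff.2 hq0) (by simpa using hq.1.1) ?_
      rw [harg _ hq0]
      push_cast
      rw [add_mul, Complex.exp_add, Complex.exp_pi_mul_I, harg _ (neg_ne_zero.2 hq0)]
      simp [neg_div]
  have hRm : ((R / 2 : ℝ) : ℂ) ∈ Metric.ball (0 : ℂ) R \ {0} := by
    have := hPm (s := R / 2) (θ := 0) (r := R) (by linarith) (by linarith)
    simpa using this
  have hexph : ∀ w ∈ Metric.ball (0 : ℂ) R \ {0}, ∀ z,
      χ (((R / 2 : ℝ) : ℂ), z) * Complex.exp (h (w, z)) = χ (w, z) := by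
    intro w hw z
    have h1 : 0 < ‖w‖ := norm_pos_iff.2 hw.2
    have h2 : ‖w‖ < R := by simpa using hw.1
    have h3 := hH' (R / 2) 0 z (by linarith) (by linarith)
    simp only [Complex.ofReal_zero, zero_mul, Complex.exp_zero, mul_one] at h3
    simp only [h, H₀, Complex.exp_sub]
    rw [hH' _ _ _ h1 h2, h3, Complex.norm_mul_exp_arg_mul_I]
    exact mul_div_cancel₀ _ (h0 _ hRm z)
  -- A cutoff that is `0` up to `R / 4` and `1` from `R / 2` on.
  let ρ : ℝ → ℝ := fun s => max 0 (min 1 (4 * s / R - 1))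
  have hρ : Continuous ρ := by fun_prop
  have hρ0 : ∀ s, s ≤ R / 4 → ρ s = 0 := by
    intro s hs
    have : 4 * s / R ≤ 1 := by rw [div_le_one hR]; linarith
    exact max_eq_left ((min_le_right _ _).trans (by linarith))
  have hρ1 : ∀ s, R / 2 ≤ s → ρ s = 1 := by
    intro s hs
    have : 2 ≤ 4 * s / R := by rw [le_div_iff₀ hR]; linarith
    simp only [ρ]
    rw [min_eq_left (by linarith)]
    simp
  have hcR : Continuous fun z : ℝ => χ (((R / 2 : ℝ) : ℂ), z) := by
    rw [← continuousOn_univ]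
    exact hc.comp (by fun_prop) fun z _ => ⟨hRm, trivial⟩
  refine ⟨fun q => χ (((R / 2 : ℝ) : ℂ), q.2) * Complex.exp (ρ ‖q.1‖ * h q), ?_, ?_, ?_, ?_⟩
  · rintro ⟨w, z⟩ ⟨hw, -⟩
    refine ContinuousAt.continuousWithinAt ?_
    by_cases hw0 : w = 0
    · subst hw0
      have hev : ∀ᶠ q : ℂ × ℝ in 𝓝 (0, z), ‖q.1‖ < R / 4 :=
        (continuous_norm.comp continuous_fst).continuousAt.eventually_lt_const (by simp; linarith)
      refine ContinuousAt.congr (f := fun q : ℂ × ℝ => χ (((R / 2 : ℝ) : ℂ), q.2))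
        (hcR.comp continuous_snd).continuousAt ?_
      filter_upwards [hev] with q hq
      simp [hρ0 _ hq.le]
    · have hh : ContinuousAt h (w, z) := hhc.continuousAt
        (((Metric.isOpen_ball.sdiff isClosed_singleton).prod isOpen_univ).mem_nhds ⟨⟨hw, hw0⟩, trivial⟩)
      refine (hcR.comp continuous_snd).continuousAt.mul (Complex.continuous_exp.continuousAt.comp ?_)
      refine ContinuousAt.mul ?_ hh
      exact (Complex.continuous_ofReal.comp (hρ.comp (continuous_norm.comp continuous_fst))).continuousAt
  · intro w hw z
    exact mul_ne_zero (h0 _ hRm z) (Complex.exp_ne_zero _)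
  · intro w hw z
    simp only
    rw [hper _ hRm]
    by_cases hw0 : w = 0
    · subst hw0; rw [norm_zero, hρ0 0 (by linarith)]; simp
    · have : h (w, z + 1) = h (w, z) :=
        hper' _ _ _ (norm_pos_iff.2 hw0) (by simpa using hw)
      rw [this]
  · intro w hw hwR z
    have hw0 : w ≠ 0 := by
      rintro rfl
      simp at hwR
      linarith
    simp only
    rw [hρ1 _ hwR, Complex.ofReal_one, one_mul]
    exact hexph w ⟨hw, hw0⟩ z

end Tube

/-! ## Orientations in coordinates -/

section OrientationCoords

open Set Filter

lemma ManifoldOrientation.exists_isPos {E H : Type*} [NormedAddCommGroup E] [NormedSpace ℝ E]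
    [TopologicalSpace H] {I : ModelWithCorners ℝ E H} {X : Type*} [TopologicalSpace X]
    [ChartedSpace H X] [IsManifold I ∞ X] {d : ℕ} (o : ManifoldOrientation I X (d + 1))
    (bE : Module.Basis (Fin (d + 1)) ℝ E) (x : X) : ∃ v, o.IsPos x v :=
  let b : Module.Basis (Fin (d + 1)) ℝ (TangentSpace I x) := bE
  ⟨b.adjustToOrientation (o.at_point x), b.adjustToOrientation (o.at_point x), fun _ => rfl,
    b.orientation_adjustToOrientation _⟩

/-- The frame of the tangent bundle given by the trivialisation at `x` is continuous, and
coordinates with respect to it are computed by the derivative of the chart. The statement also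
covers boundary points. -/
lemma ManifoldOrientation.eventually_isPos_iff_chart {E H : Type*} [NormedAddCommGroup E]
    [NormedSpace ℝ E] [TopologicalSpace H] {I : ModelWithCorners ℝ E H} {X : Type*}
    [TopologicalSpace X] [ChartedSpace H X] [IsManifold I ∞ X] {d : ℕ}
    (o : ManifoldOrientation I X (d + 1)) (bE : Module.Basis (Fin (d + 1)) ℝ E) (x : X) :
    ∃ ε : ℝ, (ε = 1 ∨ ε = -1) ∧ ∀ᶠ y in 𝓝 x, ∀ v : Fin (d + 1) → TangentSpace I y,
      o.IsPos y v ↔ 0 < ε * bE.det (fun i => (mfderiv I 𝓘(ℝ, E) (extChartAt I x) y (v i) : E)) := by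
  have hI : IsManifold I 1 X := IsManifold.of_le (n := ∞) (by simp)
  let T := trivializationAt E (TangentSpace I (M := X)) x
  have hbase : T.baseSet ∈ 𝓝 x := T.open_baseSet.mem_nhds (FiberBundle.mem_baseSet_trivializationAt' x)
  let V : E → ∀ y : X, TangentSpace I y := fun w y => T.symmL ℝ y w
  have hV : ∀ w, ContinuousAt (fun y => (⟨y, V w y⟩ : TangentBundle I X)) x := by
    intro w
    rw [FiberBundle.continuousAt_totalSpace]
    refine ⟨continuousAt_id, ?_⟩
    refine (continuousAt_const (y := w)).congr ?_
    filter_upwards [hbase] with y hy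
    change w = (T ⟨y, T.symmL ℝ y w⟩).2
    rw [Bundle.Trivialization.symmL_apply, T.apply_mk_symm hy]
    exact hy
  have hequiv : ∀ y ∈ T.baseSet, ∃ f : E ≃ₗ[ℝ] TangentSpace I y, (∀ w, f w = V w y) ∧
      ∀ v, f.symm v = (mfderiv I 𝓘(ℝ, E) (extChartAt I x) y v : E) := by
    intro y hy
    have hy' : y ∈ (chartAt H x).source := by simpa [T] using hy
    refine ⟨(T.continuousLinearEquivAt ℝ y hy).symm.toLinearEquiv, fun w => ?_, fun v => ?_⟩
    · change (T.continuousLinearEquivAt ℝ y hy).symm w = T.symmL ℝ y w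
      rw [← Bundle.Trivialization.symm_continuousLinearEquivAt_eq T hy]
    rw [← TangentBundle.continuousLinearMapAt_trivializationAt hy']
    change T.continuousLinearEquivAt ℝ y hy v = _
    rw [Bundle.Trivialization.coe_continuousLinearEquivAt_eq]
    rfl
  obtain ⟨ε, hε, hev⟩ := o.eventually_isPos_iff (x := x) (fun i => V (bE i)) (fun i => hV _) (by
      have := hV (-bE 0)
      simpa only [V, map_neg] using this) (by
      obtain ⟨f, h1, -⟩ := hequiv x (mem_of_mem_nhds hbase)
      exact ⟨bE.map f, fun i => by simp [h1]⟩)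
  refine ⟨ε, hε, ?_⟩
  filter_upwards [hev, hbase] with y hy hyb v
  obtain ⟨b, h1, h2⟩ := hy
  obtain ⟨f, h3, h4⟩ := hequiv y hyb
  have : b = bE.map f := Module.Basis.eq_of_apply_eq fun i => by simp [h1, h3]
  rw [h2, this, Module.Basis.det_map]
  have e : (f.symm ∘ v) = fun i => (mfderiv I 𝓘(ℝ, E) (extChartAt I x) y (v i) : E) :=
    funext fun i => h4 (v i)
  rw [← e]

variable {E' : Type*} [NormedAddCommGroup E'] [NormedSpace ℝ E'] [FiniteDimensional ℝ E']
  {X : Type*} [TopologicalSpace X] [ChartedSpace (EuclideanSpace ℝ (Fin 3)) X]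

lemma IsParam.congr {θ θ' : E' → X} {U : Set E'} (h : IsParam θ U) (he : EqOn θ' θ U) :
    IsParam θ' U := by
  refine ⟨h.isOpen, h.smooth.congr he, fun q hq => ?_⟩
  have : θ' =ᶠ[𝓝 q] θ := by filter_upwards [h.isOpen.mem_nhds hq] with r hr using he hr
  have h1 := h.bijective q hq
  have h2 := this.mfderiv_eq (I := 𝓘(ℝ, E')) (I' := 𝓡 3)
  have h3 : (mfderiv 𝓘(ℝ, E') (𝓡 3) θ' q : E' → EuclideanSpace ℝ (Fin 3)) =
      (mfderiv 𝓘(ℝ, E') (𝓡 3) θ q : E' → EuclideanSpace ℝ (Fin 3)) :=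
    congrArg (fun L : E' →L[ℝ] EuclideanSpace ℝ (Fin 3) => (L : E' → EuclideanSpace ℝ (Fin 3))) h2
  change Function.Bijective (mfderiv 𝓘(ℝ, E') (𝓡 3) θ' q : E' → EuclideanSpace ℝ (Fin 3))
  rw [h3]
  exact h1

variable [IsManifold (𝓡 3) ∞ X]

/-- The derivative of a parametrisation, as an equivalence. -/
lemma IsParam.exists_equiv {θ : E' → X} {U : Set E'} (h : IsParam θ U) {q : E'} (hq : q ∈ U) :
    ∃ A : E' ≃ₗ[ℝ] TangentSpace (𝓡 3) (θ q), ∀ v, A v = mfderiv 𝓘(ℝ, E') (𝓡 3) θ q v :=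
  ⟨LinearEquiv.ofBijective (mfderiv 𝓘(ℝ, E') (𝓡 3) θ q).toLinearMap (h.bijective q hq), fun _ => rfl⟩

/-- The images under the derivative of `θ` of the vectors of `B` form a continuous frame, to which
the local constancy of orientations applies. -/
lemma IsParam.eventually_isPos_iff {θ : E' → X} {U : Set E'} (h : IsParam θ U)
    (o : ManifoldOrientation (𝓡 3) X 3) (B : Module.Basis (Fin 3) ℝ E') {q : E'} (hq : q ∈ U) :
    ∃ ε : ℝ, (ε = 1 ∨ ε = -1) ∧ ∀ᶠ r in 𝓝 q, ∀ v : Fin 3 → E',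
      o.IsPos (θ r) (fun i => mfderiv 𝓘(ℝ, E') (𝓡 3) θ r (v i)) ↔ 0 < ε * B.det v := by
  obtain ⟨e, h1, h2, h3, h4⟩ := h.exists_homeo hq
  have hq' : e q = θ q := h3 h1
  let V : E' → ∀ y : X, TangentSpace (𝓡 3) y := fun w y => mfderiv 𝓘(ℝ, E') (𝓡 3) θ (e.symm y) w
  have hVθ : ∀ r ∈ e.source, ∀ w, V w (θ r) = mfderiv 𝓘(ℝ, E') (𝓡 3) θ r w := by
    intro r hr w
    have : e.symm (θ r) = r := by rw [← h3 hr, e.left_inv hr]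
    simp only [V]
    rw [this]
  have hV : ∀ w, ContinuousAt (fun y => (⟨y, V w y⟩ : TangentBundle (𝓡 3) X)) (θ q) := by
    intro w
    rw [h.continuousAt_section_iff (v := fun _ => w) hq]
    · exact continuousAt_const
    · filter_upwards [e.open_source.mem_nhds h1] with r hr using (hVθ r hr w).symm
  obtain ⟨ε, hε, hev⟩ := o.eventually_isPos_iff (x := θ q) (fun i => V (B i)) (fun i => hV _) (by
      have e1 : ∀ y, -V (B 0) y = V (-B 0) y := fun y => (map_neg _ _).symm
      simpa only [e1] using hV (-B 0)) (by
      obtain ⟨A, hA⟩ := h.exists_equiv hq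
      exact ⟨B.map A, fun i => by simp [hA, hVθ q h1]⟩)
  refine ⟨ε, hε, ?_⟩
  have hcont : ContinuousAt θ q := (h.contMDiffAt hq).continuousAt
  filter_upwards [hcont.eventually hev, e.open_source.mem_nhds h1] with r hr hrs v
  obtain ⟨b, h5, h6⟩ := hr
  obtain ⟨A, hA⟩ := h.exists_equiv (h2 hrs)
  have : b = B.map A := Module.Basis.eq_of_apply_eq fun i => by simp [h5, hA, hVθ r hrs]
  rw [h6, this, Module.Basis.det_map]
  have e : A.symm ∘ (fun i => mfderiv 𝓘(ℝ, E') (𝓡 3) θ r (v i)) = v :=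
    funext fun i => by rw [Function.comp, ← hA, A.symm_apply_apply]
  rw [e]

/-- Derivatives of curves in coordinates. -/
lemma IsParam.mfderiv_curve {θ : E' → X} {U : Set E'} (h : IsParam θ U) {γ : ℝ → X} {q : ℝ → E'}
    {q' : E'} {t : ℝ} (hγ : ∀ᶠ s in 𝓝 t, γ s = θ (q s)) (hq : HasDerivAt q q' t) (hU : q t ∈ U) :
    (mfderiv 𝓘(ℝ, ℝ) (𝓡 3) γ t (1 : ℝ) : EuclideanSpace ℝ (Fin 3)) =
      mfderiv 𝓘(ℝ, E') (𝓡 3) θ (q t) q' := by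
  have h1 : mfderiv 𝓘(ℝ, ℝ) (𝓡 3) γ t = mfderiv 𝓘(ℝ, ℝ) (𝓡 3) (θ ∘ q) t :=
    Filter.EventuallyEq.mfderiv_eq hγ
  have h2 := mfderiv_comp t (h.mdifferentiableAt hU) hq.differentiableAt.mdifferentiableAt
  rw [h2] at h1
  have h3 : (mfderiv 𝓘(ℝ, ℝ) 𝓘(ℝ, E') q t (1 : ℝ) : E') = q' := by
    rw [mfderiv_eq_fderiv]
    exact hq.deriv
  have h4 := congrArg (fun L : ℝ →L[ℝ] EuclideanSpace ℝ (Fin 3) => L 1) h1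
  refine h4.trans ?_
  change mfderiv 𝓘(ℝ, E') (𝓡 3) θ (q t) (mfderiv 𝓘(ℝ, ℝ) 𝓘(ℝ, E') q t (1 : ℝ)) = _
  rw [h3]

/-- A differentiable curve is differentiable in coordinates. -/
lemma IsParam.hasDerivAt_symm {e : OpenPartialHomeomorph E' X}
    (hs : ContMDiffOn (𝓡 3) 𝓘(ℝ, E') ∞ e.symm e.target) {γ : ℝ → X} {t : ℝ}
    (hγ : MDifferentiableAt 𝓘(ℝ, ℝ) (𝓡 3) γ t) (ht : γ t ∈ e.target) :
    ∃ q', HasDerivAt (fun s => e.symm (γ s)) q' t := by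
  have h1 : MDifferentiableAt (𝓡 3) 𝓘(ℝ, E') e.symm (γ t) :=
    (hs.contMDiffAt (e.open_target.mem_nhds ht)).mdifferentiableAt (by simp)
  have h2 : MDifferentiableAt 𝓘(ℝ, ℝ) 𝓘(ℝ, E') (e.symm ∘ γ) t := MDifferentiableAt.comp t h1 hγ
  exact ⟨_, h2.differentiableAt.hasDerivAt⟩

end OrientationCoords

/-! ## Charts adapted to a surface -/

section SurfaceChart

open Set Filter

lemma IsParam.comp {E' E'' : Type*} [NormedAddCommGroup E'] [NormedSpace ℝ E'] [FiniteDimensional ℝ E']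
    [NormedAddCommGroup E''] [NormedSpace ℝ E''] {X : Type*} [TopologicalSpace X]
    [ChartedSpace (EuclideanSpace ℝ (Fin 3)) X] {θ : E' → X} {U : Set E'} (h : IsParam θ U)
    {g : E'' → E'} {V : Set E''} (hV : IsOpen V) (hg : ContDiffOn ℝ ∞ g V) (hgV : MapsTo g V U)
    (hb : ∀ q ∈ V, Function.Bijective (fderiv ℝ g q)) : IsParam (θ ∘ g) V := by
  refine ⟨hV, h.smooth.comp (contMDiffOn_iff_contDiffOn.2 hg) hgV, fun q hq => ?_⟩
  have h1 : MDifferentiableAt 𝓘(ℝ, E'') 𝓘(ℝ, E') g q :=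
    ((hg.contDiffAt (hV.mem_nhds hq)).differentiableAt (by simp)).mdifferentiableAt
  rw [mfderiv_comp q (h.mdifferentiableAt (hgV hq)) h1]
  have h2 := hb q hq
  rw [← mfderiv_eq_fderiv] at h2
  exact (h.bijective _ (hgV hq)).comp h2

/-- The image of the complement of a neighbourhood of `y₀` is compact and misses `f y₀`. For an
embedded compact surface this excludes distant sheets near a given point. -/
lemma eventually_forall_mem_of_injective {Y Z : Type*} [TopologicalSpace Y] [CompactSpace Y]
    [TopologicalSpace Z] [T2Space Z] {f : Y → Z} (hf : Continuous f) (hi : Function.Injective f)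
    {y₀ : Y} {N : Set Y} (hN : N ∈ 𝓝 y₀) : ∀ᶠ z in 𝓝 (f y₀), ∀ y, f y = z → y ∈ N := by
  have hK : IsClosed (f '' (interior N)ᶜ) :=
    (isOpen_interior.isClosed_compl.isCompact.image hf).isClosed
  have hx : f y₀ ∉ f '' (interior N)ᶜ := by
    rintro ⟨y, hy, h⟩
    rw [hi h] at hy
    exact hy (mem_interior_iff_mem_nhds.2 hN)
  filter_upwards [hK.isOpen_compl.mem_nhds hx] with z hz y hy
  by_contra hcon
  exact hz ⟨y, fun h => hcon (interior_subset h), hy⟩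

/-- The standard basis of `ℝ² × ℝ`. -/
def planeBasis : Module.Basis (Fin 3) ℝ (EuclideanSpace ℝ (Fin 2) × ℝ) :=
  ((EuclideanSpace.basisFun (Fin 2) ℝ).toBasis.prod (Module.Basis.singleton (Fin 1) ℝ)).reindex
    finSumFinEquiv

lemma planeBasis_repr (v : EuclideanSpace ℝ (Fin 2) × ℝ) :
    planeBasis.repr v 0 = v.1 0 ∧ planeBasis.repr v 1 = v.1 1 ∧ planeBasis.repr v 2 = v.2 := by
  refine ⟨?_, ?_, ?_⟩
  · have : (finSumFinEquiv (m := 2) (n := 1)).symm 0 = Sum.inl 0 := rfl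
    simp [planeBasis, this]
  · have : (finSumFinEquiv (m := 2) (n := 1)).symm 1 = Sum.inl 1 := rfl
    simp [planeBasis, this]
  · have : (finSumFinEquiv (m := 2) (n := 1)).symm 2 = Sum.inr 0 := rfl
    simp [planeBasis, this]

lemma planeBasis_det (q a b : EuclideanSpace ℝ (Fin 2) × ℝ) (ha : a.2 = 0) (hb : b.2 = 0) :
    planeBasis.det ![q, a, b] =
      q.2 * (EuclideanSpace.basisFun (Fin 2) ℝ).toBasis.det ![a.1, b.1] := by
  rw [det_vec3, Module.Basis.det_apply, Matrix.det_fin_two]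
  simp only [(planeBasis_repr _).1, (planeBasis_repr _).2.1, (planeBasis_repr _).2.2,
    Module.Basis.toMatrix_apply]
  simp [ha, hb]
  ring

variable {M : Type*} [TopologicalSpace M] [ChartedSpace (EuclideanSpace ℝ (Fin 3)) M]
  [IsManifold (𝓡 3) ∞ M] {F : Type*} [TopologicalSpace F] [ChartedSpace (EuclideanHalfSpace 2) F]
  [IsManifold (𝓡∂ 2) ∞ F]

lemma ManifoldOrientation.isPos_congr (o : ManifoldOrientation (𝓡 3) M 3) {x x' : M} (h : x = x')
    (v : Fin 3 → EuclideanSpace ℝ (Fin 3)) : o.IsPos x v ↔ o.IsPos x' v := by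
  subst h; rfl

/-- `e` is a chart in which the surface is `{s = 0}`, and in which crossings of the surface can be
read off from the derivative of the last coordinate. -/
structure IsSurfaceChart (oM : ManifoldOrientation (𝓡 3) M 3) (oF : ManifoldOrientation (𝓡∂ 2) F 2)
    (ι : F → M) (e : OpenPartialHomeomorph (EuclideanSpace ℝ (Fin 2) × ℝ) M) (κ : ℝ) : Prop where
  sign : κ = 1 ∨ κ = -1
  isParam : IsParam e e.source
  smooth_symm : ContMDiffOn (𝓡 3) 𝓘(ℝ, EuclideanSpace ℝ (Fin 2) × ℝ) ∞ e.symm e.target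
  mem_range_iff : ∀ q ∈ e.source, e q ∈ range ι ↔ q.2 = 0
  crossing_iff : ∀ (γ : ℝ → M) (t : ℝ) (q : ℝ → EuclideanSpace ℝ (Fin 2) × ℝ)
    (q' : EuclideanSpace ℝ (Fin 2) × ℝ), (∀ᶠ s in 𝓝 t, γ s = e (q s)) → HasDerivAt q q' t →
    q t ∈ e.source → ∀ ε : ℝ, IsCrossing oM oF ι γ ε t ↔ (q t).2 = 0 ∧ 0 < κ * ε * q'.2
  transverse : ∀ (γ : ℝ → M) (t : ℝ) (q : ℝ → EuclideanSpace ℝ (Fin 2) × ℝ)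
    (q' : EuclideanSpace ℝ (Fin 2) × ℝ), (∀ᶠ s in 𝓝 t, γ s = e (q s)) → HasDerivAt q q' t →
    q t ∈ e.source → q'.2 ≠ 0 → ∀ y, ι y = γ t → ∀ τ : TangentSpace (𝓡∂ 2) y,
      (mfderiv (𝓡∂ 2) (𝓡 3) ι y τ : EuclideanSpace ℝ (Fin 3)) ≠
        (mfderiv 𝓘(ℝ, ℝ) (𝓡 3) γ t (1 : ℝ) : EuclideanSpace ℝ (Fin 3))

variable [CompactSpace F] [T2Space M] {m : ℕ} {L : OrientedLink M m}
  {oF : ManifoldOrientation (𝓡∂ 2) F 2} {ι : F → M}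

/-- A parametrisation of the surface is thickened along a fixed transverse direction, and the
inverse function theorem applies. The sign `κ` records how the resulting coordinates compare with
both orientations. -/
lemma exists_isSurfaceChart (oM : ManifoldOrientation (𝓡 3) M 3) (hS : IsSeifertSurface L oF ι)
    {y₀ : F} (hy₀ : (𝓡∂ 2).IsInteriorPoint y₀) :
    ∃ (e : OpenPartialHomeomorph (EuclideanSpace ℝ (Fin 2) × ℝ) M) (κ : ℝ)
      (u₀ : EuclideanSpace ℝ (Fin 2)), IsSurfaceChart oM oF ι e κ ∧ (u₀, 0) ∈ e.source ∧
        e (u₀, 0) = ι y₀ := by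
  have hI : IsManifold (𝓡 3) 1 M := IsManifold.of_le (n := ∞) (by simp)
  have hIF : IsManifold (𝓡∂ 2) 1 F := IsManifold.of_le (n := ∞) (by simp)
  set φ := extChartAt (𝓡∂ 2) y₀ with hφ
  set u₀ := φ y₀ with hu₀
  set T := interior φ.target with hT
  have hu₀T : u₀ ∈ T := ModelWithCorners.isInteriorPoint_iff.1 hy₀
  have hTφ : T ⊆ φ.target := interior_subset
  let σ : EuclideanSpace ℝ (Fin 2) → M := fun u => ι (φ.symm u)
  have hφs : ContMDiffOn 𝓘(ℝ, EuclideanSpace ℝ (Fin 2)) (𝓡∂ 2) ∞ φ.symm T :=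
    (contMDiffOn_extChartAt_symm (I := 𝓡∂ 2) y₀).mono hTφ
  have hσ : ContMDiffOn 𝓘(ℝ, EuclideanSpace ℝ (Fin 2)) (𝓡 3) ∞ σ T :=
    hS.smooth.comp_contMDiffOn hφs
  have hσ₀ : σ u₀ = ι y₀ := by simp only [σ, u₀, φ, extChartAt_to_inv]
  set ψ := extChartAt (𝓡 3) (ι y₀) with hψ
  set T' := T ∩ σ ⁻¹' ψ.source with hT'
  have hT'o : IsOpen T' := hσ.continuousOn.isOpen_inter_preimage isOpen_interior
    (isOpen_extChartAt_source (ι y₀))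
  have hu₀T' : u₀ ∈ T' := ⟨hu₀T, by rw [mem_preimage, hσ₀]; exact mem_extChartAt_source (ι y₀)⟩
  let s : EuclideanSpace ℝ (Fin 2) → EuclideanSpace ℝ (Fin 3) := fun u => ψ (σ u)
  have hs : ContDiffOn ℝ ∞ s T' := by
    rw [← contMDiffOn_iff_contDiffOn]
    exact (contMDiffOn_extChartAt (I := 𝓡 3) (x := ι y₀) (n := ∞)).comp (hσ.mono inter_subset_left)
      (fun r hr => by simpa [ψ] using hr.2)
  have hinj : Function.Injective (fderiv ℝ s u₀) := by
    have hmem : σ u₀ ∈ (chartAt (EuclideanSpace ℝ (Fin 3)) (ι y₀)).source := by simpa [ψ] using hu₀T'.2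
    have d1 : MDifferentiableAt (𝓡 3) 𝓘(ℝ, EuclideanSpace ℝ (Fin 3)) ψ (σ u₀) :=
      mdifferentiableAt_extChartAt hmem
    have d2 : MDifferentiableAt (𝓡∂ 2) (𝓡 3) ι (φ.symm u₀) :=
      hS.smooth.contMDiffAt.mdifferentiableAt (by simp)
    have d3 : MDifferentiableAt 𝓘(ℝ, EuclideanSpace ℝ (Fin 2)) (𝓡∂ 2) φ.symm u₀ :=
      (hφs.contMDiffAt (isOpen_interior.mem_nhds hu₀T)).mdifferentiableAt (by simp)
    have d23 : MDifferentiableAt 𝓘(ℝ, EuclideanSpace ℝ (Fin 2)) (𝓡 3) σ u₀ := d2.comp u₀ d3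
    have e1 : mfderiv 𝓘(ℝ, EuclideanSpace ℝ (Fin 2)) 𝓘(ℝ, EuclideanSpace ℝ (Fin 3)) s u₀ =
        (mfderiv (𝓡 3) 𝓘(ℝ, EuclideanSpace ℝ (Fin 3)) ψ (σ u₀)).comp
          (mfderiv 𝓘(ℝ, EuclideanSpace ℝ (Fin 2)) (𝓡 3) σ u₀) := mfderiv_comp u₀ d1 d23
    have e2 : mfderiv 𝓘(ℝ, EuclideanSpace ℝ (Fin 2)) (𝓡 3) σ u₀ =
        (mfderiv (𝓡∂ 2) (𝓡 3) ι (φ.symm u₀)).comp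
          (mfderiv 𝓘(ℝ, EuclideanSpace ℝ (Fin 2)) (𝓡∂ 2) φ.symm u₀) := mfderiv_comp u₀ d2 d3
    rw [← mfderiv_eq_fderiv, e1, e2]
    obtain ⟨A, hA⟩ := isInvertible_mfderiv_extChartAt (I := 𝓡 3) hu₀T'.2
    obtain ⟨C, hC⟩ := isInvertible_mfderivWithin_extChartAt_symm (I := 𝓡∂ 2) (hTφ hu₀T)
    have hr : range (𝓡∂ 2) ∈ 𝓝 u₀ :=
      mem_of_superset (isOpen_interior.mem_nhds hu₀T)
        (hTφ.trans (extChartAt_target_subset_range y₀))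
    rw [mfderivWithin_of_mem_nhds hr] at hC
    rw [← hA, ← hC]
    exact A.injective.comp ((hS.immersed _).comp C.injective)
  -- A transverse direction exists since the derivative of the surface has rank at most two.
  obtain ⟨n, hn⟩ : ∃ n, n ∉ LinearMap.range (fderiv ℝ s u₀).toLinearMap := by
    by_contra hcon
    push Not at hcon
    have h1 : LinearMap.range (fderiv ℝ s u₀).toLinearMap = ⊤ := Submodule.eq_top_iff'.2 hcon
    have h2 := LinearMap.finrank_range_le (fderiv ℝ s u₀).toLinearMap
    rw [h1, finrank_top] at h2
    simp at h2
  let g : EuclideanSpace ℝ (Fin 2) × ℝ → EuclideanSpace ℝ (Fin 3) := fun q => s q.1 + q.2 • n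
  let U₁ : Set (EuclideanSpace ℝ (Fin 2) × ℝ) := Prod.fst ⁻¹' T'
  have hU₁ : IsOpen U₁ := hT'o.preimage continuous_fst
  have hg : ContDiffOn ℝ ∞ g U₁ :=
    (hs.comp contDiff_fst.contDiffOn fun q hq => hq).add
      (contDiff_snd.smul contDiff_const).contDiffOn
  let U₂ := U₁ ∩ g ⁻¹' ψ.target
  have hU₂ : IsOpen U₂ := hg.continuousOn.isOpen_inter_preimage hU₁ (isOpen_extChartAt_target (ι y₀))
  -- Invertibility of the derivative is an open condition, so it persists near `(u₀, 0)`.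
  let U₃ := U₂ ∩ fderiv ℝ g ⁻¹' range ((↑) : ((EuclideanSpace ℝ (Fin 2) × ℝ) ≃L[ℝ]
    EuclideanSpace ℝ (Fin 3)) → ((EuclideanSpace ℝ (Fin 2) × ℝ) →L[ℝ] EuclideanSpace ℝ (Fin 3)))
  have hU₃ : IsOpen U₃ :=
    ((hg.mono inter_subset_left).continuousOn_fderiv_of_isOpen hU₂ (by simp)).isOpen_inter_preimage
      hU₂ ContinuousLinearEquiv.isOpen
  have hq₀ : (u₀, (0 : ℝ)) ∈ U₃ := by
    refine ⟨⟨hu₀T', ?_⟩, ?_⟩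
    · simp only [mem_preimage, g, zero_smul, add_zero, s]
      exact ψ.map_source hu₀T'.2
    · have hd : HasFDerivAt g ((fderiv ℝ s u₀).comp (ContinuousLinearMap.fst ℝ _ _) +
          (ContinuousLinearMap.snd ℝ (EuclideanSpace ℝ (Fin 2)) ℝ).smulRight n) (u₀, 0) := by
        have h1 : HasFDerivAt s (fderiv ℝ s u₀) u₀ :=
          ((hs.contDiffAt (hT'o.mem_nhds hu₀T')).differentiableAt (by simp)).hasFDerivAt
        have h2 : HasFDerivAt (fun q : EuclideanSpace ℝ (Fin 2) × ℝ => s q.1)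
            ((fderiv ℝ s u₀).comp (ContinuousLinearMap.fst ℝ _ _)) (u₀, 0) :=
          HasFDerivAt.comp (g := s) (f := Prod.fst) (u₀, (0 : ℝ)) h1 hasFDerivAt_fst
        exact h2.add (hasFDerivAt_snd.smul_const n)
      rw [mem_preimage, hd.fderiv]
      set A := (fderiv ℝ s u₀).comp (ContinuousLinearMap.fst ℝ (EuclideanSpace ℝ (Fin 2)) ℝ) +
          (ContinuousLinearMap.snd ℝ (EuclideanSpace ℝ (Fin 2)) ℝ).smulRight n with hA
      have hAi : Function.Injective A := by
        rw [injective_iff_map_eq_zero]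
        rintro ⟨du, dr⟩ h0
        simp only [hA, add_apply, ContinuousLinearMap.comp_apply,
          ContinuousLinearMap.coe_fst', ContinuousLinearMap.smulRight_apply,
          ContinuousLinearMap.coe_snd'] at h0
        have hdr : dr = 0 := by
          by_contra hdr
          refine hn ⟨-(dr⁻¹ • du), ?_⟩
          change fderiv ℝ s u₀ (-(dr⁻¹ • du)) = n
          rw [map_neg, map_smul, eq_neg_of_add_eq_zero_left h0, smul_neg, neg_neg, smul_smul,
            inv_mul_cancel₀ hdr, one_smul]
        subst hdr
        simp only [zero_smul, add_zero] at h0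
        rw [Prod.mk_eq_zero]
        exact ⟨hinj (by rw [h0, map_zero]), rfl⟩
      have hfr : Module.finrank ℝ (EuclideanSpace ℝ (Fin 2) × ℝ) =
          Module.finrank ℝ (EuclideanSpace ℝ (Fin 3)) := by simp
      refine ⟨(LinearEquiv.ofInjectiveOfFinrankEq A.toLinearMap hAi hfr).toContinuousLinearEquiv, ?_⟩
      exact ContinuousLinearMap.ext fun v => rfl
  have hΨ : IsParam (ψ.symm ∘ g) U₃ := by
    refine (IsParam.isParam_extChartAt_symm (ι y₀)).comp hU₃
      (hg.mono (inter_subset_left.trans inter_subset_left)) (fun q hq => hq.1.2) ?_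
    rintro q ⟨-, A, hA⟩
    rw [← hA]
    exact A.bijective
  obtain ⟨e₁, h1, h2, h3, h4⟩ := hΨ.exists_homeo hq₀
  have he₁ : ∀ u ∈ T', (u, (0 : ℝ)) ∈ e₁.source → e₁ (u, 0) = ι (φ.symm u) := by
    intro u hu hu'
    rw [h3 hu']
    simp only [Function.comp, g, zero_smul, add_zero, s]
    exact ψ.left_inv hu.2
  have he₁p : IsParam e₁ e₁.source := (hΨ.mono e₁.open_source h2).congr h3
  obtain ⟨ε₂, hε₂, hev₂⟩ := oF.eventually_isPos_iff_chart
    (EuclideanSpace.basisFun (Fin 2) ℝ).toBasis y₀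
  obtain ⟨ε₃, hε₃, hev₃⟩ := he₁p.eventually_isPos_iff oM planeBasis h1
  let N₁ : Set F := {y | y ∈ φ.source ∧ φ y ∈ T' ∧ (φ y, (0 : ℝ)) ∈ e₁.source}
  have hN₁ : IsOpen N₁ := by
    have hc : ContinuousOn φ φ.source := continuousOn_extChartAt y₀
    have : IsOpen (φ.source ∩ φ ⁻¹' (T' ∩ (fun u => (u, (0 : ℝ))) ⁻¹' e₁.source)) :=
      hc.isOpen_inter_preimage (isOpen_extChartAt_source y₀)
        (hT'o.inter (e₁.open_source.preimage (by fun_prop)))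
    exact this
  have hy₀N₁ : y₀ ∈ N₁ := ⟨mem_extChartAt_source y₀, hu₀T', h1⟩
  have he₁0 : e₁ (u₀, 0) = ι y₀ := by rw [he₁ u₀ hu₀T' h1]; exact hσ₀
  -- Near the base point every point of the surface comes from `N₁`, where it has the coordinates
  -- `(φ y, 0)`; the chart therefore sees a single sheet.
  have hevN : ∀ᶠ q in 𝓝 (u₀, (0 : ℝ)), (∀ y, ι y = e₁ q → y ∈ N₁ ∧
      ∀ v : Fin 2 → TangentSpace (𝓡∂ 2) y, oF.IsPos y v ↔
        0 < ε₂ * (EuclideanSpace.basisFun (Fin 2) ℝ).toBasis.det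
          (fun i => (mfderiv (𝓡∂ 2) 𝓘(ℝ, EuclideanSpace ℝ (Fin 2)) φ y (v i) :
            EuclideanSpace ℝ (Fin 2)))) := by
    have hc : Tendsto e₁ (𝓝 (u₀, (0 : ℝ))) (𝓝 (ι y₀)) := by
      rw [← he₁0]; exact e₁.continuousAt h1
    have := eventually_forall_mem_of_injective hS.smooth.continuous hS.injective
      ((hN₁.eventually_mem hy₀N₁).and hev₂)
    exact hc.eventually this
  obtain ⟨O, hO, hOo, hO₀⟩ := eventually_nhds_iff.1 (hevN.and hev₃)
  let e := e₁.restrOpen O hOo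
  have hes : e.source = e₁.source ∩ O := e₁.restrOpen_source O hOo
  have hec : ∀ q, e q = e₁ q := fun q => rfl
  have hN₁e : ∀ y ∈ N₁, ι y = e₁ (φ y, 0) := by
    rintro y ⟨h5, h6, h7⟩
    rw [he₁ _ h6 h7, φ.left_inv h5]
  have hloc : ∀ q ∈ e.source, ∀ y, ι y = e₁ q → q = (φ y, 0) := by
    intro q hq y hy
    rw [hes] at hq
    have hyN := ((hO q hq.2).1 y hy).1
    exact e₁.injOn hq.1 hyN.2.2 (by rw [← hy, hN₁e y hyN])
  have hderiv : ∀ y ∈ N₁, ∀ τ : TangentSpace (𝓡∂ 2) y,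
      (mfderiv (𝓡∂ 2) (𝓡 3) ι y τ : EuclideanSpace ℝ (Fin 3)) =
      mfderiv 𝓘(ℝ, EuclideanSpace ℝ (Fin 2) × ℝ) (𝓡 3) e₁ (φ y, 0)
        ((mfderiv (𝓡∂ 2) 𝓘(ℝ, EuclideanSpace ℝ (Fin 2)) φ y τ : EuclideanSpace ℝ (Fin 2)), (0 : ℝ)) := by
    intro y hy τ
    have hyc : y ∈ (chartAt (EuclideanHalfSpace 2) y₀).source := by simpa [φ] using hy.1
    let j : EuclideanSpace ℝ (Fin 2) → EuclideanSpace ℝ (Fin 2) × ℝ := fun u => (u, 0)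
    have hj : HasFDerivAt j (ContinuousLinearMap.inl ℝ (EuclideanSpace ℝ (Fin 2)) ℝ) (φ y) :=
      (ContinuousLinearMap.inl ℝ (EuclideanSpace ℝ (Fin 2)) ℝ).hasFDerivAt
    have e0 : ι =ᶠ[𝓝 y] (e₁ ∘ j) ∘ φ := by
      filter_upwards [hN₁.mem_nhds hy] with z hz using hN₁e z hz
    have d1 : MDifferentiableAt (𝓡∂ 2) 𝓘(ℝ, EuclideanSpace ℝ (Fin 2)) φ y :=
      mdifferentiableAt_extChartAt hyc
    have d2 : MDifferentiableAt 𝓘(ℝ, EuclideanSpace ℝ (Fin 2))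
      𝓘(ℝ, EuclideanSpace ℝ (Fin 2) × ℝ) j (φ y) := hj.differentiableAt.mdifferentiableAt
    have d3 : MDifferentiableAt 𝓘(ℝ, EuclideanSpace ℝ (Fin 2) × ℝ) (𝓡 3) e₁ (j (φ y)) :=
      he₁p.mdifferentiableAt hy.2.2
    have d23 : MDifferentiableAt 𝓘(ℝ, EuclideanSpace ℝ (Fin 2)) (𝓡 3) (e₁ ∘ j) (φ y) :=
      d3.comp (φ y) d2
    have e1 : mfderiv (𝓡∂ 2) (𝓡 3) ((e₁ ∘ j) ∘ φ) y = (mfderiv 𝓘(ℝ, EuclideanSpace ℝ (Fin 2)) (𝓡 3)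
        (e₁ ∘ j) (φ y)).comp (mfderiv (𝓡∂ 2) 𝓘(ℝ, EuclideanSpace ℝ (Fin 2)) φ y) := mfderiv_comp y d23 d1
    have e2 : mfderiv 𝓘(ℝ, EuclideanSpace ℝ (Fin 2)) (𝓡 3) (e₁ ∘ j) (φ y) =
        (mfderiv 𝓘(ℝ, EuclideanSpace ℝ (Fin 2) × ℝ) (𝓡 3) e₁ (j (φ y))).comp
        (mfderiv 𝓘(ℝ, EuclideanSpace ℝ (Fin 2)) 𝓘(ℝ, EuclideanSpace ℝ (Fin 2) × ℝ) j (φ y)) :=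
      mfderiv_comp (φ y) d3 d2
    have e3 : mfderiv (𝓡∂ 2) (𝓡 3) ι y = mfderiv (𝓡∂ 2) (𝓡 3) ((e₁ ∘ j) ∘ φ) y := e0.mfderiv_eq
    have e4 : mfderiv 𝓘(ℝ, EuclideanSpace ℝ (Fin 2)) 𝓘(ℝ, EuclideanSpace ℝ (Fin 2) × ℝ) j (φ y) =
        ContinuousLinearMap.inl ℝ (EuclideanSpace ℝ (Fin 2)) ℝ := by
      rw [mfderiv_eq_fderiv]; exact hj.fderiv
    rw [e1, e2, e4] at e3
    have e5 := congrArg (fun A : EuclideanSpace ℝ (Fin 2) →L[ℝ] EuclideanSpace ℝ (Fin 3) => A τ) e3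
    exact e5
  have hep : IsParam e e.source := (he₁p.mono (hes ▸ e.open_source) (hes ▸ inter_subset_left)).congr
    (fun q _ => hec q)
  -- Here `ε₂` compares the chart of the surface with `oF`, and `ε₃` compares `e` with `oM`. The
  -- sign of a crossing involves their product.
  refine ⟨e, ε₃ * ε₂, u₀, ⟨?_, hep, ?_, ?_, ?_, ?_⟩, ?_, ?_⟩
  · rcases hε₂ with rfl | rfl <;> rcases hε₃ with rfl | rfl <;> simp
  · refine h4.mono fun z hz => ?_
    have h5 : e.symm z ∈ e.source := e.map_target hz
    rw [hes] at h5
    have h6 : e₁ (e.symm z) = z := e.right_inv hz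
    rw [← h6]
    exact e₁.map_source h5.1
  · intro q hq
    constructor
    · rintro ⟨y, hy⟩
      rw [hloc q hq y hy]
    · intro hq2
      rw [hes] at hq
      refine ⟨φ.symm q.1, ?_⟩
      have hqe : q = (q.1, (0 : ℝ)) := Prod.ext rfl hq2
      have hqT : q.1 ∈ T' := (h2 hq.1).1.1
      rw [hqe] at hq
      rw [hec, hqe, he₁ q.1 hqT hq.1]
  · intro γ t q q' hγ hq hqs ε
    have hγt : γ t = e (q t) := hγ.self_of_nhds
    have hvel := hep.mfderiv_curve hγ hq hqs
    have key : ∀ y, ι y = γ t → ∀ v : Fin 2 → TangentSpace (𝓡∂ 2) y, oF.IsPos y v →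
        (oM.IsPos (ι y) ![(mfderiv 𝓘(ℝ, ℝ) (𝓡 3) γ t (1 : ℝ) : TangentSpace (𝓡 3) (ι y)),
          ε • mfderiv (𝓡∂ 2) (𝓡 3) ι y (v 0), mfderiv (𝓡∂ 2) (𝓡 3) ι y (v 1)] ↔
          0 < ε₃ * ε₂ * ε * q'.2) := by
      intro y hy v hv
      have hy' : ι y = e₁ (q t) := hy.trans hγt
      have hqy := hloc _ hqs y hy'
      rw [hes] at hqs
      obtain ⟨hyN, hyp⟩ := (hO _ hqs.2).1 y hy'
      have hp3 := (hO _ hqs.2).2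
      rw [hyp] at hv
      set a : EuclideanSpace ℝ (Fin 2) := mfderiv (𝓡∂ 2) 𝓘(ℝ, EuclideanSpace ℝ (Fin 2)) φ y (v 0)
      set b : EuclideanSpace ℝ (Fin 2) := mfderiv (𝓡∂ 2) 𝓘(ℝ, EuclideanSpace ℝ (Fin 2)) φ y (v 1)
      have hv' : (fun i => (mfderiv (𝓡∂ 2) 𝓘(ℝ, EuclideanSpace ℝ (Fin 2)) φ y (v i) :
            EuclideanSpace ℝ (Fin 2))) = ![a, b] := by
        funext i; fin_cases i <;> rfl
      rw [hv'] at hv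
      have hfin := hp3 ![q', ε • (a, (0 : ℝ)), (b, (0 : ℝ))]
      rw [planeBasis_det _ _ _ (by simp) rfl] at hfin
      have hdet : (EuclideanSpace.basisFun (Fin 2) ℝ).toBasis.det ![(ε • (a, (0 : ℝ))).1, b] =
          ε * (EuclideanSpace.basisFun (Fin 2) ℝ).toBasis.det ![a, b] := by
        rw [Module.Basis.det_apply, Module.Basis.det_apply, Matrix.det_fin_two, Matrix.det_fin_two]
        simp [Module.Basis.toMatrix_apply]
        ring
      rw [hdet] at hfin
      refine ((oM.isPos_congr hy' _).trans ?_).trans (hfin.trans ?_)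
      · apply iff_of_eq
        congr 1
        funext i
        fin_cases i
        · exact hvel
        · change (ε • (mfderiv (𝓡∂ 2) (𝓡 3) ι y (v 0) : EuclideanSpace ℝ (Fin 3))) =
            mfderiv 𝓘(ℝ, EuclideanSpace ℝ (Fin 2) × ℝ) (𝓡 3) e₁ (q t) (ε • (a, (0 : ℝ)))
          rw [hderiv y hyN, hqy]
          exact ((mfderiv 𝓘(ℝ, EuclideanSpace ℝ (Fin 2) × ℝ) (𝓡 3) e₁ (φ y, 0)).map_smul ε
            (a, (0 : ℝ))).symm
        · change (mfderiv (𝓡∂ 2) (𝓡 3) ι y (v 1) : EuclideanSpace ℝ (Fin 3)) =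
            mfderiv 𝓘(ℝ, EuclideanSpace ℝ (Fin 2) × ℝ) (𝓡 3) e₁ (q t) (b, (0 : ℝ))
          rw [hderiv y hyN, hqy]
      · set d := (EuclideanSpace.basisFun (Fin 2) ℝ).toBasis.det ![a, b]
        have hε₂2 : ε₂ * ε₂ = 1 := by rcases hε₂ with rfl | rfl <;> norm_num
        -- Since `v` is positive, `ε₂ * d > 0`; because `ε₂ * ε₂ = 1`, this positive factor can be
        -- split off.
        have : ε₃ * (q'.2 * (ε * d)) = (ε₃ * ε₂ * ε * q'.2) * (ε₂ * d) := by
          linear_combination (-(ε₃ * q'.2 * ε * d)) * hε₂2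
        rw [this, mul_pos_iff_of_pos_right hv]
    constructor
    · rintro ⟨y, hy, v, hv, hp⟩
      have hqy := hloc _ hqs y (hy.trans hγt)
      exact ⟨by rw [hqy], (key y hy v hv).1 hp⟩
    · rintro ⟨hq2, hpos⟩
      have hqs' := hqs
      rw [hes] at hqs'
      have hqe : q t = ((q t).1, (0 : ℝ)) := Prod.ext rfl hq2
      have hy : ι (φ.symm (q t).1) = γ t := by
        have hqT : (q t).1 ∈ T' := (h2 hqs'.1).1.1
        have := he₁ _ hqT (hqe ▸ hqs'.1)
        rw [← this, ← hqe, hγt]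
        rfl
      obtain ⟨v, hv⟩ := oF.exists_isPos (EuclideanSpace.basisFun (Fin 2) ℝ).toBasis (φ.symm (q t).1)
      exact ⟨_, hy, v, hv, (key _ hy v hv).2 hpos⟩
  · intro γ t q q' hγ hq hqs hq'2 y hy τ heq
    have hγt : γ t = e (q t) := hγ.self_of_nhds
    have hvel := hep.mfderiv_curve hγ hq hqs
    have hqy := hloc _ hqs y (hy.trans hγt)
    have hyN := ((hO _ (hes ▸ hqs).2).1 y (hy.trans hγt)).1
    have hvel' : (mfderiv 𝓘(ℝ, ℝ) (𝓡 3) γ t (1 : ℝ) : EuclideanSpace ℝ (Fin 3)) =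
      mfderiv 𝓘(ℝ, EuclideanSpace ℝ (Fin 2) × ℝ) (𝓡 3) e₁ (q t) q' := hvel
    rw [hvel', hderiv y hyN, ← hqy] at heq
    have := (he₁p.bijective _ (hes ▸ hqs).1).1 heq
    exact hq'2 (by rw [← this])
  · rw [hes]; exact ⟨h1, hO₀⟩
  · exact he₁0

end SurfaceChart

/-! ## Side functions of a surface -/

section SideFunction

open Set Filter

variable {M : Type*} [TopologicalSpace M] [ChartedSpace (EuclideanSpace ℝ (Fin 3)) M]
  [IsManifold (𝓡 3) ∞ M] {F : Type*} [TopologicalSpace F] [ChartedSpace (EuclideanHalfSpace 2) F]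
  [IsManifold (𝓡∂ 2) ∞ F]

/-- The integer-valued function `f` is locally constant on `W` off the surface, equal to one just after
a positive crossing and to zero just before it. -/
structure IsSideFunction (oM : ManifoldOrientation (𝓡 3) M 3) (oF : ManifoldOrientation (𝓡∂ 2) F 2)
    (ι : F → M) (f : M → ℤ) (W : Set M) : Prop where
  isOpen : IsOpen W
  eventually_eq : ∀ z ∈ W, z ∉ range ι → ∀ᶠ z' in 𝓝 z, f z' = f z
  after : ∀ (c : ℝ → M) (t : ℝ), IsCrossing oM oF ι c 1 t → c t ∈ W → ∀ᶠ s in 𝓝[>] t, f (c s) = 1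
  before : ∀ (c : ℝ → M) (t : ℝ), IsCrossing oM oF ι c 1 t → c t ∈ W → ∀ᶠ s in 𝓝[<] t, f (c s) = 0

/-- The indicator function of the positive side of a surface chart. -/
def sideFun (e : OpenPartialHomeomorph (EuclideanSpace ℝ (Fin 2) × ℝ) M) (κ : ℝ) (z : M) : ℤ :=
  if 0 < κ * (e.symm z).2 then 1 else 0

variable {oM : ManifoldOrientation (𝓡 3) M 3} {oF : ManifoldOrientation (𝓡∂ 2) F 2} {ι : F → M}
  {e : OpenPartialHomeomorph (EuclideanSpace ℝ (Fin 2) × ℝ) M} {κ : ℝ}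

lemma IsCrossing.mem_range {γ : ℝ → M} {ε t : ℝ} (h : IsCrossing oM oF ι γ ε t) : γ t ∈ range ι := by
  obtain ⟨y, hy, -⟩ := h
  exact ⟨y, hy⟩

lemma IsCrossing.mfderiv_ne_zero {γ : ℝ → M} {ε t : ℝ} (h : IsCrossing oM oF ι γ ε t) :
    (mfderiv 𝓘(ℝ, ℝ) (𝓡 3) γ t (1 : ℝ) : EuclideanSpace ℝ (Fin 3)) ≠ 0 := by
  obtain ⟨y, hy, v, hv, b, hb, -⟩ := h
  intro h0
  have h1 := b.ne_zero 0
  rw [hb 0] at h1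
  exact h1 h0

/-- A crossing has nonzero velocity as part of a frame, while the derivative of a curve that is not
differentiable is zero by convention. Thus side functions can be tested on arbitrary curves. -/
lemma IsCrossing.mdifferentiableAt {γ : ℝ → M} {ε t : ℝ} (h : IsCrossing oM oF ι γ ε t) :
    MDifferentiableAt 𝓘(ℝ, ℝ) (𝓡 3) γ t := by
  by_contra hcon
  apply h.mfderiv_ne_zero
  rw [mfderiv_zero_of_not_mdifferentiableAt hcon]
  rfl

lemma IsSurfaceChart.restr (h : IsSurfaceChart oM oF ι e κ) {O : Set (EuclideanSpace ℝ (Fin 2) × ℝ)}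
    (hO : IsOpen O) : IsSurfaceChart oM oF ι (e.restrOpen O hO) κ := by
  have hs : (e.restrOpen O hO).source = e.source ∩ O := e.restrOpen_source O hO
  refine ⟨h.sign, h.isParam.mono (e.restrOpen O hO).open_source (hs ▸ inter_subset_left),
    h.smooth_symm.mono fun z hz => ?_, fun q hq => h.mem_range_iff q (hs.subset hq).1,
    fun γ t q q' hγ hq hqs => h.crossing_iff γ t q q' hγ hq (hs.subset hqs).1,
    fun γ t q q' hγ hq hqs => h.transverse γ t q q' hγ hq (hs.subset hqs).1⟩
  have h5 : (e.restrOpen O hO).symm z ∈ (e.restrOpen O hO).source := (e.restrOpen O hO).map_target hz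
  rw [hs] at h5
  have h6 : e ((e.restrOpen O hO).symm z) = z := (e.restrOpen O hO).right_inv hz
  rw [← h6]
  exact e.map_source h5.1

/-- At a positive crossing `κ` times the last coordinate vanishes and has positive derivative, so it
is positive just after the crossing and negative just before it. -/
lemma IsSurfaceChart.isSideFunction (h : IsSurfaceChart oM oF ι e κ) :
    IsSideFunction oM oF ι (sideFun e κ) e.target := by
  have key : ∀ (c : ℝ → M) (t : ℝ), IsCrossing oM oF ι c 1 t → c t ∈ e.target →
      ∃ d > 0, HasDerivAt (fun s => κ * (e.symm (c s)).2) d t ∧ κ * (e.symm (c t)).2 = 0 := by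
    intro c t hc ht
    obtain ⟨q', hq'⟩ := IsParam.hasDerivAt_symm h.smooth_symm hc.mdifferentiableAt ht
    have hct : ContinuousAt c t := hc.mdifferentiableAt.continuousAt
    have h1 := (h.crossing_iff c t (fun s => e.symm (c s)) q' (by
      filter_upwards [hct.eventually (e.open_target.mem_nhds ht)] with s hs using
        (e.right_inv hs).symm) hq' (e.map_target ht) 1).1 hc
    have h2 : HasDerivAt (fun s => (e.symm (c s)).2) q'.2 t :=
      HasFDerivAt.comp_hasDerivAt t (f := fun s => e.symm (c s)) (hasFDerivAt_snd (p := e.symm (c t))) hq'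
    refine ⟨κ * q'.2, by simpa using h1.2, h2.const_mul κ, ?_⟩
    have h3 := h1.1
    change κ * (e.symm (c t)).2 = 0
    rw [show (e.symm (c t)).2 = 0 from h3, mul_zero]
  refine ⟨e.open_target, fun z hz hzS => ?_, fun c t hc ht => ?_, fun c t hc ht => ?_⟩
  · have h0 : (e.symm z).2 ≠ 0 := by
      rw [← e.right_inv hz, h.mem_range_iff _ (e.map_target hz)] at hzS
      exact hzS
    have hκ : κ ≠ 0 := by rcases h.sign with h | h <;> rw [h] <;> norm_num
    have hc : ContinuousAt (fun z' => κ * (e.symm z').2) z :=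
      continuousAt_const.mul (e.symm.continuousAt hz).snd
    rcases lt_or_gt_of_ne (mul_ne_zero hκ h0) with h1 | h1
    · filter_upwards [hc.eventually (gt_mem_nhds h1)] with z' hz'
      rw [sideFun, sideFun, if_neg hz'.not_gt, if_neg h1.not_gt]
    · filter_upwards [hc.eventually (lt_mem_nhds h1)] with z' hz'
      rw [sideFun, sideFun, if_pos hz', if_pos h1]
  · obtain ⟨d, hd, hder, h0⟩ := key c t hc ht
    have := hder.tendsto_slope.eventually (lt_mem_nhds hd)
    have h2 := this.filter_mono (nhdsWithin_mono t (show Ioi t ⊆ {t}ᶜ from fun x hx => (ne_of_gt hx)))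
    filter_upwards [h2, self_mem_nhdsWithin] with s hs hst
    rw [slope_def_field, h0, sub_zero] at hs
    rw [sideFun, if_pos]
    by_contra hcon
    exact absurd hs (div_nonpos_of_nonpos_of_nonneg (not_lt.1 hcon) (sub_nonneg.2 (le_of_lt hst))).not_gt
  · obtain ⟨d, hd, hder, h0⟩ := key c t hc ht
    have := hder.tendsto_slope.eventually (lt_mem_nhds hd)
    have h2 := this.filter_mono (nhdsWithin_mono t (show Iio t ⊆ {t}ᶜ from fun x hx => (ne_of_lt hx)))
    filter_upwards [h2, self_mem_nhdsWithin] with s hs hst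
    rw [slope_def_field, h0, sub_zero] at hs
    rw [sideFun, if_neg]
    intro hcon
    exact absurd hs (div_nonpos_of_nonneg_of_nonpos hcon.le (sub_nonpos.2 (le_of_lt hst))).not_gt

/-- Away from the surface the conditions on a surface chart hold vacuously, once its source avoids
the plane where the last coordinate is zero. Shrinking to a ball makes the source convex, so that
straight segments stay inside. -/
lemma exists_surfaceBox [CompactSpace F] [T2Space M] {m : ℕ} {L : OrientedLink M m}
    (oM : ManifoldOrientation (𝓡 3) M 3) (hS : IsSeifertSurface L oF ι) {x : M}
    (hx : x ∉ L.carrier) {O : Set M} (hO : O ∈ 𝓝 x) :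
    ∃ (e : OpenPartialHomeomorph (EuclideanSpace ℝ (Fin 2) × ℝ) M) (κ : ℝ)
      (q₀ : EuclideanSpace ℝ (Fin 2) × ℝ) (ρ : ℝ), IsSurfaceChart oM oF ι e κ ∧ e q₀ = x ∧ 0 < ρ ∧
      e.source = Metric.ball q₀ ρ ∧ e.target ⊆ O := by
  have hcl : IsClosed (range ι) := (isCompact_range hS.smooth.continuous).isClosed
  have key : ∃ (e : OpenPartialHomeomorph (EuclideanSpace ℝ (Fin 2) × ℝ) M) (κ : ℝ)
      (q₀ : EuclideanSpace ℝ (Fin 2) × ℝ), IsSurfaceChart oM oF ι e κ ∧ e q₀ = x ∧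
      q₀ ∈ e.source := by
    by_cases hxS : x ∈ range ι
    · obtain ⟨y₀, rfl⟩ := hxS
      have hy₀ : (𝓡∂ 2).IsInteriorPoint y₀ := by
        rw [ModelWithCorners.isInteriorPoint_iff_not_isBoundaryPoint]
        intro hb
        exact hx (hS.boundary.subset ⟨y₀, hb, rfl⟩)
      obtain ⟨e, κ, u₀, h1, h2, h3⟩ := exists_isSurfaceChart oM hS hy₀
      exact ⟨e, κ, _, h1, h3, h2⟩
    · let A : (EuclideanSpace ℝ (Fin 2) × ℝ) ≃L[ℝ] EuclideanSpace ℝ (Fin 3) :=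
        ContinuousLinearEquiv.ofFinrankEq (by simp)
      -- The centre is placed at height one, so that the points near it have nonzero last
      -- coordinate.
      let q₀ : EuclideanSpace ℝ (Fin 2) × ℝ := (0, 1)
      let g : EuclideanSpace ℝ (Fin 2) × ℝ → EuclideanSpace ℝ (Fin 3) :=
        fun q => A (q - q₀) + extChartAt (𝓡 3) x x
      have hg0 : g q₀ = extChartAt (𝓡 3) x x := by simp [g]
      have hgd : ContDiff ℝ ∞ g :=
        (A.contDiff.comp (contDiff_id.sub contDiff_const)).add contDiff_const
      have hgf : ∀ q, HasFDerivAt g (A : _ →L[ℝ] _) q := by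
        intro q
        have h1 : HasFDerivAt (fun q => q - q₀) (ContinuousLinearMap.id ℝ _) q :=
          (hasFDerivAt_id q).sub_const q₀
        have h2 := (A.hasFDerivAt (x := q - q₀)).comp q h1
        exact h2.add_const _
      let V := {q : EuclideanSpace ℝ (Fin 2) × ℝ | 0 < q.2} ∩ g ⁻¹' (extChartAt (𝓡 3) x).target
      have hV : IsOpen V := (isOpen_lt continuous_const continuous_snd).inter
        ((isOpen_extChartAt_target x).preimage hgd.continuous)
      have hp : IsParam ((extChartAt (𝓡 3) x).symm ∘ g) V :=
        (IsParam.isParam_extChartAt_symm x).comp hV hgd.contDiffOn (fun q hq => hq.2)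
          (fun q hq => by rw [(hgf q).fderiv]; exact A.bijective)
      have hθ0 : ((extChartAt (𝓡 3) x).symm ∘ g) q₀ = x := by
        simp only [Function.comp, hg0, extChartAt_to_inv]
      have hp' := hp.mono (V := V ∩ ((extChartAt (𝓡 3) x).symm ∘ g) ⁻¹' (range ι)ᶜ)
        (hp.smooth.continuousOn.isOpen_inter_preimage hV hcl.isOpen_compl) inter_subset_left
      have hq₀ : q₀ ∈ V ∩ ((extChartAt (𝓡 3) x).symm ∘ g) ⁻¹' (range ι)ᶜ := by
        refine ⟨⟨by simp [q₀], ?_⟩, ?_⟩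
        · rw [mem_preimage, hg0]; exact mem_extChartAt_target x
        · rw [mem_preimage, hθ0]; exact hxS
      obtain ⟨e, h1, h2, h3, h4⟩ := hp'.exists_homeo hq₀
      have hpos : ∀ q ∈ e.source, 0 < q.2 := fun q hq => (h2 hq).1.1
      have hnot : ∀ q ∈ e.source, e q ∉ range ι := by
        intro q hq
        have := (h2 hq).2
        rw [mem_preimage, ← h3 hq] at this
        exact this
      refine ⟨e, 1, q₀, ⟨Or.inl rfl, (hp'.mono e.open_source h2).congr h3, h4, ?_, ?_, ?_⟩, ?_, h1⟩
      · exact fun q hq => ⟨fun h => absurd h (hnot q hq), fun h => absurd h (hpos q hq).ne'⟩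
      · intro γ t q q' hγ hq hqs ε
        refine ⟨fun h => ?_, fun h => absurd h.1 (hpos _ hqs).ne'⟩
        have := h.mem_range
        rw [hγ.self_of_nhds] at this
        exact absurd this (hnot _ hqs)
      · intro γ t q q' hγ hq hqs _ y hy
        rw [hγ.self_of_nhds] at hy
        exact absurd ⟨y, hy⟩ (hnot _ hqs)
      · rw [h3 h1, hθ0]
  obtain ⟨e, κ, q₀, h1, h2, h3⟩ := key
  have hnhds : e.source ∩ e ⁻¹' O ∈ 𝓝 q₀ :=
    inter_mem (e.open_source.mem_nhds h3) ((e.continuousAt h3).preimage_mem_nhds (by rwa [h2]))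
  obtain ⟨ρ, hρ, hb⟩ := Metric.mem_nhds_iff.1 hnhds
  refine ⟨e.restrOpen (Metric.ball q₀ ρ) Metric.isOpen_ball, κ, q₀, ρ, h1.restr Metric.isOpen_ball, h2, hρ, ?_, ?_⟩
  · rw [e.restrOpen_source]
    exact inter_eq_right.2 (hb.trans inter_subset_left)
  · intro z hz
    have h5 := (e.restrOpen _ (Metric.isOpen_ball (x := q₀) (ε := ρ))).map_target hz
    have h6 := (e.restrOpen _ (Metric.isOpen_ball (x := q₀) (ε := ρ))).right_inv hz
    rw [e.restrOpen_source] at h5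
    rw [← h6]
    exact (hb h5.2).2

lemma eqOn_const_of_eventually_eq {Y : Type*} [TopologicalSpace Y] {T : Set Y} (hT : IsPreconnected T)
    {f : Y → ℤ} (hf : ∀ z ∈ T, ∀ᶠ z' in 𝓝 z, f z' = f z) {a b : Y} (ha : a ∈ T) (hb : b ∈ T) :
    f a = f b := by
  refine hT.constant (f := f) (fun z hz => ?_) ha hb
  exact (ContinuousAt.congr (f := fun _ => f z) continuousAt_const
    ((hf z hz).mono fun z' h => h.symm)).continuousWithinAt

/-- A side function in a box foliated by curves, one of which crosses the surface positively. -/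
lemma IsSideFunction.eventually_of_box {f : M → ℤ} {W : Set M} (hf : IsSideFunction oM oF ι f W)
    {Y : Type*} [NormedAddCommGroup Y] [NormedSpace ℝ Y] {Ψ : Y × ℝ → M} {u₀ : Y}
    (hc : ∀ᶠ q in 𝓝 (u₀, (0 : ℝ)), ContinuousAt Ψ q) (hW : Ψ (u₀, 0) ∈ W)
    (hS : ∀ᶠ q in 𝓝 (u₀, (0 : ℝ)), Ψ q ∈ range ι → q.2 = 0)
    (hcr : IsCrossing oM oF ι (fun s => Ψ (u₀, s)) 1 0) :
    ∀ᶠ q in 𝓝 (u₀, (0 : ℝ)), (0 < q.2 → f (Ψ q) = 1) ∧ (q.2 < 0 → f (Ψ q) = 0) := by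
  have hW' : ∀ᶠ q in 𝓝 (u₀, (0 : ℝ)), Ψ q ∈ W :=
    hc.self_of_nhds.eventually (hf.isOpen.mem_nhds hW)
  obtain ⟨ρ, hρ, hb⟩ := Metric.eventually_nhds_iff_ball.1 ((hc.and hS).and hW')
  have hbc : Convex ℝ (Metric.ball (u₀, (0 : ℝ)) ρ) := convex_ball _ _
  have hmem : ∀ s : ℝ, |s| < ρ → (u₀, s) ∈ Metric.ball (u₀, (0 : ℝ)) ρ := by
    intro s hs
    rw [Metric.mem_ball, Prod.dist_eq]
    simp only [dist_self, Real.dist_eq, sub_zero]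
    exact max_lt hρ hs
  have hloc : ∀ q ∈ Metric.ball (u₀, (0 : ℝ)) ρ, q.2 ≠ 0 → ∀ᶠ q' in 𝓝 q, f (Ψ q') = f (Ψ q) := by
    intro q hq hq2
    obtain ⟨⟨h1, h2⟩, h3⟩ := hb q hq
    exact h1.eventually (hf.eventually_eq _ h3 fun h => hq2 (h2 h))
  -- Each open half of the box is connected and off the surface, so `f ∘ Ψ` is constant on it. The
  -- value is read off on the central curve.
  have hhalf1 : Convex ℝ (Metric.ball (u₀, (0 : ℝ)) ρ ∩ {q | 0 < q.2}) :=
    hbc.inter (convex_halfSpace_gt (LinearMap.snd ℝ Y ℝ).isLinear 0)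
  have hhalf2 : Convex ℝ (Metric.ball (u₀, (0 : ℝ)) ρ ∩ {q | q.2 < 0}) :=
    hbc.inter (convex_halfSpace_lt (LinearMap.snd ℝ Y ℝ).isLinear 0)
  have h1 : ∃ s : ℝ, 0 < s ∧ s < ρ ∧ f (Ψ (u₀, s)) = 1 := by
    have h1 := hf.after _ _ hcr hW
    have h2 : ∀ᶠ s in 𝓝[>] (0 : ℝ), s < ρ := nhdsWithin_le_nhds (gt_mem_nhds hρ)
    obtain ⟨s, h3, h4, h5⟩ := (h1.and (h2.and self_mem_nhdsWithin)).exists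
    exact ⟨s, h5, h4, h3⟩
  have h2 : ∃ s : ℝ, s < 0 ∧ -ρ < s ∧ f (Ψ (u₀, s)) = 0 := by
    have h1 := hf.before _ _ hcr hW
    have h2 : ∀ᶠ s in 𝓝[<] (0 : ℝ), -ρ < s := nhdsWithin_le_nhds (lt_mem_nhds (by linarith))
    obtain ⟨s, h3, h4, h5⟩ := (h1.and (h2.and self_mem_nhdsWithin)).exists
    exact ⟨s, h5, h4, h3⟩
  obtain ⟨s₁, hs1, hs1', hf1⟩ := h1
  obtain ⟨s₂, hs2, hs2', hf2⟩ := h2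
  filter_upwards [Metric.ball_mem_nhds (u₀, (0 : ℝ)) hρ] with q hq
  constructor
  · intro hq2
    rw [← hf1]
    exact eqOn_const_of_eventually_eq (f := f ∘ Ψ) hhalf1.isPreconnected
      (fun z hz => hloc z hz.1 (ne_of_gt hz.2)) ⟨hq, hq2⟩ ⟨hmem s₁ (by rw [abs_lt]; constructor <;> linarith), hs1⟩
  · intro hq2
    rw [← hf2]
    exact eqOn_const_of_eventually_eq (f := f ∘ Ψ) hhalf2.isPreconnected
      (fun z hz => hloc z hz.1 (ne_of_lt hz.2)) ⟨hq, hq2⟩ ⟨hmem s₂ (by rw [abs_lt]; constructor <;> linarith), hs2⟩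

/-- The vertical lines of the chart, run upwards or downwards according to `κ`, cross the surface
positively, so a side function is determined near a point of the surface by its values along them.
-/
lemma IsSideFunction.eventually_eq_sideFun {f : M → ℤ} {W : Set M} (hf : IsSideFunction oM oF ι f W)
    (h : IsSurfaceChart oM oF ι e κ) {q₀ : EuclideanSpace ℝ (Fin 2) × ℝ} (hq₀ : q₀ ∈ e.source)
    (h0 : q₀.2 = 0) (hW : e q₀ ∈ W) :
    ∀ᶠ z in 𝓝 (e q₀), z ∉ range ι → f z = sideFun e κ z := by
  have hκ : κ * κ = 1 := by rcases h.sign with h | h <;> rw [h] <;> norm_num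
  obtain ⟨u₀, s₀⟩ := q₀
  simp only at h0
  subst h0
  -- The involution reversing the last coordinate when `κ = -1`; after it the lines in the direction
  -- of increasing last coordinate are positive crossings.
  let r : EuclideanSpace ℝ (Fin 2) × ℝ → EuclideanSpace ℝ (Fin 2) × ℝ := fun q => (q.1, κ * q.2)
  have hr : Continuous r := by fun_prop
  have hrr : ∀ q, r (r q) = q := fun q => by
    refine Prod.ext rfl ?_
    simp only [r, ← mul_assoc, hκ, one_mul]
  have hr0 : r (u₀, 0) = (u₀, 0) := by simp [r]
  have hrt : Tendsto r (𝓝 (u₀, (0 : ℝ))) (𝓝 (u₀, (0 : ℝ))) := by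
    have := hr.tendsto (u₀, (0 : ℝ))
    rwa [hr0] at this
  have hsrc : ∀ᶠ q in 𝓝 (u₀, (0 : ℝ)), r q ∈ e.source := hrt.eventually (e.open_source.mem_nhds hq₀)
  have hcr : IsCrossing oM oF ι (fun s => (e ∘ r) (u₀, s)) 1 0 := by
    refine (h.crossing_iff _ 0 (fun s => r (u₀, s)) (0, κ) (Eventually.of_forall fun s => rfl) ?_
      (by rw [hr0]; exact hq₀) 1).2 ⟨by simp [r], by simp [hκ]⟩
    refine HasDerivAt.prodMk (hasDerivAt_const _ _) ?_
    simpa using (hasDerivAt_id (0 : ℝ)).const_mul κ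
  have := hf.eventually_of_box (Ψ := e ∘ r) (u₀ := u₀)
    (hsrc.mono fun q hq => (e.continuousAt hq).comp hr.continuousAt)
    (by simp only [Function.comp, hr0]; exact hW)
    (hsrc.mono fun q hq hq2 => by
      have h1 := (h.mem_range_iff _ hq).1 hq2
      have h2 : κ * (κ * q.2) = κ * 0 := congrArg (κ * ·) h1
      rwa [← mul_assoc, hκ, one_mul, mul_zero] at h2) hcr
  have h3 : Tendsto (fun z => r (e.symm z)) (𝓝 (e (u₀, 0))) (𝓝 (u₀, (0 : ℝ))) := by
    have h4 := (e.symm.continuousAt (e.map_source hq₀)).tendsto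
    rw [e.left_inv hq₀] at h4
    exact hrt.comp h4
  filter_upwards [h3.eventually this, e.open_target.mem_nhds (e.map_source hq₀)] with z hz hzt hzS
  have h5 : (e ∘ r) (r (e.symm z)) = z := by
    simp only [Function.comp, hrr, e.right_inv hzt]
  rw [h5] at hz
  have hne : (e.symm z).2 ≠ 0 := by
    rw [← e.right_inv hzt, h.mem_range_iff _ (e.map_target hzt)] at hzS
    exact hzS
  have hκ0 : κ ≠ 0 := fun h => by rw [h] at hκ; norm_num at hκ
  rw [sideFun]
  split_ifs with hs
  · exact hz.1 hs
  · exact hz.2 (lt_of_le_of_ne (not_lt.1 hs) (mul_ne_zero hκ0 hne))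

/-- Two side functions differ by a constant near a point off the link. -/
lemma IsSideFunction.exists_sub_eq [CompactSpace F] [T2Space M] {m : ℕ} {L : OrientedLink M m}
    (hS : IsSeifertSurface L oF ι) {x : M} (hx : x ∉ L.carrier) {f f' : M → ℤ} {W W' : Set M}
    (hf : IsSideFunction oM oF ι f W) (hf' : IsSideFunction oM oF ι f' W') (hxW : x ∈ W)
    (hxW' : x ∈ W') : ∃ k : ℤ, ∀ᶠ z in 𝓝 x, z ∉ range ι → f z - f' z = k := by
  by_cases hxS : x ∈ range ι
  · obtain ⟨e, κ, q₀, ρ, h1, rfl, h3, h4, -⟩ := exists_surfaceBox oM hS hx univ_mem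
    have hq₀ : q₀ ∈ e.source := h4 ▸ Metric.mem_ball_self h3
    have h0 := (h1.mem_range_iff _ hq₀).1 hxS
    -- At a point of the surface both functions are the indicator of the positive side.
    refine ⟨0, ?_⟩
    filter_upwards [hf.eventually_eq_sideFun h1 hq₀ h0 hxW,
      hf'.eventually_eq_sideFun h1 hq₀ h0 hxW'] with z hz hz' hzS
    rw [hz hzS, hz' hzS, sub_self]
  · refine ⟨f x - f' x, ?_⟩
    filter_upwards [hf.eventually_eq x hxW hxS, hf'.eventually_eq x hxW' hxS] with z hz hz' _
    rw [hz, hz']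

end SideFunction

/-! ## Paths transverse to a surface -/

section TransversePath

open Set Filter

/-- With `f = expNegInvGlue` one has `f' = x⁻² f`, and the numerator of the derivative of the
quotient is `f(x) f(1 - x) (x⁻² + (1 - x)⁻²)`. -/
lemma Real.smoothTransition_deriv_pos {x : ℝ} (h0 : 0 < x) (h1 : x < 1) :
    0 < deriv Real.smoothTransition x := by
  have hg : ∀ x : ℝ, HasDerivAt expNegInvGlue (x⁻¹ ^ 2 * expNegInvGlue x) x := by
    intro x
    have := expNegInvGlue.hasDerivAt_polynomial_eval_inv_mul 1 x
    simpa using this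
  have hg1 : HasDerivAt (fun x => expNegInvGlue (1 - x))
      (-((1 - x)⁻¹ ^ 2 * expNegInvGlue (1 - x))) x := by
    have := (hg (1 - x)).comp x ((hasDerivAt_id x).const_sub 1)
    simpa [Function.comp_def] using this
  have h2 := (hg x).div ((hg x).add hg1) (Real.smoothTransition.pos_denom x).ne'
  have h3 : HasDerivAt Real.smoothTransition _ x := h2
  rw [h3.deriv]
  have a0 := expNegInvGlue.pos_of_pos h0
  have b0 : 0 < expNegInvGlue (1 - x) := expNegInvGlue.pos_of_pos (by linarith)
  have c0 : 0 < x⁻¹ ^ 2 := by positivity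
  have d0 : 0 < (1 - x)⁻¹ ^ 2 := by
    have : 0 < 1 - x := by linarith
    positivity
  simp only [Pi.add_apply]
  apply div_pos _ (by positivity)
  have : 0 < expNegInvGlue x * expNegInvGlue (1 - x) * (x⁻¹ ^ 2 + (1 - x)⁻¹ ^ 2) := by positivity
  nlinarith [this]

/-- A smooth step function with positive slope between its constant parts. -/
lemma exists_smooth_step : ∃ σ : ℝ → ℝ, ContDiff ℝ ∞ σ ∧ (∀ t ≤ 1 / 4, σ t = 0) ∧
    (∀ t ≥ 3 / 4, σ t = 1) ∧ (∀ t, σ t ∈ Icc (0 : ℝ) 1) ∧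
    ∀ c ∈ Ioo (0 : ℝ) 1, ∃ t ∈ Ioo (0 : ℝ) 1, 0 < deriv σ t ∧ ∀ t', σ t' = c ↔ t' = t := by
  -- The affine substitution leaves room for constant pieces at both ends, which make concatenations
  -- and closed loops smooth.
  let σ : ℝ → ℝ := fun t => Real.smoothTransition (2 * t - 1 / 2)
  have hσ : ContDiff ℝ ∞ σ := Real.smoothTransition.contDiff.comp (by fun_prop)
  have hd : ∀ t, 1 / 4 < t → t < 3 / 4 → 0 < deriv σ t := by
    intro t h1 h2
    have h3 : HasDerivAt (fun t : ℝ => 2 * t - 1 / 2) 2 t := by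
      simpa using ((hasDerivAt_id t).const_mul 2).sub_const (1 / 2)
    have h4 : DifferentiableAt ℝ Real.smoothTransition (2 * t - 1 / 2) :=
      (Real.smoothTransition.contDiffAt (n := 1)).differentiableAt (by simp)
    have h5 : HasDerivAt σ (deriv Real.smoothTransition (2 * t - 1 / 2) * 2) t :=
      HasDerivAt.comp (h₂ := Real.smoothTransition) (h := fun t => 2 * t - 1 / 2) t h4.hasDerivAt h3
    rw [h5.deriv]
    have := Real.smoothTransition_deriv_pos (x := 2 * t - 1 / 2) (by linarith) (by linarith)
    positivity
  have hmono : StrictMonoOn σ (Icc (1 / 4) (3 / 4)) := by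
    refine strictMonoOn_of_deriv_pos (convex_Icc _ _) hσ.continuous.continuousOn fun t ht => ?_
    rw [interior_Icc] at ht
    exact hd t ht.1 ht.2
  have h0 : ∀ t ≤ 1 / 4, σ t = 0 := fun t ht => Real.smoothTransition.zero_of_nonpos (by linarith)
  have h1 : ∀ t ≥ 3 / 4, σ t = 1 := fun t ht => Real.smoothTransition.one_of_one_le (by linarith)
  refine ⟨σ, hσ, h0, h1, fun t => ⟨Real.smoothTransition.nonneg _, Real.smoothTransition.le_one _⟩, ?_⟩
  intro c hc
  have hivt := intermediate_value_Icc (show (1 / 4 : ℝ) ≤ 3 / 4 by norm_num) hσ.continuous.continuousOn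
  rw [h0 _ le_rfl, h1 _ le_rfl] at hivt
  obtain ⟨t, ht, rfl⟩ := hivt ⟨hc.1.le, hc.2.le⟩
  have ht1 : 1 / 4 < t := by
    by_contra hcon
    have := hc.1
    rw [h0 t (not_lt.1 hcon)] at this
    exact lt_irrefl _ this
  have ht2 : t < 3 / 4 := by
    by_contra hcon
    have := hc.2
    rw [h1 t (not_lt.1 hcon)] at this
    exact lt_irrefl _ this
  refine ⟨t, ⟨by linarith, by linarith⟩, hd t ht1 ht2, fun t' => ⟨fun h => ?_, fun h => by rw [h]⟩⟩
  have ht1' : 1 / 4 < t' := by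
    by_contra hcon
    rw [← h, h0 t' (not_lt.1 hcon)] at hc
    exact lt_irrefl _ hc.1
  have ht2' : t' < 3 / 4 := by
    by_contra hcon
    rw [← h, h1 t' (not_lt.1 hcon)] at hc
    exact lt_irrefl _ hc.2
  exact hmono.injOn ⟨ht1'.le, ht2'.le⟩ ht h

variable {M : Type*} [TopologicalSpace M] [ChartedSpace (EuclideanSpace ℝ (Fin 3)) M]
  {F : Type*} [TopologicalSpace F] [ChartedSpace (EuclideanHalfSpace 2) F]

/-- The velocity of a curve. -/
def velocity (γ : ℝ → M) (t : ℝ) : EuclideanSpace ℝ (Fin 3) := mfderiv 𝓘(ℝ, ℝ) (𝓡 3) γ t (1 : ℝ)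

lemma velocity_comp_affine {γ : ℝ → M} (hγ : MDifferentiable 𝓘(ℝ, ℝ) (𝓡 3) γ) (a b t : ℝ) :
    velocity (fun s => γ (a * s + b)) t = a • velocity γ (a * t + b) := by
  have h1 : HasDerivAt (fun s : ℝ => a * s + b) a t := by
    simpa using ((hasDerivAt_id t).const_mul a).add_const b
  have h2 := mfderiv_comp t (hγ (a * t + b)) h1.differentiableAt.mdifferentiableAt
  have h3 : (mfderiv 𝓘(ℝ, ℝ) 𝓘(ℝ, ℝ) (fun s : ℝ => a * s + b) t (1 : ℝ) : ℝ) = a • (1 : ℝ) := by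
    rw [mfderiv_eq_fderiv, smul_eq_mul, mul_one]
    exact h1.deriv
  have h4 := congrArg (fun L : ℝ →L[ℝ] EuclideanSpace ℝ (Fin 3) => L 1) h2
  refine h4.trans ?_
  change mfderiv 𝓘(ℝ, ℝ) (𝓡 3) γ (a * t + b)
    (mfderiv 𝓘(ℝ, ℝ) 𝓘(ℝ, ℝ) (fun s : ℝ => a * s + b) t (1 : ℝ)) = _
  rw [h3]
  exact (mfderiv 𝓘(ℝ, ℝ) (𝓡 3) γ (a * t + b)).map_smul a (1 : ℝ)

lemma velocity_congr {γ γ' : ℝ → M} {t : ℝ} (h : γ =ᶠ[𝓝 t] γ') : velocity γ t = velocity γ' t := by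
  rw [velocity, h.mfderiv_eq]
  rfl

/-- The curve is transverse to the surface at time `t`. -/
def TransverseAt (ι : F → M) (γ : ℝ → M) (t : ℝ) : Prop :=
  ∀ y : F, ι y = γ t → ∀ τ : TangentSpace (𝓡∂ 2) y,
    (mfderiv (𝓡∂ 2) (𝓡 3) ι y τ : EuclideanSpace ℝ (Fin 3)) ≠ velocity γ t

lemma TransverseAt.of_velocity {ι : F → M} {γ γ' : ℝ → M} {t t' c : ℝ} (h : TransverseAt ι γ t)
    (hc : c ≠ 0) (h0 : γ' t' = γ t) (h1 : velocity γ' t' = c • velocity γ t) :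
    TransverseAt ι γ' t' := by
  intro y hy τ hτ
  refine h y (hy.trans h0) (c⁻¹ • τ) ?_
  have h2 : (mfderiv (𝓡∂ 2) (𝓡 3) ι y (c⁻¹ • τ) : EuclideanSpace ℝ (Fin 3)) =
      c⁻¹ • (mfderiv (𝓡∂ 2) (𝓡 3) ι y τ : EuclideanSpace ℝ (Fin 3)) :=
    (mfderiv (𝓡∂ 2) (𝓡 3) ι y).map_smul c⁻¹ τ
  rw [h2, hτ, h1]
  exact inv_smul_smul₀ hc _

lemma TransverseAt.of_not_mem {ι : F → M} {γ : ℝ → M} {t : ℝ} (h : γ t ∉ range ι) :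
    TransverseAt ι γ t := fun y hy => absurd ⟨y, hy⟩ h

/-- Run through two paths one after the other. -/
def pathConcat {Z : Type*} (γ₁ γ₂ : ℝ → Z) (t : ℝ) : Z :=
  -- Both branches have the shape `a * s + b` required by `velocity_comp_affine`.
  if t ≤ 1 / 2 then γ₁ (2 * t + 0) else γ₂ (2 * t + -1)

lemma pathConcat_left {Z : Type*} (γ₁ γ₂ : ℝ → Z) {t : ℝ} (ht : t < 1 / 2) :
    pathConcat γ₁ γ₂ =ᶠ[𝓝 t] fun s => γ₁ (2 * s + 0) := by
  filter_upwards [gt_mem_nhds ht] with s hs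
  rw [pathConcat, if_pos hs.le]

lemma pathConcat_right {Z : Type*} (γ₁ γ₂ : ℝ → Z) {t : ℝ} (ht : 1 / 2 < t) :
    pathConcat γ₁ γ₂ =ᶠ[𝓝 t] fun s => γ₂ (2 * s + -1) := by
  filter_upwards [lt_mem_nhds ht] with s hs
  rw [pathConcat, if_neg hs.not_ge]

lemma pathConcat_mid {Z : Type*} {γ₁ γ₂ : ℝ → Z} {b : Z} (h₁ : ∃ ε > 0, ∀ t ≥ 1 - ε, γ₁ t = b)
    (h₂ : ∃ ε > 0, ∀ t ≤ ε, γ₂ t = b) : pathConcat γ₁ γ₂ =ᶠ[𝓝 (1 / 2)] fun _ => b := by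
  obtain ⟨ε₁, h1, h1'⟩ := h₁
  obtain ⟨ε₂, h2, h2'⟩ := h₂
  filter_upwards [lt_mem_nhds (show 1 / 2 - ε₁ / 2 < 1 / 2 by linarith),
    gt_mem_nhds (show 1 / 2 < 1 / 2 + ε₂ / 2 by linarith)] with s hs hs'
  rw [pathConcat]
  split_ifs with h
  · exact h1' _ (by linarith)
  · exact h2' _ (by linarith)

lemma comp_pathConcat {Z Z' : Type*} (p : Z → Z') (γ₁ γ₂ : ℝ → Z) :
    p ∘ pathConcat γ₁ γ₂ = pathConcat (p ∘ γ₁) (p ∘ γ₂) := by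
  funext t
  simp only [Function.comp, pathConcat]
  split_ifs <;> rfl

lemma pathConcat_start {Z : Type*} {γ₁ γ₂ : ℝ → Z} {a : Z} (h : ∃ ε > 0, ∀ t ≤ ε, γ₁ t = a) :
    ∃ ε > 0, ∀ t ≤ ε, pathConcat γ₁ γ₂ t = a := by
  obtain ⟨ε, h1, h2⟩ := h
  refine ⟨min (ε / 2) (1 / 2), by positivity, fun t ht => ?_⟩
  have h3 := ht.trans (min_le_left _ _)
  rw [pathConcat, if_pos (ht.trans (min_le_right _ _)), h2 _ (by linarith)]

lemma pathConcat_finish {Z : Type*} {γ₁ γ₂ : ℝ → Z} {b : Z} (h : ∃ ε > 0, ∀ t ≥ 1 - ε, γ₂ t = b) :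
    ∃ ε > 0, ∀ t ≥ 1 - ε, pathConcat γ₁ γ₂ t = b := by
  obtain ⟨ε, h1, h2⟩ := h
  refine ⟨min (ε / 2) (1 / 4), by positivity, fun t ht => ?_⟩
  have h3 := min_le_left (ε / 2) (1 / 4)
  have h4 := min_le_right (ε / 2) (1 / 4)
  rw [pathConcat, if_neg (by linarith), h2 _ (by linarith)]

variable [IsManifold (𝓡 3) ∞ M] [IsManifold (𝓡∂ 2) ∞ F]

/-- `γ` is a smooth path from `a` to `b`, constant near its ends, that avoids `K` and is transverse to
the surface. -/
structure IsTransversePath (oM : ManifoldOrientation (𝓡 3) M 3)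
    (oF : ManifoldOrientation (𝓡∂ 2) F 2) (ι : F → M) (K : Set M) (γ : ℝ → M) (a b : M) : Prop where
  smooth : ContMDiff 𝓘(ℝ, ℝ) (𝓡 3) ∞ γ
  avoids : ∀ t, γ t ∉ K
  transverse : ∀ t, TransverseAt ι γ t
  start : ∃ ε > 0, ∀ t ≤ ε, γ t = a
  finish : ∃ ε > 0, ∀ t ≥ 1 - ε, γ t = b
  finite : ∀ ε, {t | t ∈ Ico (0 : ℝ) 1 ∧ IsCrossing oM oF ι γ ε t}.Finite

variable {oM : ManifoldOrientation (𝓡 3) M 3} {oF : ManifoldOrientation (𝓡∂ 2) F 2} {ι : F → M}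
  {e : OpenPartialHomeomorph (EuclideanSpace ℝ (Fin 2) × ℝ) M} {κ : ℝ} {K : Set M}

lemma ManifoldOrientation.IsPos.smul_first {x : M} {v : Fin 3 → TangentSpace (𝓡 3) x}
    (h : oM.IsPos x v) {c : ℝ} (hc : 0 < c) : oM.IsPos x (Function.update v 0 (c • v 0)) := by
  obtain ⟨b, hb, ho⟩ := h
  have hv : v = b := funext fun i => (hb i).symm
  rw [oM.isPos_iff_det b ho, hv, b.det.map_update_smul, Function.update_eq_self, b.det_self]
  simpa using hc

lemma IsCrossing.of_velocity {γ γ' : ℝ → M} {t t' ε c : ℝ} (h : IsCrossing oM oF ι γ ε t) (hc : 0 < c)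
    (h0 : γ' t' = γ t) (h1 : velocity γ' t' = c • velocity γ t) : IsCrossing oM oF ι γ' ε t' := by
  obtain ⟨y, hy, v, hv, hp⟩ := h
  refine ⟨y, hy.trans h0.symm, v, hv, ?_⟩
  have h2 := hp.smul_first hc
  refine (iff_of_eq ?_).1 h2
  congr 1
  funext i
  fin_cases i
  · exact h1.symm
  · rfl
  · rfl

lemma isCrossing_iff_of_velocity {γ γ' : ℝ → M} {t t' ε c : ℝ} (hc : 0 < c)
    (h0 : γ' t' = γ t) (h1 : velocity γ' t' = c • velocity γ t) :
    IsCrossing oM oF ι γ' ε t' ↔ IsCrossing oM oF ι γ ε t :=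
  ⟨fun h => h.of_velocity (inv_pos.2 hc) h0.symm (by
    rw [h1, smul_smul, inv_mul_cancel₀ hc.ne', one_smul]), fun h => h.of_velocity hc h0 h1⟩

/-- The paths are constant near the junction, which keeps the concatenation smooth, and the junction
is off the surface, so no crossing is gained or lost there. Doubling the speed does not change the
sign of a crossing. -/
lemma IsTransversePath.concat {γ₁ γ₂ : ℝ → M} {a b c : M}
    (h₁ : IsTransversePath oM oF ι K γ₁ a b) (h₂ : IsTransversePath oM oF ι K γ₂ b c)
    (hb : b ∉ range ι) : IsTransversePath oM oF ι K (pathConcat γ₁ γ₂) a c ∧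
      intersectionNumber oM oF ι (pathConcat γ₁ γ₂) =
        intersectionNumber oM oF ι γ₁ + intersectionNumber oM oF ι γ₂ := by
  have hmid := pathConcat_mid h₁.finish h₂.start
  have hd₁ : MDifferentiable 𝓘(ℝ, ℝ) (𝓡 3) γ₁ := h₁.smooth.mdifferentiable (by simp)
  have hd₂ : MDifferentiable 𝓘(ℝ, ℝ) (𝓡 3) γ₂ := h₂.smooth.mdifferentiable (by simp)
  have aff : ∀ b : ℝ, ContMDiff 𝓘(ℝ, ℝ) 𝓘(ℝ, ℝ) ∞ fun s : ℝ => 2 * s + b := fun b => by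
    rw [contMDiff_iff_contDiff]; fun_prop
  have hmid' : pathConcat γ₁ γ₂ (1 / 2) = b := hmid.self_of_nhds
  have hv₁ : ∀ t, t < 1 / 2 → pathConcat γ₁ γ₂ t = γ₁ (2 * t + 0) ∧
      velocity (pathConcat γ₁ γ₂) t = (2 : ℝ) • velocity γ₁ (2 * t + 0) := fun t ht =>
    ⟨(pathConcat_left γ₁ γ₂ ht).self_of_nhds,
      (velocity_congr (pathConcat_left γ₁ γ₂ ht)).trans (velocity_comp_affine hd₁ 2 0 t)⟩
  have hv₂ : ∀ t, 1 / 2 < t → pathConcat γ₁ γ₂ t = γ₂ (2 * t + -1) ∧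
      velocity (pathConcat γ₁ γ₂) t = (2 : ℝ) • velocity γ₂ (2 * t + -1) := fun t ht =>
    ⟨(pathConcat_right γ₁ γ₂ ht).self_of_nhds,
      (velocity_congr (pathConcat_right γ₁ γ₂ ht)).trans (velocity_comp_affine hd₂ 2 (-1) t)⟩
  have hset : ∀ ε, {t | t ∈ Ico (0 : ℝ) 1 ∧ IsCrossing oM oF ι (pathConcat γ₁ γ₂) ε t} =
      (fun t => t / 2) '' {t | t ∈ Ico (0 : ℝ) 1 ∧ IsCrossing oM oF ι γ₁ ε t} ∪
      (fun t => (t + 1) / 2) '' {t | t ∈ Ico (0 : ℝ) 1 ∧ IsCrossing oM oF ι γ₂ ε t} := by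
    intro ε
    ext t
    constructor
    · rintro ⟨ht, hc⟩
      rcases lt_trichotomy t (1 / 2) with h | h | h
      · left
        exact ⟨2 * t + 0, ⟨⟨by linarith [ht.1], by linarith⟩,
          (isCrossing_iff_of_velocity two_pos (hv₁ t h).1 (hv₁ t h).2).1 hc⟩, by ring⟩
      · have := hc.mem_range
        rw [h, hmid'] at this
        exact absurd this hb
      · right
        exact ⟨2 * t + -1, ⟨⟨by linarith, by linarith [ht.2]⟩,
          (isCrossing_iff_of_velocity two_pos (hv₂ t h).1 (hv₂ t h).2).1 hc⟩, by ring⟩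
    · rintro (⟨s, ⟨hs, hc⟩, rfl⟩ | ⟨s, ⟨hs, hc⟩, rfl⟩)
      · have h : s / 2 < 1 / 2 := by linarith [hs.2]
        refine ⟨⟨by linarith [hs.1], by linarith⟩,
          (isCrossing_iff_of_velocity two_pos (hv₁ _ h).1 (hv₁ _ h).2).2 ?_⟩
        rwa [show 2 * (s / 2) + 0 = s by ring]
      · have hs0 : 0 < s := by
          rcases hs.1.lt_or_eq with h | h
          · exact h
          · have := hc.mem_range
            obtain ⟨ε, hε, h'⟩ := h₂.start
            rw [← h, h' 0 hε.le] at this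
            exact absurd this hb
        have h : 1 / 2 < (s + 1) / 2 := by linarith
        refine ⟨⟨by linarith, by linarith [hs.2]⟩,
          (isCrossing_iff_of_velocity two_pos (hv₂ _ h).1 (hv₂ _ h).2).2 ?_⟩
        rwa [show 2 * ((s + 1) / 2) + -1 = s by ring]
  refine ⟨⟨fun t => ?_, fun t => ?_, fun t => ?_, pathConcat_start h₁.start,
    pathConcat_finish h₂.finish, fun ε => ?_⟩, ?_⟩
  · rcases lt_trichotomy t (1 / 2) with h | h | h
    · exact ((h₁.smooth.comp (aff 0)).contMDiffAt).congr_of_eventuallyEq (pathConcat_left γ₁ γ₂ h)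
    · rw [h]
      exact contMDiffAt_const.congr_of_eventuallyEq hmid
    · exact ((h₂.smooth.comp (aff (-1))).contMDiffAt).congr_of_eventuallyEq (pathConcat_right γ₁ γ₂ h)
  · rw [pathConcat]
    split_ifs
    · exact h₁.avoids _
    · exact h₂.avoids _
  · rcases lt_trichotomy t (1 / 2) with h | h | h
    · exact (h₁.transverse (2 * t + 0)).of_velocity two_ne_zero (hv₁ t h).1 (hv₁ t h).2
    · exact TransverseAt.of_not_mem (by rw [h, hmid']; exact hb)
    · exact (h₂.transverse (2 * t + -1)).of_velocity two_ne_zero (hv₂ t h).1 (hv₂ t h).2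
  · rw [hset]
    exact ((h₁.finite ε).image _).union ((h₂.finite ε).image _)
  · have hinj₁ : Function.Injective fun t : ℝ => t / 2 := fun s t h => by
      have : s / 2 = t / 2 := h
      linarith
    have hinj₂ : Function.Injective fun t : ℝ => (t + 1) / 2 := fun s t h => by
      have : (s + 1) / 2 = (t + 1) / 2 := h
      linarith
    have hcard : ∀ ε, {t | t ∈ Ico (0 : ℝ) 1 ∧ IsCrossing oM oF ι (pathConcat γ₁ γ₂) ε t}.ncard =
        {t | t ∈ Ico (0 : ℝ) 1 ∧ IsCrossing oM oF ι γ₁ ε t}.ncard +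
        {t | t ∈ Ico (0 : ℝ) 1 ∧ IsCrossing oM oF ι γ₂ ε t}.ncard := by
      intro ε
      rw [hset, ncard_union_eq ?_ ((h₁.finite ε).image _) ((h₂.finite ε).image _),
        ncard_image_of_injective _ hinj₁, ncard_image_of_injective _ hinj₂]
      rw [disjoint_left]
      rintro _ ⟨s, ⟨hs, -⟩, rfl⟩ ⟨s', ⟨hs', -⟩, h⟩
      have h : (s' + 1) / 2 = s / 2 := h
      linarith [hs.2, hs'.1]
    simp only [intersectionNumber, hcard]
    push_cast
    ring

/-- Closing up a path, in the total space of `p`. -/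
lemma IsTransversePath.exists_loop {N : Type*} [TopologicalSpace N] {p : N → M} {δ : ℝ → N}
    (hδ : Continuous δ) {y : N} (hs : ∃ ε > 0, ∀ t ≤ ε, δ t = y) (hf : ∃ ε > 0, ∀ t ≥ 1 - ε, δ t = y)
    (h : IsTransversePath oM oF ι K (p ∘ δ) (p y) (p y)) :
    ∃ δ' : ℝ → N, Continuous δ' ∧ δ' 1 = δ' 0 ∧ ContMDiff 𝓘(ℝ, ℝ) (𝓡 3) ∞ (p ∘ δ') ∧
      Function.Periodic (p ∘ δ') 1 ∧ (∀ t, (p ∘ δ') t ∉ K) ∧ LoopTransverse ι (p ∘ δ') ∧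
      intersectionNumber oM oF ι (p ∘ δ') = intersectionNumber oM oF ι (p ∘ δ) := by
  obtain ⟨ε₁, h1, h1'⟩ := hs
  obtain ⟨ε₂, h2, h2'⟩ := hf
  -- The loop is the periodic extension of `δ`. Near an integer both one-sided pieces are constant
  -- with value `y`, so everywhere it agrees locally with a translate of `δ`.
  have hloc : ∀ t : ℝ, (fun s => δ (Int.fract s)) =ᶠ[𝓝 t] fun s => δ (1 * s + -(⌊t⌋ : ℝ)) := by
    intro t
    rcases (Int.floor_le t).lt_or_eq with h | h
    · filter_upwards [lt_mem_nhds h, gt_mem_nhds (Int.lt_floor_add_one t)] with s hs hs'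
      have : ⌊s⌋ = ⌊t⌋ := Int.floor_eq_iff.2 ⟨hs.le, hs'⟩
      rw [Int.fract, this, one_mul, sub_eq_add_neg]
    · filter_upwards [lt_mem_nhds (show t - 1 < t by linarith), lt_mem_nhds (show t - ε₂ < t by linarith),
        gt_mem_nhds (show t < t + 1 by linarith)] with s hs1 hs2 hs3
      rcases lt_or_ge s t with hst | hst
      · have : ⌊s⌋ = ⌊t⌋ - 1 := Int.floor_eq_iff.2 ⟨by push_cast; linarith, by push_cast; linarith⟩
        rw [Int.fract, this, h2' _ (by push_cast; linarith), h1' _ (by linarith)]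
      · have : ⌊s⌋ = ⌊t⌋ := Int.floor_eq_iff.2 ⟨by linarith, by linarith⟩
        rw [Int.fract, this, one_mul, sub_eq_add_neg]
  have hd : MDifferentiable 𝓘(ℝ, ℝ) (𝓡 3) (p ∘ δ) := h.smooth.mdifferentiable (by simp)
  have hploc : ∀ t : ℝ, (p ∘ fun s => δ (Int.fract s)) =ᶠ[𝓝 t]
      fun s => (p ∘ δ) (1 * s + -(⌊t⌋ : ℝ)) := fun t => (hloc t).fun_comp p
  have hvel : ∀ t : ℝ, velocity (p ∘ fun s => δ (Int.fract s)) t =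
      (1 : ℝ) • velocity (p ∘ δ) (1 * t + -(⌊t⌋ : ℝ)) := fun t =>
    (velocity_congr (hploc t)).trans (velocity_comp_affine hd _ _ _)
  refine ⟨fun t => δ (Int.fract t), ?_, by simp, fun t => ?_, fun t => ?_, fun t => h.avoids _,
    fun t => ?_, ?_⟩
  · rw [continuous_iff_continuousAt]
    intro t
    exact ContinuousAt.congr (by fun_prop) (hloc t).symm
  · have aff : ContMDiff 𝓘(ℝ, ℝ) 𝓘(ℝ, ℝ) ∞ fun s : ℝ => 1 * s + -(⌊t⌋ : ℝ) := by
      rw [contMDiff_iff_contDiff]; fun_prop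
    exact ((h.smooth.comp aff).contMDiffAt).congr_of_eventuallyEq (hploc t)
  · simp [Function.comp]
  · exact (h.transverse _).of_velocity one_ne_zero (hploc t).self_of_nhds (hvel t)
  · have hset : ∀ ε, {t | t ∈ Ico (0 : ℝ) 1 ∧ IsCrossing oM oF ι (p ∘ fun s => δ (Int.fract s)) ε t} =
        {t | t ∈ Ico (0 : ℝ) 1 ∧ IsCrossing oM oF ι (p ∘ δ) ε t} := by
      intro ε
      ext t
      refine and_congr_right fun ht => ?_
      have h0 : ⌊t⌋ = 0 := Int.floor_eq_zero_iff.2 ht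
      have e1 := isCrossing_iff_of_velocity (oM := oM) (oF := oF) (ι := ι) (ε := ε) one_pos
        (hploc t).self_of_nhds (hvel t)
      rw [h0] at e1
      simpa using e1
    simp only [intersectionNumber, hset]

/-- Straight paths in a surface box. -/
lemma IsSurfaceChart.exists_path (h : IsSurfaceChart oM oF ι e κ)
    (hc : Convex ℝ e.source) (hK : ∀ z ∈ e.target, z ∉ K) {a b : M} (ha : a ∈ e.target)
    (hb : b ∈ e.target) (haS : a ∉ range ι) (hbS : b ∉ range ι) :
    ∃ γ, IsTransversePath oM oF ι K γ a b ∧ (∀ t, γ t ∈ e.target) ∧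
      intersectionNumber oM oF ι γ = sideFun e κ b - sideFun e κ a := by
  obtain ⟨σ, hσ, hσ0, hσ1, hσm, hσc⟩ := exists_smooth_step
  set qa := e.symm a with hqa
  set qb := e.symm b with hqb
  have hqas : qa ∈ e.source := e.map_target ha
  have hqbs : qb ∈ e.source := e.map_target hb
  have ha0 : qa.2 ≠ 0 := by
    rw [← e.right_inv ha, h.mem_range_iff _ hqas] at haS
    exact haS
  have hb0 : qb.2 ≠ 0 := by
    rw [← e.right_inv hb, h.mem_range_iff _ hqbs] at hbS
    exact hbS
  have hκ : κ * κ = 1 := by rcases h.sign with h | h <;> rw [h] <;> norm_num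
  have hκ0 : κ ≠ 0 := fun h => by rw [h] at hκ; norm_num at hκ
  -- A straight segment in the chart. As `σ` takes each value strictly between 0 and 1 once and with
  -- positive speed, the segment meets the surface at most once, and transversally.
  let q : ℝ → EuclideanSpace ℝ (Fin 2) × ℝ := fun t => qa + σ t • (qb - qa)
  have hq : ContDiff ℝ ∞ q := contDiff_const.add (hσ.smul contDiff_const)
  have hqs : ∀ t, q t ∈ e.source := fun t => hc.add_smul_sub_mem hqas hqbs (hσm t)
  have hqd : ∀ t, HasDerivAt q (deriv σ t • (qb - qa)) t := fun t =>
    (((hσ.differentiable (by simp)) t).hasDerivAt.smul_const _).const_add _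
  have hq2 : ∀ t, (q t).2 = qa.2 + σ t * (qb.2 - qa.2) := fun t => rfl
  have hcross : ∀ ε t, IsCrossing oM oF ι (fun t => e (q t)) ε t ↔
      (q t).2 = 0 ∧ 0 < κ * ε * (deriv σ t * (qb.2 - qa.2)) := fun ε t =>
    h.crossing_iff _ t q _ (Eventually.of_forall fun s => rfl) (hqd t) (hqs t) ε
  -- the times at which the path meets the surface
  have hzero : (∀ t, (q t).2 ≠ 0) ∧ (0 < qa.2 ↔ 0 < qb.2) ∨
      ∃ t₀ ∈ Ioo (0 : ℝ) 1, 0 < deriv σ t₀ ∧ (∀ t, (q t).2 = 0 ↔ t = t₀) ∧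
        ((0 < qb.2 ∧ qa.2 < 0) ∨ (qb.2 < 0 ∧ 0 < qa.2)) := by
    have hopp : ((0 < qb.2 ∧ qa.2 < 0) ∨ (qb.2 < 0 ∧ 0 < qa.2)) →
        ∃ t₀ ∈ Ioo (0 : ℝ) 1, 0 < deriv σ t₀ ∧ (∀ t, (q t).2 = 0 ↔ t = t₀) := by
      intro hop
      have hne : qb.2 - qa.2 ≠ 0 := by rcases hop with h | h <;> [exact ne_of_gt (by linarith); exact ne_of_lt (by linarith)]
      have hcm : -qa.2 / (qb.2 - qa.2) ∈ Ioo (0 : ℝ) 1 := by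
        rcases hop with h | h
        · exact ⟨div_pos (by linarith) (by linarith), (div_lt_one (by linarith)).2 (by linarith)⟩
        · exact ⟨div_pos_of_neg_of_neg (by linarith) (by linarith),
            (div_lt_one_of_neg (by linarith)).2 (by linarith)⟩
      obtain ⟨t₀, h1, h2, h3⟩ := hσc _ hcm
      refine ⟨t₀, h1, h2, fun t => ?_⟩
      rw [← h3, hq2, eq_div_iff hne]
      constructor <;> intro h <;> linarith
    rcases lt_or_gt_of_ne ha0 with h1 | h1 <;> rcases lt_or_gt_of_ne hb0 with h2 | h2
    · left
      refine ⟨fun t => ?_, by constructor <;> intro <;> linarith⟩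
      rw [hq2]
      have := hσm t
      refine ne_of_lt ?_
      have hm := max_lt h1 h2
      linarith [mul_nonneg (sub_nonneg.2 this.2) (sub_nonneg.2 (le_max_left qa.2 qb.2)),
        mul_nonneg this.1 (sub_nonneg.2 (le_max_right qa.2 qb.2))]
    · right
      obtain ⟨t₀, k1, k2, k3⟩ := hopp (Or.inl ⟨h2, h1⟩)
      exact ⟨t₀, k1, k2, k3, Or.inl ⟨h2, h1⟩⟩
    · right
      obtain ⟨t₀, k1, k2, k3⟩ := hopp (Or.inr ⟨h2, h1⟩)
      exact ⟨t₀, k1, k2, k3, Or.inr ⟨h2, h1⟩⟩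
    · left
      refine ⟨fun t => ?_, by constructor <;> intro <;> linarith⟩
      rw [hq2]
      have := hσm t
      refine ne_of_gt ?_
      have hm := lt_min h1 h2
      linarith [mul_nonneg (sub_nonneg.2 this.2) (sub_nonneg.2 (min_le_left qa.2 qb.2)),
        mul_nonneg this.1 (sub_nonneg.2 (min_le_right qa.2 qb.2))]
  refine ⟨fun t => e (q t), ⟨?_, fun t => hK _ (e.map_source (hqs t)), fun t => ?_, ?_, ?_, fun ε => ?_⟩,
    fun t => e.map_source (hqs t), ?_⟩
  · exact h.isParam.smooth.comp_contMDiff (contMDiff_iff_contDiff.2 hq) hqs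
  · by_cases ht : (q t).2 = 0
    · refine h.transverse _ t q _ (Eventually.of_forall fun s => rfl) (hqd t) (hqs t) ?_
      rcases hzero with h0 | ⟨t₀, h1, h2, h3, h4⟩
      · exact absurd ht (h0.1 t)
      · rw [(h3 t).1 ht]
        change deriv σ t₀ * (qb.2 - qa.2) ≠ 0
        refine mul_ne_zero h2.ne' ?_
        rcases h4 with h | h <;> [exact ne_of_gt (by linarith); exact ne_of_lt (by linarith)]
    · exact TransverseAt.of_not_mem fun hr => ht ((h.mem_range_iff _ (hqs t)).1 hr)
  · refine ⟨1 / 4, by norm_num, fun t ht => ?_⟩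
    simp only [q, hσ0 t ht, zero_smul, add_zero]
    exact e.right_inv ha
  · refine ⟨1 / 4, by norm_num, fun t ht => ?_⟩
    simp only [q, hσ1 t (by linarith), one_smul, add_sub_cancel]
    exact e.right_inv hb
  · rcases hzero with h0 | ⟨t₀, h1, h2, h3, h4⟩
    · refine Set.Finite.subset finite_empty fun t ht => ?_
      exact h0.1 t ((hcross ε t).1 ht.2).1
    · refine Set.Finite.subset (finite_singleton t₀) fun t ht => ?_
      exact (h3 t).1 ((hcross ε t).1 ht.2).1
  · have hempty : ∀ ε, (∀ t, ¬ IsCrossing oM oF ι (fun t => e (q t)) ε t) →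
        {t | t ∈ Ico (0 : ℝ) 1 ∧ IsCrossing oM oF ι (fun t => e (q t)) ε t} = ∅ := fun ε h =>
      eq_empty_of_forall_notMem fun t ht => h t ht.2
    rcases hzero with h0 | ⟨t₀, h1, h2, h3, h4⟩
    · have hno : ∀ ε t, ¬ IsCrossing oM oF ι (fun t => e (q t)) ε t := fun ε t hcr =>
        h0.1 t ((hcross ε t).1 hcr).1
      rw [intersectionNumber, hempty _ (hno _), hempty _ (hno _), ncard_empty, sub_self]
      have : (0 < κ * qa.2 ↔ 0 < κ * qb.2) := by
        rcases h.sign with h | h <;> rw [h]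
        · simpa using h0.2
        · simp only [neg_mul, one_mul, neg_pos]
          rw [← not_iff_not, not_lt, not_lt, ha0.symm.le_iff_lt, hb0.symm.le_iff_lt]
          exact h0.2
      simp only [sideFun, ← hqa, ← hqb, this, sub_self]
    -- The last coordinate moves in the direction of `qb.2 - qa.2`, and `κ` converts this direction
    -- into the sign of the only crossing.
    · have hone : ∀ ε, 0 < κ * ε * (qb.2 - qa.2) →
          {t | t ∈ Ico (0 : ℝ) 1 ∧ IsCrossing oM oF ι (fun t => e (q t)) ε t} = {t₀} := by
        intro ε hε
        ext t
        refine ⟨fun ht => (h3 t).1 ((hcross ε t).1 ht.2).1, ?_⟩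
        rintro rfl
        refine ⟨⟨h1.1.le, h1.2⟩, (hcross ε t).2 ⟨(h3 t).2 rfl, ?_⟩⟩
        have : κ * ε * (deriv σ t * (qb.2 - qa.2)) = deriv σ t * (κ * ε * (qb.2 - qa.2)) := by ring
        rw [this]
        exact mul_pos h2 hε
      have hnone : ∀ ε, κ * ε * (qb.2 - qa.2) < 0 →
          {t | t ∈ Ico (0 : ℝ) 1 ∧ IsCrossing oM oF ι (fun t => e (q t)) ε t} = ∅ := by
        intro ε hε
        refine hempty ε fun t hcr => ?_
        have h5 := (hcross ε t).1 hcr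
        have h6 := (h3 t).1 h5.1
        have : κ * ε * (deriv σ t * (qb.2 - qa.2)) = deriv σ t * (κ * ε * (qb.2 - qa.2)) := by ring
        rw [this, h6] at h5
        exact absurd h5.2 (mul_neg_of_pos_of_neg h2 hε).not_gt
      rw [intersectionNumber, sideFun, sideFun, ← hqa, ← hqb]
      rcases h.sign with hk | hk <;> rcases h4 with h4 | h4
      · rw [hone 1 (by rw [hk]; linarith), hnone (-1) (by rw [hk]; linarith),
          if_pos (by rw [hk]; linarith), if_neg (by rw [hk]; linarith)]
        simp
      · rw [hnone 1 (by rw [hk]; linarith), hone (-1) (by rw [hk]; linarith),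
          if_neg (by rw [hk]; linarith), if_pos (by rw [hk]; linarith)]
        simp
      · rw [hnone 1 (by rw [hk]; linarith), hone (-1) (by rw [hk]; linarith),
          if_neg (by rw [hk]; linarith), if_pos (by rw [hk]; linarith)]
        simp
      · rw [hone 1 (by rw [hk]; linarith), hnone (-1) (by rw [hk]; linarith),
          if_pos (by rw [hk]; linarith), if_neg (by rw [hk]; linarith)]
        simp

end TransversePath

/-! ## Roots of the intersection function on the cyclic cover -/

section Root

open Set Filter

lemma OrientedLink.isClosed_carrier {M : Type*} [TopologicalSpace M] [T2Space M]
    [ChartedSpace (EuclideanSpace ℝ (Fin 3)) M] {m : ℕ} (L : OrientedLink M m) :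
    IsClosed L.carrier := by
  refine isClosed_iUnion_of_finite fun i => ?_
  have : range (L.knot i) = L.knot i '' Icc 0 1 := by
    refine Subset.antisymm ?_ (image_subset_range _ _)
    rintro _ ⟨t, rfl⟩
    obtain ⟨s, hs, h⟩ := (L.periodic i).exists_mem_Ico₀ one_pos t
    exact ⟨s, Ico_subset_Icc_self hs, h.symm⟩
  rw [this]
  exact (isCompact_Icc.image (L.smooth i).continuous).isClosed

variable {M : Type*} [TopologicalSpace M] [ChartedSpace (EuclideanSpace ℝ (Fin 3)) M]
  [IsManifold (𝓡 3) ∞ M] {F : Type*} [TopologicalSpace F] [ChartedSpace (EuclideanHalfSpace 2) F]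
  [IsManifold (𝓡∂ 2) ∞ F] {oM : ManifoldOrientation (𝓡 3) M 3}
  {oF : ManifoldOrientation (𝓡∂ 2) F 2} {ι : F → M} {m : ℕ} {L : OrientedLink M m}

/-- Moving off the surface in the last coordinate of a surface chart shows that its complement is
dense off the link. Functions that are controlled only off the surface can then be extended by
limits. -/
lemma mem_closure_compl_range [CompactSpace F] [T2Space M] (oM : ManifoldOrientation (𝓡 3) M 3)
    (hS : IsSeifertSurface L oF ι) {x : M} (hx : x ∉ L.carrier) : x ∈ closure (range ι)ᶜ := by
  by_cases hxS : x ∈ range ι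
  · obtain ⟨e, κ, q₀, ρ, h1, rfl, h3, h4, -⟩ := exists_surfaceBox oM hS hx univ_mem
    have hq₀ : q₀ ∈ e.source := h4 ▸ Metric.mem_ball_self h3
    have h0 := (h1.mem_range_iff _ hq₀).1 hxS
    let c : ℝ → EuclideanSpace ℝ (Fin 2) × ℝ := fun s => (q₀.1, s)
    have hc0 : c 0 = q₀ := Prod.ext rfl h0.symm
    have hc : Tendsto c (𝓝[≠] 0) (𝓝 q₀) := by
      have : Continuous c := by fun_prop
      have := this.tendsto 0
      rw [hc0] at this
      exact this.mono_left nhdsWithin_le_nhds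
    refine mem_closure_of_tendsto ((e.continuousAt hq₀).tendsto.comp hc) ?_
    filter_upwards [hc.eventually (e.open_source.mem_nhds hq₀), self_mem_nhdsWithin] with s hs hs0 hr
    exact hs0 ((h1.mem_range_iff _ hs).1 hr)
  · exact subset_closure hxS

/-- A function that jumps by minus one along positive crossings of the surface. -/
lemma exists_jumpFunction [CompactSpace F] [CompactSpace M] [T2Space M]
    (oM : ManifoldOrientation (𝓡 3) M 3) (hS : IsSeifertSurface L oF ι) :
    ∃ Φ : M → ℝ, ∀ x ∉ L.carrier, ∀ (f : M → ℤ) (W : Set M), IsSideFunction oM oF ι f W → x ∈ W →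
      ∃ l, Tendsto (fun z => Φ z + f z) (𝓝[(range ι)ᶜ] x) (𝓝 l) := by
  have hex : ∀ x : {x : M // x ∉ L.carrier}, ∃ (f : M → ℤ) (W : Set M), IsSideFunction oM oF ι f W ∧
      (x : M) ∈ W := by
    intro x
    obtain ⟨e, κ, q₀, ρ, h1, h2, h3, h4, -⟩ := exists_surfaceBox oM hS x.2 univ_mem
    exact ⟨_, _, h1.isSideFunction, h2 ▸ e.map_source (h4 ▸ Metric.mem_ball_self h3)⟩
  choose f W hfW hxW using hex
  have hO : IsOpen {x : M | x ∉ L.carrier} := L.isClosed_carrier.isOpen_compl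
  have := ChartedSpace.secondCountable_of_sigmaCompact (EuclideanSpace ℝ (Fin 3)) M
  have : LocallyCompactSpace {x : M // x ∉ L.carrier} := hO.locallyCompactSpace
  have : SecondCountableTopology {x : M // x ∉ L.carrier} :=
    TopologicalSpace.Subtype.secondCountableTopology {x | x ∉ L.carrier}
  have : SigmaCompactSpace {x : M // x ∉ L.carrier} := inferInstance
  have : ParacompactSpace {x : M // x ∉ L.carrier} := inferInstance
  obtain ⟨ρ, hρ⟩ := PartitionOfUnity.exists_isSubordinate
    (X := {x : M // x ∉ L.carrier}) isClosed_univ (fun x => Subtype.val ⁻¹' (W x))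
    (fun x => (hfW x).isOpen.preimage continuous_subtype_val)
    (fun x _ => mem_iUnion.2 ⟨x, hxW x⟩)
  classical
  -- For a side function `g` near `x`, the sum `Φ + g` equals `∑ ρ i * (g - f i)`. The differences
  -- `g - f i` are constant off the surface near `x`, so this is a continuous function there.
  refine ⟨fun z => if h : z ∉ L.carrier then -∑ᶠ i, ρ i ⟨z, h⟩ * f i z else 0, ?_⟩
  intro x hx g W' hg hxW'
  set x' : {x : M // x ∉ L.carrier} := ⟨x, hx⟩
  set T := ρ.fintsupport x'
  have hk : ∀ i, ∃ k : ℤ, i ∈ T → ∀ᶠ z in 𝓝 x, z ∉ range ι → g z - f i z = k := by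
    intro i
    by_cases hi : i ∈ T
    · obtain ⟨k, hk⟩ := hg.exists_sub_eq hS hx (hfW i) hxW' (hρ i ((ρ.mem_fintsupport_iff x' i).1 hi))
      exact ⟨k, fun _ => hk⟩
    · exact ⟨0, fun h => absurd h hi⟩
  choose k hk using hk
  have hk' : ∀ᶠ z in 𝓝 x, ∀ i ∈ T, z ∉ range ι → g z - f i z = k i :=
    (Filter.eventually_all_finset T).2 fun i hi => hk i hi
  have hT : ∀ᶠ z : {x : M // x ∉ L.carrier} in 𝓝 x', ρ.finsupport z ⊆ T :=
    ρ.eventually_finsupport_subset x'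
  have key : ∀ᶠ z : {x : M // x ∉ L.carrier} in comap Subtype.val (𝓝[(range ι)ᶜ] x),
      (∑ i ∈ T, ρ i z * (k i : ℝ)) = (-∑ᶠ i, ρ i z * f i z) + g z := by
    have h1 : comap Subtype.val (𝓝[(range ι)ᶜ] x) ≤ 𝓝 x' := by
      rw [nhds_subtype_eq_comap]
      exact comap_mono nhdsWithin_le_nhds
    have h2 := preimage_mem_comap (m := (Subtype.val : {x : M // x ∉ L.carrier} → M))
      (mem_nhdsWithin_of_mem_nhds (t := (range ι)ᶜ) hk')
    have h3 := preimage_mem_comap (m := (Subtype.val : {x : M // x ∉ L.carrier} → M))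
      (self_mem_nhdsWithin (s := (range ι)ᶜ) (a := x))
    filter_upwards [h1 hT, h2, h3] with z hzT hzk hzS
    have hs : (∑ᶠ i, ρ i z * (f i z : ℝ)) = ∑ i ∈ T, ρ i z * (f i z : ℝ) := by
      refine finsum_eq_sum_of_support_subset _ fun i hi => hzT ?_
      rw [ρ.mem_finsupport]
      exact left_ne_zero_of_mul hi
    have hs1 : (g z : ℝ) = ∑ i ∈ T, ρ i z * (g z : ℝ) := by
      rw [← Finset.sum_mul, ρ.sum_finsupport' (mem_univ z) hzT, one_mul]
    rw [hs, hs1, neg_add_eq_sub, ← Finset.sum_sub_distrib]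
    refine Finset.sum_congr rfl fun i hi => ?_
    rw [← mul_sub, ← hzk i hi hzS]
    push_cast
    ring
  refine ⟨∑ i ∈ T, ρ i x' * (k i : ℝ), ?_⟩
  have hc : Continuous fun z : {x : M // x ∉ L.carrier} => ∑ i ∈ T, ρ i z * (k i : ℝ) := by fun_prop
  have h1 : Tendsto (fun z : {x : M // x ∉ L.carrier} => ∑ i ∈ T, ρ i z * (k i : ℝ))
      (comap Subtype.val (𝓝[(range ι)ᶜ] x)) (𝓝 (∑ i ∈ T, ρ i x' * (k i : ℝ))) := by
    refine (hc.tendsto x').mono_left ?_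
    rw [nhds_subtype_eq_comap]
    exact comap_mono nhdsWithin_le_nhds
  have h2 := h1.congr' key
  have h3 : ((fun z => (if h : z ∉ L.carrier then -∑ᶠ i, ρ i ⟨z, h⟩ * f i z else 0 : ℝ) + g z) ∘
      (Subtype.val : {x : M // x ∉ L.carrier} → M)) =
      fun z => (-∑ᶠ i, ρ i z * f i z) + g z := by
    funext z
    simp only [Function.comp, dif_pos z.2]
  rw [← h3] at h2
  refine (tendsto_comap'_iff ?_).1 h2
  have h4 : range (Subtype.val : {x : M // x ∉ L.carrier} → M) = {x : M | x ∉ L.carrier} :=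
    Subtype.range_coe
  rw [h4]
  exact mem_nhdsWithin_of_mem_nhds (hO.mem_nhds hx)

variable {N : Type*} [TopologicalSpace N]

/-- There is a path from `y` to `y'` in the cover whose projection is a transverse path with
intersection number `k`. -/
def Reach (oM : ManifoldOrientation (𝓡 3) M 3) (oF : ManifoldOrientation (𝓡∂ 2) F 2)
    (ι : F → M) (K : Set M) (p : N → M) (y y' : N) (k : ℤ) : Prop :=
  ∃ δ : ℝ → N, Continuous δ ∧ (∃ ε > 0, ∀ t ≤ ε, δ t = y) ∧ (∃ ε > 0, ∀ t ≥ 1 - ε, δ t = y') ∧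
    IsTransversePath oM oF ι K (p ∘ δ) (p y) (p y') ∧ intersectionNumber oM oF ι (p ∘ δ) = k

lemma Reach.trans {K : Set M} {p : N → M} {y₁ y₂ y₃ : N} {k l : ℤ}
    (h₁ : Reach oM oF ι K p y₁ y₂ k) (h₂ : Reach oM oF ι K p y₂ y₃ l) (hy : p y₂ ∉ range ι) :
    Reach oM oF ι K p y₁ y₃ (k + l) := by
  obtain ⟨δ₁, c₁, s₁, f₁, t₁, rfl⟩ := h₁
  obtain ⟨δ₂, c₂, s₂, f₂, t₂, rfl⟩ := h₂
  obtain ⟨h1, h2⟩ := t₁.concat t₂ hy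
  refine ⟨pathConcat δ₁ δ₂, ?_, pathConcat_start s₁, pathConcat_finish f₂, ?_, ?_⟩
  · rw [continuous_iff_continuousAt]
    intro t
    rcases lt_trichotomy t (1 / 2) with h | h | h
    · exact ContinuousAt.congr (by fun_prop) (pathConcat_left δ₁ δ₂ h).symm
    · rw [h]
      exact ContinuousAt.congr continuousAt_const (pathConcat_mid f₁ s₂).symm
    · exact ContinuousAt.congr (by fun_prop) (pathConcat_right δ₁ δ₂ h).symm
  · rw [comp_pathConcat]; exact h1
  · rw [comp_pathConcat]; exact h2

variable [ChartedSpace (EuclideanSpace ℝ (Fin 3)) N] [IsManifold (𝓡 3) ∞ N]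
  {oN : ManifoldOrientation (𝓡 3) N 3} {p : N → M} {n : ℕ}

/-- A path upstairs from `y` to `y` projects to a closed loop with a closed lift, and the monodromy
condition applies to it. -/
lemma Reach.dvd (hp : IsCyclicBranchedCover n L oM oF ι oN p) {y : N} {k : ℤ}
    (h : Reach oM oF ι L.carrier p y y k) : (n : ℤ) ∣ k := by
  obtain ⟨δ, c, s, f, t, rfl⟩ := h
  obtain ⟨δ', h1, h2, h3, h4, h5, h6, h7⟩ := t.exists_loop c s f
  rw [← h7]
  exact (hp.monodromy _ h3 h4 h5 h6 δ' h1 fun _ => rfl).1 h2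

/-- Near `y` the map `p` is a diffeomorphism, so a straight path in a surface box lifts; its
intersection number is the change of the side function. -/
lemma exists_local_reach [CompactSpace F] [T2Space M] (hS : IsSeifertSurface L oF ι)
    (hp : IsCyclicBranchedCover n L oM oF ι oN p) {y : N} (hy : p y ∉ L.carrier) :
    ∃ (f : M → ℤ) (W : Set M) (O : Set N), IsSideFunction oM oF ι f W ∧ p y ∈ W ∧ IsOpen O ∧ y ∈ O ∧
      ∀ a ∈ O, ∀ b ∈ O, p a ∉ range ι → p b ∉ range ι →
        Reach oM oF ι L.carrier p a b (f (p b) - f (p a)) := by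
  obtain ⟨Θ, hyΘ, hΘ⟩ := hp.local_diffeo y hy
  have hpy : p y ∈ Θ.target := by rw [hΘ hyΘ]; exact Θ.map_source hyΘ
  obtain ⟨e, κ, q₀, ρ, h1, h2, h3, h4, h5⟩ := exists_surfaceBox oM hS hy
    (inter_mem (Θ.open_target.mem_nhds hpy) (L.isClosed_carrier.isOpen_compl.mem_nhds hy))
  have hpe : p y ∈ e.target := h2 ▸ e.map_source (h4 ▸ Metric.mem_ball_self h3)
  have hc : ContinuousOn p Θ.source := hp.continuous.continuousOn
  refine ⟨_, _, Θ.source ∩ p ⁻¹' e.target, h1.isSideFunction, hpe,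
    hc.isOpen_inter_preimage Θ.open_source e.open_target, ⟨hyΘ, hpe⟩, ?_⟩
  intro a ha b hb haS hbS
  obtain ⟨γ, hγ, hγe, hγk⟩ := h1.exists_path (K := L.carrier) (h4 ▸ convex_ball _ _)
    (fun z hz => (h5 hz).2) ha.2 hb.2 haS hbS
  have hinv : ∀ z ∈ Θ.target, p (Θ.invFun z) = z := by
    intro z hz
    have h6 : Θ.invFun z ∈ Θ.source := Θ.map_target hz
    rw [hΘ h6]
    exact Θ.right_inv hz
  have hinv' : ∀ z ∈ Θ.source, Θ.invFun (p z) = z := by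
    intro z hz
    rw [hΘ hz]
    exact Θ.left_inv hz
  have hpδ : p ∘ (fun t => Θ.invFun (γ t)) = γ := funext fun t => hinv _ (h5 (hγe t)).1
  refine ⟨fun t => Θ.invFun (γ t), ?_, ?_, ?_, ?_, ?_⟩
  · exact Θ.contMDiffOn_invFun.continuousOn.comp_continuous hγ.smooth.continuous
      fun t => (h5 (hγe t)).1
  · obtain ⟨ε, h6, h7⟩ := hγ.start
    exact ⟨ε, h6, fun t ht => (congrArg Θ.invFun (h7 t ht)).trans (hinv' a ha.1)⟩
  · obtain ⟨ε, h6, h7⟩ := hγ.finish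
    exact ⟨ε, h6, fun t ht => (congrArg Θ.invFun (h7 t ht)).trans (hinv' b hb.1)⟩
  · rw [hpδ]; exact hγ
  · rw [hpδ]; exact hγk

lemma IsCyclicBranchedCover.map_nhds_eq (hp : IsCyclicBranchedCover n L oM oF ι oN p) {y : N}
    (hy : p y ∉ L.carrier) : map p (𝓝 y) = 𝓝 (p y) := by
  obtain ⟨Θ, hyΘ, hΘ⟩ := hp.local_diffeo y hy
  have h1 := Θ.toOpenPartialHomeomorph.map_nhds_eq (x := y) hyΘ
  have h2 : p =ᶠ[𝓝 y] Θ.toOpenPartialHomeomorph := by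
    filter_upwards [Θ.open_source.mem_nhds hyΘ] with z hz using hΘ hz
  rw [map_congr h2, h1, h2.self_of_nhds]

lemma mem_closure_preimage_compl_range [CompactSpace F] [T2Space M] (hS : IsSeifertSurface L oF ι)
    (hp : IsCyclicBranchedCover n L oM oF ι oN p) {y : N} (hy : p y ∉ L.carrier) :
    y ∈ closure (p ⁻¹' (range ι)ᶜ) := by
  have := mem_closure_iff_frequently.1 (mem_closure_compl_range oM hS hy)
  rw [← hp.map_nhds_eq hy, frequently_map] at this
  exact mem_closure_iff_frequently.2 this

/-- Mutual reachability holds locally and is transitive, so it holds on the connected complement of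
the branch set. Since junctions must lie off the surface, the relation between `a` and `b` speaks of
nearby points off the surface. -/
lemma exists_reach [CompactSpace F] [T2Space M] (hS : IsSeifertSurface L oF ι)
    (hp : IsCyclicBranchedCover n L oM oF ι oN p) {y y' : N} (hy : p y ∉ L.carrier)
    (hy' : p y' ∉ L.carrier) (hyS : p y ∉ range ι) (hyS' : p y' ∉ range ι) :
    ∃ k, Reach oM oF ι L.carrier p y y' k := by
  set D : Set N := p ⁻¹' (range ι)ᶜ with hD
  -- Both directions are included so that the relation is symmetric without reversing paths.
  let P : N → N → Prop := fun a b => ∀ᶠ q in 𝓝[D] a ×ˢ 𝓝[D] b,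
    (∃ k, Reach oM oF ι L.carrier p q.1 q.2 k) ∧ ∃ k, Reach oM oF ι L.carrier p q.2 q.1 k
  have hP : P y y' := by
    refine hp.connected.isPreconnected.induction₂ P ?_ ?_ ?_ hy hy'
    · intro a ha
      obtain ⟨f, W, O, -, -, hO, haO, hr⟩ := exists_local_reach hS hp ha
      filter_upwards [mem_nhdsWithin_of_mem_nhds (hO.mem_nhds haO)] with b hb
      have h1 : O ∩ D ∈ 𝓝[D] a := inter_mem (mem_nhdsWithin_of_mem_nhds (hO.mem_nhds haO)) self_mem_nhdsWithin
      have h2 : O ∩ D ∈ 𝓝[D] b := inter_mem (mem_nhdsWithin_of_mem_nhds (hO.mem_nhds hb)) self_mem_nhdsWithin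
      filter_upwards [prod_mem_prod h1 h2] with q hq
      exact ⟨⟨_, hr _ hq.1.1 _ hq.2.1 hq.1.2 hq.2.2⟩, ⟨_, hr _ hq.2.1 _ hq.1.1 hq.2.2 hq.1.2⟩⟩
    · intro a b c _ hb _ hab hbc
      have : (𝓝[D] b).NeBot :=
        mem_closure_iff_nhdsWithin_neBot.1 (mem_closure_preimage_compl_range hS hp hb)
      obtain ⟨pa, h1, pb, h2, h3⟩ := eventually_prod_iff.1 hab
      obtain ⟨pb', h4, pc, h5, h6⟩ := eventually_prod_iff.1 hbc
      -- By density of the complement of the surface there is a point near `b` through which the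
      -- paths can be joined.
      obtain ⟨b', hb1, hb2, hb3⟩ := (h2.and (h4.and self_mem_nhdsWithin)).exists
      refine eventually_prod_iff.2 ⟨pa, h1, pc, h5, fun {a'} ha' {c'} hc' => ?_⟩
      obtain ⟨⟨k, k1⟩, ⟨l, l1⟩⟩ := h3 ha' hb1
      obtain ⟨⟨k', k1'⟩, ⟨l', l1'⟩⟩ := h6 hb2 hc'
      exact ⟨⟨_, k1.trans k1' hb3⟩, ⟨_, l1'.trans l1 hb3⟩⟩
    · intro a b _ _ hab
      exact ((tendsto_snd.prodMk tendsto_fst).eventually hab).mono fun q hq => ⟨hq.2, hq.1⟩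
  have := hP.filter_mono (prod_mono (pure_le_nhdsWithin hyS) (pure_le_nhdsWithin hyS'))
  rw [prod_pure_pure] at this
  exact (eventually_pure.1 this).1

/-- The number of the sheet: it changes like a side function, modulo `n`. -/
lemma exists_sheetFunction [CompactSpace F] [T2Space M] (hS : IsSeifertSurface L oF ι)
    (hp : IsCyclicBranchedCover n L oM oF ι oN p) :
    ∃ s : N → ℤ, ∀ y, p y ∉ L.carrier → ∃ (f : M → ℤ) (W : Set M) (c : ℤ),
      IsSideFunction oM oF ι f W ∧ p y ∈ W ∧
        ∀ᶠ a in 𝓝[p ⁻¹' (range ι)ᶜ] y, (n : ℤ) ∣ s a - f (p a) - c := by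
  obtain ⟨y₁, hy₁⟩ := hp.connected.nonempty
  have hne : (p ⁻¹' (range ι)ᶜ ∩ p ⁻¹' L.carrierᶜ).Nonempty := by
    have h1 := mem_closure_preimage_compl_range hS hp hy₁
    have := mem_closure_iff.1 h1 _ (L.isClosed_carrier.isOpen_compl.preimage hp.continuous) hy₁
    rwa [inter_comm]
  obtain ⟨y₀, hy₀S, hy₀⟩ := hne
  classical
  -- The intersection number of a chosen path from the base point. It depends on the choice, but its
  -- class modulo `n` does not.
  let s : N → ℤ := fun y => if h : ∃ k, Reach oM oF ι L.carrier p y₀ y k then h.choose else 0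
  have hs : ∀ y, p y ∉ L.carrier → p y ∉ range ι → Reach oM oF ι L.carrier p y₀ y (s y) := by
    intro y hy hyS
    have h := exists_reach hS hp hy₀ hy hy₀S hyS
    simp only [s, dif_pos h]
    exact h.choose_spec
  refine ⟨s, fun y hy => ?_⟩
  obtain ⟨f, W, O, hf, hW, hO, hyO, hr⟩ := exists_local_reach hS hp hy
  have : (𝓝[p ⁻¹' (range ι)ᶜ] y).NeBot :=
    mem_closure_iff_nhdsWithin_neBot.1 (mem_closure_preimage_compl_range hS hp hy)
  have hev : ∀ᶠ a in 𝓝[p ⁻¹' (range ι)ᶜ] y, (a ∈ O ∧ p a ∉ L.carrier) ∧ p a ∉ range ι :=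
    inter_mem (mem_nhdsWithin_of_mem_nhds (inter_mem (hO.mem_nhds hyO)
      ((L.isClosed_carrier.isOpen_compl.preimage hp.continuous).mem_nhds hy))) self_mem_nhdsWithin
  obtain ⟨a₀, ⟨ha₀O, ha₀⟩, ha₀S⟩ := hev.exists
  refine ⟨f, W, s a₀ - f (p a₀), hf, hW, ?_⟩
  filter_upwards [hev] with a ⟨⟨haO, ha⟩, haS⟩
  -- Both the chosen path to `a` and the path through `a₀` are closed up by the same path back to
  -- `y₀`. The two loops have intersection numbers divisible by `n`, and the contribution `l` of the
  -- return path cancels in the difference.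
  obtain ⟨l, hl⟩ := exists_reach hS hp ha hy₀ haS hy₀S
  have h1 := (((hs a₀ ha₀ ha₀S).trans (hr a₀ ha₀O a haO ha₀S haS) ha₀S).trans hl haS).dvd hp
  have h2 := ((hs a ha haS).trans hl haS).dvd hp
  have := dvd_sub h2 h1
  rwa [show s a + l - (s a₀ + (f (p a) - f (p a₀)) + l) = s a - f (p a) - (s a₀ - f (p a₀)) by
    ring] at this

/-- The root is `exp (2πi (Φ ∘ p + s) / n)` with `s` the sheet number. Near a point, `s` agrees
modulo `n` with a side function up to a constant, and the jump of the side function compensates that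
of `Φ`; hence the root extends continuously across the surface. Its `n`-th power does not see the
integer `s`. -/
lemma exists_root [CompactSpace F] [CompactSpace M] [T2Space M] (hn : 1 ≤ n)
    (hS : IsSeifertSurface L oF ι) (hp : IsCyclicBranchedCover n L oM oF ι oN p) :
    ∃ (Φ : M → ℝ) (g : N → ℂ),
      (∀ x ∉ L.carrier, ∀ (f : M → ℤ) (W : Set M), IsSideFunction oM oF ι f W → x ∈ W →
        ∃ l, Tendsto (fun z => Φ z + f z) (𝓝[(range ι)ᶜ] x) (𝓝 l)) ∧
      ContinuousOn g (p ⁻¹' L.carrierᶜ) ∧ (∀ y, p y ∉ L.carrier → ‖g y‖ = 1) ∧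
      ∀ y, p y ∉ L.carrier → p y ∉ range ι →
        g y ^ n = Complex.exp (2 * Real.pi * Complex.I * Φ (p y)) := by
  obtain ⟨Φ, hΦ⟩ := exists_jumpFunction oM hS
  obtain ⟨s, hs⟩ := exists_sheetFunction hS hp
  have hn0 : (n : ℂ) ≠ 0 := by exact_mod_cast (by omega : n ≠ 0)
  let g₀ : N → ℂ := fun y => Complex.exp (((2 * Real.pi * (Φ (p y) + s y) / n : ℝ) : ℂ) * Complex.I)
  set D : Set N := p ⁻¹' (range ι)ᶜ with hD
  have hlim : ∀ y ∈ p ⁻¹' L.carrierᶜ, ∃ z, Tendsto g₀ (𝓝[D] y) (𝓝 z) := by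
    intro y hy
    obtain ⟨f, W, c, hf, hW, hev⟩ := hs y hy
    obtain ⟨l, hl⟩ := hΦ _ hy f W hf hW
    have hpt : Tendsto p (𝓝[D] y) (𝓝[(range ι)ᶜ] (p y)) :=
      tendsto_nhdsWithin_of_tendsto_nhds_of_eventually_within _
        (hp.continuous.continuousAt.mono_left nhdsWithin_le_nhds) self_mem_nhdsWithin
    have h1 := hl.comp hpt
    have hc : Continuous fun r : ℝ =>
        Complex.exp (((2 * Real.pi * (r + c) / n : ℝ) : ℂ) * Complex.I) := by fun_prop
    refine ⟨_, ((hc.tendsto l).comp h1).congr' ?_⟩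
    filter_upwards [hev] with a ⟨k, hk⟩
    simp only [Function.comp, g₀]
    rw [Complex.exp_eq_exp_iff_exists_int]
    -- Replacing `s a` by `f (p a) + c` changes the exponent by `-k` times `2πi`, since the two
    -- differ by `n * k`.
    refine ⟨-k, ?_⟩
    have hk' : (s a : ℝ) = f (p a) + c + n * k := by
      have : s a = f (p a) + c + n * k := by linarith
      rw [this]; push_cast; ring
    rw [hk']
    push_cast
    field_simp
    ring
  have hcl : p ⁻¹' L.carrierᶜ ⊆ closure D := fun y hy => mem_closure_preimage_compl_range hS hp hy
  refine ⟨Φ, extendFrom D g₀, hΦ, continuousOn_extendFrom hcl hlim, fun y hy => ?_, fun y hy hyS => ?_⟩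
  · have h1 := (tendsto_extendFrom (hlim y hy)).norm
    have : (𝓝[D] y).NeBot := mem_closure_iff_nhdsWithin_neBot.1 (hcl hy)
    refine tendsto_nhds_unique h1 ?_
    have : (fun y => ‖g₀ y‖) = fun _ => 1 := funext fun y => Complex.norm_exp_ofReal_mul_I _
    rw [this]
    exact tendsto_const_nhds
  · have h1 : extendFrom D g₀ y = g₀ y := by
      obtain ⟨z, hz⟩ := hlim y hy
      rw [extendFrom_eq (hcl hy) hz]
      exact tendsto_nhds_unique (hz.mono_left (pure_le_nhdsWithin hyS)) (tendsto_pure_nhds _ _)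
    rw [h1]
    simp only [g₀]
    rw [← Complex.exp_nat_mul, Complex.exp_eq_exp_iff_exists_int]
    refine ⟨s y, ?_⟩
    push_cast
    field_simp

end Root

/-! ## The exterior derivative in a parametrisation, and orientations at the link -/

section Core

open Set Filter

section DForm

variable {E' : Type*} [NormedAddCommGroup E'] [NormedSpace ℝ E'] [FiniteDimensional ℝ E']
  {X : Type*} [TopologicalSpace X] [ChartedSpace (EuclideanSpace ℝ (Fin 3)) X]

/-- Transport along an equality of base points: tangent vectors at different points are compared as
vectors of the model space. -/
lemma form_congr (α : ∀ x : X, TangentSpace (𝓡 3) x →L[ℝ] ℝ) {x x' : X} (h : x = x')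
    {v v' : EuclideanSpace ℝ (Fin 3)} (hv : v = v') : α x v = α x' v' := by
  subst h hv; rfl

/-- The pull-back of a form by a parametrisation. -/
def pullForm (α : ∀ x : X, TangentSpace (𝓡 3) x →L[ℝ] ℝ) (θ : E' → X) (q : E') : E' →L[ℝ] ℝ :=
  (α (θ q)).comp (mfderiv 𝓘(ℝ, E') (𝓡 3) θ q)

variable [IsManifold (𝓡 3) ∞ X]

/-- Naturality of the exterior derivative. In `pullForm = A(H) ∘ DH` the derivative contains a term
with the second derivative of `H`, which is symmetric and disappears on antisymmetrising. -/
lemma IsParam.dForm_apply {θ : E' → X} {U : Set E'} (h : IsParam θ U) {q₀ : E'} (hq₀ : q₀ ∈ U)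
    {α : ∀ x : X, TangentSpace (𝓡 3) x →L[ℝ] ℝ} (hα : IsSmoothForm α) :
    ∃ a' : E' →L[ℝ] E' →L[ℝ] ℝ, HasFDerivAt (pullForm α θ) a' q₀ ∧ ∀ v w,
      dForm α (θ q₀) (mfderiv 𝓘(ℝ, E') (𝓡 3) θ q₀ v) (mfderiv 𝓘(ℝ, E') (𝓡 3) θ q₀ w) =
        a' v w - a' w v := by
  have hI : IsManifold (𝓡 3) 1 X := IsManifold.of_le (n := ∞) (by simp)
  set x := θ q₀ with hx
  set ψ := extChartAt (𝓡 3) x with hψ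
  set A := chartForm α x with hA
  let H : E' → EuclideanSpace ℝ (Fin 3) := fun q => ψ (θ q)
  let U' : Set E' := U ∩ θ ⁻¹' ψ.source
  have hU' : IsOpen U' :=
    h.smooth.continuousOn.isOpen_inter_preimage h.isOpen (isOpen_extChartAt_source x)
  have hq₀' : q₀ ∈ U' := ⟨hq₀, mem_extChartAt_source x⟩
  have hH : ContDiffOn ℝ ∞ H U' := by
    rw [← contMDiffOn_iff_contDiffOn]
    exact (contMDiffOn_extChartAt (I := 𝓡 3) (x := x) (n := ∞)).comp (h.smooth.mono inter_subset_left)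
      (fun r hr => by simpa [ψ] using hr.2)
  have hH' : ∀ q ∈ U', ∀ v, (mfderiv (𝓡 3) 𝓘(ℝ, EuclideanSpace ℝ (Fin 3)) ψ (θ q)
      (mfderiv 𝓘(ℝ, E') (𝓡 3) θ q v) : EuclideanSpace ℝ (Fin 3)) = fderiv ℝ H q v := by
    intro q hq v
    have hq2 : θ q ∈ (chartAt (EuclideanSpace ℝ (Fin 3)) x).source := by simpa [ψ] using hq.2
    have h1 := (mdifferentiableAt_extChartAt (I := 𝓡 3) hq2)
    have h2 : mfderiv 𝓘(ℝ, E') 𝓘(ℝ, EuclideanSpace ℝ (Fin 3)) H q =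
        (mfderiv (𝓡 3) 𝓘(ℝ, EuclideanSpace ℝ (Fin 3)) ψ (θ q)).comp
          (mfderiv 𝓘(ℝ, E') (𝓡 3) θ q) :=
      mfderiv_comp q h1 (h.mdifferentiableAt hq.1)
    rw [← mfderiv_eq_fderiv, h2]
    rfl
  have hpull : ∀ q ∈ U', pullForm α θ q = (A (H q)).comp (fderiv ℝ H q) := by
    intro q hq
    have hHq : H q ∈ ψ.target := ψ.map_source hq.2
    have e0 : θ =ᶠ[𝓝 q] ψ.symm ∘ H := by
      filter_upwards [hU'.mem_nhds hq] with r hr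
      exact (ψ.left_inv hr.2).symm
    have d1 : MDifferentiableAt 𝓘(ℝ, E') 𝓘(ℝ, EuclideanSpace ℝ (Fin 3)) H q :=
      ((hH.contDiffAt (hU'.mem_nhds hq)).differentiableAt (by simp)).mdifferentiableAt
    have e1 := e0.mfderiv_eq (I := 𝓘(ℝ, E')) (I' := 𝓡 3)
    have e2 : mfderiv 𝓘(ℝ, E') (𝓡 3) (ψ.symm ∘ H) q = _ :=
      mfderiv_comp q ((IsParam.isParam_extChartAt_symm x).mdifferentiableAt hHq) d1
    rw [mfderiv_eq_fderiv] at e2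
    refine ContinuousLinearMap.ext fun v => ?_
    have e3 := congrArg (fun L : E' →L[ℝ] EuclideanSpace ℝ (Fin 3) => L v) (e1.trans e2)
    exact form_congr α e0.self_of_nhds e3
  have hAd : HasFDerivAt A (fderiv ℝ A (H q₀)) (H q₀) :=
    (((hα x).contDiffAt ((isOpen_extChartAt_target x).mem_nhds (ψ.map_source hq₀'.2))).differentiableAt
      (by simp)).hasFDerivAt
  have hHc := hH.contDiffAt (hU'.mem_nhds hq₀')
  have hHd : HasFDerivAt H (fderiv ℝ H q₀) q₀ := (hHc.differentiableAt (by simp)).hasFDerivAt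
  have hHdd : HasFDerivAt (fderiv ℝ H) (fderiv ℝ (fderiv ℝ H) q₀) q₀ :=
    ((hHc.fderiv_right (m := 1) (by norm_cast)).differentiableAt (by simp)).hasFDerivAt
  have hsym : IsSymmSndFDerivAt ℝ H q₀ := hHc.isSymmSndFDerivAt (by
    rw [minSmoothness_of_isRCLikeNormedField]; exact WithTop.coe_le_coe.2 (le_top : (2 : ℕ∞) ≤ ⊤))
  have hc := (hAd.comp q₀ hHd).clm_comp hHdd
  refine ⟨_, hc.congr_of_eventuallyEq ?_, fun v w => ?_⟩
  · filter_upwards [hU'.mem_nhds hq₀'] with q hq using hpull q hq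
  · have e1 := hH' q₀ hq₀' v
    have e2 := hH' q₀ hq₀' w
    have e3 : dForm α (θ q₀) (mfderiv 𝓘(ℝ, E') (𝓡 3) θ q₀ v) (mfderiv 𝓘(ℝ, E') (𝓡 3) θ q₀ w) =
        fderiv ℝ A (H q₀) (fderiv ℝ H q₀ v) (fderiv ℝ H q₀ w) -
        fderiv ℝ A (H q₀) (fderiv ℝ H q₀ w) (fderiv ℝ H q₀ v) := by
      rw [← e1, ← e2]; rfl
    rw [e3]
    have e4 := hsym v w
    change _ = (A (H q₀) (fderiv ℝ (fderiv ℝ H) q₀ v w) +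
        fderiv ℝ A (H q₀) (fderiv ℝ H q₀ v) (fderiv ℝ H q₀ w)) -
      (A (H q₀) (fderiv ℝ (fderiv ℝ H) q₀ w v) +
        fderiv ℝ A (H q₀) (fderiv ℝ H q₀ w) (fderiv ℝ H q₀ v))
    rw [e4]
    ring

end DForm

/-- The basis `1, i` of `ℂ` completed to one of `ℂ × ℝ`. -/
def tubeBasis : Module.Basis (Fin 3) ℝ (ℂ × ℝ) :=
  (Complex.basisOneI.prod (Module.Basis.singleton (Fin 1) ℝ)).reindex finSumFinEquiv

lemma tubeBasis_repr (v : ℂ × ℝ) :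
    tubeBasis.repr v 0 = v.1.re ∧ tubeBasis.repr v 1 = v.1.im ∧ tubeBasis.repr v 2 = v.2 := by
  refine ⟨?_, ?_, ?_⟩
  · have : (finSumFinEquiv (m := 2) (n := 1)).symm 0 = Sum.inl 0 := rfl
    simp [tubeBasis, this]
  · have : (finSumFinEquiv (m := 2) (n := 1)).symm 1 = Sum.inl 1 := rfl
    simp [tubeBasis, this]
  · have : (finSumFinEquiv (m := 2) (n := 1)).symm 2 = Sum.inr 0 := rfl
    simp [tubeBasis, this]

lemma tubeBasis_apply : tubeBasis 0 = (1, 0) ∧ tubeBasis 1 = (Complex.I, 0) ∧ tubeBasis 2 = (0, 1) := by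
  refine ⟨?_, ?_, ?_⟩
  · have : (finSumFinEquiv (m := 2) (n := 1)).symm 0 = Sum.inl 0 := rfl
    simp [tubeBasis, this]
  · have : (finSumFinEquiv (m := 2) (n := 1)).symm 1 = Sum.inl 1 := rfl
    simp [tubeBasis, this]
  · have : (finSumFinEquiv (m := 2) (n := 1)).symm 2 = Sum.inr 0 := rfl
    simp [tubeBasis, this]

lemma CylindricalCoords.isParam {X : Type*} [TopologicalSpace X]
    [ChartedSpace (EuclideanSpace ℝ (Fin 3)) X] (Θ : CylindricalCoords X) :
    IsParam Θ.map (Metric.ball 0 Θ.radius ×ˢ univ) :=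
  ⟨Metric.isOpen_ball.prod isOpen_univ, Θ.smooth, fun q hq => Θ.local_diffeo q.1 hq.1 q.2⟩

/-- The component belonging to a tube is its axis, and the other components lie in disjoint tubes.
-/
lemma BranchedCoords.eq_zero_of_mem_carrier {M N : Type*} [TopologicalSpace M]
    [ChartedSpace (EuclideanSpace ℝ (Fin 3)) M] [TopologicalSpace N]
    [ChartedSpace (EuclideanSpace ℝ (Fin 3)) N] {m n : ℕ} {L : OrientedLink M m}
    {p : N → M} (B : BranchedCoords n L p) {i : Fin m} {q : ℂ × ℝ}
    (hq : q.1 ∈ Metric.ball (0 : ℂ) (B.base i).radius) (h : (B.base i).map q ∈ L.carrier) :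
    q.1 = 0 := by
  obtain ⟨j, hj⟩ := mem_iUnion.1 h
  rw [← B.core j] at hj
  obtain ⟨z, hz⟩ := hj
  by_cases hij : i = j
  · subst hij
    exact ((B.base i).injective q.1 hq 0 (Metric.mem_ball_self (B.base i).radius_pos) q.2 z hz.symm).1
  · exact absurd (mem_image_of_mem _ (mk_mem_prod (Metric.mem_ball_self (B.base j).radius_pos)
      (mem_univ z))) (disjoint_left.1 (B.disjoint i j hij) ⟨q, ⟨hq, mem_univ _⟩, hz.symm⟩)

variable {M : Type*} [TopologicalSpace M] [ChartedSpace (EuclideanSpace ℝ (Fin 3)) M]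
  [IsManifold (𝓡 3) ∞ M]

/-- Cylindrical coordinates in which a positive contact form is standard are positively oriented. -/
lemma CylindricalCoords.isPos_core (Θ : CylindricalCoords M) {oM : ManifoldOrientation (𝓡 3) M 3}
    {α : ∀ x : M, TangentSpace (𝓡 3) x →L[ℝ] ℝ} (hα : IsPositiveContactForm oM α)
    (hstd : ∀ w ∈ Metric.ball (0 : ℂ) Θ.radius, ∀ z : ℝ, ∃ f : ℝ, 0 < f ∧ ∀ (η : ℂ) (ζ : ℝ),
      α (Θ.map (w, z)) (mfderiv 𝓘(ℝ, ℂ × ℝ) (𝓡 3) Θ.map (w, z) (η, ζ)) =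
        f * (ζ + (starRingEnd ℂ w * η).im)) (z : ℝ) :
    oM.IsPos (Θ.map (0, z)) (fun i => mfderiv 𝓘(ℝ, ℂ × ℝ) (𝓡 3) Θ.map (0, z)
      (![((0 : ℂ), (1 : ℝ)), (1, 0), (Complex.I, 0)] i)) := by
  have h0 : ((0 : ℂ), z) ∈ Metric.ball (0 : ℂ) Θ.radius ×ˢ (univ : Set ℝ) :=
    ⟨Metric.mem_ball_self Θ.radius_pos, mem_univ _⟩
  obtain ⟨a', ha', hd⟩ := Θ.isParam.dForm_apply h0 hα.1
  set a := pullForm α Θ.map with ha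
  have hav : ∀ v : ℂ × ℝ, HasFDerivAt (fun q => a q v) (a'.flip v) (0, z) := fun v =>
    ha'.clm_apply (hasFDerivAt_const v _) |>.congr_fderiv (by ext w <;> simp)
  -- The conformal factor is only given pointwise, but it is the value of the form on `(0, 1)` and
  -- therefore differentiable.
  have hev : ∀ᶠ q in 𝓝 ((0 : ℂ), z), ∀ (η : ℂ) (ζ : ℝ),
      a q (η, ζ) = a q (0, 1) * (ζ + (starRingEnd ℂ q.1 * η).im) := by
    filter_upwards [Θ.isParam.isOpen.mem_nhds h0] with q hq η ζ
    obtain ⟨f, -, hf⟩ := hstd q.1 hq.1 q.2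
    have h1 : ∀ η ζ, a q (η, ζ) = f * (ζ + (starRingEnd ℂ q.1 * η).im) := hf
    rw [h1, h1]
    simp
  obtain ⟨f, hfpos, hf⟩ := hstd 0 (Metric.mem_ball_self Θ.radius_pos) z
  have hf0 : ∀ η ζ, a (0, z) (η, ζ) = f * ζ := fun η ζ => (hf η ζ).trans (by simp)
  have hre : HasFDerivAt (fun q : ℂ × ℝ => q.1.re)
      (Complex.reCLM.comp (ContinuousLinearMap.fst ℝ ℂ ℝ)) (0, z) :=
    (Complex.reCLM.comp (ContinuousLinearMap.fst ℝ ℂ ℝ)).hasFDerivAt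
  have him : HasFDerivAt (fun q : ℂ × ℝ => q.1.im)
      (Complex.imCLM.comp (ContinuousLinearMap.fst ℝ ℂ ℝ)) (0, z) :=
    (Complex.imCLM.comp (ContinuousLinearMap.fst ℝ ℂ ℝ)).hasFDerivAt
  have e1 : a' (1, 0) (Complex.I, 0) = f := by
    have h1 := ((hav (0, 1)).mul hre).congr_of_eventuallyEq (f₁ := fun q => a q (Complex.I, 0)) (by
      filter_upwards [hev] with q hq
      rw [hq]; simp)
    have h2 := congrArg (fun L : ℂ × ℝ →L[ℝ] ℝ => L (1, 0)) ((hav (Complex.I, 0)).unique h1)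
    simpa [hf0] using h2
  have e2 : a' (Complex.I, 0) (1, 0) = -f := by
    have h1 := ((hav (0, 1)).mul him.neg).congr_of_eventuallyEq (f₁ := fun q => a q (1, 0)) (by
      filter_upwards [hev] with q hq
      rw [hq]; simp)
    have h2 := congrArg (fun L : ℂ × ℝ →L[ℝ] ℝ => L (Complex.I, 0)) ((hav (1, 0)).unique h1)
    simpa [hf0] using h2
  set D := mfderiv 𝓘(ℝ, ℂ × ℝ) (𝓡 3) Θ.map ((0 : ℂ), z) with hD
  have hα0 : ∀ η ζ, α (Θ.map (0, z)) (D (η, ζ)) = f * ζ := hf0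
  have hlin : LinearIndependent ℝ ![D (0, 1), D (1, 0), D (Complex.I, 0)] := by
    have hinj : Function.Injective D.toLinearMap := (Θ.isParam.bijective _ h0).1
    have h1 : LinearIndependent ℝ (D.toLinearMap ∘ (tubeBasis ∘ ![2, 0, 1])) := by
      refine LinearIndependent.map' ?_ _ (LinearMap.ker_eq_bot.2 hinj)
      exact tubeBasis.linearIndependent.comp _ (by decide)
    convert h1 using 1
    funext i
    fin_cases i
    · exact congrArg D tubeBasis_apply.2.2.symm
    · exact congrArg D tubeBasis_apply.1.symm
    · exact congrArg D tubeBasis_apply.2.1.symm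
  rcases oM.isPos_or_isPos_neg hlin with h | h
  · convert h using 1
    funext i
    fin_cases i <;> rfl
  -- On the axis `α` is `f dz` and `dα(1, i) = 2f`. For a frame of the opposite orientation `α ∧ dα`
  -- would take the value `-2f²`.
  · exfalso
    have hneg : -D (Complex.I, 0) = D (-(Complex.I, (0 : ℝ))) := (map_neg D _).symm
    rw [hneg] at h
    have h1 : 0 < α (Θ.map (0, z)) (D (0, 1)) *
          dForm α (Θ.map (0, z)) (D (1, 0)) (D (-(Complex.I, (0 : ℝ)))) +
        α (Θ.map (0, z)) (D (1, 0)) *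
          dForm α (Θ.map (0, z)) (D (-(Complex.I, (0 : ℝ)))) (D (0, 1)) +
        α (Θ.map (0, z)) (D (-(Complex.I, (0 : ℝ)))) *
          dForm α (Θ.map (0, z)) (D (0, 1)) (D (1, 0)) := hα.2 _ _ h
    have t1 : α (Θ.map (0, z)) (D (0, 1)) = f := (hα0 0 1).trans (mul_one f)
    have t2 : α (Θ.map (0, z)) (D (1, 0)) = 0 := (hα0 1 0).trans (mul_zero f)
    have t3 : α (Θ.map (0, z)) (D (-(Complex.I, (0 : ℝ)))) = 0 :=
      (hα0 (-Complex.I) (-0)).trans (by simp)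
    have t4 : dForm α (Θ.map (0, z)) (D (1, 0)) (D (-(Complex.I, (0 : ℝ)))) = -(2 * f) := by
      refine (hd (1, 0) (-(Complex.I, (0 : ℝ)))).trans ?_
      rw [map_neg, map_neg, neg_apply, e1, e2]
      ring
    rw [t1, t2, t3, t4] at h1
    nlinarith

end Core

/-! ## Half planes -/

section HalfPlane

open Set Filter

/-- The closed half plane. -/
def halfPlane : Set (EuclideanSpace ℝ (Fin 2)) := {u | 0 ≤ u 0}

lemma range_eq_halfPlane : range (𝓡∂ 2) = halfPlane := range_modelWithCornersEuclideanHalfSpace 2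

lemma uniqueDiffOn_halfPlane : UniqueDiffOn ℝ halfPlane :=
  range_eq_halfPlane ▸ (𝓡∂ 2).uniqueDiffOn

lemma convex_halfPlane : Convex ℝ halfPlane :=
  range_eq_halfPlane ▸ (𝓡∂ 2).convex_range

/-- Being a boundary point can be tested in any chart around the point, here the chart at the fixed
point `y₀`. -/
lemma isBoundaryPoint_iff_extChartAt {F : Type*} [TopologicalSpace F]
    [ChartedSpace (EuclideanHalfSpace 2) F] [IsManifold (𝓡∂ 2) ∞ F] {y₀ y : F}
    (hy : y ∈ (extChartAt (𝓡∂ 2) y₀).source) :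
    (𝓡∂ 2).IsBoundaryPoint y ↔ (extChartAt (𝓡∂ 2) y₀ y) 0 = 0 := by
  have hy' : y ∈ (chartAt (EuclideanHalfSpace 2) y₀).source := by simpa using hy
  rw [← not_iff_not, ← ModelWithCorners.isInteriorPoint_iff_not_isBoundaryPoint,
    (𝓡∂ 2).isInteriorPoint_iff_of_mem_atlas (n := ∞) (by simp) (chart_mem_atlas _ y₀) hy']
  have h1 : (extChartAt (𝓡∂ 2) y₀ y) ∈ interior (range (𝓡∂ 2)) ↔ (extChartAt (𝓡∂ 2) y₀ y) 0 ≠ 0 := by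
    rw [interior_range_modelWithCornersEuclideanHalfSpace]
    have h2 : extChartAt (𝓡∂ 2) y₀ y ∈ halfPlane := by
      rw [← range_eq_halfPlane]
      exact mem_range_self _
    exact ⟨fun h => ne_of_gt (show (0:ℝ) < (extChartAt (𝓡∂ 2) y₀ y) 0 from h), fun h => lt_of_le_of_ne h2 (Ne.symm h)⟩
  refine Iff.trans ⟨fun h => ?_, fun h => ?_⟩ h1
  · exact OpenPartialHomeomorph.interior_extend_target_subset_interior_range _ h
  · exact (chartAt (EuclideanHalfSpace 2) y₀).mem_interior_extend_target
      ((chartAt (EuclideanHalfSpace 2) y₀).map_source hy') h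

/-- The retraction of the plane to the half plane. -/
def clampPlane (u : EuclideanSpace ℝ (Fin 2)) : EuclideanSpace ℝ (Fin 2) := !₂[max (u 0) 0, u 1]

lemma clampPlane_mem (u : EuclideanSpace ℝ (Fin 2)) : clampPlane u ∈ halfPlane := by
  simp [clampPlane, halfPlane]

lemma clampPlane_of_mem {u : EuclideanSpace ℝ (Fin 2)} (hu : u ∈ halfPlane) : clampPlane u = u := by
  have : 0 ≤ u 0 := hu
  ext i
  fin_cases i <;> simp [clampPlane, this]

lemma norm_clampPlane_sub_le (u v : EuclideanSpace ℝ (Fin 2)) :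
    ‖clampPlane u - clampPlane v‖ ≤ ‖u - v‖ := by
  rw [EuclideanSpace.norm_eq, EuclideanSpace.norm_eq]
  refine Real.sqrt_le_sqrt ?_
  rw [Fin.sum_univ_two, Fin.sum_univ_two]
  have h := abs_max_sub_max_le_abs (u 0) (v 0) 0
  have h' := pow_le_pow_left₀ (abs_nonneg _) h 2
  simp only [clampPlane, PiLp.sub_apply, Real.norm_eq_abs]
  simpa using h'

/-- A function that is `C¹` on the half plane up to the boundary extends to a function that is strictly
differentiable at a given boundary point. -/
lemma hasStrictFDerivAt_clampExtension {V : Type*} [NormedAddCommGroup V] [NormedSpace ℝ V]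
    {σ : EuclideanSpace ℝ (Fin 2) → V} {p₀ : EuclideanSpace ℝ (Fin 2)} (hp₀ : p₀ ∈ halfPlane)
    (hσ : ContDiffWithinAt ℝ 1 σ halfPlane p₀) :
    HasStrictFDerivAt (fun u => σ (clampPlane u) + fderivWithin ℝ σ halfPlane p₀ (u - clampPlane u))
      (fderivWithin ℝ σ halfPlane p₀) p₀ := by
  set A := fderivWithin ℝ σ halfPlane p₀ with hA
  have h1 : ContDiffWithinAt ℝ (0 + 1) σ halfPlane p₀ := by rwa [zero_add]
  obtain ⟨U, hU, -, -, f', hf', hf'c⟩ := (contDiffWithinAt_succ_iff_hasFDerivWithinAt' (by simp)).1 h1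
  rw [insert_eq_of_mem hp₀] at hU
  have hA' : f' p₀ = A :=
    ((hf' p₀ (mem_of_mem_nhdsWithin hp₀ hU)).fderivWithin (uniqueDiffOn_halfPlane p₀ hp₀)).symm
  have hcl₀ : clampPlane p₀ = p₀ := clampPlane_of_mem hp₀
  refine HasStrictFDerivAt.of_isLittleO (Asymptotics.isLittleO_iff.2 fun ε hε => ?_)
  have hU' : ∀ᶠ u in 𝓝[halfPlane] p₀, u ∈ U := hU
  have h2 : ∀ᶠ u in 𝓝[halfPlane] p₀, u ∈ U ∧ ‖f' u - A‖ ≤ ε := by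
    refine hU'.and ?_
    · have h3 := hf'c.continuousWithinAt.sub (continuousWithinAt_const (b := A)) |>.norm
      have h4 : ‖f' p₀ - A‖ < ε := by rw [hA', sub_self, norm_zero]; exact hε
      exact (h3.eventually (gt_mem_nhds h4)).mono fun u hu => le_of_lt hu
  obtain ⟨ρ, hρ, hb⟩ := Metric.mem_nhdsWithin_iff.1 h2
  have hball : Metric.ball (p₀, p₀) ρ ∈ 𝓝 (p₀, p₀) := Metric.ball_mem_nhds _ hρ
  filter_upwards [hball] with ⟨u, v⟩ huv
  rw [Metric.mem_ball, Prod.dist_eq] at huv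
  have hmem : ∀ u : EuclideanSpace ℝ (Fin 2), dist u p₀ < ρ →
      clampPlane u ∈ Metric.ball p₀ ρ ∩ halfPlane := by
    intro u hu
    refine ⟨?_, clampPlane_mem u⟩
    rw [Metric.mem_ball, dist_eq_norm, ← hcl₀]
    refine (norm_clampPlane_sub_le u p₀).trans_lt ?_
    rwa [← dist_eq_norm]
  -- The mean value inequality on the convex half ball, applied to the clamped points. The linear
  -- correction term turns their difference into that of `u` and `v`, and clamping does not increase
  -- distances.
  have h3 := (((convex_ball p₀ ρ).inter convex_halfPlane)).norm_image_sub_le_of_norm_hasFDerivWithin_le'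
    (f := σ) (f' := f') (φ := A) (C := ε)
    (fun x hx => (hf' x (hb hx).1).mono inter_subset_right) (fun x hx => (hb hx).2)
    (hmem v ((le_max_right _ _).trans_lt huv)) (hmem u ((le_max_left _ _).trans_lt huv))
  have h4 : σ (clampPlane u) + A (u - clampPlane u) - (σ (clampPlane v) + A (v - clampPlane v)) -
      A (u - v) = σ (clampPlane u) - σ (clampPlane v) - A (clampPlane u - clampPlane v) := by
    simp only [map_sub]; abel
  change ‖σ (clampPlane u) + A (u - clampPlane u) - (σ (clampPlane v) + A (v - clampPlane v)) -
      A (u - v)‖ ≤ ε * ‖u - v‖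
  rw [h4]
  exact h3.trans (mul_le_mul_of_nonneg_left (norm_clampPlane_sub_le u v) hε.le)

end HalfPlane

/-! ## The surface near its boundary, in cylindrical coordinates -/

section BoundaryChart

open Set Filter

variable {M : Type*} [TopologicalSpace M] [ChartedSpace (EuclideanSpace ℝ (Fin 3)) M]
  [IsManifold (𝓡 3) ∞ M] {F : Type*} [TopologicalSpace F] [ChartedSpace (EuclideanHalfSpace 2) F]
  [IsManifold (𝓡∂ 2) ∞ F] {oM : ManifoldOrientation (𝓡 3) M 3}
  {oF : ManifoldOrientation (𝓡∂ 2) F 2} {ι : F → M} {m : ℕ} {L : OrientedLink M m}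

/-- The surface read in the coordinates given by `e` and in the chart of the surface at `y₀`. -/
def surfaceCoords (ι : F → M) (e : OpenPartialHomeomorph (ℂ × ℝ) M) (y₀ : F)
    (u : EuclideanSpace ℝ (Fin 2)) : ℂ × ℝ := e.symm (ι ((extChartAt (𝓡∂ 2) y₀).symm u))

/-- The chain rule for `ι = e ∘ σ ∘ φ`. Derivatives of `σ` are taken within the half plane, so that
the formula remains valid at the boundary. -/
lemma surfaceCoords_spec (hι : ContMDiff (𝓡∂ 2) (𝓡 3) ∞ ι) {e : OpenPartialHomeomorph (ℂ × ℝ) M}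
    (he : IsParam e e.source) (hs : ContMDiffOn (𝓡 3) 𝓘(ℝ, ℂ × ℝ) ∞ e.symm e.target) {y₀ : F}
    (hy₀ : ι y₀ ∈ e.target) :
    ∃ O : Set (EuclideanSpace ℝ (Fin 2)), IsOpen O ∧ extChartAt (𝓡∂ 2) y₀ y₀ ∈ O ∧
      (∀ u ∈ O ∩ halfPlane, u ∈ (extChartAt (𝓡∂ 2) y₀).target ∧
        ι ((extChartAt (𝓡∂ 2) y₀).symm u) ∈ e.target) ∧
      ContDiffOn ℝ ∞ (surfaceCoords ι e y₀) (O ∩ halfPlane) ∧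
      ∀ y ∈ (extChartAt (𝓡∂ 2) y₀).source, extChartAt (𝓡∂ 2) y₀ y ∈ O → ∀ τ : TangentSpace (𝓡∂ 2) y,
        (mfderiv (𝓡∂ 2) (𝓡 3) ι y τ : EuclideanSpace ℝ (Fin 3)) =
        mfderiv 𝓘(ℝ, ℂ × ℝ) (𝓡 3) e (surfaceCoords ι e y₀ (extChartAt (𝓡∂ 2) y₀ y))
          (fderivWithin ℝ (surfaceCoords ι e y₀) halfPlane (extChartAt (𝓡∂ 2) y₀ y)
            (mfderiv (𝓡∂ 2) 𝓘(ℝ, EuclideanSpace ℝ (Fin 2)) (extChartAt (𝓡∂ 2) y₀) y τ)) := by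
  have hIF : IsManifold (𝓡∂ 2) 1 F := IsManifold.of_le (n := ∞) (by simp)
  set φ := extChartAt (𝓡∂ 2) y₀ with hφ
  set σ := surfaceCoords ι e y₀ with hσ
  have hφs : ContMDiffOn 𝓘(ℝ, EuclideanSpace ℝ (Fin 2)) (𝓡∂ 2) ∞ φ.symm φ.target :=
    contMDiffOn_extChartAt_symm (I := 𝓡∂ 2) y₀
  have hT : φ.target ∩ (ι ∘ φ.symm) ⁻¹' e.target ∈ 𝓝[halfPlane] (φ y₀) := by
    have h1 : φ.target ∈ 𝓝[halfPlane] (φ y₀) :=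
      range_eq_halfPlane ▸ extChartAt_target_mem_nhdsWithin y₀
    refine inter_mem h1 ?_
    have h2 : ContinuousWithinAt (ι ∘ φ.symm) φ.target (φ y₀) :=
      hι.continuous.continuousAt.comp_continuousWithinAt
        (hφs.continuousOn (φ y₀) (mem_extChartAt_target y₀))
    have h3 : (ι ∘ φ.symm) (φ y₀) = ι y₀ := by simp only [Function.comp, φ, extChartAt_to_inv]
    have h4 := h2.preimage_mem_nhdsWithin (t := e.target) (by rw [h3]; exact e.open_target.mem_nhds hy₀)
    exact nhdsWithin_le_iff.2 h1 h4
  obtain ⟨O, hO, hO₀, hOT⟩ := mem_nhdsWithin.1 hT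
  have hsm : ContDiffOn ℝ ∞ σ (O ∩ halfPlane) := by
    rw [← contMDiffOn_iff_contDiffOn]
    exact hs.comp (hι.comp_contMDiffOn (hφs.mono fun u hu => (hOT hu).1)) fun u hu => (hOT hu).2
  refine ⟨O, hO, hO₀, fun u hu => hOT hu, hsm, ?_⟩
  intro y hy hyO τ
  have hyH : φ y ∈ halfPlane := range_eq_halfPlane ▸ mem_range_self _
  have hyc : y ∈ (chartAt (EuclideanHalfSpace 2) y₀).source := by simpa [φ] using hy
  have d1 : MDifferentiableAt (𝓡∂ 2) 𝓘(ℝ, EuclideanSpace ℝ (Fin 2)) φ y :=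
    mdifferentiableAt_extChartAt hyc
  have d2 : DifferentiableWithinAt ℝ σ halfPlane (φ y) := by
    refine ((hsm _ ⟨hyO, hyH⟩).differentiableWithinAt (by simp)).mono_of_mem_nhdsWithin ?_
    exact inter_mem (mem_nhdsWithin_of_mem_nhds (hO.mem_nhds hyO)) self_mem_nhdsWithin
  have hσs : σ (φ y) ∈ e.source := e.map_target (hOT ⟨hyO, hyH⟩).2
  have d3 : MDifferentiableAt 𝓘(ℝ, ℂ × ℝ) (𝓡 3) e (σ (φ y)) := he.mdifferentiableAt hσs
  have e1 : mfderivWithin (𝓡∂ 2) 𝓘(ℝ, ℂ × ℝ) (σ ∘ φ) univ y =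
      (mfderivWithin 𝓘(ℝ, EuclideanSpace ℝ (Fin 2)) 𝓘(ℝ, ℂ × ℝ) σ halfPlane (φ y)).comp
        (mfderivWithin (𝓡∂ 2) 𝓘(ℝ, EuclideanSpace ℝ (Fin 2)) φ univ y) :=
    mfderivWithin_comp y d2.mdifferentiableWithinAt d1.mdifferentiableWithinAt
      (fun z _ => range_eq_halfPlane ▸ mem_range_self _) (uniqueMDiffWithinAt_univ _)
  have d4 : MDifferentiableAt (𝓡∂ 2) 𝓘(ℝ, ℂ × ℝ) (σ ∘ φ) y := by
    rw [← mdifferentiableWithinAt_univ]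
    exact d2.mdifferentiableWithinAt.comp y d1.mdifferentiableWithinAt
      (fun z _ => range_eq_halfPlane ▸ mem_range_self _)
  have e2 : mfderiv (𝓡∂ 2) (𝓡 3) (e ∘ (σ ∘ φ)) y = _ := mfderiv_comp y d3 d4
  have e3 : ι =ᶠ[𝓝 y] e ∘ (σ ∘ φ) := by
    have h1 : φ.source ∩ φ ⁻¹' O ∈ 𝓝 y :=
      ((continuousOn_extChartAt (I := 𝓡∂ 2) y₀).isOpen_inter_preimage
        (isOpen_extChartAt_source y₀) hO).mem_nhds ⟨hy, hyO⟩
    filter_upwards [h1] with z hz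
    have h2 := (hOT ⟨hz.2, range_eq_halfPlane ▸ mem_range_self _⟩).2
    have h2' : ι (φ.symm (φ z)) ∈ e.target := h2
    have h3 : e (e.symm (ι (φ.symm (φ z)))) = ι (φ.symm (φ z)) := e.right_inv h2'
    rw [φ.left_inv hz.1] at h3
    change ι z = e (e.symm (ι (φ.symm (φ z))))
    rw [φ.left_inv hz.1, h3]
  have e4 := e3.mfderiv_eq (I := 𝓡∂ 2) (I' := 𝓡 3)
  rw [mfderivWithin_univ, mfderivWithin_univ, mfderivWithin_eq_fderivWithin] at e1
  rw [e1] at e2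
  exact congrArg (fun A : EuclideanSpace ℝ (Fin 2) →L[ℝ] EuclideanSpace ℝ (Fin 3) => A τ) (e4.trans e2)

end BoundaryChart

/-! ### Orientation of the surface at a boundary point -/

section BoundaryFrame

open Set Filter

variable {M : Type*} [TopologicalSpace M] [ChartedSpace (EuclideanSpace ℝ (Fin 3)) M]
  [IsManifold (𝓡 3) ∞ M] {F : Type*} [TopologicalSpace F] [ChartedSpace (EuclideanHalfSpace 2) F]
  [IsManifold (𝓡∂ 2) ∞ F] {oM : ManifoldOrientation (𝓡 3) M 3}
  {oF : ManifoldOrientation (𝓡∂ 2) F 2} {ι : F → M} {m : ℕ} {L : OrientedLink M m}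

lemma det_planeBasis (a b : EuclideanSpace ℝ (Fin 2)) :
    (EuclideanSpace.basisFun (Fin 2) ℝ).toBasis.det ![a, b] = a 0 * b 1 - a 1 * b 0 := by
  rw [Module.Basis.det_apply, Matrix.det_fin_two]
  simp [Module.Basis.toMatrix_apply]
  ring

/-- Near a boundary point of a Seifert surface, in coordinates `e` in which the link is the axis: the
derivative of the surface at that point, and positive frames of the surface nearby. -/
lemma exists_boundary_frame [CompactSpace F] (hS : IsSeifertSurface L oF ι)
    {e : OpenPartialHomeomorph (ℂ × ℝ) M}
    (he : IsParam e e.source) (hs : ContMDiffOn (𝓡 3) 𝓘(ℝ, ℂ × ℝ) ∞ e.symm e.target) {y₀ : F}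
    (h0 : (0, 0) ∈ e.source) (hy₀ : e (0, 0) = ι y₀)
    (hL : ∀ q ∈ e.source, e q ∈ L.carrier → q.1 = 0)
    (hpos : ∀ᶠ q in 𝓝 ((0 : ℂ), (0 : ℝ)), ∀ v : Fin 3 → ℂ × ℝ,
      oM.IsPos (e q) (fun i => mfderiv 𝓘(ℝ, ℂ × ℝ) (𝓡 3) e q (v i)) ↔ 0 < tubeBasis.det v)
    {i : Fin m} {t k : ℝ} (hk : 0 < k) (hknot : L.knot i t = e (0, 0))
    (hknot' : (mfderiv 𝓘(ℝ, ℝ) (𝓡 3) (L.knot i) t (1 : ℝ) : EuclideanSpace ℝ (Fin 3)) =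
      mfderiv 𝓘(ℝ, ℂ × ℝ) (𝓡 3) e (0, 0) ((0 : ℂ), k)) :
    ∃ (c : ℂ) (a l : ℝ) (O : Set (EuclideanSpace ℝ (Fin 2))), c ≠ 0 ∧ l ≠ 0 ∧
      (extChartAt (𝓡∂ 2) y₀ y₀) 0 = 0 ∧
      fderivWithin ℝ (surfaceCoords ι e y₀) halfPlane (extChartAt (𝓡∂ 2) y₀ y₀) !₂[1, 0] = (c, a) ∧
      fderivWithin ℝ (surfaceCoords ι e y₀) halfPlane (extChartAt (𝓡∂ 2) y₀ y₀) !₂[0, 1] = (0, l) ∧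
      IsOpen O ∧ extChartAt (𝓡∂ 2) y₀ y₀ ∈ O ∧
      (∀ u ∈ O ∩ halfPlane, u ∈ (extChartAt (𝓡∂ 2) y₀).target ∧
        ι ((extChartAt (𝓡∂ 2) y₀).symm u) ∈ e.target) ∧
      ContDiffOn ℝ ∞ (surfaceCoords ι e y₀) (O ∩ halfPlane) ∧
      ∀ y ∈ (extChartAt (𝓡∂ 2) y₀).source, extChartAt (𝓡∂ 2) y₀ y ∈ O →
        ∃ v : Fin 2 → TangentSpace (𝓡∂ 2) y, oF.IsPos y v ∧ ∀ X : EuclideanSpace ℝ (Fin 3),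
          X = mfderiv 𝓘(ℝ, ℂ × ℝ) (𝓡 3) e (surfaceCoords ι e y₀ (extChartAt (𝓡∂ 2) y₀ y))
            (Complex.I * c, 0) →
          oM.IsPos (ι y) ![X, mfderiv (𝓡∂ 2) (𝓡 3) ι y (v 0), mfderiv (𝓡∂ 2) (𝓡 3) ι y (v 1)] := by
  have hIF : IsManifold (𝓡∂ 2) 1 F := IsManifold.of_le (n := ∞) (by simp)
  have hy₀t : ι y₀ ∈ e.target := hy₀ ▸ e.map_source h0
  obtain ⟨O, hO, hO₀, hOT, hsm, hder⟩ := surfaceCoords_spec hS.smooth he hs hy₀t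
  set φ := extChartAt (𝓡∂ 2) y₀ with hφ
  set σ := surfaceCoords ι e y₀ with hσ
  set p₀ := φ y₀ with hp₀
  have hy₀s : y₀ ∈ φ.source := mem_extChartAt_source y₀
  have hφH : ∀ y, φ y ∈ halfPlane := fun y => range_eq_halfPlane ▸ mem_range_self _
  have hσφ : ∀ y ∈ φ.source, σ (φ y) = e.symm (ι y) := fun y hy => by
    change e.symm (ι (φ.symm (φ y))) = _
    rw [φ.left_inv hy]
  have hσ₀ : σ p₀ = (0, 0) := by rw [hp₀, hσφ y₀ hy₀s, ← hy₀, e.left_inv h0]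
  have hcar : ∀ y, (𝓡∂ 2).IsBoundaryPoint y ↔ ι y ∈ L.carrier := by
    intro y
    rw [← hS.boundary]
    exact ⟨fun h => ⟨y, h, rfl⟩, fun ⟨y', h1, h2⟩ => hS.injective h2 ▸ h1⟩
  have hp₀0 : p₀ 0 = 0 := by
    refine (isBoundaryPoint_iff_extChartAt hy₀s).1 ((hcar y₀).2 ?_)
    rw [← hy₀, ← hknot]
    exact mem_iUnion.2 ⟨i, mem_range_self _⟩
  set A := fderivWithin ℝ σ halfPlane p₀ with hA
  have hAd : HasFDerivWithinAt σ A halfPlane p₀ := by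
    refine DifferentiableWithinAt.hasFDerivWithinAt ?_
    refine ((hsm _ ⟨hO₀, hφH y₀⟩).differentiableWithinAt (by simp)).mono_of_mem_nhdsWithin ?_
    exact inter_mem (mem_nhdsWithin_of_mem_nhds (hO.mem_nhds hO₀)) self_mem_nhdsWithin
  have hself : ∀ τ : EuclideanSpace ℝ (Fin 2),
      (mfderiv (𝓡∂ 2) 𝓘(ℝ, EuclideanSpace ℝ (Fin 2)) (extChartAt (𝓡∂ 2) y₀) y₀ τ :
        EuclideanSpace ℝ (Fin 2)) = τ := fun τ =>
    congrArg (fun D : EuclideanSpace ℝ (Fin 2) →L[ℝ] EuclideanSpace ℝ (Fin 2) => D τ)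
      (mfderiv_extChartAt_self (I := 𝓡∂ 2) (x := y₀))
  have hder₀ : ∀ τ : EuclideanSpace ℝ (Fin 2),
      (mfderiv (𝓡∂ 2) (𝓡 3) ι y₀ τ : EuclideanSpace ℝ (Fin 3)) =
        mfderiv 𝓘(ℝ, ℂ × ℝ) (𝓡 3) e (0, 0) (A τ) := by
    intro τ
    have h1 := hder y₀ hy₀s hO₀ τ
    rw [hself τ] at h1
    exact h1.trans (congrArg (fun q => (mfderiv 𝓘(ℝ, ℂ × ℝ) (𝓡 3) e q (A τ) :
      EuclideanSpace ℝ (Fin 3))) hσ₀)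
  have hAinj : Function.Injective A := by
    intro a b hab
    apply hS.immersed y₀
    exact (hder₀ a).trans ((congrArg (fun v => (mfderiv 𝓘(ℝ, ℂ × ℝ) (𝓡 3) e ((0 : ℂ), (0 : ℝ)) v :
      EuclideanSpace ℝ (Fin 3))) hab).trans (hder₀ b).symm)
  -- The boundary line of the half plane is mapped into the link, which is the axis in the
  -- coordinates `e`.
  have hA1 : (A !₂[0, 1]).1 = 0 := by
    have h1 : HasDerivAt (fun s : ℝ => p₀ + s • (!₂[0, 1] : EuclideanSpace ℝ (Fin 2)))
        !₂[0, 1] 0 := by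
      simpa using ((hasDerivAt_id (0 : ℝ)).smul_const (!₂[0, 1] : EuclideanSpace ℝ (Fin 2))).const_add p₀
    have hline0 : p₀ + (0 : ℝ) • (!₂[0, 1] : EuclideanSpace ℝ (Fin 2)) = p₀ := by simp
    have hzero : ∀ s : ℝ, (p₀ + s • (!₂[0, 1] : EuclideanSpace ℝ (Fin 2))) 0 = 0 := by
      intro s; simp [hp₀0]
    have hH : ∀ s : ℝ, p₀ + s • (!₂[0, 1] : EuclideanSpace ℝ (Fin 2)) ∈ halfPlane := fun s =>
      (hzero s).ge
    have h2 : HasDerivAt (fun s : ℝ => σ (p₀ + s • (!₂[0, 1] : EuclideanSpace ℝ (Fin 2))))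
        (A !₂[0, 1]) 0 := by
      rw [← hasDerivWithinAt_univ] at h1 ⊢
      have hAd' : HasFDerivWithinAt σ A halfPlane
          (p₀ + (0 : ℝ) • (!₂[0, 1] : EuclideanSpace ℝ (Fin 2))) := by rwa [hline0]
      exact hAd'.comp_hasDerivWithinAt (0 : ℝ) h1 fun s _ => hH s
    have h3 : HasDerivAt (fun s : ℝ => (σ (p₀ + s • (!₂[0, 1] : EuclideanSpace ℝ (Fin 2)))).1)
        (A !₂[0, 1]).1 0 := h2.fst
    refine h3.unique ((hasDerivAt_const (0 : ℝ) (0 : ℂ)).congr_of_eventuallyEq ?_)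
    have h4 : ∀ᶠ s : ℝ in 𝓝 0, p₀ + s • (!₂[0, 1] : EuclideanSpace ℝ (Fin 2)) ∈ O :=
      h1.continuousAt.eventually (hO.mem_nhds (by
        change p₀ + (0 : ℝ) • (!₂[0, 1] : EuclideanSpace ℝ (Fin 2)) ∈ O
        rw [hline0]; exact hO₀))
    filter_upwards [h4] with s hsO
    obtain ⟨h5, h6⟩ := hOT _ ⟨hsO, hH s⟩
    set u := p₀ + s • (!₂[0, 1] : EuclideanSpace ℝ (Fin 2)) with hu
    refine hL _ (e.map_target h6) ?_
    rw [show e (σ u) = ι (φ.symm u) from e.right_inv h6, ← hcar,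
      isBoundaryPoint_iff_extChartAt (φ.map_target h5)]
    change (φ (φ.symm u)) 0 = 0
    rw [φ.right_inv h5]
    exact hzero s
  obtain ⟨c, a, hca⟩ : ∃ c a, A !₂[1, 0] = (c, a) := ⟨_, _, rfl⟩
  obtain ⟨l, hl⟩ : ∃ l, A !₂[0, 1] = (0, l) := ⟨_, Prod.ext hA1 rfl⟩
  have hl0 : l ≠ 0 := by
    rintro rfl
    have h1 : A !₂[0, 1] = A 0 := by rw [hl, map_zero]; rfl
    have := congrArg (fun u : EuclideanSpace ℝ (Fin 2) => u 1) (hAinj h1)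
    simp at this
  have hc0 : c ≠ 0 := by
    rintro rfl
    have h1 : A (l • !₂[1, 0] - a • !₂[0, 1]) = A 0 := by
      rw [map_sub, map_smul, map_smul, hca, hl, map_zero]
      ext <;> simp [mul_comm]
    have := congrArg (fun u : EuclideanSpace ℝ (Fin 2) => u 0) (hAinj h1)
    simp [hl0] at this
  obtain ⟨ε, hε, hεev⟩ := oF.eventually_isPos_iff_chart (EuclideanSpace.basisFun (Fin 2) ℝ).toBasis y₀
  -- The vector `(-1, 0)` points outward, and `(0, k / l)` is mapped to the velocity of the knot. By
  -- "outward normal first" this pair is positive, so `-ε * (k / l) > 0`, where `k > 0`.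
  have hεl : ε * l < 0 := by
    have h1 := hS.oriented y₀ i t (hy₀.symm.trans hknot.symm)
      (!₂[-1, 0] : EuclideanSpace ℝ (Fin 2)) (!₂[0, k / l] : EuclideanSpace ℝ (Fin 2)) (by
        unfold IsOutward
        rw [hself]
        simp) (by
        rw [hknot', hder₀]
        have : A !₂[0, k / l] = ((0 : ℂ), k) := by
          have h2 : (!₂[0, k / l] : EuclideanSpace ℝ (Fin 2)) = (k / l) • !₂[0, 1] := by
            ext j; fin_cases j <;> simp
          rw [h2, map_smul, hl]
          ext <;> simp [hl0]
        rw [this])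
    have h2 := (hεev.self_of_nhds _).1 h1
    have h3 : (fun j => (mfderiv (𝓡∂ 2) 𝓘(ℝ, EuclideanSpace ℝ (Fin 2)) (extChartAt (𝓡∂ 2) y₀) y₀
        ((![(!₂[-1, 0] : EuclideanSpace ℝ (Fin 2)), (!₂[0, k / l] : EuclideanSpace ℝ (Fin 2))] :
          Fin 2 → EuclideanSpace ℝ (Fin 2)) j) : EuclideanSpace ℝ (Fin 2))) =
        ![!₂[-1, 0], !₂[0, k / l]] := by
      funext j
      fin_cases j
      · exact hself _
      · exact hself _
    have h4 : 0 < ε * (EuclideanSpace.basisFun (Fin 2) ℝ).toBasis.det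
        ![(!₂[-1, 0] : EuclideanSpace ℝ (Fin 2)), !₂[0, k / l]] := by
      rw [← h3]; exact h2
    rw [det_planeBasis] at h4
    simp at h4
    rcases hε with rfl | rfl
    · have h5 : k / l < 0 := by linarith
      have := (div_neg_iff.1 h5)
      rcases this with h | h <;> linarith [h.1, h.2]
    · have h5 : 0 < k / l := by linarith
      have := (div_pos_iff.1 h5)
      rcases this with h | h <;> linarith [h.1, h.2]
  -- At the boundary point `d = -ε * l * ‖c‖²`, which is positive by `hεl`: as the surface leaves
  -- the axis in the direction `c`, the direction `i c` crosses it positively. By continuity this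
  -- persists nearby.
  let d : EuclideanSpace ℝ (Fin 2) → ℝ := fun u => ε * tubeBasis.det
    ![(Complex.I * c, 0), fderivWithin ℝ σ halfPlane u !₂[1, 0], fderivWithin ℝ σ halfPlane u !₂[0, 1]]
  have hOH : UniqueDiffOn ℝ (O ∩ halfPlane) := by
    rw [inter_comm]; exact uniqueDiffOn_halfPlane.inter hO
  have hdc : ContinuousWithinAt d halfPlane p₀ := by
    have h1 : ContinuousWithinAt (fderivWithin ℝ σ (O ∩ halfPlane)) (O ∩ halfPlane) p₀ :=
      hsm.continuousOn_fderivWithin hOH (by simp) _ ⟨hO₀, hφH y₀⟩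
    have h2 : ContinuousWithinAt (fderivWithin ℝ σ halfPlane) halfPlane p₀ := by
      have hmem : O ∩ halfPlane ∈ 𝓝[halfPlane] p₀ :=
        inter_mem (mem_nhdsWithin_of_mem_nhds (hO.mem_nhds hO₀)) self_mem_nhdsWithin
      refine (h1.mono_of_mem_nhdsWithin hmem).congr_of_eventuallyEq_of_mem ?_ (hφH y₀)
      filter_upwards [hmem] with u hu
      rw [inter_comm]
      exact (fderivWithin_inter (hO.mem_nhds hu.1)).symm
    have h3 : ∀ w : EuclideanSpace ℝ (Fin 2), ContinuousWithinAt
        (fun u => fderivWithin ℝ σ halfPlane u w) halfPlane p₀ := fun w =>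
      h2.clm_apply continuousWithinAt_const
    have h4 := h3 !₂[1, 0]
    have h5 := h3 !₂[0, 1]
    simp only [d, det_vec3, (tubeBasis_repr _).1, (tubeBasis_repr _).2.1, (tubeBasis_repr _).2.2]
    have g1 : ∀ {w : EuclideanSpace ℝ (Fin 2)}, ContinuousWithinAt
        (fun u => (fderivWithin ℝ σ halfPlane u w).1.re) halfPlane p₀ :=
      fun {w} => Complex.continuous_re.continuousAt.comp_continuousWithinAt (h3 w).fst
    have g2 : ∀ {w : EuclideanSpace ℝ (Fin 2)}, ContinuousWithinAt
        (fun u => (fderivWithin ℝ σ halfPlane u w).1.im) halfPlane p₀ :=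
      fun {w} => Complex.continuous_im.continuousAt.comp_continuousWithinAt (h3 w).fst
    have g3 : ∀ {w : EuclideanSpace ℝ (Fin 2)}, ContinuousWithinAt
        (fun u => (fderivWithin ℝ σ halfPlane u w).2) halfPlane p₀ := fun {w} => (h3 w).snd
    simp only [Matrix.cons_val_zero, Matrix.cons_val_one, Matrix.cons_val]
    exact continuousWithinAt_const.mul (((continuousWithinAt_const.mul ((g2.mul g3).sub (g2.mul g3))).sub
      (g1.mul ((continuousWithinAt_const.mul g3).sub (g2.mul continuousWithinAt_const)))).add
      (g1.mul ((continuousWithinAt_const.mul g3).sub (g2.mul continuousWithinAt_const))))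
  have hd₀ : 0 < d p₀ := by
    have h1 : d p₀ = -(ε * l) * (c.re * c.re + c.im * c.im) := by
      change ε * tubeBasis.det ![(Complex.I * c, 0), A !₂[1, 0], A !₂[0, 1]] = _
      rw [hca, hl, det_vec3]
      simp [tubeBasis_repr]
      ring
    have h2 := Complex.normSq_pos.2 hc0
    rw [Complex.normSq_apply] at h2
    rw [h1]
    exact mul_pos (by linarith) h2
  have hev : ∀ᶠ u in 𝓝[halfPlane] p₀, 0 < d u := hdc.eventually (lt_mem_nhds hd₀)
  have hφsymm : Tendsto φ.symm (𝓝[halfPlane] p₀) (𝓝 y₀) := by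
    have := (continuousAt_extChartAt_symm (I := 𝓡∂ 2) y₀).tendsto
    rw [extChartAt_to_inv] at this
    exact this.mono_left nhdsWithin_le_nhds
  have hσt : Tendsto σ (𝓝[halfPlane] p₀) (𝓝 (0, 0)) := by
    rw [← hσ₀]; exact hAd.continuousWithinAt
  obtain ⟨O', hO', hO'₀, hO'g⟩ := mem_nhdsWithin.1
    (hev.and ((hφsymm.eventually hεev).and (hσt.eventually hpos)))
  refine ⟨c, a, l, O ∩ O', hc0, hl0, hp₀0, hca, hl, hO.inter hO', ⟨hO₀, hO'₀⟩,
    fun u hu => hOT u ⟨hu.1.1, hu.2⟩, hsm.mono (inter_subset_inter_left _ inter_subset_left), ?_⟩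
  intro y hy hyO
  obtain ⟨h1, h2, h3⟩ := hO'g ⟨hyO.2, hφH y⟩
  rw [φ.left_inv hy] at h2
  set Dφ : EuclideanSpace ℝ (Fin 2) →L[ℝ] EuclideanSpace ℝ (Fin 2) :=
    mfderiv (𝓡∂ 2) 𝓘(ℝ, EuclideanSpace ℝ (Fin 2)) (extChartAt (𝓡∂ 2) y₀) y with hDφ
  have hsurj : Function.Surjective Dφ := by
    obtain ⟨f, hf⟩ := isInvertible_mfderiv_extChartAt (I := 𝓡∂ 2) hy
    intro w
    refine ⟨f.symm w, ?_⟩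
    rw [hDφ, ← hf]
    exact f.apply_symm_apply w
  obtain ⟨v0, hv0⟩ := hsurj !₂[1, 0]
  -- The factor `ε` makes the pair `(v0, v1)` positive for `oF`.
  obtain ⟨v1, hv1⟩ := hsurj (ε • !₂[0, 1])
  have hεε : ε * ε = 1 := by rcases hε with rfl | rfl <;> norm_num
  refine ⟨![v0, v1], ?_, ?_⟩
  · rw [h2]
    have h4 : (fun j => Dφ ((![v0, v1] : Fin 2 → EuclideanSpace ℝ (Fin 2)) j)) =
        ![!₂[1, 0], ε • !₂[0, 1]] := by
      funext j
      fin_cases j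
      · exact hv0
      · exact hv1
    change 0 < ε * (EuclideanSpace.basisFun (Fin 2) ℝ).toBasis.det
      (fun j => Dφ ((![v0, v1] : Fin 2 → EuclideanSpace ℝ (Fin 2)) j))
    rw [h4, det_planeBasis]
    simp [hεε]
  · intro X hX
    have hιy : ι y = e (σ (φ y)) := by
      have h5 := (hOT (φ y) ⟨hyO.1, hφH y⟩).2
      rw [φ.left_inv hy] at h5
      rw [hσφ y hy, e.right_inv h5]
    set D := fderivWithin ℝ σ halfPlane (φ y) with hD
    have e0 := hder y hy hyO.1 v0
    have e1 := hder y hy hyO.1 v1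
    have h4 := (h3 ![(Complex.I * c, 0), D !₂[1, 0], D (ε • !₂[0, 1])]).2 (by
      have h5 : tubeBasis.det ![(Complex.I * c, 0), D !₂[1, 0], D (ε • !₂[0, 1])] = d (φ y) := by
        change _ = ε * tubeBasis.det ![(Complex.I * c, 0), D !₂[1, 0], D !₂[0, 1]]
        rw [det_vec3, det_vec3, map_smul]
        simp [tubeBasis_repr]
        ring
      rw [h5]; exact h1)
    refine (oM.isPos_congr hιy _).2 ?_
    refine (iff_of_eq (congrArg (oM.IsPos (e (σ (φ y)))) ?_)).2 h4
    funext j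
    fin_cases j
    · exact hX
    · exact e0.trans (congrArg (fun w => (mfderiv 𝓘(ℝ, ℂ × ℝ) (𝓡 3) e (σ (φ y)) (D w) :
        EuclideanSpace ℝ (Fin 3))) hv0)
    · exact e1.trans (congrArg (fun w => (mfderiv 𝓘(ℝ, ℂ × ℝ) (𝓡 3) e (σ (φ y)) (D w) :
        EuclideanSpace ℝ (Fin 3))) hv1)

end BoundaryFrame

/-! ### Straightening the surface near its boundary -/

section BoundaryParam

open Set Filter

/-- The real linear automorphism `(ζ, t) ↦ (c ζ, a Re ζ + l t)`. -/
def shearEquiv {c : ℂ} {l : ℝ} (a : ℝ) (hc : c ≠ 0) (hl : l ≠ 0) : (ℂ × ℝ) ≃L[ℝ] (ℂ × ℝ) :=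
  LinearEquiv.toContinuousLinearEquiv
    { toFun := fun q => (c * q.1, a * q.1.re + l * q.2)
      invFun := fun q => (c⁻¹ * q.1, (q.2 - a * (c⁻¹ * q.1).re) / l)
      map_add' := fun p q => by ext <;> simp <;> ring
      map_smul' := fun r q => by ext <;> simp <;> ring
      left_inv := fun q => by ext <;> simp [hc, hl]
      right_inv := fun q => by
        ext1
        · exact mul_inv_cancel_left₀ hc _
        · change a * (c⁻¹ * q.1).re + l * ((q.2 - a * (c⁻¹ * q.1).re) / l) = q.2
          field_simp
          ring }

lemma shearEquiv_symm_apply {c : ℂ} {l : ℝ} (a : ℝ) (hc : c ≠ 0) (hl : l ≠ 0) (q : ℂ × ℝ) :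
    (shearEquiv a hc hl).symm q = (c⁻¹ * q.1, (q.2 - a * (c⁻¹ * q.1).re) / l) := rfl

/-- The projection `(ζ, t) ↦ (Re ζ, t)`. -/
def rePlane : (ℂ × ℝ) →L[ℝ] EuclideanSpace ℝ (Fin 2) :=
  LinearMap.toContinuousLinearMap
    { toFun := fun q => !₂[q.1.re, q.2]
      map_add' := fun p q => by ext i; fin_cases i <;> simp
      map_smul' := fun r q => by ext i; fin_cases i <;> simp }

lemma rePlane_apply (q : ℂ × ℝ) : rePlane q = !₂[q.1.re, q.2] := rfl

variable {M : Type*} [TopologicalSpace M] [ChartedSpace (EuclideanSpace ℝ (Fin 3)) M]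
  [IsManifold (𝓡 3) ∞ M] {F : Type*} [TopologicalSpace F] [ChartedSpace (EuclideanHalfSpace 2) F]
  [IsManifold (𝓡∂ 2) ∞ F] {oM : ManifoldOrientation (𝓡 3) M 3}
  {oF : ManifoldOrientation (𝓡∂ 2) F 2} {ι : F → M} {m : ℕ} {L : OrientedLink M m}

/-- `E` is a local homeomorphism straightening a surface with boundary, read in the coordinates `e` in which
the boundary is the axis: the surface is the half plane `Im ζ = 0 ≤ Re ζ`, crossed positively by
the lines in the direction of increasing `Im ζ`; at the points of the axis `ζ` is comparable to the
first coordinate. -/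
structure IsBoundaryParam (oM : ManifoldOrientation (𝓡 3) M 3) (oF : ManifoldOrientation (𝓡∂ 2) F 2)
    (ι : F → M) (θ : ℂ × ℝ → M) (E : OpenPartialHomeomorph (ℂ × ℝ) (ℂ × ℝ)) (c : ℂ) : Prop where
  ne_zero : c ≠ 0
  mem_target : (0, 0) ∈ E.target
  mem_range_iff : ∀ q ∈ E.source, θ (E q) ∈ range ι ↔ q.1.im = 0 ∧ 0 ≤ q.1.re
  axis : ∀ q ∈ E.source, q.1 = 0 → (E q).1 = 0
  crossing : ∀ q ∈ E.source, q.1.im = 0 → 0 ≤ q.1.re →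
    IsCrossing oM oF ι (fun s : ℝ => θ (E (q.1 + s * Complex.I, q.2))) 1 0
  tendsto : Tendsto (fun w : ℂ => (E.symm (w, 0)).1 / w) (𝓝[≠] 0) (𝓝 c)

/-- The surface is extended past its boundary and thickened in the direction `i c`. The extension is
only strictly differentiable at the base point, which suffices for the inverse function theorem and
gives a local homeomorphism. The derivative has first component `c ζ`, so the new coordinate `ζ` is
asymptotic to `c⁻¹ w`. -/
lemma exists_isBoundaryParam [CompactSpace F] [T2Space M] (hS : IsSeifertSurface L oF ι)
    {e : OpenPartialHomeomorph (ℂ × ℝ) M}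
    (he : IsParam e e.source) (hs : ContMDiffOn (𝓡 3) 𝓘(ℝ, ℂ × ℝ) ∞ e.symm e.target) {y₀ : F}
    (h0 : (0, 0) ∈ e.source) (hy₀ : e (0, 0) = ι y₀)
    (hL : ∀ q ∈ e.source, e q ∈ L.carrier → q.1 = 0)
    (hpos : ∀ᶠ q in 𝓝 ((0 : ℂ), (0 : ℝ)), ∀ v : Fin 3 → ℂ × ℝ,
      oM.IsPos (e q) (fun i => mfderiv 𝓘(ℝ, ℂ × ℝ) (𝓡 3) e q (v i)) ↔ 0 < tubeBasis.det v)
    {i : Fin m} {t k : ℝ} (hk : 0 < k) (hknot : L.knot i t = e (0, 0))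
    (hknot' : (mfderiv 𝓘(ℝ, ℝ) (𝓡 3) (L.knot i) t (1 : ℝ) : EuclideanSpace ℝ (Fin 3)) =
      mfderiv 𝓘(ℝ, ℂ × ℝ) (𝓡 3) e (0, 0) ((0 : ℂ), k)) :
    ∃ E c, IsBoundaryParam oM oF ι e E c ∧ E.target ⊆ e.source := by
  obtain ⟨c, a, l, O, hc, hl, hp₀0, hA0, hA1, hO, hO₀, hOT, hsm, hfr⟩ :=
    exists_boundary_frame hS he hs h0 hy₀ hL hpos hk hknot hknot'
  set φ := extChartAt (𝓡∂ 2) y₀ with hφ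
  set σ := surfaceCoords ι e y₀ with hσ
  set p₀ := φ y₀ with hp₀
  set A := fderivWithin ℝ σ halfPlane p₀ with hA
  have hy₀s : y₀ ∈ φ.source := mem_extChartAt_source y₀
  have hφH : ∀ y, φ y ∈ halfPlane := fun y => range_eq_halfPlane ▸ mem_range_self _
  have hσφ : ∀ y ∈ φ.source, σ (φ y) = e.symm (ι y) := fun y hy => by
    change e.symm (ι (φ.symm (φ y))) = _
    rw [φ.left_inv hy]
  have hσ₀ : σ p₀ = (0, 0) := by rw [hp₀, hσφ y₀ hy₀s, ← hy₀, e.left_inv h0]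
  have hcar : ∀ y, (𝓡∂ 2).IsBoundaryPoint y ↔ ι y ∈ L.carrier := by
    intro y
    rw [← hS.boundary]
    exact ⟨fun h => ⟨y, h, rfl⟩, fun ⟨y', h1, h2⟩ => hS.injective h2 ▸ h1⟩
  let σ' : EuclideanSpace ℝ (Fin 2) → ℂ × ℝ := fun u => σ (clampPlane u) + A (u - clampPlane u)
  have hσ' : ∀ u ∈ halfPlane, σ' u = σ u := fun u hu => by simp [σ', clampPlane_of_mem hu]
  -- The half plane `Im ζ = 0 ≤ Re ζ` goes to the surface, and over its points the lines in the
  -- direction of `Im ζ` have velocity `(i c, 0)`, a positive crossing direction by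
  -- `exists_boundary_frame`.
  let Ψ : ℂ × ℝ → ℂ × ℝ := fun q => σ' (rePlane q) + (Complex.I * c * q.1.im, 0)
  let q₀ : ℂ × ℝ := (0, p₀ 1)
  have hq₀ : rePlane q₀ = p₀ := by
    ext j; fin_cases j <;> simp [rePlane_apply, q₀, hp₀0]
  have hΨ₀ : Ψ q₀ = (0, 0) := by
    change σ' (rePlane q₀) + (Complex.I * c * ((0 : ℂ).im : ℝ), 0) = _
    rw [hq₀, hσ' _ (hφH y₀), hσ₀]
    simp
  have hΨd : HasStrictFDerivAt Ψ (shearEquiv a hc hl : (ℂ × ℝ) →L[ℝ] (ℂ × ℝ)) q₀ := by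
    have h1 : HasStrictFDerivAt σ' A (rePlane q₀) := by
      rw [hq₀]
      refine hasStrictFDerivAt_clampExtension (hφH y₀) ?_
      refine ((hsm _ ⟨hO₀, hφH y₀⟩).of_le (by simp)).mono_of_mem_nhdsWithin ?_
      exact inter_mem (mem_nhdsWithin_of_mem_nhds (hO.mem_nhds hO₀)) self_mem_nhdsWithin
    let K : (ℂ × ℝ) →L[ℝ] (ℂ × ℝ) := LinearMap.toContinuousLinearMap
      { toFun := fun q => (Complex.I * c * q.1.im, 0)
        map_add' := fun p q => by ext <;> simp <;> ring
        map_smul' := fun r q => by ext <;> simp <;> ring }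
    have h2 : HasStrictFDerivAt Ψ (A.comp rePlane + K) q₀ :=
      (h1.comp q₀ rePlane.hasStrictFDerivAt).add K.hasStrictFDerivAt
    refine h2.congr_fderiv ?_
    refine ContinuousLinearMap.ext fun q => ?_
    change A (rePlane q) + (Complex.I * c * q.1.im, 0) = (c * q.1, a * q.1.re + l * q.2)
    have h3 : rePlane q = q.1.re • !₂[1, 0] + q.2 • !₂[0, 1] := by
      ext j; fin_cases j <;> simp [rePlane_apply]
    rw [h3, map_add, map_smul, map_smul, hA0, hA1]
    ext1
    · change (q.1.re • (c, a) + q.2 • ((0 : ℂ), l)).1 + Complex.I * c * q.1.im = c * q.1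
      simp
      linear_combination c * Complex.re_add_im q.1
    · simp
      ring
  let E₀ := hΨd.toOpenPartialHomeomorph Ψ
  have hE₀ : ∀ q, E₀ q = Ψ q := fun q => rfl
  have hq₀E : q₀ ∈ E₀.source := hΨd.mem_toOpenPartialHomeomorph_source
  have hΨc : ContinuousAt Ψ q₀ := hΨd.continuousAt
  have hπ : ContinuousAt (fun q : ℂ × ℝ => rePlane q) q₀ := rePlane.continuous.continuousAt
  have ev1 : ∀ᶠ q in 𝓝 q₀, Ψ q ∈ e.source :=
    hΨc.eventually (e.open_source.mem_nhds (by rw [hΨ₀]; exact h0))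
  have ev2 : ∀ᶠ q in 𝓝 q₀, rePlane q ∈ O := hπ.eventually (hO.mem_nhds (by
    change rePlane q₀ ∈ O
    rw [hq₀]; exact hO₀))
  let N₀ : Set F := {y | y ∈ φ.source ∧ φ y ∈ O ∧ (((φ y 0 : ℝ) : ℂ), φ y 1) ∈ E₀.source}
  have hN₀ : N₀ ∈ 𝓝 y₀ := by
    have hφc : ContinuousAt φ y₀ := continuousAt_extChartAt y₀
    refine inter_mem (extChartAt_source_mem_nhds y₀) (inter_mem (hφc.preimage_mem_nhds (hO.mem_nhds hO₀)) ?_)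
    have h1 : ContinuousAt (fun y => (((φ y 0 : ℝ) : ℂ), φ y 1)) y₀ := by
      have h2 : Continuous fun u : EuclideanSpace ℝ (Fin 2) => (((u 0 : ℝ) : ℂ), u 1) := by fun_prop
      exact h2.continuousAt.comp hφc
    refine h1.preimage_mem_nhds (E₀.open_source.mem_nhds ?_)
    change (((p₀ 0 : ℝ) : ℂ), p₀ 1) ∈ E₀.source
    rw [hp₀0]
    exact hq₀E
  -- No other sheet of the surface enters the neighbourhood, so `Ψ` detects membership in the
  -- surface and not just one inclusion.
  have ev3 : ∀ᶠ q in 𝓝 q₀, ∀ y, ι y = e (Ψ q) → y ∈ N₀ := by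
    have h1 := eventually_forall_mem_of_injective hS.smooth.continuous hS.injective hN₀
    have h2 : ContinuousAt (fun q => e (Ψ q)) q₀ := by
      refine ContinuousAt.comp (g := e) (f := Ψ) ?_ hΨc
      rw [hΨ₀]
      exact e.continuousAt h0
    have h3 : e (Ψ q₀) = ι y₀ := by rw [hΨ₀, hy₀]
    rw [← h3] at h1
    exact h2.eventually h1
  obtain ⟨G, hG, hGo, hG₀⟩ := eventually_nhds_iff.1 (ev1.and (ev2.and ev3))
  let E := E₀.restrOpen G hGo
  have hEs : E.source = E₀.source ∩ G := E₀.restrOpen_source G hGo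
  have hE : ∀ q, E q = Ψ q := fun q => rfl
  have hq₀s : q₀ ∈ E.source := by rw [hEs]; exact ⟨hq₀E, hG₀⟩
  have key : ∀ q ∈ E.source, q.1.im = 0 → 0 ≤ q.1.re →
      rePlane q ∈ φ.target ∧ Ψ q = σ (rePlane q) ∧ e (Ψ q) = ι (φ.symm (rePlane q)) := by
    intro q hq him hre
    rw [hEs] at hq
    obtain ⟨h1, h2, h3⟩ := hG q hq.2
    have hH : rePlane q ∈ halfPlane := by simpa [rePlane_apply, halfPlane] using hre
    obtain ⟨h4, h5⟩ := hOT _ ⟨h2, hH⟩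
    have h6 : Ψ q = σ (rePlane q) := by
      change σ' (rePlane q) + (Complex.I * c * (q.1.im : ℝ), 0) = _
      rw [hσ' _ hH, him]
      simp
    refine ⟨h4, h6, ?_⟩
    rw [h6]
    exact e.right_inv h5
  refine ⟨E, c⁻¹, ⟨inv_ne_zero hc, ?_, ?_, ?_, ?_, ?_⟩, ?_⟩
  · rw [← hΨ₀, ← hE]; exact E.map_source hq₀s
  · intro q hq
    constructor
    · rintro ⟨y, hy⟩
      rw [hEs] at hq
      obtain ⟨h1, h2, h3⟩ := hG q hq.2
      rw [hE] at hy
      obtain ⟨h4, h5, h6⟩ := h3 y hy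
      set q' : ℂ × ℝ := (((φ y 0 : ℝ) : ℂ), φ y 1) with hq'
      have h7 : rePlane q' = φ y := by
        ext j; fin_cases j <;> simp [rePlane_apply, hq']
      have h8 : Ψ q' = Ψ q := by
        change σ' (rePlane q') + (Complex.I * c * (((φ y 0 : ℝ) : ℂ).im : ℝ), 0) = _
        rw [h7, hσ' _ (hφH y), hσφ y h4, hy, e.left_inv h1]
        simp
      have h9 : q' = q := E₀.injOn h6 hq.1 h8
      rw [← h9]
      exact ⟨by simp [hq'], by simpa [hq'] using (show 0 ≤ φ y 0 from hφH y)⟩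
    · rintro ⟨him, hre⟩
      rw [hE, (key q hq him hre).2.2]
      exact mem_range_self _
  · intro q hq h
    obtain ⟨h1, -, h2⟩ := key q hq (by simp [h]) (by simp [h])
    rw [hEs] at hq
    refine hL _ (hG q hq.2).1 ?_
    rw [hE, h2, ← hcar, isBoundaryPoint_iff_extChartAt (φ.map_target h1)]
    change (φ (φ.symm (rePlane q))) 0 = 0
    rw [φ.right_inv h1]
    simp [rePlane_apply, h]
  · intro q hq him hre
    obtain ⟨h1, h2, h3⟩ := key q hq him hre
    rw [hEs] at hq
    set y := φ.symm (rePlane q) with hy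
    have hys : y ∈ φ.source := φ.map_target h1
    have hφy : φ y = rePlane q := φ.right_inv h1
    obtain ⟨v, hv, hv'⟩ := hfr y hys (by rw [hφy]; exact (hG q hq.2).2.1)
    have hq0 : (q.1 + ((0 : ℝ) : ℂ) * Complex.I, q.2) = q := by simp
    refine ⟨y, ?_, v, hv, ?_⟩
    · change ι y = e (Ψ (q.1 + ((0 : ℝ) : ℂ) * Complex.I, q.2))
      rw [hq0, h3]
    · have hcurve : ∀ s : ℝ, Ψ (q.1 + s * Complex.I, q.2) = Ψ q + s • (Complex.I * c, 0) := by
        intro s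
        change σ' (rePlane (q.1 + s * Complex.I, q.2)) +
          (Complex.I * c * ((q.1 + s * Complex.I).im : ℝ), 0) =
          σ' (rePlane q) + (Complex.I * c * (q.1.im : ℝ), 0) + s • (Complex.I * c, 0)
        have : rePlane (q.1 + s * Complex.I, q.2) = rePlane q := by simp [rePlane_apply]
        rw [this]
        refine Eq.trans ?_ (add_assoc _ _ _).symm
        refine congrArg (σ' (rePlane q) + ·) ?_
        ext1
        · simp [him, mul_comm]
        · simp
      have hd : HasDerivAt (fun s : ℝ => Ψ (q.1 + s * Complex.I, q.2)) (Complex.I * c, 0) 0 := by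
        simp only [hcurve]
        simpa using ((hasDerivAt_id (0 : ℝ)).smul_const ((Complex.I * c, (0 : ℝ)) : ℂ × ℝ)).const_add (Ψ q)
      have hX : (mfderiv 𝓘(ℝ, ℝ) (𝓡 3) (fun s : ℝ => e (E (q.1 + s * Complex.I, q.2))) 0 (1 : ℝ) :
          EuclideanSpace ℝ (Fin 3)) = mfderiv 𝓘(ℝ, ℂ × ℝ) (𝓡 3) e
            (Ψ (q.1 + ((0 : ℝ) : ℂ) * Complex.I, q.2)) (Complex.I * c, 0) := he.mfderiv_curve (γ := fun s : ℝ => e (E (q.1 + s * Complex.I, q.2)))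
        (q := fun s : ℝ => Ψ (q.1 + s * Complex.I, q.2))
        (Eventually.of_forall fun s => rfl) hd (by rw [hq0]; exact (hG q hq.2).1)
      have hXq : Ψ (q.1 + ((0 : ℝ) : ℂ) * Complex.I, q.2) = σ (φ y) := by rw [hq0, h2, hφy]
      have hX' : (mfderiv 𝓘(ℝ, ℂ × ℝ) (𝓡 3) e (Ψ (q.1 + ((0 : ℝ) : ℂ) * Complex.I, q.2))
          (Complex.I * c, 0) : EuclideanSpace ℝ (Fin 3)) =
          mfderiv 𝓘(ℝ, ℂ × ℝ) (𝓡 3) e (σ (φ y)) (Complex.I * c, 0) := by rw [hXq]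
      refine (iff_of_eq (congrArg (oM.IsPos (ι y)) ?_)).2 (hv' _ (hX.trans hX'))
      funext j
      fin_cases j
      · rfl
      · exact one_smul ℝ _
      · rfl
  · have h1 : HasStrictFDerivAt E.symm ((shearEquiv a hc hl).symm : (ℂ × ℝ) →L[ℝ] (ℂ × ℝ)) (Ψ q₀) :=
      hΨd.to_localInverse
    rw [hΨ₀] at h1
    have h2 : HasFDerivAt (fun w : ℂ => (E.symm (w, 0)).1)
        ((ContinuousLinearMap.fst ℝ ℂ ℝ).comp (((shearEquiv a hc hl).symm :
          (ℂ × ℝ) →L[ℝ] (ℂ × ℝ)).comp (ContinuousLinearMap.inl ℝ ℂ ℝ))) 0 := by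
      have h3 : HasFDerivAt (fun w : ℂ => E.symm (w, (0 : ℝ))) _ 0 :=
        HasFDerivAt.comp (g := E.symm) (f := fun w : ℂ => (w, (0 : ℝ))) (0 : ℂ) h1.hasFDerivAt
        (ContinuousLinearMap.inl ℝ ℂ ℝ).hasFDerivAt
      exact h3.fst
    -- The real derivative at the base point is multiplication by `c⁻¹`, hence complex linear, and a
    -- complex derivative yields the limit of the quotient.
    have h4 : HasFDerivAt (fun w : ℂ => (E.symm (w, 0)).1)
        (ContinuousLinearMap.toSpanSingleton ℂ c⁻¹) 0 := by
      refine hasFDerivAt_of_restrictScalars ℝ h2 ?_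
      ext1 <;> simp [shearEquiv_symm_apply, mul_comm]
    have h5 : HasDerivAt (fun w : ℂ => (E.symm (w, 0)).1) c⁻¹ 0 := by
      simpa using h4.hasDerivAt
    have h6 : E.symm (0, 0) = q₀ := by rw [← hΨ₀, ← hE, E.left_inv hq₀s]
    have h7 := hasDerivAt_iff_tendsto_slope.1 h5
    refine h7.congr fun w => ?_
    rw [slope_def_field, h6]
    simp [q₀]
  · intro q hq
    have h1 := E.map_target hq
    rw [hEs] at h1
    rw [← E.right_inv hq]
    exact (hG _ h1.2).1

end BoundaryParam

/-! ### The dual circle-valued function near the link -/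

section Winding

open Set Filter

variable {M : Type*} [TopologicalSpace M] [ChartedSpace (EuclideanSpace ℝ (Fin 3)) M]
  [IsManifold (𝓡 3) ∞ M] {F : Type*} [TopologicalSpace F] [ChartedSpace (EuclideanHalfSpace 2) F]
  [IsManifold (𝓡∂ 2) ∞ F] {oM : ManifoldOrientation (𝓡 3) M 3}
  {oF : ManifoldOrientation (𝓡∂ 2) F 2} {ι : F → M} {m : ℕ} {L : OrientedLink M m}

/-- This is where the contact geometry fixes the signs: `α ∧ dα > 0` orients the cylindrical
coordinates, and positive transversality makes the component run in the positive `z`-direction. -/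
lemma BranchedCoords.exists_isBoundaryParam [CompactSpace F] [T2Space M]
    {N : Type*} [TopologicalSpace N] [ChartedSpace (EuclideanSpace ℝ (Fin 3)) N]
    {n : ℕ} {p : N → M} (B : BranchedCoords n L p) (hS : IsSeifertSurface L oF ι)
    {α : ∀ x : M, TangentSpace (𝓡 3) x →L[ℝ] ℝ} (hα : IsPositiveContactForm oM α)
    (hLα : L.PositivelyTransverse α) (i : Fin m)
    (hstd : ∀ w ∈ Metric.ball (0 : ℂ) (B.base i).radius, ∀ z : ℝ, ∃ f : ℝ, 0 < f ∧ ∀ (η : ℂ) (ζ : ℝ),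
      α ((B.base i).map (w, z)) (mfderiv 𝓘(ℝ, ℂ × ℝ) (𝓡 3) (B.base i).map (w, z) (η, ζ)) =
        f * (ζ + (starRingEnd ℂ w * η).im)) :
    ∃ (e : OpenPartialHomeomorph (ℂ × ℝ) M) (E : OpenPartialHomeomorph (ℂ × ℝ) (ℂ × ℝ)) (c : ℂ),
      e.source ⊆ Metric.ball 0 (B.base i).radius ×ˢ univ ∧ EqOn e (B.base i).map e.source ∧
      E.target ⊆ e.source ∧ IsBoundaryParam oM oF ι e E c := by
  set Θ := B.base i with hΘ
  have h0 : ((0 : ℂ), (0 : ℝ)) ∈ Metric.ball (0 : ℂ) Θ.radius ×ˢ (univ : Set ℝ) :=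
    ⟨Metric.mem_ball_self Θ.radius_pos, mem_univ _⟩
  obtain ⟨e, h0e, hes, heΘ, hsm⟩ := Θ.isParam.exists_homeo h0
  have he : IsParam e e.source := (Θ.isParam.mono e.open_source hes).congr heΘ
  have hL : ∀ q ∈ e.source, e q ∈ L.carrier → q.1 = 0 := fun q hq h =>
    B.eq_zero_of_mem_carrier (i := i) (hes hq).1 (by rw [← heΘ hq]; exact h)
  have hD : ∀ v : ℂ × ℝ, (mfderiv 𝓘(ℝ, ℂ × ℝ) (𝓡 3) e (0, 0) v : EuclideanSpace ℝ (Fin 3)) =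
      mfderiv 𝓘(ℝ, ℂ × ℝ) (𝓡 3) Θ.map (0, 0) v := by
    intro v
    have h1 : (e : ℂ × ℝ → M) =ᶠ[𝓝 (0, 0)] Θ.map := heΘ.eventuallyEq_of_mem (e.open_source.mem_nhds h0e)
    exact congrArg (fun D : ℂ × ℝ →L[ℝ] EuclideanSpace ℝ (Fin 3) => D v)
      (h1.mfderiv_eq (I := 𝓘(ℝ, ℂ × ℝ)) (I' := 𝓡 3))
  have he0 : e (0, 0) = Θ.map (0, 0) := heΘ h0e
  obtain ⟨t, ht⟩ : ∃ t, L.knot i t = e (0, 0) := by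
    have : Θ.map (0, 0) ∈ range (L.knot i) := B.core i ▸ mem_range_self (0 : ℝ)
    rw [he0]; exact this
  obtain ⟨y₀, -, hy₀⟩ : e (0, 0) ∈ ι '' (𝓡∂ 2).boundary F := by
    rw [hS.boundary, ← ht]
    exact mem_iUnion.2 ⟨i, mem_range_self _⟩
  have hkd : MDifferentiableAt 𝓘(ℝ, ℝ) (𝓡 3) (L.knot i) t :=
    (L.smooth i).mdifferentiable (by simp) t
  have htt : L.knot i t ∈ e.target := ht ▸ e.map_source h0e
  obtain ⟨⟨q', k⟩, hq'⟩ := IsParam.hasDerivAt_symm hsm hkd htt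
  have hevt : ∀ᶠ s in 𝓝 t, L.knot i s ∈ e.target :=
    hkd.continuousAt.eventually (e.open_target.mem_nhds htt)
  -- The knot stays on the axis, so its velocity has no component in `ℂ`.
  have hq'0 : q' = 0 := by
    have h1 : HasDerivAt (fun s => (e.symm (L.knot i s)).1) q' t := hq'.fst
    refine h1.unique ((hasDerivAt_const t (0 : ℂ)).congr_of_eventuallyEq ?_)
    filter_upwards [hevt] with s hs
    refine hL _ (e.map_target hs) ?_
    rw [e.right_inv hs]
    exact mem_iUnion.2 ⟨i, mem_range_self _⟩
  subst hq'0
  have hsymm : e.symm (L.knot i t) = (0, 0) := by rw [ht, e.left_inv h0e]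
  have hknot' : (mfderiv 𝓘(ℝ, ℝ) (𝓡 3) (L.knot i) t (1 : ℝ) : EuclideanSpace ℝ (Fin 3)) =
      mfderiv 𝓘(ℝ, ℂ × ℝ) (𝓡 3) e (0, 0) ((0 : ℂ), k) := by
    have h1 : (mfderiv 𝓘(ℝ, ℝ) (𝓡 3) (L.knot i) t (1 : ℝ) : EuclideanSpace ℝ (Fin 3)) =
        mfderiv 𝓘(ℝ, ℂ × ℝ) (𝓡 3) e (e.symm (L.knot i t)) ((0 : ℂ), k) :=
      he.mfderiv_curve (γ := L.knot i) (q := fun s => e.symm (L.knot i s))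
        (hevt.mono fun s hs => (e.right_inv hs).symm) hq' (e.map_target htt)
    have h2 : (mfderiv 𝓘(ℝ, ℂ × ℝ) (𝓡 3) e (e.symm (L.knot i t)) ((0 : ℂ), k) :
        EuclideanSpace ℝ (Fin 3)) = mfderiv 𝓘(ℝ, ℂ × ℝ) (𝓡 3) e (0, 0) ((0 : ℂ), k) := by
      rw [hsymm]
    exact h1.trans h2
  -- On the axis `α` is a positive multiple of `dz`, so positivity on the velocity of the knot is
  -- positivity of `k`.
  have hk : 0 < k := by
    obtain ⟨f, hf, hfα⟩ := hstd 0 h0.1 0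
    have h1 := hLα i t
    have h2 : α (L.knot i t) (mfderiv 𝓘(ℝ, ℝ) (𝓡 3) (L.knot i) t (1 : ℝ)) =
        α (Θ.map (0, 0)) (mfderiv 𝓘(ℝ, ℂ × ℝ) (𝓡 3) Θ.map (0, 0) ((0 : ℂ), k)) :=
      form_congr α (ht.trans he0) (hknot'.trans (hD _))
    rw [h2, hfα] at h1
    simp at h1
    exact (pos_iff_pos_of_mul_pos h1).1 hf
  have hpos : ∀ᶠ q in 𝓝 ((0 : ℂ), (0 : ℝ)), ∀ v : Fin 3 → ℂ × ℝ,
      oM.IsPos (e q) (fun i => mfderiv 𝓘(ℝ, ℂ × ℝ) (𝓡 3) e q (v i)) ↔ 0 < tubeBasis.det v := by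
    obtain ⟨ε, hε, hev⟩ := he.eventually_isPos_iff oM tubeBasis h0e
    have h1 := Θ.isPos_core hα hstd 0
    have h2 := (hev.self_of_nhds ![((0 : ℂ), (1 : ℝ)), (1, 0), (Complex.I, 0)]).1 (by
      refine (oM.isPos_congr he0 _).2 ?_
      refine (iff_of_eq (congrArg (oM.IsPos (Θ.map (0, 0))) ?_)).2 h1
      funext j
      exact hD _)
    rw [det_vec3] at h2
    simp [tubeBasis_repr] at h2
    have hε1 : ε = 1 := by
      rcases hε with h | h
      · exact h
      · rw [h] at h2; norm_num at h2
    simpa [hε1] using hev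
  obtain ⟨E, c, hE, hEs⟩ := _root_.exists_isBoundaryParam hS he hsm h0e hy₀.symm hL hpos hk ht hknot'
  exact ⟨e, E, c, hes, heΘ, hEs, hE⟩

/-- The argument of the function defining the cover, near a boundary point of the surface. -/
lemma IsBoundaryParam.exists_arg [CompactSpace F] [T2Space M] (hS : IsSeifertSurface L oF ι)
    {Φ : M → ℝ} (hΦ : ∀ x ∉ L.carrier, ∀ f W, IsSideFunction oM oF ι f W → x ∈ W →
      ∃ l, Tendsto (fun z => Φ z + f z) (𝓝[(range ι)ᶜ] x) (𝓝 l))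
    {θ : ℂ × ℝ → M} {E : OpenPartialHomeomorph (ℂ × ℝ) (ℂ × ℝ)} {c : ℂ}
    (hE : IsBoundaryParam oM oF ι θ E c) (hθ : ContinuousOn θ E.target)
    (hL : ∀ q ∈ E.target, θ q ∈ L.carrier → q.1 = 0) :
    ∃ D : ℂ × ℝ → ℝ, ContinuousOn D {q | q ∈ E.target ∧ q.1 ≠ 0} ∧
      ∀ q ∈ E.target, q.1 ≠ 0 → θ q ∉ range ι →
        Complex.exp (2 * Real.pi * Complex.I * Φ (θ q)) =
          -((E.symm q).1 / ‖(E.symm q).1‖) * Complex.exp (2 * Real.pi * Complex.I * D q) := by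
  set T : Set (ℂ × ℝ) := {r | r ∈ E.source ∧ (E r).1 ≠ 0} with hT
  set H : Set (ℂ × ℝ) := {r | r ∈ E.source ∧ -r.1 ∈ Complex.slitPlane} with hH
  have hslit : ∀ z : ℂ, -z ∈ Complex.slitPlane ↔ ¬(z.im = 0 ∧ 0 ≤ z.re) := by
    intro z
    rw [Complex.mem_slitPlane_iff]
    simp only [Complex.neg_re, Complex.neg_im, neg_ne_zero, Left.neg_pos_iff, not_and, not_le]
    tauto
  have hθE : ∀ r ∈ E.source, ContinuousAt (fun r => θ (E r)) r := fun r hr =>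
    ContinuousAt.comp (g := θ) (hθ.continuousAt (E.open_target.mem_nhds (E.map_source hr)))
      (E.continuousAt hr)
  have hHS : ∀ r ∈ E.source, θ (E r) ∉ range ι ↔ r ∈ H := by
    intro r hr
    rw [hE.mem_range_iff r hr, ← hslit]
    exact ⟨fun h => ⟨hr, h⟩, fun h => h.2⟩
  -- The function `arg (-ζ)` is cut exactly along the half plane that is the surface. Crossing it in
  -- the direction of increasing `Im ζ`, both `Φ` and `arg (-ζ) / (2π)` jump by `-1`, so the
  -- difference extends continuously over the surface off the axis.
  let D₀ : ℂ × ℝ → ℝ := fun r => Φ (θ (E r)) - Complex.arg (-r.1) / (2 * Real.pi)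
  have key : ∀ r ∈ T, ∃ l, Tendsto D₀ (𝓝[H] r) (𝓝 l) := by
    rintro r ⟨hr, hr1⟩
    have hx : θ (E r) ∉ L.carrier := fun h => hr1 (hL _ (E.map_source hr) h)
    obtain ⟨e', κ, q₀, ρ, he', hq₀, hρ, hes, -⟩ := exists_surfaceBox oM hS hx univ_mem
    have hf := he'.isSideFunction
    have hxW : θ (E r) ∈ e'.target := by
      rw [← hq₀]
      exact e'.map_source (by rw [hes]; exact Metric.mem_ball_self hρ)
    obtain ⟨l, hl⟩ := hΦ _ hx _ _ hf hxW
    set f := sideFun e' κ with hfdef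
    have htend : Tendsto (fun r => θ (E r)) (𝓝[H] r) (𝓝[(range ι)ᶜ] (θ (E r))) := by
      refine tendsto_nhdsWithin_iff.2 ⟨(hθE r hr).mono_left nhdsWithin_le_nhds, ?_⟩
      filter_upwards [self_mem_nhdsWithin] with r' hr'
      exact (hHS r' hr'.1).2 hr'
    have hl' := hl.comp htend
    by_cases hrH : r ∈ H
    · have hconst := hf.eventually_eq _ hxW ((hHS r hr).2 hrH)
      refine ⟨l - f (θ (E r)) - Complex.arg (-r.1) / (2 * Real.pi), ?_⟩
      have harg : Tendsto (fun r : ℂ × ℝ => Complex.arg (-r.1) / (2 * Real.pi)) (𝓝[H] r)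
          (𝓝 (Complex.arg (-r.1) / (2 * Real.pi))) := by
        have h1 : ContinuousAt (fun r : ℂ × ℝ => -r.1) r := by fun_prop
        have h2 : ContinuousAt (fun r : ℂ × ℝ => Complex.arg (-r.1)) r :=
          ContinuousAt.comp (g := Complex.arg) (Complex.continuousAt_arg hrH.2) h1
        exact (h2.div_const _).mono_left nhdsWithin_le_nhds
      refine ((hl'.sub_const (f (θ (E r)) : ℝ)).sub harg).congr' ?_
      have h3 : ∀ᶠ r' in 𝓝[H] r, f (θ (E r')) = f (θ (E r)) :=
        ((hθE r hr).eventually hconst).filter_mono nhdsWithin_le_nhds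
      filter_upwards [h3] with r' hr'
      simp only [Function.comp, hr', D₀]
      ring
    · have hon : r.1.im = 0 ∧ 0 ≤ r.1.re := by
        by_contra h
        exact hrH ⟨hr, (hslit _).2 h⟩
      have hre : 0 < r.1.re := by
        refine lt_of_le_of_ne hon.2 fun h => hr1 (hE.axis r hr ?_)
        exact Complex.ext h.symm hon.1
      -- Reordering the coordinates so that `Im ζ` is last, as `eventually_of_box` requires.
      let J : (ℝ × ℝ) × ℝ → ℂ × ℝ := fun a => ((a.1.1 : ℂ) + a.2 * Complex.I, a.1.2)
      have hJ : Continuous J := by fun_prop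
      let J' : ℂ × ℝ → (ℝ × ℝ) × ℝ := fun r => ((r.1.re, r.2), r.1.im)
      have hJ' : Continuous J' := by fun_prop
      have hJJ : ∀ r, J (J' r) = r := fun r => Prod.ext (Complex.re_add_im r.1) rfl
      have hJr : J ((r.1.re, r.2), 0) = r := by
        have := hJJ r
        simp only [J', hon.1] at this
        exact this
      have hJc : ∀ᶠ a in 𝓝 (((r.1.re, r.2) : ℝ × ℝ), (0 : ℝ)), J a ∈ E.source :=
        hJ.continuousAt.eventually (E.open_source.mem_nhds (by rw [hJr]; exact hr))
      have hbox := hf.eventually_of_box (Ψ := fun a => θ (E (J a))) (u₀ := (r.1.re, r.2))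
        (hJc.mono fun a ha => ContinuousAt.comp (g := fun r => θ (E r)) (f := J) (hθE _ ha)
          hJ.continuousAt)
        (by simp only [hJr]; exact hxW)
        (hJc.mono fun a ha h => by
          have := ((hE.mem_range_iff _ ha).1 h).1
          simpa [J] using this)
        (by
          have h1 := hE.crossing r hr hon.1 hon.2
          have h2 : ((r.1.re : ℝ) : ℂ) = r.1 := Complex.ext rfl (by simp [hon.1])
          simpa only [J, h2] using h1)
      have hbox' : ∀ᶠ r' in 𝓝 r, (0 < r'.1.im → f (θ (E r')) = 1) ∧
          (r'.1.im < 0 → f (θ (E r')) = 0) := by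
        have h1 : J' r = ((r.1.re, r.2), 0) := by simp [J', hon.1]
        rw [← h1] at hbox
        refine (hJ'.continuousAt.eventually hbox).mono fun r' h => ?_
        simp only [hJJ] at h
        exact h
      -- Above the surface `f = 1` and `arg (-ζ) = arg ζ - π`, below it `f = 0` and `arg (-ζ) = arg
      -- ζ + π`. In both cases `D₀` is `Φ + f - arg ζ / (2π) - 1/2`.
      refine ⟨l - Complex.arg r.1 / (2 * Real.pi) - 1 / 2, ?_⟩
      have harg : Tendsto (fun r : ℂ × ℝ => Complex.arg r.1 / (2 * Real.pi)) (𝓝[H] r)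
          (𝓝 (Complex.arg r.1 / (2 * Real.pi))) := by
        have h1 : ContinuousAt (fun r : ℂ × ℝ => r.1) r := by fun_prop
        have h2 : ContinuousAt (fun r : ℂ × ℝ => Complex.arg r.1) r :=
          ContinuousAt.comp (g := Complex.arg)
            (Complex.continuousAt_arg (Complex.mem_slitPlane_iff.2 (Or.inl hre))) h1
        exact (h2.div_const _).mono_left nhdsWithin_le_nhds
      refine ((hl'.sub harg).sub_const (1 / 2)).congr' ?_
      have hre' : ∀ᶠ r' : ℂ × ℝ in 𝓝 r, 0 < r'.1.re := by
        have h1 : ContinuousAt (fun r : ℂ × ℝ => r.1.re) r := by fun_prop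
        exact h1.eventually (lt_mem_nhds hre)
      filter_upwards [self_mem_nhdsWithin, hbox'.filter_mono nhdsWithin_le_nhds,
        hre'.filter_mono nhdsWithin_le_nhds] with r' h1 h2 h3
      have hpi := Real.pi_pos
      have him : r'.1.im ≠ 0 := fun h => (hslit _).1 h1.2 ⟨h, h3.le⟩
      simp only [Function.comp, D₀]
      rcases lt_or_gt_of_ne him with h | h
      · rw [h2.2 h, Complex.arg_neg_eq_arg_add_pi_of_im_neg h]
        push_cast
        field_simp
        ring
      · rw [h2.1 h, Complex.arg_neg_eq_arg_sub_pi_of_im_pos h]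
        push_cast
        field_simp
        ring
  -- A small displacement in the direction of `Im ζ` leaves the half plane.
  have hTcl : T ⊆ closure H := by
    rintro r ⟨hr, -⟩
    have h1 : Tendsto (fun s : ℝ => ((r.1 + s * Complex.I, r.2) : ℂ × ℝ)) (𝓝[≠] 0) (𝓝 r) := by
      have h2 : Continuous fun s : ℝ => ((r.1 + s * Complex.I, r.2) : ℂ × ℝ) := by fun_prop
      have h3 := h2.tendsto 0
      simp only [Complex.ofReal_zero, zero_mul, add_zero] at h3
      exact h3.mono_left nhdsWithin_le_nhds
    refine mem_closure_of_frequently_of_tendsto ?_ h1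
    have h4 : ∀ᶠ s : ℝ in 𝓝[≠] 0, ((r.1 + s * Complex.I, r.2) : ℂ × ℝ) ∈ E.source :=
      h1.eventually (E.open_source.mem_nhds hr)
    have h5 : ∀ᶠ s : ℝ in 𝓝[≠] 0, r.1.im + s ≠ 0 := by
      by_cases him : r.1.im = 0
      · filter_upwards [self_mem_nhdsWithin] with s hs
        rw [him, zero_add]; exact hs
      · have h6 : ContinuousAt (fun s : ℝ => r.1.im + s) 0 := by fun_prop
        exact (h6.eventually_ne (by simpa using him)).filter_mono nhdsWithin_le_nhds
    refine Eventually.frequently ?_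
    filter_upwards [h4, h5] with s hs hs'
    refine ⟨hs, (hslit _).2 fun h => hs' ?_⟩
    simpa using h.1
  have hext : ContinuousOn (extendFrom H D₀) T := continuousOn_extendFrom hTcl key
  have heq : ∀ r ∈ T, r ∈ H → extendFrom H D₀ r = D₀ r := by
    intro r hr hrH
    obtain ⟨l, hl⟩ := key r hr
    rw [extendFrom_eq (hTcl hr) hl]
    exact (tendsto_nhds_unique (hl.mono_left (pure_le_nhdsWithin hrH)) (tendsto_pure_nhds D₀ r))
  refine ⟨fun q => extendFrom H D₀ (E.symm q), ?_, ?_⟩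
  · refine hext.comp (E.continuousOn_symm.mono fun q hq => hq.1) fun q hq => ?_
    exact ⟨E.map_target hq.1, by rw [E.right_inv hq.1]; exact hq.2⟩
  · intro q hq hq1 hqS
    set r := E.symm q with hr
    have hrs : r ∈ E.source := E.map_target hq
    have hErq : E r = q := E.right_inv hq
    have hrH : r ∈ H := (hHS r hrs).1 (by rw [hErq]; exact hqS)
    beta_reduce
    rw [heq r ⟨hrs, by rw [hErq]; exact hq1⟩ hrH]
    have hr0 : r.1 ≠ 0 := fun h => hq1 (by rw [← hErq]; exact hE.axis r hrs h)
    have h1 : -(r.1 / ‖r.1‖) = Complex.exp (Complex.arg (-r.1) * Complex.I) := by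
      have h2 := Complex.norm_mul_exp_arg_mul_I (-r.1)
      rw [norm_neg] at h2
      have h3 : (‖r.1‖ : ℂ) ≠ 0 := by simpa using hr0
      rw [← neg_div, div_eq_iff h3, mul_comm]
      exact h2.symm
    rw [h1, ← Complex.exp_add]
    congr 1
    simp only [D₀, hErq]
    have hpi : (Real.pi : ℂ) ≠ 0 := by exact_mod_cast Real.pi_ne_zero
    push_cast
    field_simp
    ring

end Winding

/-! ### Winding of an `n`-th root on a meridian disc -/

section BranchMap

open Set Filter

lemma norm_branchMap_fst (n : ℕ) (q : ℂ × ℝ) : ‖(branchMap n q).1‖ = ‖q.1‖ := by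
  by_cases h : q.1 = 0
  · simp [branchMap, h]
  · have h1 : ‖q.1‖ ≠ 0 := norm_ne_zero_iff.2 h
    simp [branchMap, h1]

lemma continuousAt_branchMap (n : ℕ) {q : ℂ × ℝ} (hq : q.1 ≠ 0) : ContinuousAt (branchMap n) q := by
  have h1 : (‖q.1‖ : ℂ) ≠ 0 := by simpa using hq
  have h2 : ContinuousAt (fun q : ℂ × ℝ => (‖q.1‖ : ℂ)) q := by fun_prop
  have h3 : ContinuousAt (fun q : ℂ × ℝ => q.1 / (‖q.1‖ : ℂ)) q :=
    continuousAt_fst.div h2 h1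
  exact (h2.mul (h3.pow n)).prodMk continuousAt_snd

/-- If the `n`-th power of `G`, read through the branch map, winds once around the origin relative
to the pull-back, then so does `G`. -/
lemma exists_log_of_pow_eq {n : ℕ} (hn : 1 ≤ n) {R : ℝ} (hR : 0 < R) {G ζ : ℂ → ℂ} {D : ℂ → ℝ} {c : ℂ}
    (hc : c ≠ 0) (hG : ContinuousOn G (Metric.ball 0 R \ {0}))
    (hζ : ContinuousOn ζ (Metric.ball 0 R \ {0})) (hD : ContinuousOn D (Metric.ball 0 R \ {0}))
    (hζc : Tendsto (fun w => ζ w / w) (𝓝[≠] 0) (𝓝 c))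
    (hpow : ∀ w ∈ Metric.ball (0 : ℂ) R \ {0}, G w ^ n =
      -(ζ (branchMap n (w, 0)).1 / ‖ζ (branchMap n (w, 0)).1‖) *
        Complex.exp (2 * Real.pi * Complex.I * D (branchMap n (w, 0)).1)) :
    ∃ ε, 0 < ε ∧ ε ≤ R ∧ ∃ ℓ : ℂ → ℂ, ContinuousOn ℓ (Metric.ball 0 ε \ {0}) ∧
      ∀ w ∈ Metric.ball (0 : ℂ) ε \ {0}, G w = w / ‖w‖ * Complex.exp (ℓ w) := by
  -- Near the origin `ζ w / (c w)` is close to one, so the principal logarithm applies to it.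
  have hev : ∀ᶠ w in 𝓝[≠] (0 : ℂ), ζ w / w / c ∈ Complex.slitPlane := by
    have h1 : Tendsto (fun w => ζ w / w / c) (𝓝[≠] 0) (𝓝 1) := by
      simpa [hc] using hζc.div_const c
    exact h1.eventually (Complex.isOpen_slitPlane.mem_nhds Complex.one_mem_slitPlane)
  obtain ⟨ε', hε', hb⟩ := Metric.mem_nhdsWithin_iff.1 hev
  set ε := min ε' R with hε
  have hε0 : 0 < ε := lt_min hε' hR
  set P : Set ℂ := Metric.ball (0 : ℂ) ε \ {0} with hP
  have hPR : P ⊆ Metric.ball (0 : ℂ) R \ {0} :=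
    sdiff_subset_sdiff_left (Metric.ball_subset_ball (min_le_right _ _))
  have hPs : ∀ w ∈ P, ζ w / w / c ∈ Complex.slitPlane := fun w hw =>
    hb ⟨Metric.ball_subset_ball (min_le_left _ _) hw.1, hw.2⟩
  let b : ℂ → ℂ := fun w => (branchMap n (w, 0)).1
  have hbP : ∀ w ∈ P, b w ∈ P := by
    intro w hw
    have h1 : ‖b w‖ = ‖w‖ := norm_branchMap_fst n (w, 0)
    refine ⟨?_, ?_⟩
    · rw [mem_ball_zero_iff, h1]; exact mem_ball_zero_iff.1 hw.1
    · rw [mem_singleton_iff, ← norm_eq_zero, h1, norm_eq_zero]; exact hw.2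
  have hbc : ContinuousOn b P := fun w hw => by
    have h1 : ContinuousAt (fun w : ℂ => ((w, 0) : ℂ × ℝ)) w := by fun_prop
    have h2 : ContinuousAt (fun w : ℂ => branchMap n (w, 0)) w :=
      ContinuousAt.comp (g := branchMap n) (continuousAt_branchMap n hw.2) h1
    exact h2.fst.continuousWithinAt
  have hζ0 : ∀ w ∈ P, ζ w ≠ 0 := fun w hw h => by
    have := Complex.slitPlane_ne_zero (hPs w hw)
    simp [h] at this
  -- A logarithm of the quotient of `-(ζ / ‖ζ‖) * exp (2πi D)` by `w / ‖w‖`; the sign is absorbed in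
  -- `log (-c)`.
  let μ : ℂ → ℂ := fun w => Complex.log (ζ w / w / c) + Complex.log (-c) -
    (Real.log ‖ζ w / w‖ : ℂ) + 2 * Real.pi * Complex.I * D w
  have hμc : ContinuousOn μ P := by
    have h1 : ContinuousOn (fun w => ζ w / w) P :=
      (hζ.mono hPR).div continuousOn_id fun w hw => hw.2
    have h2 : ContinuousOn (fun w => Complex.log (ζ w / w / c)) P :=
      (h1.div_const c).clog hPs
    have h3 : ContinuousOn (fun w => (Real.log ‖ζ w / w‖ : ℂ)) P := by
      refine Complex.continuous_ofReal.comp_continuousOn (h1.norm.log fun w hw => ?_)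
      exact norm_ne_zero_iff.2 (div_ne_zero (hζ0 w hw) hw.2)
    have h4 : ContinuousOn (fun w => (D w : ℂ)) P :=
      Complex.continuous_ofReal.comp_continuousOn (hD.mono hPR)
    exact ((h2.add continuousOn_const).sub h3).add (continuousOn_const.mul h4)
  have hμ : ∀ w ∈ P, -(ζ w / ‖ζ w‖) * Complex.exp (2 * Real.pi * Complex.I * D w) =
      w / ‖w‖ * Complex.exp (μ w) := by
    intro w hw
    have hw0 : w ≠ 0 := hw.2
    have h1 : Complex.exp (Complex.log (ζ w / w / c)) = ζ w / w / c :=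
      Complex.exp_log (Complex.slitPlane_ne_zero (hPs w hw))
    have h2 : Complex.exp (Complex.log (-c)) = -c := Complex.exp_log (neg_ne_zero.2 hc)
    have h3 : Complex.exp (Real.log ‖ζ w / w‖ : ℂ) = ‖ζ w‖ / ‖w‖ := by
      rw [← Complex.ofReal_exp, Real.exp_log (norm_pos_iff.2 (div_ne_zero (hζ0 w hw) hw0)), norm_div]
      push_cast; rfl
    have h4 : (‖w‖ : ℂ) ≠ 0 := by simpa using hw0
    have h5 : (‖ζ w‖ : ℂ) ≠ 0 := by simpa using hζ0 w hw
    simp only [μ]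
    rw [Complex.exp_add, Complex.exp_sub, Complex.exp_add, h1, h2, h3]
    field_simp
  have hn0 : (n : ℂ) ≠ 0 := by exact_mod_cast (show n ≠ 0 by omega)
  -- The branch map raises `w / ‖w‖` to the `n`-th power, so the denominator is an explicit `n`-th
  -- root of the right-hand side of `hpow`, and `h` takes values in the `n`-th roots of unity.
  let h : ℂ → ℂ := fun w => G w / (w / ‖w‖ * Complex.exp (μ (b w) / n))
  have hden : ∀ w ∈ P, w / ‖w‖ * Complex.exp (μ (b w) / n) ≠ 0 := fun w hw =>
    mul_ne_zero (div_ne_zero hw.2 (by simpa using hw.2)) (Complex.exp_ne_zero _)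
  have hhc : ContinuousOn h P := by
    have h1 : ContinuousOn (fun w : ℂ => (‖w‖ : ℂ)) P :=
      (Complex.continuous_ofReal.comp continuous_norm).continuousOn
    have h2 : ContinuousOn (fun w : ℂ => w / (‖w‖ : ℂ)) P :=
      continuousOn_id.div h1 fun w hw => by simpa using hw.2
    have h3 : ContinuousOn (fun w => Complex.exp (μ (b w) / n)) P :=
      ((hμc.comp hbc hbP).div_const _).cexp
    exact (hG.mono hPR).div (h2.mul h3) hden
  have hhn : ∀ w ∈ P, h w ^ n = 1 := by
    intro w hw
    have hw0 : w ≠ 0 := hw.2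
    have h4 : (‖w‖ : ℂ) ≠ 0 := by simpa using hw0
    have h1 := hpow w (hPR hw)
    have h2 := hμ (b w) (hbP w hw)
    simp only [b] at h2
    rw [h2] at h1
    have h3 : (branchMap n (w, 0)).1 / (‖(branchMap n (w, 0)).1‖ : ℂ) = (w / ‖w‖) ^ n := by
      rw [norm_branchMap_fst]
      simp only [branchMap]
      field_simp
    rw [h3] at h1
    simp only [h]
    rw [div_pow, h1, mul_pow, ← Complex.exp_nat_mul, mul_div_cancel₀ _ hn0]
    exact div_self (mul_ne_zero (pow_ne_zero _ (div_ne_zero hw0 h4)) (Complex.exp_ne_zero _))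
  -- A connected set of roots of unity is a single point, so `G` differs from the explicit root by a
  -- constant `κ`.
  have hsub : (h '' P).Subsingleton := by
    have h1 : IsPreconnected (h '' P) := (isPreconnected_ball_diff_zero ε).image h hhc
    have h2 : (h '' P).Finite := by
      refine Set.Finite.subset (Polynomial.rootSet_finite (Polynomial.X ^ n - Polynomial.C 1 : Polynomial ℂ) ℂ) ?_
      rintro _ ⟨w, hw, rfl⟩
      rw [Polynomial.mem_rootSet_of_ne (Polynomial.X_pow_sub_C_ne_zero (by omega) (1 : ℂ))]
      simp [hhn w hw]
    by_contra hcon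
    exact h1.infinite_of_nontrivial (not_subsingleton_iff.1 hcon) h2
  have hmem : ((ε / 2 : ℝ) : ℂ) ∈ P := by
    refine ⟨?_, ?_⟩
    · rw [mem_ball_zero_iff, Complex.norm_real, Real.norm_eq_abs, abs_of_pos (by linarith)]
      linarith
    · simpa using hε0.ne'
  set κ := h ((ε / 2 : ℝ) : ℂ) with hκ
  have hκ0 : κ ≠ 0 := fun h0 => by
    have := hhn _ hmem
    rw [← hκ, h0, zero_pow (by omega)] at this
    exact zero_ne_one this
  refine ⟨ε, hε0, min_le_right _ _, fun w => μ (b w) / n + Complex.log κ,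
    ((hμc.comp hbc hbP).div_const _).add continuousOn_const, fun w hw => ?_⟩
  have h1 : h w = κ := hsub (mem_image_of_mem h hw) (mem_image_of_mem h hmem)
  have h2 : G w = κ * (w / ‖w‖ * Complex.exp (μ (b w) / n)) := by
    rw [← h1]; exact (div_mul_cancel₀ _ (hden w hw)).symm
  rw [h2, Complex.exp_add, Complex.exp_log hκ0]
  ring

end BranchMap

/-! ### Winding of `g` around the branch set -/

section CoverLog

open Set Filter

variable {M : Type*} [TopologicalSpace M] [ChartedSpace (EuclideanSpace ℝ (Fin 3)) M]
  [IsManifold (𝓡 3) ∞ M] {F : Type*} [TopologicalSpace F] [ChartedSpace (EuclideanHalfSpace 2) F]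
  [IsManifold (𝓡∂ 2) ∞ F] {N : Type*} [TopologicalSpace N] [ChartedSpace (EuclideanSpace ℝ (Fin 3)) N]
  [IsManifold (𝓡 3) ∞ N] {oM : ManifoldOrientation (𝓡 3) M 3}
  {oF : ManifoldOrientation (𝓡∂ 2) F 2} {oN : ManifoldOrientation (𝓡 3) N 3}
  {ι : F → M} {m n : ℕ} {L : OrientedLink M m} {p : N → M}

/-- The branch map preserves the distance from the axis. -/
lemma BranchedCoords.cover_notMem (B : BranchedCoords n L p) {i : Fin m} {q : ℂ × ℝ}
    (hq : q.1 ∈ Metric.ball (0 : ℂ) (B.base i).radius) (h0 : q.1 ≠ 0) :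
    p ((B.cover i).map q) ∉ L.carrier := by
  rw [show q = (q.1, q.2) from rfl, B.proj i q.1 hq q.2]
  intro h
  have h1 := norm_branchMap_fst n q
  have h2 := B.eq_zero_of_mem_carrier (i := i) (q := branchMap n q)
    (by rw [mem_ball_zero_iff, h1]; exact mem_ball_zero_iff.1 hq) h
  rw [h2, norm_zero] at h1
  exact h0 (norm_eq_zero.1 h1.symm)

/-- On a small meridian disc of the branch set, a function `g` as provided by `exists_root` winds once
around the origin. -/
lemma BranchedCoords.exists_cover_log [CompactSpace F] [T2Space M] (B : BranchedCoords n L p)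
    (hn : 1 ≤ n) (hS : IsSeifertSurface L oF ι) (hp : IsCyclicBranchedCover n L oM oF ι oN p)
    {α : ∀ x : M, TangentSpace (𝓡 3) x →L[ℝ] ℝ} (hα : IsPositiveContactForm oM α)
    (hLα : L.PositivelyTransverse α) (i : Fin m)
    (hstd : ∀ w ∈ Metric.ball (0 : ℂ) (B.base i).radius, ∀ z : ℝ, ∃ f : ℝ, 0 < f ∧ ∀ (η : ℂ) (ζ : ℝ),
      α ((B.base i).map (w, z)) (mfderiv 𝓘(ℝ, ℂ × ℝ) (𝓡 3) (B.base i).map (w, z) (η, ζ)) =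
        f * (ζ + (starRingEnd ℂ w * η).im))
    {Φ : M → ℝ} (hΦ : ∀ x ∉ L.carrier, ∀ f W, IsSideFunction oM oF ι f W → x ∈ W →
      ∃ l, Tendsto (fun z => Φ z + f z) (𝓝[(range ι)ᶜ] x) (𝓝 l))
    {g : N → ℂ} (hg : ContinuousOn g (p ⁻¹' L.carrierᶜ))
    (hgn : ∀ y, p y ∉ L.carrier → p y ∉ range ι →
      g y ^ n = Complex.exp (2 * Real.pi * Complex.I * Φ (p y))) :
    ∃ ε, 0 < ε ∧ ε ≤ (B.base i).radius ∧ ∃ ℓ : ℂ → ℂ, ContinuousOn ℓ (Metric.ball 0 ε \ {0}) ∧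
      ∀ w ∈ Metric.ball (0 : ℂ) ε \ {0},
        g ((B.cover i).map (w, 0)) = w / ‖w‖ * Complex.exp (ℓ w) := by
  obtain ⟨e, E, c, hes, heΘ, hEe, hE⟩ := B.exists_isBoundaryParam hS hα hLα i hstd
  have hEc : ContinuousOn e E.target := e.continuousOn.mono hEe
  have hEL : ∀ q ∈ E.target, e q ∈ L.carrier → q.1 = 0 := fun q hq h =>
    B.eq_zero_of_mem_carrier (i := i) (hes (hEe hq)).1 (by rw [← heΘ (hEe hq)]; exact h)
  obtain ⟨D, hD, hDeq⟩ := hE.exists_arg hS hΦ hEc hEL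
  set ψ := (B.cover i).map with hψ
  have hrad : (B.cover i).radius = (B.base i).radius := B.radius_eq i
  have hψP : IsParam ψ (Metric.ball 0 (B.base i).radius ×ˢ univ) := hrad ▸ (B.cover i).isParam
  obtain ⟨R', hR', hball⟩ := Metric.isOpen_iff.1 E.open_target _ hE.mem_target
  set R := min R' (B.base i).radius with hR
  have hR0 : 0 < R := lt_min hR' (B.base i).radius_pos
  have hRt : ∀ w ∈ Metric.ball (0 : ℂ) R, ((w, 0) : ℂ × ℝ) ∈ E.target := by
    intro w hw
    refine hball ?_
    rw [Metric.mem_ball, Prod.dist_eq]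
    refine max_lt ((Metric.mem_ball.1 hw).trans_le (min_le_left _ _)) ?_
    simpa using hR'
  have hRb : Metric.ball (0 : ℂ) R ⊆ Metric.ball (0 : ℂ) (B.base i).radius :=
    Metric.ball_subset_ball (min_le_right _ _)
  have hgc : ∀ q : ℂ × ℝ, q.1 ∈ Metric.ball (0 : ℂ) (B.base i).radius → q.1 ≠ 0 →
      ContinuousAt (fun q => g (ψ q)) q := by
    intro q hq hq0
    have h1 : p ⁻¹' L.carrierᶜ ∈ 𝓝 (ψ q) :=
      (L.isClosed_carrier.isOpen_compl.preimage hp.continuous).mem_nhds (B.cover_notMem hq hq0)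
    exact ContinuousAt.comp (g := g) (hg.continuousAt h1) (hψP.contMDiffAt ⟨hq, mem_univ _⟩).continuousAt
  have hpt : ContinuousOn (fun w : ℂ => ((w, 0) : ℂ × ℝ)) (Metric.ball 0 R \ {0}) := by fun_prop
  have hdisc : ∀ w ∈ Metric.ball (0 : ℂ) R \ {0}, ((w, 0) : ℂ × ℝ) ∈ {q | q ∈ E.target ∧ q.1 ≠ 0} :=
    fun w hw => ⟨hRt w hw.1, hw.2⟩
  have hTo : IsOpen {q : ℂ × ℝ | q ∈ E.target ∧ q.1 ≠ 0} :=
    E.open_target.inter (isOpen_ne_fun continuous_fst continuous_const)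
  refine (exists_log_of_pow_eq hn hR0 (G := fun w => g (ψ (w, 0))) (ζ := fun w => (E.symm (w, 0)).1)
    (D := fun w => D (w, 0)) hE.ne_zero ?_ ?_ (hD.comp hpt hdisc) hE.tendsto ?_).imp
    fun ε hε => ⟨hε.1, hε.2.1.trans (min_le_right _ _), hε.2.2⟩
  · intro w hw
    have h1 := hgc (w, 0) (hRb hw.1) hw.2
    exact (ContinuousAt.comp (g := fun q => g (ψ q)) (f := fun w : ℂ => ((w, 0) : ℂ × ℝ)) h1
      (by fun_prop)).continuousWithinAt
  · exact continuous_fst.comp_continuousOn (E.continuousOn_symm.comp hpt fun w hw => hRt w hw.1)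
  · intro w hw
    let K : ℂ × ℝ → ℂ := fun q => -((E.symm q).1 / ‖(E.symm q).1‖) *
      Complex.exp (2 * Real.pi * Complex.I * D q)
    have hb0 : branchMap n (w, 0) = ((branchMap n (w, 0)).1, 0) := rfl
    have hbn := norm_branchMap_fst n (w, 0)
    have hbR : (branchMap n (w, 0)).1 ∈ Metric.ball (0 : ℂ) R \ {0} := by
      refine ⟨?_, ?_⟩
      · rw [mem_ball_zero_iff, hbn]; exact mem_ball_zero_iff.1 hw.1
      · rw [mem_singleton_iff, ← norm_eq_zero, hbn, norm_eq_zero]; exact hw.2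
    have hbT : branchMap n (w, 0) ∈ {q : ℂ × ℝ | q ∈ E.target ∧ q.1 ≠ 0} := by
      rw [hb0]; exact hdisc _ hbR
    change g (ψ (w, 0)) ^ n = K (branchMap n (w, 0))
    have hKc : ContinuousAt K (branchMap n (w, 0)) := by
      have hζ : ContinuousAt (fun q => (E.symm q).1) (branchMap n (w, 0)) :=
        (E.continuousAt_symm hbT.1).fst
      have hζ0 : (E.symm (branchMap n (w, 0))).1 ≠ 0 := fun h => hbT.2 (by
        rw [← E.right_inv hbT.1]; exact hE.axis _ (E.map_target hbT.1) h)
      have hDc : ContinuousAt (fun q => (D q : ℂ)) (branchMap n (w, 0)) :=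
        Complex.continuous_ofReal.continuousAt.comp (hD.continuousAt (hTo.mem_nhds hbT))
      have hnc : ContinuousAt (fun q => (‖(E.symm q).1‖ : ℂ)) (branchMap n (w, 0)) :=
        Complex.continuous_ofReal.continuousAt.comp hζ.norm
      exact (hζ.div hnc (by simpa using hζ0)).neg.mul (continuousAt_const.mul hDc).cexp
    have hbc : ContinuousAt (branchMap n) ((w, 0) : ℂ × ℝ) := continuousAt_branchMap n hw.2
    have hKb : ContinuousAt (fun q => K (branchMap n q)) (w, 0) :=
      ContinuousAt.comp (g := K) hKc hbc
    have hgb : ContinuousAt (fun q => g (ψ q) ^ n) (w, 0) := (hgc (w, 0) (hRb hw.1) hw.2).pow n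
    -- The identity is available only over the complement of the surface. Both sides are continuous
    -- in `q` near `(w, 0)` and that complement is dense, so an inequality at `(w, 0)` would persist
    -- at a point where equality holds.
    by_contra hne
    have hnear : ∀ᶠ q in 𝓝 ((w, 0) : ℂ × ℝ), g (ψ q) ^ n ≠ K (branchMap n q) :=
      (hgb.prodMk hKb).eventually (isOpen_ne_fun continuous_fst continuous_snd |>.mem_nhds hne)
    have hfreq : ∃ᶠ q in 𝓝 ((w, 0) : ℂ × ℝ), p (ψ q) ∉ range ι := by
      have h1 := mem_closure_iff_frequently.1
        (mem_closure_preimage_compl_range hS hp (B.cover_notMem (q := (w, 0)) (hRb hw.1) hw.2))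
      rw [← hψP.map_nhds_eq (q := (w, 0)) ⟨hRb hw.1, mem_univ _⟩, frequently_map] at h1
      exact h1
    have hmem : ∀ᶠ q in 𝓝 ((w, 0) : ℂ × ℝ), branchMap n q ∈ {q : ℂ × ℝ | q ∈ E.target ∧ q.1 ≠ 0} ∧
        q.1 ∈ Metric.ball (0 : ℂ) (B.base i).radius ∧ q.1 ≠ 0 := by
      refine (hbc.eventually (hTo.mem_nhds hbT)).and ?_
      exact ((Metric.isOpen_ball.inter isOpen_ne).preimage continuous_fst).mem_nhds ⟨hRb hw.1, hw.2⟩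
    obtain ⟨q, hqS, hq1, hq2, hq3, hq4⟩ := (hfreq.and_eventually (hnear.and hmem)).exists
    refine hq1 ?_
    have hpq : p (ψ q) = e (branchMap n q) := by
      rw [show q = (q.1, q.2) from rfl, hψ, B.proj i q.1 hq3 q.2, heΘ (hEe hq2.1)]
    rw [hgn _ (B.cover_notMem hq3 hq4) hqS, hpq]
    exact hDeq _ hq2.1 hq2.2 (by rw [← hpq]; exact hqS)

end CoverLog

/-! ### The derivative of the branch map and its effect on winding -/

section BranchDeriv

open Set Filter ComplexConjugate

/-- The derivative of `w ↦ |w| (w / |w|) ^ n`. -/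
def branchDeriv (n : ℕ) (w η : ℂ) : ℂ :=
  (w / ‖w‖) ^ n * (((conj (w / (‖w‖ : ℂ)) * η).re : ℂ) +
    n * ((conj (w / (‖w‖ : ℂ)) * η).im : ℂ) * Complex.I)

lemma norm_div_norm_self {w : ℂ} (hw : w ≠ 0) : ‖w / (‖w‖ : ℂ)‖ = 1 := by
  have : ‖w‖ ≠ 0 := norm_ne_zero_iff.2 hw
  simp [this]

lemma div_norm_mul_conj {w : ℂ} (hw : w ≠ 0) : w / (‖w‖ : ℂ) * conj (w / (‖w‖ : ℂ)) = 1 := by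
  rw [Complex.mul_conj, Complex.normSq_eq_norm_sq, norm_div_norm_self hw]
  simp

/-- Along a curve with affine modulus and argument the branch map just multiplies the argument by
`n`. One such curve for each tangent vector is enough to find the derivative of `p`, whose
differentiability off the branch set is known. -/
lemma exists_branch_curve (n : ℕ) {w : ℂ} (hw : w ≠ 0) (η : ℂ) :
    ∃ c : ℝ → ℂ, c 0 = w ∧ HasDerivAt c η 0 ∧
      ∀ z : ℝ → ℝ, HasDerivAt (fun s => (branchMap n (c s, z s)).1) (branchDeriv n w η) 0 := by
  set ρ := ‖w‖ with hρ
  have hρ0 : 0 < ρ := norm_pos_iff.2 hw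
  have hρc : (ρ : ℂ) ≠ 0 := by exact_mod_cast hρ0.ne'
  set u := w / (ρ : ℂ) with hu
  have hun : ‖u‖ = 1 := norm_div_norm_self hw
  have huu : u * conj u = 1 := div_norm_mul_conj hw
  set ξ := conj u * η with hξ
  have hη : u * ξ = η := by rw [hξ, ← mul_assoc, huu, one_mul]
  let r : ℝ → ℝ := fun s => ρ + s * ξ.re
  let θ : ℝ → ℝ := fun s => s * (ξ.im / ρ)
  have hr : HasDerivAt r ξ.re 0 := by
    have h := ((hasDerivAt_id (0 : ℝ)).mul_const ξ.re).const_add ρ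
    rw [one_mul] at h
    exact h
  have hθ : HasDerivAt θ (ξ.im / ρ) 0 := by
    simpa using (hasDerivAt_id (0 : ℝ)).mul_const (ξ.im / ρ)
  have hr0 : r 0 = ρ := by simp [r]
  have hθ0 : θ 0 = 0 := by simp [θ]
  have key : ∀ k : ℂ, HasDerivAt (fun s => (r s : ℂ) * Complex.exp (k * (θ s * Complex.I)))
      (ξ.re + k * ξ.im * Complex.I) 0 := by
    intro k
    have h1 := hr.ofReal_comp
    have h2 := ((hθ.ofReal_comp.mul_const Complex.I).const_mul k).cexp
    have h3 := h1.mul h2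
    refine h3.congr_deriv ?_
    simp only [hr0, hθ0]
    simp
    field_simp
  refine ⟨fun s => u * ((r s : ℂ) * Complex.exp (θ s * Complex.I)), ?_, ?_, fun z => ?_⟩
  · simp only [hr0, hθ0]
    simp [hu, hρc]
  · have h1 := (key 1).const_mul u
    simp only [one_mul] at h1
    rwa [Complex.re_add_im, hη] at h1
  · have h1 := (key n).const_mul (u ^ n)
    refine h1.congr_of_eventuallyEq ?_
    have hev : ∀ᶠ s in 𝓝 (0 : ℝ), 0 < r s :=
      hr.continuousAt.eventually (lt_mem_nhds (by rw [hr0]; exact hρ0))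
    filter_upwards [hev] with s hs
    have h2 : ‖u * ((r s : ℂ) * Complex.exp (θ s * Complex.I))‖ = r s := by
      rw [norm_mul, norm_mul, hun, Complex.norm_exp_ofReal_mul_I, Complex.norm_real,
        Real.norm_of_nonneg hs.le]
      ring
    have h3 : (r s : ℂ) ≠ 0 := by exact_mod_cast hs.ne'
    simp only [branchMap]
    rw [h2, Complex.exp_nat_mul]
    have h4 : u * ((r s : ℂ) * Complex.exp (θ s * Complex.I)) / (r s : ℂ) =
        u * Complex.exp (θ s * Complex.I) := by field_simp
    rw [h4, mul_pow]
    ring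

/-- The pull-back of `r² dθ` by the branch map is `n r² dθ`. -/
lemma conj_branchMap_mul_branchDeriv_im (n : ℕ) {q : ℂ × ℝ} (hq : q.1 ≠ 0) (η : ℂ) :
    (conj (branchMap n q).1 * branchDeriv n q.1 η).im = n * (conj q.1 * η).im := by
  set u := q.1 / (‖q.1‖ : ℂ) with hu
  have hn : (‖q.1‖ : ℂ) ≠ 0 := by simpa using hq
  have huu : u * conj u = 1 := div_norm_mul_conj hq
  have h1 : q.1 = ‖q.1‖ * u := by rw [hu]; field_simp
  have h2 : conj (branchMap n q).1 * branchDeriv n q.1 η =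
      (‖q.1‖ : ℂ) * (((conj u * η).re : ℂ) + n * ((conj u * η).im : ℂ) * Complex.I) := by
    have h3 : (conj u) ^ n * u ^ n = 1 := by rw [← mul_pow, mul_comm, huu, one_pow]
    simp only [branchMap, branchDeriv, ← hu, map_mul, map_pow, Complex.conj_ofReal]
    linear_combination ((‖q.1‖ : ℂ) * (((conj u * η).re : ℂ) + n * ((conj u * η).im : ℂ) * Complex.I)) * h3
  have h4 : conj q.1 * η = (‖q.1‖ : ℂ) * (conj u * η) := by
    conv_lhs => rw [h1]
    simp only [map_mul, Complex.conj_ofReal]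
    ring
  rw [h2, h4, Complex.im_ofReal_mul, Complex.im_ofReal_mul]
  simp
  ring

/-- A function `χ` whose image under the derivative of the branch map is `Re v a + Im v b`, where `(a, b)` is a
positive frame of `ℂ` and `v` winds `n - 1` times around the origin, has a continuous logarithm. -/
lemma exists_log_of_branchDeriv_eq {n : ℕ} (hn : 1 ≤ n) {R : ℝ} (hR : 0 < R) {a b χ v ℓ : ℂ → ℂ}
    {a₀ b₀ : ℂ} (hab : 0 < (conj a₀ * b₀).im)
    (ha : ContinuousOn a (Metric.ball 0 R \ {0})) (hb : ContinuousOn b (Metric.ball 0 R \ {0}))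
    (ha₀ : Tendsto a (𝓝[≠] 0) (𝓝 a₀)) (hb₀ : Tendsto b (𝓝[≠] 0) (𝓝 b₀))
    (hℓ : ContinuousOn ℓ (Metric.ball 0 R \ {0}))
    (hv : ∀ w ∈ Metric.ball (0 : ℂ) R \ {0}, v w = (w / ‖w‖) ^ (n - 1) * Complex.exp (ℓ w))
    (hχ : ∀ w ∈ Metric.ball (0 : ℂ) R \ {0},
      branchDeriv n w (χ w) = ((v w).re : ℂ) * a w + ((v w).im : ℂ) * b w) :
    ∃ ε, 0 < ε ∧ ε ≤ R ∧ ∃ ℓ' : ℂ → ℂ, ContinuousOn ℓ' (Metric.ball 0 ε \ {0}) ∧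
      ∀ w ∈ Metric.ball (0 : ℂ) ε \ {0}, χ w = Complex.exp (ℓ' w) := by
  -- The real linear map `v ↦ Re v a + Im v b` is `v ↦ A v + C conj v`.
  let A : ℂ → ℂ := fun w => (a w - Complex.I * b w) / 2
  let C : ℂ → ℂ := fun w => (a w + Complex.I * b w) / 2
  set A₀ : ℂ := (a₀ - Complex.I * b₀) / 2 with hA₀
  set C₀ : ℂ := (a₀ + Complex.I * b₀) / 2 with hC₀
  -- The difference `‖A₀‖² - ‖C₀‖²` is the imaginary part of `conj a₀ * b₀`, so positivity of the
  -- frame makes the complex linear part dominant.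
  have hAC₀ : ‖C₀‖ < ‖A₀‖ := by
    have h1 : ‖C₀‖ ^ 2 < ‖A₀‖ ^ 2 := by
      rw [← Complex.normSq_eq_norm_sq, ← Complex.normSq_eq_norm_sq, hA₀, hC₀, Complex.normSq_apply,
        Complex.normSq_apply]
      simp at hab ⊢
      nlinarith
    exact lt_of_pow_lt_pow_left₀ 2 (norm_nonneg _) h1
  have hA₀0 : A₀ ≠ 0 := norm_pos_iff.1 ((norm_nonneg _).trans_lt hAC₀)
  have hAt : Tendsto A (𝓝[≠] 0) (𝓝 A₀) := (ha₀.sub (hb₀.const_mul _)).div_const 2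
  have hCt : Tendsto C (𝓝[≠] 0) (𝓝 C₀) := (ha₀.add (hb₀.const_mul _)).div_const 2
  have hev : ∀ᶠ w in 𝓝[≠] (0 : ℂ), A w / A₀ ∈ Complex.slitPlane ∧ ‖C w‖ < ‖A w‖ := by
    refine Eventually.and ?_ (hCt.norm.eventually_lt hAt.norm hAC₀)
    have h1 : Tendsto (fun w => A w / A₀) (𝓝[≠] 0) (𝓝 1) := by
      simpa [hA₀0] using hAt.div_const A₀
    exact h1.eventually (Complex.isOpen_slitPlane.mem_nhds Complex.one_mem_slitPlane)
  obtain ⟨ε', hε', hball⟩ := Metric.mem_nhdsWithin_iff.1 hev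
  set ε := min ε' R with hε
  set P : Set ℂ := Metric.ball (0 : ℂ) ε \ {0} with hP
  have hPR : P ⊆ Metric.ball (0 : ℂ) R \ {0} :=
    sdiff_subset_sdiff_left (Metric.ball_subset_ball (min_le_right _ _))
  have hPs : ∀ w ∈ P, A w / A₀ ∈ Complex.slitPlane ∧ ‖C w‖ < ‖A w‖ := fun w hw =>
    hball ⟨Metric.ball_subset_ball (min_le_left _ _) hw.1, hw.2⟩
  have hA0 : ∀ w ∈ P, A w ≠ 0 := fun w hw =>
    norm_pos_iff.1 ((norm_nonneg _).trans_lt (hPs w hw).2)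
  have hnc : (n : ℂ) ≠ 0 := by exact_mod_cast (show n ≠ 0 by omega)
  have hn1 : (n : ℂ) + 1 ≠ 0 := by exact_mod_cast n.succ_ne_zero
  have conj_div_norm : ∀ z : ℂ, ‖conj z / z‖ ≤ 1 := fun z => by
    rw [norm_div, Complex.norm_conj]; exact div_self_le_one _
  let V : ℂ → ℂ := fun w => (w / ‖w‖) ^ (n - 1) * Complex.exp (ℓ w)
  have hV0 : ∀ w ∈ P, V w ≠ 0 := fun w hw => mul_ne_zero
    (pow_ne_zero _ (div_ne_zero hw.2 (by simpa using hw.2))) (Complex.exp_ne_zero _)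
  -- With `κ` so defined, `A V + C conj V = V A (1 + κ)`. Since `‖κ‖ < 1`, the factor `1 + κ` has a
  -- principal logarithm and does not wind.
  let κ : ℂ → ℂ := fun w => conj (V w) / V w * (C w / A w)
  have hκ : ∀ w ∈ P, ‖κ w‖ < 1 := fun w hw => by
    have h1 : ‖C w / A w‖ < 1 := by
      rw [norm_div, div_lt_one (norm_pos_iff.2 (hA0 w hw))]
      exact (hPs w hw).2
    calc ‖κ w‖ = ‖conj (V w) / V w‖ * ‖C w / A w‖ := norm_mul _ _
      _ ≤ 1 * ‖C w / A w‖ := mul_le_mul_of_nonneg_right (conj_div_norm _) (norm_nonneg _)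
      _ < 1 := by rwa [one_mul]
  have hκs : ∀ w ∈ P, 1 + κ w ∈ Complex.slitPlane := fun w hw =>
    Complex.mem_slitPlane_of_norm_lt_one (hκ w hw)
  let τ : ℂ → ℂ := fun w => conj (w / (‖w‖ : ℂ)) ^ n * (V w * (A w * (1 + κ w)))
  have hτ0 : ∀ w ∈ P, τ w ≠ 0 := fun w hw => by
    refine mul_ne_zero (pow_ne_zero _ ?_) (mul_ne_zero (hV0 w hw) (mul_ne_zero (hA0 w hw)
      (Complex.slitPlane_ne_zero (hκs w hw))))
    exact right_ne_zero_of_mul_eq_one (div_norm_mul_conj hw.2)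
  -- The inverse of the stretching `x + i y ↦ x + n i y` is `τ ↦ ((n + 1) τ + (n - 1) conj τ) /
  -- (2n)`, again with dominant complex linear part, so it equals `c₀ τ (1 + κ')` with `‖κ'‖ < 1`.
  let κ' : ℂ → ℂ := fun w => conj (τ w) / τ w * ((n - 1) / (n + 1))
  have hκ' : ∀ w, ‖κ' w‖ < 1 := fun w => by
    have h0 : (1 : ℝ) ≤ n := by exact_mod_cast hn
    have h1 : ‖((n : ℂ) - 1) / (n + 1)‖ < 1 := by
      have h2 : ((n : ℂ) - 1) / (n + 1) = (((n : ℝ) - 1) / (n + 1) : ℝ) := by push_cast; rfl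
      rw [h2, Complex.norm_real, Real.norm_of_nonneg (div_nonneg (by linarith) (by linarith)),
        div_lt_one (by linarith)]
      linarith
    calc ‖κ' w‖ = ‖conj (τ w) / τ w‖ * ‖((n : ℂ) - 1) / (n + 1)‖ := norm_mul _ _
      _ ≤ 1 * ‖((n : ℂ) - 1) / (n + 1)‖ := mul_le_mul_of_nonneg_right (conj_div_norm _) (norm_nonneg _)
      _ < 1 := by rwa [one_mul]
  have hκ's : ∀ w, 1 + κ' w ∈ Complex.slitPlane := fun w =>
    Complex.mem_slitPlane_of_norm_lt_one (hκ' w)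
  set c₀ : ℂ := (n + 1) / (2 * n) with hc₀
  have hc₀0 : c₀ ≠ 0 := div_ne_zero hn1 (mul_ne_zero two_ne_zero hnc)
  have huc : ContinuousOn (fun w : ℂ => w / (‖w‖ : ℂ)) P :=
    continuousOn_id.div (Complex.continuous_ofReal.comp continuous_norm).continuousOn
      fun w hw => by simpa using hw.2
  have hVc : ContinuousOn V P := (huc.pow _).mul (hℓ.mono hPR).cexp
  have hAc : ContinuousOn A P :=
    ((ha.mono hPR).sub (continuousOn_const.mul (hb.mono hPR))).div_const 2
  have hCc : ContinuousOn C P :=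
    ((ha.mono hPR).add (continuousOn_const.mul (hb.mono hPR))).div_const 2
  have hκc : ContinuousOn κ P :=
    ((Complex.continuous_conj.comp_continuousOn hVc).div hVc hV0).mul (hCc.div hAc hA0)
  have hκ1 : ContinuousOn (fun w => 1 + κ w) P := continuousOn_const.add hκc
  have hτc : ContinuousOn τ P :=
    ((Complex.continuous_conj.comp_continuousOn huc).pow n).mul (hVc.mul (hAc.mul hκ1))
  have hκ'1 : ContinuousOn (fun w => 1 + κ' w) P :=
    continuousOn_const.add (((Complex.continuous_conj.comp_continuousOn hτc).div hτc hτ0).mul_const _)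
  refine ⟨ε, lt_min hε' hR, min_le_right _ _, fun w => ℓ w + (Complex.log A₀ + Complex.log (A w / A₀) +
    Complex.log (1 + κ w)) + (Complex.log c₀ + Complex.log (1 + κ' w)), ?_, fun w hw => ?_⟩
  · exact ((hℓ.mono hPR).add ((continuousOn_const.add ((hAc.div_const A₀).clog fun w hw => (hPs w hw).1)).add
      (hκ1.clog hκs))).add (continuousOn_const.add (hκ'1.clog fun w _ => hκ's w))
  · have hw0 : w ≠ 0 := hw.2
    set u := w / (‖w‖ : ℂ) with hu
    have huu : u * conj u = 1 := div_norm_mul_conj hw0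
    have hT : branchDeriv n w (χ w) = V w * (A w * (1 + κ w)) := by
      rw [hχ w (hPR hw), hv w (hPR hw)]
      change ((V w).re : ℂ) * a w + ((V w).im : ℂ) * b w = _
      have h1 : V w * (A w * (1 + κ w)) = V w * A w + conj (V w) * C w := by
        have := hV0 w hw
        have := hA0 w hw
        simp only [κ]
        field_simp
      rw [h1]
      apply Complex.ext <;> simp [A, C] <;> ring
    have hτ : τ w = ((conj u * χ w).re : ℂ) + n * ((conj u * χ w).im : ℂ) * Complex.I := by
      change conj u ^ n * (V w * (A w * (1 + κ w))) = _
      rw [← hT]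
      simp only [branchDeriv, ← hu]
      rw [← mul_assoc, ← mul_pow, mul_comm (conj u) u, huu, one_pow, one_mul]
    have hS : conj u * χ w = c₀ * (τ w * (1 + κ' w)) := by
      have h1 : c₀ * (τ w * (1 + κ' w)) = ((n + 1) * τ w + (n - 1) * conj (τ w)) / (2 * n) := by
        have := hτ0 w hw
        simp only [κ', hc₀]
        field_simp
      rw [h1, eq_div_iff (mul_ne_zero two_ne_zero hnc), hτ]
      apply Complex.ext <;> simp <;> ring
    have hfin : χ w = Complex.exp (ℓ w) * (A w * (1 + κ w)) * (c₀ * (1 + κ' w)) := by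
      have h1 : χ w = u * (conj u * χ w) := by rw [← mul_assoc, huu, one_mul]
      -- The cancellation of windings, for which the exponent `n - 1` is chosen: inverting the
      -- derivative of the branch map contributes `u ^ (1 - n)`, and the rotation by `v` contributes
      -- `u ^ (n - 1)`.
      have h2 : u * conj u ^ n * u ^ (n - 1) = 1 := by
        have h3 : u * u ^ (n - 1) = u ^ n := by
          rw [← pow_succ']; congr 1; omega
        calc u * conj u ^ n * u ^ (n - 1) = (u * u ^ (n - 1)) * conj u ^ n := by ring
          _ = 1 := by rw [h3, ← mul_pow, huu, one_pow]
      rw [h1, hS]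
      change u * (c₀ * (conj u ^ n * (u ^ (n - 1) * Complex.exp (ℓ w) * (A w * (1 + κ w))) *
        (1 + κ' w))) = _
      linear_combination (Complex.exp (ℓ w) * (A w * (1 + κ w)) * (c₀ * (1 + κ' w))) * h2
    rw [Complex.exp_add, Complex.exp_add, Complex.exp_add, Complex.exp_add, Complex.exp_add,
      Complex.exp_log hA₀0, Complex.exp_log (Complex.slitPlane_ne_zero (hPs w hw).1),
      Complex.exp_log (Complex.slitPlane_ne_zero (hκs w hw)), Complex.exp_log hc₀0,
      Complex.exp_log (Complex.slitPlane_ne_zero (hκ's w)), mul_div_cancel₀ _ hA₀0]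
    exact hfin

end BranchDeriv

/-! ### Lifting vector fields and the plane field to the cover -/

section Lift

open Set Filter ComplexConjugate

variable {M : Type*} [TopologicalSpace M] [ChartedSpace (EuclideanSpace ℝ (Fin 3)) M]
  [IsManifold (𝓡 3) ∞ M] {F : Type*} [TopologicalSpace F] [ChartedSpace (EuclideanHalfSpace 2) F]
  [IsManifold (𝓡∂ 2) ∞ F] {N : Type*} [TopologicalSpace N] [ChartedSpace (EuclideanSpace ℝ (Fin 3)) N]
  [IsManifold (𝓡 3) ∞ N] {oM : ManifoldOrientation (𝓡 3) M 3}
  {oF : ManifoldOrientation (𝓡∂ 2) F 2} {oN : ManifoldOrientation (𝓡 3) N 3}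
  {ι : F → M} {m n : ℕ} {L : OrientedLink M m} {p : N → M}

lemma IsCyclicBranchedCover.bijective_mfderiv (hp : IsCyclicBranchedCover n L oM oF ι oN p) {y : N}
    (hy : p y ∉ L.carrier) : Function.Bijective (mfderiv (𝓡 3) (𝓡 3) p y) := by
  have h := (hp.local_diffeo y hy).mfderivToContinuousLinearEquiv_coe (by simp)
  rw [← h]
  exact ((hp.local_diffeo y hy).mfderivToContinuousLinearEquiv (by simp)).bijective

lemma IsCyclicBranchedCover.isParam_comp (hp : IsCyclicBranchedCover n L oM oF ι oN p)
    {E' : Type*} [NormedAddCommGroup E'] [NormedSpace ℝ E'] {θ : E' → N} {U : Set E'}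
    (h : IsParam θ U) (hU : ∀ q ∈ U, p (θ q) ∉ L.carrier) : IsParam (p ∘ θ) U := by
  refine ⟨h.isOpen, fun q hq => ?_, fun q hq => ?_⟩
  · exact ((hp.local_diffeo _ (hU q hq)).contMDiffAt).comp_contMDiffWithinAt q (h.smooth q hq)
  · rw [mfderiv_comp q ((hp.local_diffeo _ (hU q hq)).mdifferentiableAt (by simp))
      (((h.smooth q hq).contMDiffAt (h.isOpen.mem_nhds hq)).mdifferentiableAt (by simp))]
    exact (hp.bijective_mfderiv (hU q hq)).comp (h.bijective q hq)

/-- The covering map in cylindrical coordinates has the derivative of the branch map. -/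
lemma BranchedCoords.mfderiv_proj (B : BranchedCoords n L p)
    (hp : IsCyclicBranchedCover n L oM oF ι oN p) {i : Fin m} {q : ℂ × ℝ}
    (hq : q.1 ∈ Metric.ball (0 : ℂ) (B.base i).radius) (h0 : q.1 ≠ 0) (v : ℂ × ℝ) :
    (mfderiv (𝓡 3) (𝓡 3) p ((B.cover i).map q) (mfderiv 𝓘(ℝ, ℂ × ℝ) (𝓡 3) (B.cover i).map q v) :
      EuclideanSpace ℝ (Fin 3)) =
    mfderiv 𝓘(ℝ, ℂ × ℝ) (𝓡 3) (B.base i).map (branchMap n q) (branchDeriv n q.1 v.1, v.2) := by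
  set ψ := (B.cover i).map with hψ
  set Θ := (B.base i).map with hΘ
  have hψP : IsParam ψ (Metric.ball 0 (B.base i).radius ×ˢ univ) :=
    B.radius_eq i ▸ (B.cover i).isParam
  obtain ⟨c, hc0, hc, hbc⟩ := exists_branch_curve n h0 v.1
  let Q : ℝ → ℂ × ℝ := fun s => (c s, q.2 + s * v.2)
  have hQ0 : Q 0 = q := by simp [Q, hc0]
  have hz : HasDerivAt (fun s : ℝ => q.2 + s * v.2) v.2 0 := by
    have h := ((hasDerivAt_id (0 : ℝ)).mul_const v.2).const_add q.2
    rw [one_mul] at h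
    exact h
  have hQ : HasDerivAt Q v 0 := hc.prodMk hz
  have hbQ : HasDerivAt (fun s => branchMap n (Q s)) (branchDeriv n q.1 v.1, v.2) 0 :=
    (hbc fun s => q.2 + s * v.2).prodMk hz
  have hQb : ∀ᶠ s in 𝓝 (0 : ℝ), (Q s).1 ∈ Metric.ball (0 : ℂ) (B.base i).radius :=
    hc.continuousAt.eventually (Metric.isOpen_ball.mem_nhds (by rw [hc0]; exact hq))
  have hQm : Q 0 ∈ Metric.ball (0 : ℂ) (B.base i).radius ×ˢ (univ : Set ℝ) := by
    rw [hQ0]; exact ⟨hq, mem_univ _⟩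
  have hbm : branchMap n (Q 0) ∈ Metric.ball (0 : ℂ) (B.base i).radius ×ˢ (univ : Set ℝ) := by
    rw [hQ0]
    exact ⟨by rw [mem_ball_zero_iff, norm_branchMap_fst]; exact mem_ball_zero_iff.1 hq, mem_univ _⟩
  have e1 : (mfderiv 𝓘(ℝ, ℝ) (𝓡 3) (ψ ∘ Q) 0 (1 : ℝ) : EuclideanSpace ℝ (Fin 3)) =
      mfderiv 𝓘(ℝ, ℂ × ℝ) (𝓡 3) ψ (Q 0) v :=
    hψP.mfderiv_curve (Eventually.of_forall fun s => rfl) hQ hQm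
  have e2 : (mfderiv 𝓘(ℝ, ℝ) (𝓡 3) (p ∘ (ψ ∘ Q)) 0 (1 : ℝ) : EuclideanSpace ℝ (Fin 3)) =
      mfderiv 𝓘(ℝ, ℂ × ℝ) (𝓡 3) Θ (branchMap n (Q 0)) (branchDeriv n q.1 v.1, v.2) := by
    refine (B.base i).isParam.mfderiv_curve (γ := p ∘ (ψ ∘ Q)) (q := fun s => branchMap n (Q s)) ?_ hbQ hbm
    filter_upwards [hQb] with s hs
    exact B.proj i _ hs _
  have hyc : p (ψ (Q 0)) ∉ L.carrier := by rw [hQ0]; exact B.cover_notMem hq h0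
  have d1 : MDifferentiableAt 𝓘(ℝ, ℝ) (𝓡 3) (ψ ∘ Q) 0 :=
    MDifferentiableAt.comp 0 (hψP.mdifferentiableAt hQm) hQ.differentiableAt.mdifferentiableAt
  have d2 : MDifferentiableAt (𝓡 3) (𝓡 3) p ((ψ ∘ Q) 0) :=
    (hp.local_diffeo _ hyc).mdifferentiableAt (by simp)
  have e3 := congrArg (fun D : ℝ →L[ℝ] EuclideanSpace ℝ (Fin 3) => D 1) (mfderiv_comp (0 : ℝ) d2 d1)
  have e4 : (mfderiv (𝓡 3) (𝓡 3) p (ψ (Q 0)) (mfderiv 𝓘(ℝ, ℝ) (𝓡 3) (ψ ∘ Q) 0 (1 : ℝ)) :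
      EuclideanSpace ℝ (Fin 3)) = mfderiv (𝓡 3) (𝓡 3) p (ψ (Q 0))
        (mfderiv 𝓘(ℝ, ℂ × ℝ) (𝓡 3) ψ (Q 0) v) :=
    congrArg (fun w : EuclideanSpace ℝ (Fin 3) => (mfderiv (𝓡 3) (𝓡 3) p (ψ (Q 0)) w :
      EuclideanSpace ℝ (Fin 3))) e1
  have e5 : (mfderiv (𝓡 3) (𝓡 3) p (ψ (Q 0)) (mfderiv 𝓘(ℝ, ℂ × ℝ) (𝓡 3) ψ (Q 0) v) :
      EuclideanSpace ℝ (Fin 3)) =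
      mfderiv 𝓘(ℝ, ℂ × ℝ) (𝓡 3) Θ (branchMap n (Q 0)) (branchDeriv n q.1 v.1, v.2) :=
    e4.symm.trans (e3.symm.trans e2)
  rw [hQ0] at e5
  exact e5

variable {α : ∀ x : M, TangentSpace (𝓡 3) x →L[ℝ] ℝ} {β : ∀ y : N, TangentSpace (𝓡 3) y →L[ℝ] ℝ}

/-- The lifted plane field in cylindrical coordinates, off the branch set. -/
lemma IsContactLift.exists_apply_eq {B : BranchedCoords n L p} (hβ : IsContactLift B α β)
    (hp : IsCyclicBranchedCover n L oM oF ι oN p) {i : Fin m} {q : ℂ × ℝ}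
    (hq : q.1 ∈ Metric.ball (0 : ℂ) (B.base i).radius) (h0 : q.1 ≠ 0) :
    ∃ k : ℝ, 0 < k ∧ ∀ (η : ℂ) (ζ : ℝ), β ((B.cover i).map q)
      (mfderiv 𝓘(ℝ, ℂ × ℝ) (𝓡 3) (B.cover i).map q (η, ζ)) = k * (ζ + n * (conj q.1 * η).im) := by
  obtain ⟨g, hg, hgβ⟩ := hβ.pullback _ (B.cover_notMem hq h0)
  obtain ⟨f, hf, hfα⟩ := hβ.standard i (branchMap n q).1
    (by rw [mem_ball_zero_iff, norm_branchMap_fst]; exact mem_ball_zero_iff.1 hq) q.2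
  refine ⟨g * f, mul_pos hg hf, fun η ζ => ?_⟩
  rw [hgβ]
  have h1 : α (p ((B.cover i).map q)) (mfderiv (𝓡 3) (𝓡 3) p ((B.cover i).map q)
      (mfderiv 𝓘(ℝ, ℂ × ℝ) (𝓡 3) (B.cover i).map q (η, ζ))) =
      α ((B.base i).map (branchMap n q)) (mfderiv 𝓘(ℝ, ℂ × ℝ) (𝓡 3) (B.base i).map (branchMap n q)
        (branchDeriv n q.1 η, ζ)) :=
    form_congr α (B.proj i q.1 hq q.2) (B.mfderiv_proj hp hq h0 (η, ζ))
  have h2 : α ((B.base i).map (branchMap n q)) (mfderiv 𝓘(ℝ, ℂ × ℝ) (𝓡 3) (B.base i).map (branchMap n q)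
        (branchDeriv n q.1 η, ζ)) = f * (ζ + (conj (branchMap n q).1 * branchDeriv n q.1 η).im) :=
    hfα _ _
  rw [h1, h2, conj_branchMap_mul_branchDeriv_im n h0]
  ring

/-- Off the branch set this is the formula `ker β = ker (dz + n r² dθ)`; it passes to the branch set
by continuity, since `β` is smooth. -/
lemma IsContactLift.apply_eq_zero {B : BranchedCoords n L p} (hβ : IsContactLift B α β)
    (hp : IsCyclicBranchedCover n L oM oF ι oN p) {i : Fin m} {q : ℂ × ℝ}
    (hq : q.1 ∈ Metric.ball (0 : ℂ) (B.base i).radius) (η : ℂ) :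
    β ((B.cover i).map q) (mfderiv 𝓘(ℝ, ℂ × ℝ) (𝓡 3) (B.cover i).map q
      (η, -(n * (conj q.1 * η).im))) = 0 := by
  have hoff : ∀ q : ℂ × ℝ, q.1 ∈ Metric.ball (0 : ℂ) (B.base i).radius → q.1 ≠ 0 →
      β ((B.cover i).map q) (mfderiv 𝓘(ℝ, ℂ × ℝ) (𝓡 3) (B.cover i).map q
        (η, -(n * (conj q.1 * η).im))) = 0 := by
    intro q hq h0
    obtain ⟨k, -, hk⟩ := hβ.exists_apply_eq hp hq h0
    rw [hk]
    ring
  by_cases h0 : q.1 = 0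
  · have hψP : IsParam (B.cover i).map (Metric.ball 0 (B.base i).radius ×ˢ univ) :=
      B.radius_eq i ▸ (B.cover i).isParam
    obtain ⟨a', ha', -⟩ := hψP.dForm_apply (q₀ := q) ⟨hq, mem_univ _⟩ hβ.smooth
    have hc : ContinuousAt (fun r : ℂ × ℝ => pullForm β (B.cover i).map r
        (η, -(n * (conj r.1 * η).im))) q := by
      have h1 : Continuous fun r : ℂ × ℝ => ((η, -(n * (conj r.1 * η).im)) : ℂ × ℝ) :=
        continuous_const.prodMk (continuous_const.mul (Complex.continuous_im.comp
          ((Complex.continuous_conj.comp continuous_fst).mul continuous_const))).neg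
      exact ha'.continuousAt.clm_apply h1.continuousAt
    have hpath : Tendsto (fun s : ℝ => ((q.1 + s, q.2) : ℂ × ℝ)) (𝓝[≠] 0) (𝓝 q) := by
      have h2 : Continuous fun s : ℝ => ((q.1 + s, q.2) : ℂ × ℝ) := by fun_prop
      have h3 := h2.tendsto 0
      simp only [Complex.ofReal_zero, add_zero] at h3
      exact h3.mono_left nhdsWithin_le_nhds
    refine tendsto_nhds_unique (hc.tendsto.comp hpath) (tendsto_const_nhds.congr' ?_)
    have hev : ∀ᶠ s : ℝ in 𝓝[≠] 0, ((q.1 + s, q.2) : ℂ × ℝ).1 ∈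
        Metric.ball (0 : ℂ) (B.base i).radius :=
      hpath.eventually ((Metric.isOpen_ball.preimage continuous_fst).mem_nhds hq)
    filter_upwards [hev, self_mem_nhdsWithin] with s hs hs0
    refine (hoff _ hs ?_).symm
    simpa [h0] using hs0
  · exact hoff q hq h0

/-- Vector fields lift along the covering. -/
lemma IsCyclicBranchedCover.exists_lift_section [T2Space M] (hp : IsCyclicBranchedCover n L oM oF ι oN p)
    {a : ∀ x : M, TangentSpace (𝓡 3) x} (ha : Continuous (fun x => (⟨x, a x⟩ : TangentBundle (𝓡 3) M))) :
    ∃ A : ∀ y : N, TangentSpace (𝓡 3) y, ∀ y, p y ∉ L.carrier →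
      mfderiv (𝓡 3) (𝓡 3) p y (A y) = a (p y) ∧
      ContinuousAt (fun y => (⟨y, A y⟩ : TangentBundle (𝓡 3) N)) y := by
  have hex : ∀ y, ∃ A : TangentSpace (𝓡 3) y, p y ∉ L.carrier → mfderiv (𝓡 3) (𝓡 3) p y A = a (p y) := by
    intro y
    by_cases hy : p y ∈ L.carrier
    · exact ⟨0, fun h => absurd hy h⟩
    · obtain ⟨A, hA⟩ := (hp.bijective_mfderiv hy).2 (a (p y))
      exact ⟨A, fun _ => hA⟩
  choose A hA using hex
  refine ⟨A, fun y hy => ⟨hA y hy, ?_⟩⟩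
  set e := extChartAt (𝓡 3) y with he
  have hch := IsParam.isParam_extChartAt_symm y
  let U : Set (EuclideanSpace ℝ (Fin 3)) := e.target ∩ e.symm ⁻¹' (p ⁻¹' L.carrierᶜ)
  have hUo : IsOpen U := hch.smooth.continuousOn.isOpen_inter_preimage hch.isOpen
    (L.isClosed_carrier.isOpen_compl.preimage hp.continuous)
  have hU : IsParam e.symm U := hch.mono hUo inter_subset_left
  have hU' := hp.isParam_comp hU fun q hq => hq.2
  have hey : e.symm (e y) = y := e.left_inv (mem_extChartAt_source y)
  have hyU : e y ∈ U := ⟨mem_extChartAt_target y, by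
    change p (e.symm (e y)) ∉ L.carrier
    rw [hey]; exact hy⟩
  have hcoord : ∀ r, ∃ v : EuclideanSpace ℝ (Fin 3), r ∈ U →
      mfderiv 𝓘(ℝ, EuclideanSpace ℝ (Fin 3)) (𝓡 3) e.symm r v = A (e.symm r) := by
    intro r
    by_cases hr : r ∈ U
    · obtain ⟨v, hv⟩ := (hU.bijective r hr).2 (A (e.symm r))
      exact ⟨v, fun _ => hv⟩
    · exact ⟨0, fun h => absurd h hr⟩
  choose v hv using hcoord
  have h1 : ContinuousAt v (e y) := by
    -- The composite of `p` with the inverse chart is itself a parametrisation in `M`, and in it `v`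
    -- gives the coordinates of `a`. Continuity of `a` therefore gives that of `v`, and then of the
    -- lift.
    refine (hU'.continuousAt_section_iff hyU (V := a) ?_).1 ha.continuousAt
    filter_upwards [hUo.mem_nhds hyU] with r hr
    have h2 := mfderiv_comp r ((hp.local_diffeo _ hr.2).mdifferentiableAt (by simp)) (hU.mdifferentiableAt hr)
    have h3 := congrArg (fun D : EuclideanSpace ℝ (Fin 3) →L[ℝ] EuclideanSpace ℝ (Fin 3) => D (v r)) h2
    refine h3.trans (Eq.trans ?_ (hA _ hr.2))
    exact congrArg (fun w : EuclideanSpace ℝ (Fin 3) => (mfderiv (𝓡 3) (𝓡 3) p (e.symm r) w :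
      EuclideanSpace ℝ (Fin 3))) (hv r hr)
  have h2 := (hU.continuousAt_section_iff hyU (V := A) (v := v) (by
    filter_upwards [hUo.mem_nhds hyU] with r hr using hv r hr)).2 h1
  rwa [hey] at h2

lemma IsPositiveFrame.eq_zero_of_smul_add_smul {a b : ∀ x : M, TangentSpace (𝓡 3) x}
    (h : IsPositiveFrame oM α a b) {x : M} {s t : ℝ} (hst : s • a x + t • b x = 0) : s = 0 ∧ t = 0 := by
  obtain ⟨r, -, c, hc, -⟩ := h.pos x
  have h1 : c 1 = a x := hc 1
  have h2 : c 2 = b x := hc 2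
  rw [← h1, ← h2] at hst
  have h3 := congrArg (fun w => c.repr w) hst
  refine ⟨?_, ?_⟩
  · simpa using congrArg (fun w => w 1) h3
  · simpa using congrArg (fun w => w 2) h3

/-- A positive frame of a standard contact structure in cylindrical coordinates at the core. -/
lemma IsPositiveFrame.im_pos {a b : ∀ x : M, TangentSpace (𝓡 3) x} (h : IsPositiveFrame oM α a b)
    (hα : IsPositiveContactForm oM α) (Θ : CylindricalCoords M)
    (hstd : ∀ w ∈ Metric.ball (0 : ℂ) Θ.radius, ∀ z : ℝ, ∃ f : ℝ, 0 < f ∧ ∀ (η : ℂ) (ζ : ℝ),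
      α (Θ.map (w, z)) (mfderiv 𝓘(ℝ, ℂ × ℝ) (𝓡 3) Θ.map (w, z) (η, ζ)) =
        f * (ζ + (starRingEnd ℂ w * η).im)) {z : ℝ} {a' b' : ℂ × ℝ}
    (ha' : mfderiv 𝓘(ℝ, ℂ × ℝ) (𝓡 3) Θ.map (0, z) a' = a (Θ.map (0, z)))
    (hb' : mfderiv 𝓘(ℝ, ℂ × ℝ) (𝓡 3) Θ.map (0, z) b' = b (Θ.map (0, z))) :
    0 < (conj a'.1 * b'.1).im := by
  have h0 : ((0 : ℂ), z) ∈ Metric.ball (0 : ℂ) Θ.radius ×ˢ (univ : Set ℝ) :=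
    ⟨Metric.mem_ball_self Θ.radius_pos, mem_univ _⟩
  obtain ⟨f, hf, hfα⟩ := hstd 0 h0.1 z
  have hα' : ∀ v : ℂ × ℝ, α (Θ.map (0, z)) (mfderiv 𝓘(ℝ, ℂ × ℝ) (𝓡 3) Θ.map (0, z) v) = f * v.2 := by
    intro v
    refine (hfα v.1 v.2).trans ?_
    simp
  obtain ⟨r, hr, hpos⟩ := h.pos (Θ.map (0, z))
  obtain ⟨r', hr'⟩ : ∃ r' : ℂ × ℝ, mfderiv 𝓘(ℝ, ℂ × ℝ) (𝓡 3) Θ.map (0, z) r' = r :=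
    (Θ.isParam.bijective _ h0).2 r
  have ha2 : a'.2 = 0 := by
    have h1 := h.left_mem (Θ.map (0, z))
    rw [← ha', hα'] at h1
    exact (mul_eq_zero.1 h1).resolve_left hf.ne'
  have hb2 : b'.2 = 0 := by
    have h1 := h.right_mem (Θ.map (0, z))
    rw [← hb', hα'] at h1
    exact (mul_eq_zero.1 h1).resolve_left hf.ne'
  have hr2 : 0 < r'.2 := by
    rw [← (hα' r').symm.trans (congrArg (α (Θ.map (0, z))) hr')] at hr
    exact (pos_iff_pos_of_mul_pos hr).1 hf
  obtain ⟨ε, hε, hev⟩ := Θ.isParam.eventually_isPos_iff oM tubeBasis h0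
  have hε1 : 0 < ε := by
    have h2 := (hev.self_of_nhds _).1 (Θ.isPos_core hα hstd z)
    rw [det_vec3] at h2
    simpa [tubeBasis_repr] using h2
  have h3 := (hev.self_of_nhds ![r', a', b']).1 (by
    refine (iff_of_eq (congrArg (oM.IsPos (Θ.map (0, z))) ?_)).2 hpos
    funext j
    fin_cases j
    · exact hr'
    · exact ha'
    · exact hb')
  have h4 := (pos_iff_pos_of_mul_pos h3).1 hε1
  rw [det_vec3] at h4
  simp [tubeBasis_repr, ha2, hb2] at h4
  have h5 : 0 < r'.2 * (conj a'.1 * b'.1).im := by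
    rw [Complex.mul_im, Complex.conj_re, Complex.conj_im]
    linarith
  exact (pos_iff_pos_of_mul_pos h5).1 hr2

end Lift

/-! ### Extending the section over a tube around the branch set -/

section Tube

open Set Filter ComplexConjugate

/-- A line through `(w, z)` and its translate through `(w, z + 1)` have the same image near the base
point, hence equal velocities. -/
lemma CylindricalCoords.mfderiv_periodic {X : Type*} [TopologicalSpace X]
    [ChartedSpace (EuclideanSpace ℝ (Fin 3)) X] [IsManifold (𝓡 3) ∞ X] (Θ : CylindricalCoords X) {w : ℂ}
    (hw : w ∈ Metric.ball (0 : ℂ) Θ.radius) (z : ℝ) (v : ℂ × ℝ) :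
    (mfderiv 𝓘(ℝ, ℂ × ℝ) (𝓡 3) Θ.map (w, z + 1) v : EuclideanSpace ℝ (Fin 3)) =
      mfderiv 𝓘(ℝ, ℂ × ℝ) (𝓡 3) Θ.map (w, z) v := by
  have hq : ∀ q : ℂ × ℝ, HasDerivAt (fun s : ℝ => q + s • v) v 0 := fun q => by
    simpa using ((hasDerivAt_id (0 : ℝ)).smul_const v).const_add q
  have h0 : ∀ q : ℂ × ℝ, q + (0 : ℝ) • v = q := fun q => by simp
  have h1 : (mfderiv 𝓘(ℝ, ℝ) (𝓡 3) (fun s : ℝ => Θ.map ((w, z) + s • v)) 0 (1 : ℝ) :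
      EuclideanSpace ℝ (Fin 3)) = mfderiv 𝓘(ℝ, ℂ × ℝ) (𝓡 3) Θ.map ((w, z) + (0 : ℝ) • v) v :=
    Θ.isParam.mfderiv_curve (Eventually.of_forall fun s => rfl) (hq _)
      (by rw [h0]; exact ⟨hw, mem_univ _⟩)
  have h2 : (mfderiv 𝓘(ℝ, ℝ) (𝓡 3) (fun s : ℝ => Θ.map ((w, z) + s • v)) 0 (1 : ℝ) :
      EuclideanSpace ℝ (Fin 3)) = mfderiv 𝓘(ℝ, ℂ × ℝ) (𝓡 3) Θ.map ((w, z + 1) + (0 : ℝ) • v) v := by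
    refine Θ.isParam.mfderiv_curve (q := fun s : ℝ => (w, z + 1) + s • v) ?_ (hq _)
      (by rw [h0]; exact ⟨hw, mem_univ _⟩)
    have h3 : ∀ᶠ s : ℝ in 𝓝 0, ((w, z) + s • v : ℂ × ℝ).1 ∈ Metric.ball (0 : ℂ) Θ.radius :=
      (hq (w, z)).continuousAt.fst.eventually (Metric.isOpen_ball.mem_nhds (by simpa using hw))
    filter_upwards [h3] with s hs
    have h4 := Θ.periodic _ hs (z + s * v.2)
    change Θ.map ((w + s • v.1), (z + s * v.2)) = Θ.map ((w + s • v.1), (z + 1 + s * v.2))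
    rw [add_right_comm]
    exact h4.symm
  rw [h0 (w, z)] at h1
  rw [h0 (w, z + 1)] at h2
  exact h2.symm.trans h1

lemma IsParam.exists_coords {E' X : Type*} [NormedAddCommGroup E'] [NormedSpace ℝ E'] [TopologicalSpace X]
    [ChartedSpace (EuclideanSpace ℝ (Fin 3)) X] {θ : E' → X} {U : Set E'} (h : IsParam θ U)
    (V : ∀ x : X, TangentSpace (𝓡 3) x) :
    ∃ v : E' → E', ∀ q ∈ U, mfderiv 𝓘(ℝ, E') (𝓡 3) θ q (v q) = V (θ q) := by
  have hcoord : ∀ q, ∃ v : E', q ∈ U → mfderiv 𝓘(ℝ, E') (𝓡 3) θ q v = V (θ q) := by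
    intro q
    by_cases hq : q ∈ U
    · obtain ⟨v, hv⟩ := (h.bijective q hq).2 (V (θ q))
      exact ⟨v, fun _ => hv⟩
    · exact ⟨0, fun h => absurd h hq⟩
  choose v hv using hcoord
  exact ⟨v, hv⟩

variable {M : Type*} [TopologicalSpace M] [ChartedSpace (EuclideanSpace ℝ (Fin 3)) M]
  [IsManifold (𝓡 3) ∞ M] {F : Type*} [TopologicalSpace F] [ChartedSpace (EuclideanHalfSpace 2) F]
  [IsManifold (𝓡∂ 2) ∞ F] {N : Type*} [TopologicalSpace N] [ChartedSpace (EuclideanSpace ℝ (Fin 3)) N]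
  [IsManifold (𝓡 3) ∞ N] {oM : ManifoldOrientation (𝓡 3) M 3}
  {oF : ManifoldOrientation (𝓡∂ 2) F 2} {oN : ManifoldOrientation (𝓡 3) N 3}
  {ι : F → M} {m n : ℕ} {L : OrientedLink M m} {p : N → M}
  {α : ∀ x : M, TangentSpace (𝓡 3) x →L[ℝ] ℝ} {β : ∀ y : N, TangentSpace (𝓡 3) y →L[ℝ] ℝ}

/-- The section of the lifted plane field that projects to `Re v a + Im v b`, with `v = g ^ (n - 1)`, extends
from the complement of a tube around the branch set to the tube, if `g` winds once around a meridian. -/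
lemma BranchedCoords.exists_tube_section (B : BranchedCoords n L p) (hn : 1 ≤ n)
    (hp : IsCyclicBranchedCover n L oM oF ι oN p) (hα : IsPositiveContactForm oM α)
    (hβ : IsContactLift B α β) {a b : ∀ x : M, TangentSpace (𝓡 3) x} (hab : IsPositiveFrame oM α a b)
    {g : N → ℂ} (hg1 : ∀ y, p y ∉ L.carrier → ‖g y‖ = 1) {X₀ : ∀ y : N, TangentSpace (𝓡 3) y}
    (hX₀ : ∀ y, p y ∉ L.carrier → mfderiv (𝓡 3) (𝓡 3) p y (X₀ y) =
      (g y ^ (n - 1)).re • a (p y) + (g y ^ (n - 1)).im • b (p y))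
    (hX₀c : ∀ y, p y ∉ L.carrier → ContinuousAt (fun y => (⟨y, X₀ y⟩ : TangentBundle (𝓡 3) N)) y)
    (hX₀β : ∀ y, p y ∉ L.carrier → β y (X₀ y) = 0) (i : Fin m)
    {ε : ℝ} (hε : 0 < ε) (hεR : ε ≤ (B.base i).radius) {ℓ : ℂ → ℂ}
    (hℓ : ContinuousOn ℓ (Metric.ball 0 ε \ {0}))
    (hgℓ : ∀ w ∈ Metric.ball (0 : ℂ) ε \ {0},
        g ((B.cover i).map (w, 0)) = w / ‖w‖ * Complex.exp (ℓ w)) :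
    ∃ χ : ℂ × ℝ → ℂ, ContinuousOn χ (Metric.ball 0 (B.base i).radius ×ˢ univ) ∧
      (∀ w ∈ Metric.ball (0 : ℂ) (B.base i).radius, ∀ z, χ (w, z) ≠ 0) ∧
      (∀ w ∈ Metric.ball (0 : ℂ) (B.base i).radius, ∀ z, χ (w, z + 1) = χ (w, z)) ∧
      ∀ w ∈ Metric.ball (0 : ℂ) (B.base i).radius, (B.base i).radius / 2 ≤ ‖w‖ → ∀ z,
        mfderiv 𝓘(ℝ, ℂ × ℝ) (𝓡 3) (B.cover i).map (w, z)
          (χ (w, z), -(n * (conj w * χ (w, z)).im)) = X₀ ((B.cover i).map (w, z)) := by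
  set ψ := (B.cover i).map with hψ
  set Θ := B.base i with hΘ
  set R := Θ.radius with hR
  have hrad : (B.cover i).radius = R := B.radius_eq i
  have hψP : IsParam ψ (Metric.ball 0 R ×ˢ univ) := hrad ▸ (B.cover i).isParam
  have hΘP : IsParam Θ.map (Metric.ball 0 R ×ˢ univ) := Θ.isParam
  have hbm : ∀ q : ℂ × ℝ, q.1 ∈ Metric.ball (0 : ℂ) R → branchMap n q ∈
      Metric.ball (0 : ℂ) R ×ˢ (univ : Set ℝ) := fun q hq =>
    ⟨by rw [mem_ball_zero_iff, norm_branchMap_fst]; exact mem_ball_zero_iff.1 hq, mem_univ _⟩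
  obtain ⟨x, hx⟩ := hψP.exists_coords X₀
  obtain ⟨a', ha'⟩ := hΘP.exists_coords a
  obtain ⟨b', hb'⟩ := hΘP.exists_coords b
  have hxc : ∀ q : ℂ × ℝ, q.1 ∈ Metric.ball (0 : ℂ) R → q.1 ≠ 0 → ContinuousAt x q := by
    intro q hq h0
    have hqU : q ∈ Metric.ball (0 : ℂ) R ×ˢ (univ : Set ℝ) := ⟨hq, mem_univ _⟩
    refine (hψP.continuousAt_section_iff hqU (V := X₀) ?_).1 (hX₀c _ (B.cover_notMem hq h0))
    filter_upwards [hψP.isOpen.mem_nhds hqU] with r hr using hx r hr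
  have hac : ∀ q ∈ Metric.ball (0 : ℂ) R ×ˢ (univ : Set ℝ), ContinuousAt a' q := fun q hq =>
    (hΘP.continuousAt_section_iff hq (V := a) (by
      filter_upwards [hΘP.isOpen.mem_nhds hq] with r hr using ha' r hr)).1
        hab.continuous_left.continuousAt
  have hbc : ∀ q ∈ Metric.ball (0 : ℂ) R ×ˢ (univ : Set ℝ), ContinuousAt b' q := fun q hq =>
    (hΘP.continuousAt_section_iff hq (V := b) (by
      filter_upwards [hΘP.isOpen.mem_nhds hq] with r hr using hb' r hr)).1
        hab.continuous_right.continuousAt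
  -- The defining equation `hX₀`, read in the coordinates of the tube downstairs, where `dp` acts by
  -- `branchDeriv`; only the component in `ℂ` is recorded.
  have hbranch : ∀ q : ℂ × ℝ, q.1 ∈ Metric.ball (0 : ℂ) R → q.1 ≠ 0 →
      branchDeriv n q.1 (x q).1 = ((g (ψ q) ^ (n - 1)).re : ℂ) * (a' (branchMap n q)).1 +
        ((g (ψ q) ^ (n - 1)).im : ℂ) * (b' (branchMap n q)).1 := by
    intro q hq h0
    have hqU : q ∈ Metric.ball (0 : ℂ) R ×ˢ (univ : Set ℝ) := ⟨hq, mem_univ _⟩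
    have e1 := B.mfderiv_proj hp hq h0 (x q)
    have e2 : (mfderiv (𝓡 3) (𝓡 3) p (ψ q) (mfderiv 𝓘(ℝ, ℂ × ℝ) (𝓡 3) ψ q (x q)) :
        EuclideanSpace ℝ (Fin 3)) = mfderiv (𝓡 3) (𝓡 3) p (ψ q) (X₀ (ψ q)) :=
      congrArg (fun w : EuclideanSpace ℝ (Fin 3) => (mfderiv (𝓡 3) (𝓡 3) p (ψ q) w :
        EuclideanSpace ℝ (Fin 3))) (hx q hqU)
    have hpq : p (ψ q) = Θ.map (branchMap n q) := B.proj i q.1 hq q.2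
    have e3 : (a (p (ψ q)) : EuclideanSpace ℝ (Fin 3)) =
        mfderiv 𝓘(ℝ, ℂ × ℝ) (𝓡 3) Θ.map (branchMap n q) (a' (branchMap n q)) :=
      (congrArg (fun x => (a x : EuclideanSpace ℝ (Fin 3))) hpq).trans (ha' _ (hbm q hq)).symm
    have e4 : (b (p (ψ q)) : EuclideanSpace ℝ (Fin 3)) =
        mfderiv 𝓘(ℝ, ℂ × ℝ) (𝓡 3) Θ.map (branchMap n q) (b' (branchMap n q)) :=
      (congrArg (fun x => (b x : EuclideanSpace ℝ (Fin 3))) hpq).trans (hb' _ (hbm q hq)).symm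
    set D : ℂ × ℝ →L[ℝ] EuclideanSpace ℝ (Fin 3) :=
      mfderiv 𝓘(ℝ, ℂ × ℝ) (𝓡 3) Θ.map (branchMap n q) with hD
    have hDi : Function.Injective D := (hΘP.bijective _ (hbm q hq)).1
    set s := (g (ψ q) ^ (n - 1)).re
    set t := (g (ψ q) ^ (n - 1)).im
    have e5 : D (branchDeriv n q.1 (x q).1, (x q).2) = s • D (a' (branchMap n q)) +
        t • D (b' (branchMap n q)) :=
      e1.symm.trans (e2.trans (Eq.trans (hX₀ _ (B.cover_notMem hq h0))
        (congrArg₂ (fun A B : EuclideanSpace ℝ (Fin 3) => s • A + t • B) e3 e4)))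
    rw [← map_smul, ← map_smul, ← map_add] at e5
    have e6 := congrArg Prod.fst (hDi e5)
    simpa using e6
  -- For vectors in `ker β` the `z`-component is determined by the component in `ℂ`. So it suffices
  -- to extend a nowhere zero complex function.
  have hx2 : ∀ q : ℂ × ℝ, q.1 ∈ Metric.ball (0 : ℂ) R → q.1 ≠ 0 →
      (x q).2 = -(n * (conj q.1 * (x q).1).im) := by
    intro q hq h0
    obtain ⟨k, hk, hkβ⟩ := hβ.exists_apply_eq hp hq h0
    have e1 : β (ψ q) (mfderiv 𝓘(ℝ, ℂ × ℝ) (𝓡 3) ψ q (x q)) = 0 :=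
      (congrArg (β (ψ q)) (hx q ⟨hq, mem_univ _⟩)).trans (hX₀β _ (B.cover_notMem hq h0))
    have e2 := (hkβ (x q).1 (x q).2).symm.trans e1
    have := (mul_eq_zero.1 e2).resolve_left hk.ne'
    linarith
  have hx0 : ∀ q : ℂ × ℝ, q.1 ∈ Metric.ball (0 : ℂ) R → q.1 ≠ 0 → (x q).1 ≠ 0 := by
    intro q hq h0 h
    have hxq : x q = 0 := by
      refine Prod.ext h ?_
      rw [hx2 q hq h0, h]; simp
    have e1 : X₀ (ψ q) = 0 := by
      rw [← hx q ⟨hq, mem_univ _⟩, hxq]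
      exact map_zero (mfderiv 𝓘(ℝ, ℂ × ℝ) (𝓡 3) ψ q)
    have hy := B.cover_notMem hq h0
    have e2 := hX₀ _ hy
    rw [e1, map_zero] at e2
    obtain ⟨h1, h2⟩ := hab.eq_zero_of_smul_add_smul e2.symm
    have h3 : g (ψ q) ^ (n - 1) = 0 := Complex.ext h1 h2
    have h4 := hg1 _ hy
    rw [eq_zero_of_pow_eq_zero h3, norm_zero] at h4
    exact zero_ne_one h4
  have hxper : ∀ w ∈ Metric.ball (0 : ℂ) R, ∀ z, x (w, z + 1) = x (w, z) := by
    intro w hw z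
    have hw' : w ∈ Metric.ball (0 : ℂ) (B.cover i).radius := by rw [hrad]; exact hw
    apply (hψP.bijective (w, z) ⟨hw, mem_univ _⟩).1
    have e1 := (B.cover i).mfderiv_periodic hw' z (x (w, z + 1))
    have e2 : (X₀ (ψ (w, z + 1)) : EuclideanSpace ℝ (Fin 3)) = X₀ (ψ (w, z)) :=
      congrArg (fun y => (X₀ y : EuclideanSpace ℝ (Fin 3))) ((B.cover i).periodic w hw' z)
    exact e1.symm.trans ((hx (w, z + 1) ⟨hw, mem_univ _⟩).trans
      (e2.trans (hx (w, z) ⟨hw, mem_univ _⟩).symm))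
  have h00 : ((0 : ℂ), (0 : ℝ)) ∈ Metric.ball (0 : ℂ) R ×ˢ (univ : Set ℝ) :=
    ⟨Metric.mem_ball_self Θ.radius_pos, mem_univ _⟩
  have hpos : 0 < (conj (a' (0, 0)).1 * (b' (0, 0)).1).im :=
    hab.im_pos hα Θ (hβ.standard i) (ha' _ h00) (hb' _ h00)
  have hεb : ∀ w ∈ Metric.ball (0 : ℂ) ε \ {0}, w ∈ Metric.ball (0 : ℂ) R := fun w hw =>
    Metric.ball_subset_ball hεR hw.1
  have hbt : Tendsto (fun w : ℂ => branchMap n (w, 0)) (𝓝[≠] 0) (𝓝 (0, 0)) := by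
    refine Tendsto.prodMk_nhds ?_ tendsto_const_nhds
    rw [tendsto_zero_iff_norm_tendsto_zero]
    have h1 : Tendsto (fun w : ℂ => ‖w‖) (𝓝[≠] 0) (𝓝 0) := by
      have := (continuous_norm (E := ℂ)).tendsto 0
      rw [norm_zero] at this
      exact this.mono_left nhdsWithin_le_nhds
    exact h1.congr fun w => (norm_branchMap_fst n (w, 0)).symm
  have hbco : ∀ c' : ℂ × ℝ → ℂ × ℝ, (∀ q ∈ Metric.ball (0 : ℂ) R ×ˢ (univ : Set ℝ), ContinuousAt c' q) →
      ContinuousOn (fun w => (c' (branchMap n (w, 0))).1) (Metric.ball 0 ε \ {0}) := by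
    intro c' hc' w hw
    have h1 : ContinuousAt (fun w : ℂ => branchMap n (w, 0)) w :=
      ContinuousAt.comp (g := branchMap n) (f := fun w : ℂ => ((w, 0) : ℂ × ℝ))
        (continuousAt_branchMap n hw.2) (by fun_prop)
    have h2 : ContinuousAt (fun w : ℂ => c' (branchMap n (w, 0))) w :=
      ContinuousAt.comp (g := c') (hc' _ (hbm (w, 0) (hεb w hw))) h1
    exact h2.fst.continuousWithinAt
  -- On the meridian disc at height zero `v = g ^ (n - 1)` winds `n - 1` times, because `g` winds
  -- once; the logarithm of its remaining factor is `(n - 1) * ℓ`.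
  obtain ⟨ε', hε', hεε', ℓ', hℓ', hχℓ⟩ := exists_log_of_branchDeriv_eq hn hε (χ := fun w => (x (w, 0)).1)
    (v := fun w => g (ψ (w, 0)) ^ (n - 1)) (ℓ := fun w => (n - 1 : ℕ) * ℓ w) hpos
    (hbco a' hac) (hbco b' hbc)
    ((hac _ h00).fst.tendsto.comp hbt) ((hbc _ h00).fst.tendsto.comp hbt)
    (continuousOn_const.mul hℓ)
    (fun w hw => by
      rw [hgℓ w hw, mul_pow, ← Complex.exp_nat_mul])
    (fun w hw => hbranch (w, 0) (hεb w hw) hw.2)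
  obtain ⟨χ, h1, h2, h3, h4⟩ := exists_tube_extension (R := R) (χ := fun q => (x q).1)
    (fun q hq => (hxc q hq.1.1 hq.1.2).fst.continuousWithinAt)
    (fun w hw z => hx0 (w, z) hw.1 hw.2)
    (fun w hw z => congrArg Prod.fst (hxper w hw.1 z)) hε' (hεε'.trans hεR) hℓ' hχℓ
  refine ⟨χ, h1, h2, h3, fun w hw hwR z => ?_⟩
  have hw0 : w ≠ 0 := by
    rintro rfl
    rw [norm_zero] at hwR
    have := Θ.radius_pos
    linarith
  rw [h4 w hw hwR z, ← hx2 (w, z) hw hw0]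
  exact hx (w, z) ⟨hw, mem_univ _⟩

end Tube

/-! ### Gluing and conclusion -/

section Glue

open Set Filter ComplexConjugate

variable {M : Type*} [TopologicalSpace M] [ChartedSpace (EuclideanSpace ℝ (Fin 3)) M]
  [IsManifold (𝓡 3) ∞ M] {F : Type*} [TopologicalSpace F] [ChartedSpace (EuclideanHalfSpace 2) F]
  [IsManifold (𝓡∂ 2) ∞ F] {N : Type*} [TopologicalSpace N] [ChartedSpace (EuclideanSpace ℝ (Fin 3)) N]
  [IsManifold (𝓡 3) ∞ N] {oM : ManifoldOrientation (𝓡 3) M 3}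
  {oF : ManifoldOrientation (𝓡∂ 2) F 2} {oN : ManifoldOrientation (𝓡 3) N 3}
  {ι : F → M} {m n : ℕ} {L : OrientedLink M m} {p : N → M}
  {α : ∀ x : M, TangentSpace (𝓡 3) x →L[ℝ] ℝ} {β : ∀ y : N, TangentSpace (𝓡 3) y →L[ℝ] ℝ}

/-- By periodicity in `z` the closed solid torus is the image of a compact set. -/
lemma CylindricalCoords.isClosed_image_closedBall {X : Type*} [TopologicalSpace X] [T2Space X]
    [ChartedSpace (EuclideanSpace ℝ (Fin 3)) X] (Θ : CylindricalCoords X) {r : ℝ} (hr : r < Θ.radius) :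
    IsClosed (Θ.map '' (Metric.closedBall 0 r ×ˢ univ)) := by
  have hsub : Metric.closedBall (0 : ℂ) r ⊆ Metric.ball 0 Θ.radius := Metric.closedBall_subset_ball hr
  have h1 : Θ.map '' (Metric.closedBall 0 r ×ˢ univ) = Θ.map '' (Metric.closedBall 0 r ×ˢ Icc 0 1) := by
    refine Subset.antisymm ?_ (image_mono (prod_mono_right (subset_univ _)))
    rintro _ ⟨⟨w, z⟩, ⟨hw, -⟩, rfl⟩
    refine ⟨(w, Int.fract z), ⟨hw, Int.fract_nonneg z, (Int.fract_lt_one z).le⟩, ?_⟩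
    have hper : Function.Periodic (fun z => Θ.map (w, z)) 1 := fun z => Θ.periodic w (hsub hw) z
    have := hper.sub_int_mul_eq (x := z) ⌊z⌋
    rw [mul_one] at this
    exact this
  rw [h1]
  exact (((isCompact_closedBall 0 r).prod isCompact_Icc).image_of_continuousOn
    (Θ.smooth.continuousOn.mono (prod_mono hsub (subset_univ _)))).isClosed

/-- Gluing a section over the complement of the branch set with sections over the tubes. -/
lemma BranchedCoords.exists_glued_section [T2Space N] (B : BranchedCoords n L p)
    {X₀ : ∀ y : N, TangentSpace (𝓡 3) y}
    (hX₀c : ∀ y, p y ∉ L.carrier → ContinuousAt (fun y => (⟨y, X₀ y⟩ : TangentBundle (𝓡 3) N)) y)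
    {x : Fin m → ℂ × ℝ → ℂ × ℝ}
    (hxc : ∀ i, ContinuousOn (x i) (Metric.ball 0 (B.base i).radius ×ˢ univ))
    (hxp : ∀ i, ∀ w ∈ Metric.ball (0 : ℂ) (B.base i).radius, ∀ z, x i (w, z + 1) = x i (w, z))
    (hx : ∀ i, ∀ w ∈ Metric.ball (0 : ℂ) (B.base i).radius, (B.base i).radius / 2 ≤ ‖w‖ → ∀ z,
        mfderiv 𝓘(ℝ, ℂ × ℝ) (𝓡 3) (B.cover i).map (w, z) (x i (w, z)) = X₀ ((B.cover i).map (w, z))) :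
    ∃ X : ∀ y : N, TangentSpace (𝓡 3) y, Continuous (fun y => (⟨y, X y⟩ : TangentBundle (𝓡 3) N)) ∧
      (∀ i (q : ℂ × ℝ), q.1 ∈ Metric.ball (0 : ℂ) (B.base i).radius →
        X ((B.cover i).map q) = mfderiv 𝓘(ℝ, ℂ × ℝ) (𝓡 3) (B.cover i).map q (x i q)) ∧
      ∀ y, (∀ i (q : ℂ × ℝ), q.1 ∈ Metric.ball (0 : ℂ) (B.base i).radius → (B.cover i).map q ≠ y) →
        p y ∉ L.carrier ∧ X y = X₀ y := by
  classical
  let Y : Fin m → ℂ × ℝ → EuclideanSpace ℝ (Fin 3) := fun i q =>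
    mfderiv 𝓘(ℝ, ℂ × ℝ) (𝓡 3) (B.cover i).map q (x i q)
  have hψP : ∀ i, IsParam (B.cover i).map (Metric.ball 0 (B.base i).radius ×ˢ univ) := fun i =>
    B.radius_eq i ▸ (B.cover i).isParam
  -- Different tubes are disjoint, and within one tube the coordinates are unique up to integral
  -- translations in `z`, under which `x i` is periodic. So the prescribed vectors do not depend on
  -- the coordinates chosen.
  have huniq : ∀ i (q : ℂ × ℝ) i' (q' : ℂ × ℝ), q.1 ∈ Metric.ball (0 : ℂ) (B.base i).radius →
      q'.1 ∈ Metric.ball (0 : ℂ) (B.base i').radius → (B.cover i).map q = (B.cover i').map q' →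
      Y i q = Y i' q' := by
    intro i q i' q' hq hq' h
    have hii' : i = i' := by
      by_contra hne
      have h1 : ∀ j (r : ℂ × ℝ), r.1 ∈ Metric.ball (0 : ℂ) (B.base j).radius →
          p ((B.cover j).map r) ∈ (B.base j).image := fun j r hr => by
        have h2 : (B.cover j).map r ∈ (B.cover j).image :=
          ⟨r, ⟨by rw [B.radius_eq]; exact hr, mem_univ _⟩, rfl⟩
        rwa [B.image_eq] at h2
      exact disjoint_left.1 (B.disjoint i i' hne) (h1 i q hq) (by rw [h]; exact h1 i' q' hq')
    subst hii'
    rw [← B.radius_eq] at hq hq'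
    obtain ⟨h1, k, hk⟩ := (B.cover i).injective q.1 hq q'.1 hq' q.2 q'.2 h
    have hper : Function.Periodic (fun z => Y i (q.1, z)) 1 := by
      intro z
      have e1 := (B.cover i).mfderiv_periodic hq z (x i (q.1, z + 1))
      refine Eq.trans e1 ?_
      rw [hxp i q.1 (by rw [← B.radius_eq]; exact hq)]
    have h2 := hper.sub_int_mul_eq (x := q.2) k
    rw [mul_one, ← hk, sub_sub_cancel] at h2
    have h3 : q' = (q.1, q'.2) := Prod.ext h1.symm rfl
    rw [h3]
    exact h2.symm
  let P : N → Fin m × (ℂ × ℝ) → Prop := fun y a =>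
    a.2.1 ∈ Metric.ball (0 : ℂ) (B.base a.1).radius ∧ (B.cover a.1).map a.2 = y
  let X : ∀ y : N, TangentSpace (𝓡 3) y := fun y =>
    if h : ∃ a, P y a then Y h.choose.1 h.choose.2 else X₀ y
  have hXin : ∀ i (q : ℂ × ℝ), q.1 ∈ Metric.ball (0 : ℂ) (B.base i).radius →
      (X ((B.cover i).map q) : EuclideanSpace ℝ (Fin 3)) = Y i q := by
    intro i q hq
    have h : ∃ a, P ((B.cover i).map q) a := ⟨(i, q), hq, rfl⟩
    exact Eq.trans (dif_pos h) (huniq _ _ _ _ h.choose_spec.1 hq h.choose_spec.2)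
  -- In the outer half of a tube the prescribed section is already `X₀`, so `X` agrees with `X₀`
  -- outside the inner halves.
  have hXout : ∀ y, (∀ i (q : ℂ × ℝ), q.1 ∈ Metric.ball (0 : ℂ) (B.base i).radius →
      (B.cover i).map q = y → (B.base i).radius / 2 ≤ ‖q.1‖) → X y = X₀ y := by
    intro y hy
    by_cases h : ∃ a, P y a
    · obtain ⟨⟨i, q⟩, hq, rfl⟩ := h
      exact (hXin i q hq).trans (hx i q.1 hq (hy i q hq rfl) q.2)
    · exact dif_neg h
  have hcar : ∀ y, (∀ i (q : ℂ × ℝ), q.1 ∈ Metric.ball (0 : ℂ) (B.base i).radius →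
      (B.cover i).map q ≠ y) → p y ∉ L.carrier := by
    intro y hy hyL
    obtain ⟨i, hi⟩ := mem_iUnion.1 hyL
    rw [← B.core i] at hi
    obtain ⟨z, hz⟩ := hi
    have h1 : y ∈ (B.cover i).image := by
      rw [B.image_eq]
      exact ⟨(0, z), ⟨Metric.mem_ball_self (B.base i).radius_pos, mem_univ _⟩, hz⟩
    obtain ⟨q, ⟨hq, -⟩, hqy⟩ := h1
    exact hy i q (by rw [← B.radius_eq]; exact hq) hqy
  refine ⟨X, continuous_iff_continuousAt.2 fun y => ?_, hXin, fun y hy => ⟨hcar y hy, hXout y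
    fun i q hq h => absurd h (hy i q hq)⟩⟩
  by_cases h : ∃ a, P y a
  · obtain ⟨⟨i, q⟩, hq, rfl⟩ := h
    have hqU : q ∈ Metric.ball (0 : ℂ) (B.base i).radius ×ˢ (univ : Set ℝ) := ⟨hq, mem_univ _⟩
    refine ((hψP i).continuousAt_section_iff hqU (V := X) (v := x i) ?_).2
      ((hxc i).continuousAt ((hψP i).isOpen.mem_nhds hqU))
    filter_upwards [(hψP i).isOpen.mem_nhds hqU] with r hr using (hXin i r hr.1).symm
  · have hy : ∀ i (q : ℂ × ℝ), q.1 ∈ Metric.ball (0 : ℂ) (B.base i).radius →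
        (B.cover i).map q ≠ y := fun i q hq hqy => h ⟨(i, q), hq, hqy⟩
    refine (hX₀c y (hcar y hy)).congr ?_
    have hhalf : ∀ i, (B.base i).radius / 2 < (B.base i).radius := fun i =>
      half_lt_self (B.base i).radius_pos
    -- A point outside the open tubes may be a limit of points inside them, but it has a
    -- neighbourhood missing the closed inner halves, which suffices for `X = X₀` near it.
    have hev : ∀ᶠ y' in 𝓝 y, ∀ i, y' ∉ (B.cover i).map ''
        (Metric.closedBall 0 ((B.base i).radius / 2) ×ˢ univ) := by
      refine eventually_all.2 fun i => ?_
      have hcl := (B.cover i).isClosed_image_closedBall (r := (B.base i).radius / 2)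
        (by rw [B.radius_eq]; exact hhalf i)
      refine hcl.isOpen_compl.mem_nhds ?_
      rintro ⟨q, ⟨hq, -⟩, hqy⟩
      exact hy i q (Metric.closedBall_subset_ball (hhalf i) hq) hqy
    filter_upwards [hev] with y' hy'
    have h1 : X y' = X₀ y' := hXout y' fun i q hq hqy => by
      by_contra hlt
      exact hy' i ⟨q, ⟨mem_closedBall_zero_iff.2 (not_le.1 hlt).le, mem_univ _⟩, hqy⟩
    rw [h1]

/-- The lift of a contact structure with vanishing Euler class to a cyclic branched cover has vanishing
Euler class. -/
lemma IsContactLift.isEulerClass_zero [CompactSpace M] [T2Space M] [CompactSpace F] [CompactSpace N]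
    [T2Space N] {B : BranchedCoords n L p} (hβ : IsContactLift B α β)
    (hp : IsCyclicBranchedCover n L oM oF ι oN p) (hn : 1 ≤ n) (hS : IsSeifertSurface L oF ι)
    (hα : IsPositiveContactForm oM α) (hLα : L.PositivelyTransverse α) (he : IsEulerClass oM α 0) :
    IsEulerClass oN β 0 := by
  obtain ⟨a, b, hab⟩ := exists_isPositiveFrame he
  obtain ⟨Φ, g, hΦ, hg, hg1, hgn⟩ := exists_root hn hS hp
  obtain ⟨A', hA'⟩ := hp.exists_lift_section hab.continuous_left
  obtain ⟨B', hB'⟩ := hp.exists_lift_section hab.continuous_right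
  -- The lifted frame vector `A'` rotated by `g ^ (n - 1)`, which cancels its `-(n - 1)` turns
  -- around the branch set.
  let X₀ : ∀ y : N, TangentSpace (𝓡 3) y := fun y =>
    (g y ^ (n - 1)).re • A' y + (g y ^ (n - 1)).im • B' y
  have hX₀ : ∀ y, p y ∉ L.carrier → mfderiv (𝓡 3) (𝓡 3) p y (X₀ y) =
      (g y ^ (n - 1)).re • a (p y) + (g y ^ (n - 1)).im • b (p y) := by
    intro y hy
    simp only [X₀, map_add, map_smul]
    rw [(hA' y hy).1, (hB' y hy).1]
  have hX₀c : ∀ y, p y ∉ L.carrier →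
      ContinuousAt (fun y => (⟨y, X₀ y⟩ : TangentBundle (𝓡 3) N)) y := by
    intro y hy
    have h1 : ContinuousAt (fun y => g y ^ (n - 1)) y :=
      (hg.continuousAt ((L.isClosed_carrier.isOpen_compl.preimage hp.continuous).mem_nhds hy)).pow _
    exact continuousAt_section_lincomb (Complex.continuous_re.continuousAt.comp h1)
      (Complex.continuous_im.continuousAt.comp h1) (hA' y hy).2 (hB' y hy).2
  have hX₀β : ∀ y, p y ∉ L.carrier → β y (X₀ y) = 0 := by
    intro y hy
    obtain ⟨k, -, hk⟩ := hβ.pullback y hy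
    rw [hk, hX₀ y hy, map_add, map_smul, map_smul, hab.left_mem, hab.right_mem]
    simp
  have hX₀0 : ∀ y, p y ∉ L.carrier → X₀ y ≠ 0 := by
    intro y hy h
    have h1 := hX₀ y hy
    rw [h, map_zero] at h1
    obtain ⟨h2, h3⟩ := hab.eq_zero_of_smul_add_smul h1.symm
    have h4 : g y ^ (n - 1) = 0 := Complex.ext h2 h3
    have h5 := hg1 y hy
    rw [eq_zero_of_pow_eq_zero h4, norm_zero] at h5
    exact zero_ne_one h5
  choose ε hε hεR ℓ hℓ hgℓ using fun i =>
    B.exists_cover_log hn hS hp hα hLα i (hβ.standard i) hΦ hg hgn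
  choose χ hχc hχ0 hχp hχ using fun i =>
    B.exists_tube_section hn hp hα hβ hab hg1 hX₀ hX₀c hX₀β i (hε i) (hεR i) (hℓ i) (hgℓ i)
  -- The second component is forced by membership in `ker β`; the first vanishes nowhere, so neither
  -- does the vector.
  let x : Fin m → ℂ × ℝ → ℂ × ℝ := fun i q => (χ i q, -(n * (conj q.1 * χ i q).im))
  have hxc : ∀ i, ContinuousOn (x i) (Metric.ball 0 (B.base i).radius ×ˢ univ) := fun i =>
    (hχc i).prodMk (continuousOn_const.mul (Complex.continuous_im.comp_continuousOn
      ((Complex.continuous_conj.comp continuous_fst).continuousOn.mul (hχc i)))).neg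
  obtain ⟨X, hX, hXin, hXout⟩ := B.exists_glued_section hX₀c hxc
    (fun i w hw z => by simp only [x, hχp i w hw]) hχ
  have hψP : ∀ i, IsParam (B.cover i).map (Metric.ball 0 (B.base i).radius ×ˢ univ) := fun i =>
    B.radius_eq i ▸ (B.cover i).isParam
  have hcases : ∀ y, (∃ i, ∃ q : ℂ × ℝ, q.1 ∈ Metric.ball (0 : ℂ) (B.base i).radius ∧
      (B.cover i).map q = y) ∨ (p y ∉ L.carrier ∧ X y = X₀ y) := by
    intro y
    by_cases h : ∃ i, ∃ q : ℂ × ℝ, q.1 ∈ Metric.ball (0 : ℂ) (B.base i).radius ∧ (B.cover i).map q = y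
    · exact Or.inl h
    · push Not at h
      exact Or.inr (hXout y h)
  refine isEulerClass_zero_of_section hβ.smooth hβ.ne_zero hX (fun y => ?_) (fun y => ?_)
  · rcases hcases y with ⟨i, q, hq, rfl⟩ | ⟨hy, h⟩
    · rw [hXin i q hq]
      exact hβ.apply_eq_zero hp hq _
    · rw [h]
      exact hX₀β y hy
  · rcases hcases y with ⟨i, q, hq, rfl⟩ | ⟨hy, h⟩
    · rw [hXin i q hq]
      intro h0
      have h1 : x i q = 0 := ((hψP i).bijective q ⟨hq, mem_univ _⟩).1
        (h0.trans (map_zero (mfderiv 𝓘(ℝ, ℂ × ℝ) (𝓡 3) (B.cover i).map q)).symm)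
      exact hχ0 i q.1 hq q.2 (congrArg Prod.fst h1)
    · rw [h]
      exact hX₀0 y hy

end Glue

end

theorem mainTheorem12
    {M : Type*} [TopologicalSpace M] [ChartedSpace (EuclideanSpace ℝ (Fin 3)) M]
    [IsManifold (𝓡 3) ∞ M] [CompactSpace M] [T2Space M] [ConnectedSpace M]
    (oM : ManifoldOrientation (𝓡 3) M 3) (hM : IsRationalHomologySphere M)
    {m : ℕ} (L : OrientedLink M m) (hL : L.NullHomologous)
    (α : ∀ x : M, TangentSpace (𝓡 3) x →L[ℝ] ℝ) (hα : IsPositiveContactForm oM α)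
    (hLα : L.PositivelyTransverse α)
    {F : Type*} [TopologicalSpace F] [ChartedSpace (EuclideanHalfSpace 2) F]
    [IsManifold (𝓡∂ 2) ∞ F] [CompactSpace F] [T2Space F] [ConnectedSpace F]
    (oF : ManifoldOrientation (𝓡∂ 2) F 2) (ι : F → M) (hS : IsSeifertSurface L oF ι)
    (n : ℕ) (hn : 1 ≤ n)
    {N : Type*} [TopologicalSpace N] [ChartedSpace (EuclideanSpace ℝ (Fin 3)) N]
    [IsManifold (𝓡 3) ∞ N] [CompactSpace N] [T2Space N] [ConnectedSpace N]
    (oN : ManifoldOrientation (𝓡 3) N 3) (p : N → M)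
    (hp : IsCyclicBranchedCover n L oM oF ι oN p) (B : BranchedCoords n L p)
    (β : ∀ y : N, TangentSpace (𝓡 3) y →L[ℝ] ℝ) (hβ : IsContactLift B α β)
    (he : IsEulerClass oM α 0) :
    IsEulerClass oN β 0 := by
  exact hβ.isEulerClass_zero hp hn hS hα hLα he
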